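/- Write $I_\gamma=\,]-\gamma,\gamma[$ for $\gamma>0$, let $L^1_0(\mathbb R)=\{g\in L^1(\mathbb R):\int g=0\}$ (complex-valued functions), and let $H\varphi(x)=\frac1\pi\,\mathrm{pv}\!\int_{\mathbb R}\frac{\varphi(t)}{x-t}\,dt$ and $\tilde H\varphi(x)=\frac1\pi\,\mathrm{pv}\!\int_{\mathbb R}\varphi(t)\big\{\frac1{x-t}+\frac t{1+t^2}\big\}\,dt$ denote the Hilbert transform and the modified Hilbert transform. For $f\in L^1(\mathbb R)$ and $g\in L^1_0(\mathbb R)$, let $f+Hg$ be the distribution on $\mathbb R$ with $\langle\varphi,f+Hg\rangle=\langle\varphi,f\rangle-\langle H\varphi,g\rangle$, $\varphi\in C_c^\infty(\mathbb R)$, where $\langle\varphi,f\rangle=\int\varphi f$. Let $\mathfrak L(I_1)$ be the space of the distributions on $I_1$ which are restrictions to $I_1$ of distributions $f+Hg$ of this kind. Put $J_1f(x)=x^{-2}f(-1/x)$ and $J_1(f+Hg)=J_1f+HJ_1g$. Put $P_2\varphi(x)=\sum_{j\in\mathbb Z}\varphi(x+2j)$ for test functions $\varphi$, let $P_2(f+Hg)$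 be the ($2$-periodic) distribution on $\mathbb R$ with $\langle\varphi,P_2(f+Hg)\rangle=\langle P_2\varphi,f\rangle-\langle\tilde HP_2\varphi,g\rangle$, and put $\Sigma_2U=P_2U-U$. The subtransfer operator $T_1$ is defined on $\mathfrak L(I_1)$ by $$T_1\big(U|_{I_1}\big)=(\Sigma_2J_1U)|_{I_1},\qquad U=f+Hg,\ f\in L^1(\mathbb R),\ g\in L^1_0(\mathbb R)$$ (on $L^1(I_1)$ this is $T_1u(x)=\sum_{j\in\mathbb Z\setminus\{0\}}(x+2j)^{-2}u(-1/(x+2j))$). For a distribution $u$ on $I_1$, the valeur au point of $u$ at $x\in I_1$ is $\mathrm{pev}[u](x)=\lim_{\epsilon\to0^+}\langle\chi P_{x+i\epsilon},u\rangle$ where the limit exists; here $P_{x+i\epsilon}(t)=\frac1\pi\frac{\epsilon}{\epsilon^2+(x-t)^2}$ and $\chi\in C_c^\infty(I_1)$ is any function with $\chi=1$ near $x$. The weak-$L^1$ space $L^{1,\infty}(I_1)$ consists of the measurable functions $h$ on $I_1$ with finite quasinorm $\|h\|_{L^{1,\infty}(I_1)}=\sup_{\lambda>0}\lambda\,|\{t\in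 I_1:|h(t)|>\lambda\}|$. **Theorem.** The operator $T_1$ is well defined (independent of the choice of the extension $U$) and maps $\mathfrak L(I_1)$ into $\mathfrak L(I_1)$. Let $u_0\in\mathfrak L(I_1)$ be odd, that is, $\langle\varphi,u_0\rangle=0$ for all even test functions $\varphi\in C_c^\infty(I_1)$. Then, for every $N\ge0$, $\mathrm{pev}(T_1^Nu_0)$ is defined almost everywhere on $I_1$ and belongs to $L^{1,\infty}(I_1)$, and for every $\eta$ with $0<\eta<1$, $$1_{I_\eta}\,\mathrm{pev}(T_1^Nu_0)\to0\quad\text{in }L^{1,\infty}(I_1)\text{ as }N\to+\infty.$$ -/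

import Mathlib

open Set Filter Topology MeasureTheory
open scoped Distributions ContDiff ENNReal

noncomputable section

namespace GaussHilbert

/-- The open symmetric interval `I_γ = ]-γ, γ[`. -/
def symmInterval (γ : ℝ) : TopologicalSpace.Opens ℝ := ⟨Ioo (-γ) γ, isOpen_Ioo⟩

/-- The Hilbert transform `Hφ(x) = (1/π) pv ∫ φ(t) dt / (x - t)` of a test function. -/
def hilbert (φ : ℝ → ℝ) (x : ℝ) : ℝ :=
  limUnder (𝓝[>] (0 : ℝ)) fun ε =>
    Real.pi⁻¹ * ∫ t in {t : ℝ | ε < |x - t|}, φ t * (1 / (x - t))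

/-- The modified Hilbert transform
`H̃φ(x) = (1/π) pv ∫ φ(t) {1 / (x - t) + t / (1 + t²)} dt` of a bounded smooth function. -/
def modHilbert (φ : ℝ → ℝ) (x : ℝ) : ℝ :=
  limUnder (𝓝[>] (0 : ℝ)) fun ε =>
    Real.pi⁻¹ * ∫ t in {t : ℝ | ε < |x - t|}, φ t * (1 / (x - t) + t / (1 + t ^ 2))

/-- `f ∈ L¹(ℝ)` and `g ∈ L¹₀(ℝ)`, that is, `g ∈ L¹(ℝ)` and `∫ g = 0`. -/
def Admissible (f g : ℝ → ℂ) : Prop :=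
  Integrable f ∧ Integrable g ∧ ∫ t, g t = 0

/-- The value `⟨φ, f + Hg⟩ = ⟨φ, f⟩ - ⟨Hφ, g⟩` of the distribution `f + Hg` on the line at the
test function `φ`. -/
def lineAction (f g : ℝ → ℂ) (φ : ℝ → ℝ) : ℂ :=
  (∫ t, (φ t : ℂ) * f t) - ∫ t, (hilbert φ t : ℂ) * g t

/-- `u = (f + Hg)|_Ω` with `f ∈ L¹(ℝ)` and `g ∈ L¹₀(ℝ)`: the distribution `u` on the open set `Ω`
is the restriction of the distribution `f + Hg` on the line. -/
def Represents {Ω : TopologicalSpace.Opens ℝ} (f g : ℝ → ℂ) (u : 𝓓'(Ω, ℂ)) : Prop :=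
  Admissible f g ∧ ∀ φ : 𝓓(Ω, ℝ), u φ = lineAction f g φ

/-- The space `𝔏(Ω)` of the restrictions to `Ω` of the distributions in `L¹(ℝ) + H L¹₀(ℝ)`. -/
def Lspace (Ω : TopologicalSpace.Opens ℝ) : Set 𝓓'(Ω, ℂ) :=
  {u | ∃ f g : ℝ → ℂ, Represents f g u}

/-- A distribution on a symmetric interval is odd if it annihilates the even test functions. -/
def IsOdd {γ : ℝ} (u : 𝓓'(symmInterval γ, ℂ)) : Prop :=
  ∀ φ : 𝓓(symmInterval γ, ℝ), (∀ t, φ (-t) = φ t) → u φ = 0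

/-- The involution `J₁ f(x) = x⁻² f(-1/x)` on functions; on `𝔏₀(ℝ) = L¹(ℝ) + H L¹₀(ℝ)` it acts by
`J₁(f + Hg) = J₁f + H J₁g`. -/
def involution (f : ℝ → ℂ) (x : ℝ) : ℂ :=
  ((1 / x ^ 2 : ℝ) : ℂ) * f (-1 / x)

/-- The periodization `P₂φ(x) = ∑_{j ∈ ℤ} φ(x + 2j)` of a test function. -/
def periodize (φ : ℝ → ℝ) (x : ℝ) : ℝ :=
  ∑' j : ℤ, φ (x + 2 * j)

/-- The value at the test function `φ` of the `2`-periodic distribution `P₂(f + Hg)`, considered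
as a distribution on the line: `⟨P₂φ, f⟩ - ⟨H̃P₂φ, g⟩`. -/
def periodizedAction (f g : ℝ → ℂ) (φ : ℝ → ℝ) : ℂ :=
  (∫ t, (periodize φ t : ℂ) * f t) - ∫ t, (modHilbert (periodize φ) t : ℂ) * g t

/-- The value of `Σ₂(f + Hg) = P₂(f + Hg) - (f + Hg)` at the test function `φ`. -/
def sigmaAction (f g : ℝ → ℂ) (φ : ℝ → ℝ) : ℂ :=
  periodizedAction f g φ - lineAction f g φ

/-- `v = T₁ u` for distributions `u`, `v` on `I_1`: for some extension `f + Hg` of `u` to the line,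
`v` is the restriction to `I_1` of `Σ₂ J₁ (f + Hg)`. -/
def IsSubtransfer (u v : 𝓓'(symmInterval 1, ℂ)) : Prop :=
  ∃ f g : ℝ → ℂ, Represents f g u ∧
    ∀ φ : 𝓓(symmInterval 1, ℝ), v φ = sigmaAction (involution f) (involution g) φ

open Classical in
/-- The subtransfer operator `T₁`, given on `𝔏(I_1)` by `T₁ (f + Hg)|_{I_1} = (Σ₂ J₁ (f + Hg))|_{I_1}`
(and by the junk value `0` off `𝔏(I_1)`). -/
def subtransfer (u : 𝓓'(symmInterval 1, ℂ)) : 𝓓'(symmInterval 1, ℂ) :=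
  if h : ∃ v, IsSubtransfer u v then h.choose else 0

/-- The Poisson kernel `P_{x+iε}(t) = π⁻¹ ε / (ε² + (x - t)²)`. -/
def poisson (x ε t : ℝ) : ℝ :=
  Real.pi⁻¹ * (ε / (ε ^ 2 + (x - t) ^ 2))

theorem contDiff_poisson (x ε : ℝ) : ContDiff ℝ ((⊤ : ℕ∞) : WithTop ℕ∞) (poisson x ε) := by
  rcases eq_or_ne ε 0 with rfl | hε
  · have h : poisson x 0 = fun _ => 0 := by
      funext t
      simp [poisson]
    rw [h]
    exact contDiff_const
  · unfold poisson
    refine contDiff_const.mul (contDiff_const.div (by fun_prop) fun t => ?_)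
    positivity

/-- The test function `χ P_{x+iε}`. -/
def poissonCutoff {Ω : TopologicalSpace.Opens ℝ} (χ : 𝓓(Ω, ℝ)) (x ε : ℝ) : 𝓓(Ω, ℝ) where
  toFun t := χ t * poisson x ε t
  contDiff' := χ.contDiff.mul (contDiff_poisson x ε)
  hasCompactSupport' := χ.hasCompactSupport.mul_right
  tsupport_subset' := (tsupport_mul_subset_left).trans χ.tsupport_subset

/-- The "valeur au point" of `u` at `x ∈ Ω` exists and equals `c`:
`⟨χ P_{x+iε}, u⟩ → c` as `ε → 0⁺`, where `χ` is a smooth cut-off function with compact support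
in `Ω` and `χ = 1` near `x`. (The choice of `χ` is immaterial.) -/
def HasPev {Ω : TopologicalSpace.Opens ℝ} (u : 𝓓'(Ω, ℂ)) (x : ℝ) (c : ℂ) : Prop :=
  x ∈ Ω ∧ ∀ χ : 𝓓(Ω, ℝ), (∀ᶠ t in 𝓝 x, χ t = 1) →
    Tendsto (fun ε : ℝ => u (poissonCutoff χ x ε)) (𝓝[>] 0) (𝓝 c)

open Classical in
/-- The "valeur au point" function `pev[u]`, with the value `0` where the limit does not exist. -/
def pev {Ω : TopologicalSpace.Opens ℝ} (u : 𝓓'(Ω, ℂ)) (x : ℝ) : ℂ :=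
  if h : ∃ c, HasPev u x c then h.choose else 0

/-- The quasinorm `sup_{c > 0} c |{t ∈ E : |f(t)| > c}|` of weak `L¹` on `E`. -/
def weakNorm (E : Set ℝ) (f : ℝ → ℂ) : ℝ≥0∞ :=
  ⨆ (c : ℝ) (_ : 0 < c), ENNReal.ofReal c * volume {t ∈ E | c < ‖f t‖}

/-- `f` belongs to `L^{1,∞}(E)`: it is measurable (almost everywhere) on `E` with finite
quasinorm. -/
def MemWeakL1 (E : Set ℝ) (f : ℝ → ℂ) : Prop :=
  AEMeasurable f (volume.restrict E) ∧ weakNorm E f < ⊤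

end GaussHilbert

end

/-! By duality, `T₁` is the transpose of an operation on test functions: `φ` is replaced by the sum
over `j ≠ 0` of the functions `y ↦ φ(-1/y + 2j)`, each of which is again a test function on `I_1`.
The infinite sum is in general not a test function, so it is approximated by its Fejér means
`tentTest φ n`, and `⟨φ, T₁u⟩ = lim ⟨tentTest φ n, u⟩` (`UnitTest.tendsto_lineAction_tentTest`).
Hence `T₁u` depends on `u` alone and may be computed from any convenient expression for `u` on
`I_1`. Folding the line onto `]-1, 1[` exhibits `T₁u` as an element of `𝔏(I_1)`
(`exists_isSubtransfer`).

An odd `u₀` can be written `f + Hg` with `f` odd and `g` even. A Lipschitz even function close to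
`g` in `L¹` has a bounded odd Hilbert transform, which can be moved into `f`; what remains is `u₀ =
f + Hk` on `I_1` with `‖k‖₁` as small as desired (`IsOdd.exists_small_represents`). Writing `T` for
the operator on functions (`transfer`, an `L¹` contraction), one finds on `I_1` that `T₁^N u₀ = T^N
f + O_N + H(1_{I_1} T^N k)` (`iterate_subtransfer_apply`). Here `O_N` is the odd function `oddPart k
N`, produced by the parts of the Hilbert kernel whose singularities lie outside `I_1`.

Three estimates finish the proof. The Hilbert transform term has weak-`L¹` quasinorm `O(‖k‖₁)` by
the weak type inequality (`exists_conjugate`), which is derived from the bounded holomorphic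
function `F/(1+F)`, where `F` is the Cauchy transform of a nonnegative function. Next, `T^N f → 0`
in `L¹(I_η)` (`tendsto_integral_iterate_transfer`). Finally `|O_N(x)| ≤ C ‖k‖₁ (1-x²)⁻²` uniformly
in `N` (`exists_oddPart_bound`). So the limit superior of the quasinorms is `O(‖k‖₁)`, hence zero.

The last two estimates rest on a positivity property: on odd functions, `T` preserves domination of
increments on `[0, 1[` (`Dom.oddTransfer`). For `L(x) = 2x/(1-x²)`, that is `logKer 1`, the defect
`L - TL` increases with slope at least `1/15`. It therefore dominates every Lipschitz function
vanishing at `0`, up to a constant, while the sum of `T^m(L - TL)` telescopes and stays below `L`.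
This gives decay for Lipschitz odd functions, and density gives it in `L¹`. For `O_N` one needs the
kernels `logKer s`: `T` sends `logKer s` to `logKer (1/(2-s))` up to a Lipschitz remainder. The
iterates of `s ↦ 1/(2-s)` approach the parabolic fixed point `1` by steps `O(m⁻²)`, so `T^m(logKer s
- T logKer s)` has a majorant that is summable in `m` and independent of `s` (`exists_majorant`). A
rearrangement of the recursion for `O_N` then yields the uniform bound (`exists_iteration_bound`).
-/

namespace GaussHilbert

open scoped NNReal

/-! ### The Hilbert transform of integrable Lipschitz functions -/

/-- The symmetric difference quotient whose integral over `y > 0` gives the Hilbert transform. -/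
noncomputable def symmQuot (φ : ℝ → ℝ) (x y : ℝ) : ℝ := (φ (x - y) - φ (x + y)) / y

/-- The truncated Hilbert transform. -/
noncomputable def hilbertTrunc (ε : ℝ) (φ : ℝ → ℝ) (x : ℝ) : ℝ :=
  Real.pi⁻¹ * ∫ t in {t : ℝ | ε < |x - t|}, φ t * (1 / (x - t))

theorem measurableSet_lt_abs_sub (ε x : ℝ) : MeasurableSet {t : ℝ | ε < |x - t|} :=
  (isOpen_lt continuous_const (by fun_prop)).measurableSet

theorem abs_symmQuot_le {φ : ℝ → ℝ} {K : ℝ≥0} (hL : LipschitzWith K φ) (x : ℝ) {y : ℝ}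
    (hy : 0 < y) : |symmQuot φ x y| ≤ 2 * K := by
  have h := hL.dist_le_mul (x - y) (x + y)
  rw [Real.dist_eq, Real.dist_eq, show x - y - (x + y) = -(2 * y) by ring, abs_neg,
    abs_of_pos (by positivity : (0 : ℝ) < 2 * y)] at h
  rw [symmQuot, abs_div, abs_of_pos hy, div_le_iff₀ hy]
  linarith

theorem abs_symmQuot_le_of_one_le (φ : ℝ → ℝ) (x : ℝ) {y : ℝ} (hy : 1 ≤ y) :
    |symmQuot φ x y| ≤ |φ (x - y)| + |φ (x + y)| := by
  rw [symmQuot, abs_div, abs_of_pos (by linarith : 0 < y)]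
  exact (div_le_self (abs_nonneg _) hy).trans (abs_sub _ _)

theorem measurable_uncurry_symmQuot {φ : ℝ → ℝ} (h : Continuous φ) :
    Measurable (fun p : ℝ × ℝ => symmQuot φ p.1 p.2) := by
  unfold symmQuot
  exact Measurable.div (by fun_prop) measurable_snd

theorem measurable_symmQuot {φ : ℝ → ℝ} (h : Continuous φ) (x : ℝ) :
    Measurable (symmQuot φ x) :=
  (measurable_uncurry_symmQuot h).comp (measurable_const.prodMk measurable_id)

section
variable {φ : ℝ → ℝ} {K : ℝ≥0} (hi : Integrable φ) (hL : LipschitzWith K φ)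
include hi hL

/-- The Lipschitz bound controls `y ≤ 1` and integrability of `φ` controls `y > 1`. The bound does
not depend on `x`; it provides the dominating constants for the limits `ε → 0` below. -/
theorem integrableOn_symmQuot (x : ℝ) : IntegrableOn (symmQuot φ x) (Ioi 0) ∧
    ∫ y in Ioi 0, |symmQuot φ x y| ≤ 2 * K + 2 * ∫ t, |φ t| := by
  have hm := (measurable_symmQuot hL.continuous x).aestronglyMeasurable (μ := volume)
  have i1 : IntegrableOn (symmQuot φ x) (Ioc 0 1) := by
    refine Measure.integrableOn_of_bounded (M := 2 * K) (by simp) hm ?_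
    filter_upwards [ae_restrict_mem measurableSet_Ioc] with y hy
    exact abs_symmQuot_le hL x hy.1
  have j1 : Integrable fun y => |φ (x - y)| := (hi.comp_sub_left x).norm
  have j2 : Integrable fun y => |φ (x + y)| := (hi.comp_add_left x).norm
  have i2 : IntegrableOn (symmQuot φ x) (Ioi 1) := by
    refine Integrable.mono' (j1.add j2).integrableOn hm.restrict ?_
    filter_upwards [ae_restrict_mem measurableSet_Ioi] with y hy
    exact abs_symmQuot_le_of_one_le φ x (le_of_lt hy)
  have hu : Ioc (0 : ℝ) 1 ∪ Ioi 1 = Ioi 0 := Ioc_union_Ioi_eq_Ioi zero_le_one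
  refine ⟨hu ▸ i1.union i2, ?_⟩
  rw [← hu, setIntegral_union Ioc_disjoint_Ioi_same measurableSet_Ioi i1.abs i2.abs]
  have e1 : ∫ y in Ioc 0 1, |symmQuot φ x y| ≤ 2 * K := by
    calc ∫ y in Ioc 0 1, |symmQuot φ x y| ≤ ∫ y in Ioc (0:ℝ) 1, (2 * K : ℝ) :=
          setIntegral_mono_on i1.abs (integrableOn_const (by simp)) measurableSet_Ioc
            fun y hy => abs_symmQuot_le hL x hy.1
      _ = 2 * K := by simp
  have e2 : ∫ y in Ioi 1, |symmQuot φ x y| ≤ 2 * ∫ t, |φ t| := by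
    calc ∫ y in Ioi 1, |symmQuot φ x y| ≤ ∫ y in Ioi (1:ℝ), (|φ (x - y)| + |φ (x + y)|) :=
          setIntegral_mono_on i2.abs (j1.add j2).integrableOn measurableSet_Ioi
            fun y hy => abs_symmQuot_le_of_one_le φ x (le_of_lt hy)
      _ ≤ ∫ y, (|φ (x - y)| + |φ (x + y)|) :=
          setIntegral_le_integral (j1.add j2) (Eventually.of_forall fun y => by positivity)
      _ = 2 * ∫ t, |φ t| := by
          rw [integral_add j1 j2, integral_sub_left_eq_self (fun t => |φ t|) volume x,
            integral_add_left_eq_self (fun t => |φ t|) x]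
          ring
  linarith

omit hL in
theorem integrable_trunc_kernel {ε : ℝ} (hε : 0 < ε) (x : ℝ) :
    IntegrableOn (fun t => φ t * (1 / (x - t))) {t : ℝ | ε < |x - t|} := by
  have hs := measurableSet_lt_abs_sub ε x
  refine Integrable.mono' (g := fun t => |φ t| * ε⁻¹) (hi.abs.mul_const _).integrableOn ?_ ?_
  · exact (hi.1.mul (by measurability : Measurable fun t : ℝ => 1 / (x - t)).aestronglyMeasurable).restrict
  · filter_upwards [ae_restrict_mem hs] with t ht
    rw [norm_mul, Real.norm_eq_abs, Real.norm_eq_abs, abs_div, abs_one, one_div]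
    have ht' : ε < |x - t| := ht
    gcongr

-- Substituting `t = x - y` and folding negative `y` onto positive `y` makes the cancellation of the
-- principal value explicit.
omit hL in
theorem hilbertTrunc_eq {ε : ℝ} (hε : 0 < ε) (x : ℝ) :
    hilbertTrunc ε φ x = Real.pi⁻¹ * ∫ y in Ioi ε, symmQuot φ x y := by
  rw [hilbertTrunc]
  congr 1
  have hs := measurableSet_lt_abs_sub ε x
  have hI := integrable_trunc_kernel hi hε x
  rw [← integrable_indicator_iff hs] at hI
  rw [← integral_indicator hs, ← integral_sub_left_eq_self _ volume x]
  have hI' := hI.comp_sub_left x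
  have e : (fun y => {t : ℝ | ε < |x - t|}.indicator (fun t => φ t * (1 / (x - t))) (x - y)) =
      fun y => (Ioi ε).indicator (fun y => φ (x - y) / y) y +
        (Ioi ε).indicator (fun y => - φ (x + y) / y) (-y) := by
    funext y
    simp only [indicator, mem_ofPred_eq, sub_sub_cancel, mem_Ioi, lt_abs,
      ← sub_eq_add_neg]
    by_cases h1 : ε < y
    · have h2 : ¬ ε < -y := by linarith
      simp [h1, h2, div_eq_mul_inv]
    · by_cases h2 : ε < -y
      · simp [h1, h2, div_eq_mul_inv]
      · simp [h1, h2]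
  have a1 : Integrable ((Ioi ε).indicator (fun y => φ (x - y) / y)) := by
    refine (hI'.indicator (measurableSet_Ioi (a := ε))).congr (Eventually.of_forall fun y => ?_)
    simp only [indicator, mem_Ioi, mem_ofPred_eq, sub_sub_cancel]
    split_ifs with h1 h2
    · ring
    · exact absurd (h1.trans_le (le_abs_self y)) h2
    · rfl
  have a2 : Integrable ((Ioi ε).indicator (fun y => - φ (x + y) / y)) := by
    refine (hI'.comp_neg.indicator (measurableSet_Ioi (a := ε))).congr
      (Eventually.of_forall fun y => ?_)
    simp only [indicator, mem_Ioi, mem_ofPred_eq, sub_neg_eq_add,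
      show x - (x + y) = -y by ring, abs_neg]
    split_ifs with h1 h2
    · rw [one_div, inv_neg]; ring
    · exact absurd (h1.trans_le (le_abs_self y)) h2
    · rfl
  rw [e, integral_add a1 a2.comp_neg, integral_neg_eq_self (f := (Ioi ε).indicator (fun y => - φ (x + y) / y)),
    integral_indicator measurableSet_Ioi, integral_indicator measurableSet_Ioi,
    ← integral_add ((integrable_indicator_iff measurableSet_Ioi).1 a1)
      ((integrable_indicator_iff measurableSet_Ioi).1 a2)]
  refine setIntegral_congr_fun measurableSet_Ioi fun y _ => ?_
  simp only [symmQuot]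
  ring

theorem tendsto_hilbertTrunc (x : ℝ) :
    Tendsto (fun ε => hilbertTrunc ε φ x) (𝓝[>] 0)
      (𝓝 (Real.pi⁻¹ * ∫ y in Ioi 0, symmQuot φ x y)) := by
  have hI := (integrableOn_symmQuot hi hL x).1
  have : Tendsto (fun ε : ℝ => ∫ y in Ioi 0, (Ioi ε).indicator (symmQuot φ x) y) (𝓝[>] 0)
      (𝓝 (∫ y in Ioi 0, symmQuot φ x y)) := by
    refine tendsto_integral_filter_of_dominated_convergence (fun y => |symmQuot φ x y|) ?_ ?_
      hI.abs ?_
    · exact Eventually.of_forall fun ε =>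
        ((measurable_symmQuot hL.continuous x).indicator measurableSet_Ioi).aestronglyMeasurable
    · exact Eventually.of_forall fun ε => Eventually.of_forall fun y =>
        norm_indicator_le_norm_self _ _
    · filter_upwards [ae_restrict_mem measurableSet_Ioi] with y hy
      have : ∀ᶠ ε : ℝ in 𝓝[>] 0, ε < y :=
        (eventually_lt_nhds (show (0:ℝ) < y from hy)).filter_mono nhdsWithin_le_nhds
      refine tendsto_const_nhds.congr' ?_
      filter_upwards [this] with ε h
      rw [indicator_of_mem (show y ∈ Ioi ε from h)]
  refine (this.const_mul _).congr' ?_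
  filter_upwards [self_mem_nhdsWithin] with ε hε
  rw [hilbertTrunc_eq hi hε, setIntegral_indicator measurableSet_Ioi,
    inter_eq_self_of_subset_right (Ioi_subset_Ioi (le_of_lt hε))]

theorem hilbert_eq (x : ℝ) : hilbert φ x = Real.pi⁻¹ * ∫ y in Ioi 0, symmQuot φ x y :=
  (tendsto_hilbertTrunc hi hL x).limUnder_eq

theorem tendsto_hilbertTrunc_hilbert (x : ℝ) :
    Tendsto (fun ε => hilbertTrunc ε φ x) (𝓝[>] 0) (𝓝 (hilbert φ x)) :=
  hilbert_eq hi hL x ▸ tendsto_hilbertTrunc hi hL x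

theorem abs_hilbertTrunc_le {ε : ℝ} (hε : 0 < ε) (x : ℝ) :
    |hilbertTrunc ε φ x| ≤ 2 * K + 2 * ∫ t, |φ t| := by
  obtain ⟨hI, hb⟩ := integrableOn_symmQuot hi hL x
  have h1 : |∫ y in Ioi ε, symmQuot φ x y| ≤ 2 * K + 2 * ∫ t, |φ t| := by
    refine (abs_integral_le_integral_abs).trans (le_trans ?_ hb)
    exact setIntegral_mono_set hI.abs (Eventually.of_forall fun y => abs_nonneg _)
      (Ioi_subset_Ioi hε.le).eventuallyLE
  rw [hilbertTrunc_eq hi hε, abs_mul, abs_of_pos (by positivity)]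
  refine (mul_le_of_le_one_left (abs_nonneg _) ?_).trans h1
  exact inv_le_one_of_one_le₀ (by linarith [Real.pi_gt_three])

theorem abs_hilbert_le (x : ℝ) : |hilbert φ x| ≤ 2 * K + 2 * ∫ t, |φ t| := by
  refine le_of_tendsto (tendsto_hilbertTrunc_hilbert hi hL x).abs ?_
  filter_upwards [self_mem_nhdsWithin] with ε hε
  exact abs_hilbertTrunc_le hi hL hε x

theorem measurable_hilbert : Measurable (hilbert φ) := by
  have : hilbert φ = fun x => Real.pi⁻¹ * ∫ y in Ioi 0, symmQuot φ x y :=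
    funext fun x => hilbert_eq hi hL x
  rw [this]
  exact ((measurable_uncurry_symmQuot hL.continuous).stronglyMeasurable.integral_prod_right
    (ν := volume.restrict (Ioi 0))).measurable.const_mul _

-- Off the support the truncation is inactive for small `ε`, so no principal value is needed.
omit hi hL in
theorem hilbert_eq_of_eventually_zero {x : ℝ} (h0 : ∀ᶠ t in 𝓝 x, φ t = 0) :
    hilbert φ x = Real.pi⁻¹ * ∫ t, φ t / (x - t) := by
  obtain ⟨r, hr, h⟩ := Metric.eventually_nhds_iff.1 h0
  refine Tendsto.limUnder_eq (tendsto_const_nhds.congr' ?_)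
  filter_upwards [Ioo_mem_nhdsGT hr] with ε hε
  congr 1
  rw [setIntegral_eq_integral_of_forall_compl_eq_zero]
  · simp [div_eq_mul_inv]
  · intro t ht
    have : |x - t| ≤ ε := not_lt.1 ht
    rw [h (by rw [Real.dist_eq, abs_sub_comm]; exact this.trans_lt hε.2), zero_mul]

end

theorem hilbert_add {φ ψ : ℝ → ℝ} {K K' : ℝ≥0} (hi : Integrable φ) (hL : LipschitzWith K φ)
    (hi' : Integrable ψ) (hL' : LipschitzWith K' ψ) (x : ℝ) :
    hilbert (fun t => φ t + ψ t) x = hilbert φ x + hilbert ψ x := by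
  refine Tendsto.limUnder_eq (((tendsto_hilbertTrunc_hilbert hi hL x).add
    (tendsto_hilbertTrunc_hilbert hi' hL' x)).congr' ?_)
  filter_upwards [self_mem_nhdsWithin] with ε hε
  simp only [hilbertTrunc]
  rw [← mul_add, ← integral_add (integrable_trunc_kernel hi hε x)
    (integrable_trunc_kernel hi' hε x)]
  simp only [add_mul]

theorem hilbert_const_mul {φ : ℝ → ℝ} {K : ℝ≥0} (hi : Integrable φ) (hL : LipschitzWith K φ)
    (c x : ℝ) : hilbert (fun t => c * φ t) x = c * hilbert φ x := by
  refine Tendsto.limUnder_eq (((tendsto_hilbertTrunc_hilbert hi hL x).const_mul c).congr ?_)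
  intro ε
  simp only [hilbertTrunc, mul_assoc]
  rw [integral_const_mul]
  ring

theorem hilbert_comp_neg {φ : ℝ → ℝ} {K : ℝ≥0} (hi : Integrable φ) (hL : LipschitzWith K φ)
    (x : ℝ) : hilbert (fun t => φ (-t)) x = - hilbert φ (-x) := by
  refine Tendsto.limUnder_eq ((tendsto_hilbertTrunc_hilbert hi hL (-x)).neg.congr fun ε => ?_)
  rw [hilbertTrunc, ← mul_neg, ← integral_neg, ← integral_indicator (measurableSet_lt_abs_sub _ _),
    ← integral_indicator (measurableSet_lt_abs_sub _ _), ← integral_neg_eq_self]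
  congr 2
  funext t
  simp only [indicator, mem_ofPred_eq, sub_neg_eq_add, ← sub_eq_neg_add, abs_sub_comm t x]
  split_ifs
  · rw [← neg_sub x t, one_div, one_div, inv_neg]; ring
  · rfl

theorem hilbert_comp_add (φ : ℝ → ℝ) (a x : ℝ) :
    hilbert (fun t => φ (t + a)) x = hilbert φ (x + a) := by
  unfold hilbert
  congr 1
  funext ε
  congr 1
  rw [← integral_indicator (measurableSet_lt_abs_sub _ _),
    ← integral_indicator (measurableSet_lt_abs_sub _ _)]
  conv_rhs => rw [← integral_add_right_eq_self _ a]
  congr 1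
  funext t
  simp [indicator]

theorem integral_inv_sub_left {a b x : ℝ} (hab : a ≤ b) (hb : b < x) :
    ∫ t in a..b, 1 / (x - t) = Real.log ((x - a) / (x - b)) := by
  rw [intervalIntegral.integral_comp_sub_left (fun u => 1 / u) x, integral_one_div]
  rw [uIcc_of_le (by linarith)]
  intro h
  linarith [h.1]

theorem integral_inv_sub_right {a b x : ℝ} (hab : a ≤ b) (ha : x < a) :
    ∫ t in a..b, 1 / (x - t) = - Real.log ((b - x) / (a - x)) := by
  have : ∀ t, 1 / (x - t) = - (1 / (t - x)) := fun t => by rw [← neg_sub t x, one_div, one_div, inv_neg]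
  simp only [this]
  rw [intervalIntegral.integral_neg, intervalIntegral.integral_comp_sub_right (fun u => 1 / u) x,
    integral_one_div]
  rw [uIcc_of_le (by linarith)]
  intro h
  linarith [h.1]

/-- The truncated principal value of `∫_α^β dt / (x - t)`. -/
theorem setIntegral_trunc_Icc {α β x ε : ℝ} (hε : 0 < ε) (h1 : ε < x - α) (h2 : ε < β - x) :
    IntegrableOn (fun t => (Icc α β).indicator (fun _ => (1 : ℝ)) t * (1 / (x - t)))
      {t : ℝ | ε < |x - t|} ∧
    ∫ t in {t : ℝ | ε < |x - t|}, (Icc α β).indicator (fun _ => (1 : ℝ)) t * (1 / (x - t)) =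
      Real.log ((x - α) / (β - x)) := by
  have hi : Integrable ((Icc α β).indicator (fun _ => (1 : ℝ))) :=
    (integrable_indicator_iff measurableSet_Icc).2 (by simp)
  have hI := integrable_trunc_kernel hi hε x
  refine ⟨hI, ?_⟩
  have e : ∀ t, (Icc α β).indicator (fun _ => (1 : ℝ)) t * (1 / (x - t)) =
      (Icc α β).indicator (fun t => 1 / (x - t)) t := fun t => by
    by_cases h : t ∈ Icc α β <;> simp [h]
  simp only [e]
  rw [setIntegral_indicator measurableSet_Icc]
  have hs : {t : ℝ | ε < |x - t|} ∩ Icc α β = Ico α (x - ε) ∪ Ioc (x + ε) β := by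
    ext t
    simp only [mem_inter_iff, mem_ofPred_eq, lt_abs, mem_Icc, mem_union, mem_Ico, mem_Ioc]
    constructor
    · rintro ⟨h | h, h3, h4⟩
      · left; constructor <;> linarith
      · right; constructor <;> linarith
    · rintro (h | h)
      · exact ⟨Or.inl (by linarith), h.1, by linarith⟩
      · exact ⟨Or.inr (by linarith), by linarith, h.2⟩
  have hI2 : IntegrableOn (fun t => 1 / (x - t)) (Ico α (x - ε) ∪ Ioc (x + ε) β) := by
    rw [← hs]
    simp only [e] at hI
    rw [IntegrableOn, inter_comm, ← Measure.restrict_restrict measurableSet_Icc]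
    exact (integrable_indicator_iff measurableSet_Icc).1 hI
  rw [hs, setIntegral_union _ measurableSet_Ioc (hI2.mono_set subset_union_left)
    (hI2.mono_set subset_union_right), integral_Ico_eq_integral_Ioo,
    ← integral_Ioc_eq_integral_Ioo, ← intervalIntegral.integral_of_le (by linarith),
    ← intervalIntegral.integral_of_le (by linarith), integral_inv_sub_left (by linarith) (by linarith),
    integral_inv_sub_right (by linarith) (by linarith)]
  · rw [sub_sub_cancel, add_sub_cancel_left, Real.log_div, Real.log_div, Real.log_div] <;>
      first | ring1 | (intro h; linarith)
  · rw [disjoint_left]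
    intro t h h'
    linarith [h.2, h'.1]

/-- The Hilbert transform with the singularity removed by means of an interval around `x`. -/
theorem hilbert_regularized {φ : ℝ → ℝ} {K : ℝ≥0} (hi : Integrable φ) (hL : LipschitzWith K φ)
    {α β x : ℝ} (h1 : α < x) (h2 : x < β) :
    Integrable (fun t => (φ t - φ x * (Icc α β).indicator (fun _ => (1 : ℝ)) t) / (x - t)) ∧
    Real.pi * hilbert φ x =
      (∫ t, (φ t - φ x * (Icc α β).indicator (fun _ => (1 : ℝ)) t) / (x - t)) +
        φ x * Real.log ((x - α) / (β - x)) := by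
  set b : ℝ → ℝ := (Icc α β).indicator (fun _ => (1 : ℝ)) with hb
  have hbi : Integrable b := (integrable_indicator_iff measurableSet_Icc).2 (by simp)
  set δ := min (x - α) (β - x) with hδ
  have hδ0 : 0 < δ := lt_min (by linarith) (by linarith)
  have hF : Integrable (fun t => φ t - φ x * b t) := hi.sub (hbi.const_mul _)
  have hb1 : ∀ t, |x - t| < δ → b t = 1 := fun t ht => by
    rw [abs_lt] at ht
    exact indicator_of_mem (show t ∈ Icc α β from
      ⟨by linarith [min_le_left (x - α) (β - x)], by linarith [min_le_right (x - α) (β - x)]⟩) _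
  have hm : AEStronglyMeasurable (fun t => (φ t - φ x * b t) / (x - t)) :=
    (hF.1.aemeasurable.div (by fun_prop)).aestronglyMeasurable
  have hI : Integrable (fun t => (φ t - φ x * b t) / (x - t)) := by
    -- Within distance `δ` of `x` the indicator equals `1` and the Lipschitz constant bounds the
    -- quotient; farther away the denominator is at least `δ`.
    refine Integrable.mono' (g := fun t => (Icc (x - δ) (x + δ)).indicator (fun _ => (K : ℝ)) t +
      δ⁻¹ * |φ t - φ x * b t|) (Integrable.add ((integrable_indicator_iff measurableSet_Icc).2
        (by simp)) (hF.abs.const_mul _)) hm (Eventually.of_forall fun t => ?_)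
    rw [Real.norm_eq_abs, abs_div]
    rcases lt_or_ge (|x - t|) δ with h | h
    · rw [indicator_of_mem (show t ∈ Icc (x - δ) (x + δ) by
        rw [abs_lt] at h; constructor <;> linarith), hb1 t h, mul_one]
      have : |φ t - φ x| / |x - t| ≤ K := by
        refine div_le_of_le_mul₀ (abs_nonneg _) K.2 ?_
        rw [abs_sub_comm x t]
        exact hL.dist_le_mul t x
      have : 0 ≤ δ⁻¹ * |φ t - φ x| := by positivity
      linarith
    · have : |φ t - φ x * b t| / |x - t| ≤ δ⁻¹ * |φ t - φ x * b t| := by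
        rw [div_eq_inv_mul]
        gcongr
      have : 0 ≤ (Icc (x - δ) (x + δ)).indicator (fun _ => (K : ℝ)) t :=
        indicator_nonneg (fun _ _ => K.2) _
      linarith
  refine ⟨hI, ?_⟩
  have l1 := (tendsto_hilbertTrunc_hilbert hi hL x).const_mul Real.pi
  refine tendsto_nhds_unique l1 ?_
  have l2 : Tendsto (fun ε : ℝ => ∫ t in {t : ℝ | ε < |x - t|}, (φ t - φ x * b t) / (x - t))
      (𝓝[>] 0) (𝓝 (∫ t, (φ t - φ x * b t) / (x - t))) := by
    simp_rw [← integral_indicator (measurableSet_lt_abs_sub _ x)]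
    refine tendsto_integral_filter_of_dominated_convergence _ (Eventually.of_forall fun ε =>
      hm.indicator (measurableSet_lt_abs_sub _ x)) (Eventually.of_forall fun ε =>
      Eventually.of_forall fun y => norm_indicator_le_norm_self _ _) hI.norm
      (Eventually.of_forall fun t => ?_)
    rcases eq_or_ne t x with ht | ht
    · subst ht
      simp [indicator]
    have : ∀ᶠ ε : ℝ in 𝓝[>] 0, ε < |x - t| :=
      (eventually_lt_nhds (abs_pos.2 (sub_ne_zero.2 ht.symm))).filter_mono nhdsWithin_le_nhds
    refine tendsto_const_nhds.congr' ?_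
    filter_upwards [this] with ε h
    rw [indicator_of_mem (show t ∈ {t : ℝ | ε < |x - t|} from h)]
  refine (l2.add_const (φ x * Real.log ((x - α) / (β - x)))).congr' ?_
  -- For `ε < δ` the truncated integral of the indicator is exactly the logarithm, whatever `ε`.
  filter_upwards [Ioo_mem_nhdsGT hδ0] with ε hε
  obtain ⟨j1, j2⟩ := setIntegral_trunc_Icc (α := α) (β := β) hε.1
    (hε.2.trans_le (min_le_left _ _)) (hε.2.trans_le (min_le_right _ _))
  rw [hilbertTrunc, mul_inv_cancel_left₀ Real.pi_ne_zero, ← j2, ← integral_const_mul,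
    ← integral_add hI.integrableOn (j1.const_mul _)]
  refine integral_congr_ae (Eventually.of_forall fun t => ?_)
  simp only
  ring

theorem image_inversion : (fun s : ℝ => -1 / s) '' {0}ᶜ = {0}ᶜ := by
  ext t
  simp only [mem_image, mem_compl_iff, mem_singleton_iff]
  constructor
  · rintro ⟨s, hs, rfl⟩
    exact div_ne_zero (by norm_num) hs
  · intro h
    exact ⟨-1 / t, div_ne_zero (by norm_num) h, by field_simp⟩

theorem inversion_inversion (s : ℝ) : -1 / (-1 / s) = s := by
  rcases eq_or_ne s 0 with rfl | h
  · simp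
  · field_simp

theorem hasDerivAt_inversion {s : ℝ} (hs : s ≠ 0) :
    HasDerivAt (fun s : ℝ => -1 / s) (1 / s ^ 2) s := by
  simpa [div_eq_mul_inv] using (hasDerivAt_inv hs).const_mul (-1)

theorem injective_inversion : Function.Injective (fun s : ℝ => -1 / s) := fun a b h => by
  have := congrArg (fun s : ℝ => -1 / s) h
  simpa only [inversion_inversion] using this

/-- Change of variables under `s ↦ -1 / s`. -/
theorem integral_inversion {E : Type*} [NormedAddCommGroup E] [NormedSpace ℝ E] (F : ℝ → E) :
    ∫ s, (1 / s ^ 2 : ℝ) • F (-1 / s) = ∫ t, F t := by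
  have h := integral_image_eq_integral_abs_deriv_smul (s := ({0}ᶜ : Set ℝ))
    (measurableSet_singleton _).compl (f := fun s : ℝ => -1 / s) (f' := fun s => 1 / s ^ 2)
    (fun s hs => (hasDerivAt_inversion hs).hasDerivWithinAt) injective_inversion.injOn F
  rw [image_inversion, restrict_compl_singleton] at h
  rw [h]
  simp only [abs_of_nonneg (show (0 : ℝ) ≤ 1 / _ ^ 2 by positivity)]

theorem integrable_inversion {E : Type*} [NormedAddCommGroup E] [NormedSpace ℝ E] {F : ℝ → E} :
    Integrable (fun s => (1 / s ^ 2 : ℝ) • F (-1 / s)) ↔ Integrable F := by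
  have h := integrableOn_image_iff_integrableOn_abs_deriv_smul (s := ({0}ᶜ : Set ℝ))
    (measurableSet_singleton _).compl (f := fun s : ℝ => -1 / s) (f' := fun s => 1 / s ^ 2)
    (fun s hs => (hasDerivAt_inversion hs).hasDerivWithinAt) injective_inversion.injOn F
  rw [image_inversion, IntegrableOn, IntegrableOn, restrict_compl_singleton] at h
  rw [h]
  simp only [abs_of_nonneg (show (0 : ℝ) ≤ 1 / _ ^ 2 by positivity)]

/-- The Hilbert transform commutes with the inversion, up to a constant. -/
theorem hilbert_comp_inversion {φ : ℝ → ℝ} {K K' : ℝ≥0} (hi : Integrable φ)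
    (hL : LipschitzWith K φ) (h0 : ∀ᶠ t in 𝓝 0, φ t = 0)
    (hi' : Integrable fun s => φ (-1 / s)) (hL' : LipschitzWith K' fun s => φ (-1 / s))
    {y : ℝ} (hy : y ≠ 0) :
    hilbert (fun s => φ (-1 / s)) y = hilbert φ (-1 / y) - hilbert φ 0 := by
  set z := -1 / y with hz
  have hz0 : z ≠ 0 := div_ne_zero (by norm_num) hy
  have hyz : y = -1 / z := (inversion_inversion y).symm
  -- An interval around `z` that avoids `0` is carried by the inversion to an interval around `y`,
  -- so both transforms can be regularized with corresponding indicators.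
  obtain ⟨α, β, hαz, hzβ, hαβ⟩ : ∃ α β : ℝ, α < z ∧ z < β ∧ 0 < α * β := by
    rcases hz0.lt_or_gt with h | h
    · exact ⟨2 * z, z / 2, by linarith, by linarith, by nlinarith⟩
    · exact ⟨z / 2, 2 * z, by linarith, by linarith, by nlinarith⟩
  have hα0 : α ≠ 0 := left_ne_zero_of_mul hαβ.ne'
  have hβ0 : β ≠ 0 := right_ne_zero_of_mul hαβ.ne'
  have hαz0 : 0 < α * z := by
    rcases hα0.lt_or_gt with h | h
    · have : β < 0 := by by_contra! h'; nlinarith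
      nlinarith
    · nlinarith
  have hβz0 : 0 < β * z := by
    rcases hα0.lt_or_gt with h | h
    · have : β < 0 := by by_contra! h'; nlinarith
      nlinarith
    · nlinarith
  have hle : ∀ {a b : ℝ}, 0 < a * b → (-1 / a ≤ -1 / b ↔ a ≤ b) := by
    intro a b hab
    have ha : a ≠ 0 := left_ne_zero_of_mul hab.ne'
    have hb : b ≠ 0 := right_ne_zero_of_mul hab.ne'
    have : -1 / b - -1 / a = (b - a) / (a * b) := by field_simp; ring
    rw [← sub_nonneg, this, ← sub_nonneg (a := b)]
    exact ⟨fun h => by simpa [div_mul_cancel₀ _ hab.ne'] using mul_nonneg h hab.le,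
      fun h => div_nonneg h hab.le⟩
  have hlt : ∀ {a b : ℝ}, 0 < a * b → (-1 / a < -1 / b ↔ a < b) := by
    intro a b hab
    rw [← not_le, ← not_le, hle (by linarith [mul_comm a b])]
  obtain ⟨I1, e1⟩ := hilbert_regularized hi hL hαz hzβ
  obtain ⟨I2, e2⟩ := hilbert_regularized hi' hL' (x := y) (α := -1 / α) (β := -1 / β)
    (by rw [hyz]; exact (hlt hαz0).2 hαz) (by rw [hyz]; exact (hlt (by linarith)).2 hzβ)
  simp only [← hz] at e2
  set b : ℝ → ℝ := (Icc α β).indicator (fun _ => (1 : ℝ)) with hb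
  have hbb : ∀ t, t ≠ 0 → (Icc (-1 / α) (-1 / β)).indicator (fun _ => (1 : ℝ)) (-1 / t) = b t := by
    intro t ht
    rcases lt_or_ge 0 (α * t) with h | h
    · have h' : 0 < t * β := by
        have : 0 < (α * t) * (α * β) := by positivity
        have h3 : (α * t) * (α * β) = α ^ 2 * (t * β) := by ring
        rw [h3] at this
        exact pos_of_mul_pos_right this (by positivity)
      simp only [hb, indicator, mem_Icc, hle h, hle h']
    · have h1 : t ∉ Icc α β := fun ⟨h2, h3⟩ => by
        rcases hα0.lt_or_gt with h4 | h4
        · have : β < 0 := by by_contra! h'; nlinarith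
          nlinarith
        · nlinarith
      have h2 : -1 / t ∉ Icc (-1 / α) (-1 / β) := fun ⟨h2, h3⟩ => by
        have hαt : α * t < 0 := lt_of_le_of_ne h (mul_ne_zero hα0 ht)
        have p : 0 < (-1 / α) * (-1 / β) := by
          have : (-1 / α) * (-1 / β) = 1 / (α * β) := by field_simp
          rw [this]; positivity
        have q : (-1 / α) * (-1 / t) < 0 := by
          have : (-1 / α) * (-1 / t) = 1 / (α * t) := by field_simp
          rw [this]; exact one_div_neg.2 hαt
        rcases (left_ne_zero_of_mul p.ne').lt_or_gt with h4 | h4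
        · have : -1 / β < 0 := by by_contra! h'; nlinarith
          nlinarith
        · nlinarith
      rw [indicator_of_notMem h2, hb, indicator_of_notMem h1]
  -- Both `φ` and the indicator vanish near `0`, so the division by `t` is harmless.
  have hFi : Integrable (fun t => (φ t - φ z * b t) / t) := by
    have hbi : Integrable b := (integrable_indicator_iff measurableSet_Icc).2 (by simp)
    obtain ⟨r, hr, h⟩ := Metric.eventually_nhds_iff.1 h0
    have hF : Integrable (fun t => φ t - φ z * b t) := hi.sub (hbi.const_mul _)
    set δ := min r (min |α| |β|) with hδ
    have hδ0 : 0 < δ := lt_min hr (lt_min (abs_pos.2 hα0) (abs_pos.2 hβ0))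
    refine Integrable.mono' (g := fun t => δ⁻¹ * |φ t - φ z * b t|) (hF.abs.const_mul _)
      (hF.1.aemeasurable.div (by fun_prop)).aestronglyMeasurable (Eventually.of_forall fun t => ?_)
    rw [Real.norm_eq_abs, abs_div]
    rcases lt_or_ge (|t|) δ with h' | h'
    · have h1 : φ t = 0 := h (by
        rw [Real.dist_eq, sub_zero]; exact h'.trans_le (min_le_left _ _))
      have h2 : t ∉ Icc α β := fun ⟨h2, h3⟩ => by
        have h4 : |t| < |α| := h'.trans_le ((min_le_right _ _).trans (min_le_left _ _))
        have h5 : |t| < |β| := h'.trans_le ((min_le_right _ _).trans (min_le_right _ _))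
        rcases hα0.lt_or_gt with h6 | h6
        · have h7 : β < 0 := by by_contra! h'; nlinarith
          rw [abs_of_neg h7, abs_of_neg (by linarith)] at h5
          linarith
        · rw [abs_of_pos h6, abs_of_pos (by linarith)] at h4
          linarith
      rw [h1, hb, indicator_of_notMem h2]
      simp
    · rw [div_eq_inv_mul]
      gcongr
  have e3 : ∫ s, (φ (-1 / s) - φ z * (Icc (-1 / α) (-1 / β)).indicator (fun _ => (1 : ℝ)) s) /
      (y - s) = (∫ t, (φ t - φ z * b t) / (z - t)) + ∫ t, (φ t - φ z * b t) / t := by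
    rw [← integral_add I1 hFi, ← integral_inversion]
    refine integral_congr_ae ?_
    filter_upwards [compl_mem_ae_iff.2 (measure_singleton (0 : ℝ)),
      compl_mem_ae_iff.2 (measure_singleton z)] with t ht0 htz
    rw [hbb t ht0, inversion_inversion, smul_eq_mul]
    have ht0' : t ≠ 0 := ht0
    have htz' : z - t ≠ 0 := sub_ne_zero.2 (Ne.symm htz)
    have : y - -1 / t ≠ 0 := by
      rw [hyz]
      intro h
      apply htz
      have := injective_inversion (sub_eq_zero.1 h)
      exact this.symm
    -- Partial fractions: the first term gives the transform at `z`, the second the constant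
    -- `-hilbert φ 0`.
    have h4 : 1 / t ^ 2 / (y - -1 / t) = 1 / (z - t) + 1 / t := by
      rw [hyz] at this ⊢
      have e : -1 / z - -1 / t = (z - t) / (z * t) := by field_simp; ring
      rw [e]
      field_simp
      ring
    calc _ = (φ t - φ z * b t) * (1 / t ^ 2 / (y - -1 / t)) := by ring
      _ = _ := by rw [h4]; ring
  have e4 : ∫ t, (φ t - φ z * b t) / t = - (Real.pi * hilbert φ 0) - φ z * Real.log (β / α) := by
    have hbI : Integrable (fun t => b t * (1 / t)) ∧ ∫ t, b t * (1 / t) = Real.log (β / α) := by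
      have e : ∀ t, b t * (1 / t) = (Icc α β).indicator (fun t => 1 / t) t := fun t => by
        by_cases h : t ∈ Icc α β <;> simp [hb, h]
      simp only [e]
      have hnot : (0 : ℝ) ∉ uIcc α β := by
        rw [uIcc_of_le (by linarith)]
        intro h
        nlinarith [h.1, h.2]
      constructor
      · rw [integrable_indicator_iff measurableSet_Icc]
        refine ContinuousOn.integrableOn_Icc (continuousOn_const.div continuousOn_id fun t ht => ?_)
        intro h
        rw [uIcc_of_le (by linarith)] at hnot
        exact hnot (by rw [← show t = 0 from h]; exact ht)
      · rw [integral_indicator measurableSet_Icc, integral_Icc_eq_integral_Ioc,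
          ← intervalIntegral.integral_of_le (by linarith), integral_one_div hnot]
    have hφ : Integrable (fun t => φ t / t) := by
      refine (hFi.add (hbI.1.const_mul (φ z))).congr (Eventually.of_forall fun t => ?_)
      simp only [Pi.add_apply]
      ring
    have : ∀ t, (φ t - φ z * b t) / t = φ t / t - φ z * (b t * (1 / t)) := fun t => by ring
    simp only [this]
    rw [integral_sub hφ (hbI.1.const_mul _), integral_const_mul, hbI.2,
      hilbert_eq_of_eventually_zero h0, mul_inv_cancel_left₀ Real.pi_ne_zero, ← integral_neg]
    congr 2
    funext t
    rw [zero_sub, div_neg, neg_neg]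
  -- The two regularizing intervals give logarithms differing by `log (β / α)`, which cancels the
  -- logarithm in `e4`.
  have e5 : Real.log ((y - -1 / α) / (-1 / β - y)) =
      Real.log ((z - α) / (β - z)) + Real.log (β / α) := by
    have hp : (z - α) / (β - z) ≠ 0 := (div_pos (by linarith) (by linarith)).ne'
    rw [← Real.log_mul hp (div_ne_zero hβ0 hα0)]
    congr 1
    rw [hyz]
    have e6 : -1 / z - -1 / α = (z - α) / (z * α) := by field_simp; ring
    have e7 : -1 / β - -1 / z = (β - z) / (z * β) := by field_simp; ring
    have : β - z ≠ 0 := by linarith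
    rw [e6, e7]
    field_simp
  have : Real.pi * hilbert (fun s => φ (-1 / s)) y =
      Real.pi * (hilbert φ z - hilbert φ 0) := by
    rw [e2, e3, e4, e5, mul_sub, e1]
    ring
  exact mul_left_cancel₀ Real.pi_ne_zero this

/-- The Hilbert transform is antisymmetric. -/
theorem integral_hilbert_mul {φ ψ : ℝ → ℝ} {K K' : ℝ≥0} (hi : Integrable φ)
    (hL : LipschitzWith K φ) (hi' : Integrable ψ) (hL' : LipschitzWith K' ψ) :
    ∫ x, hilbert φ x * ψ x = - ∫ x, φ x * hilbert ψ x := by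
  have meas : ∀ {φ : ℝ → ℝ} {K : ℝ≥0} (hi : Integrable φ) (hL : LipschitzWith K φ) {ε : ℝ}
      (hε : 0 < ε), Measurable (hilbertTrunc ε φ) := by
    intro φ K hi hL ε hε
    have : hilbertTrunc ε φ = fun x => Real.pi⁻¹ * ∫ y in Ioi ε, symmQuot φ x y :=
      funext fun x => hilbertTrunc_eq hi hε x
    rw [this]
    exact ((measurable_uncurry_symmQuot hL.continuous).stronglyMeasurable.integral_prod_right
      (ν := volume.restrict (Ioi ε))).measurable.const_mul _
  have lim : ∀ {φ ψ : ℝ → ℝ} {K : ℝ≥0} (hi : Integrable φ) (hL : LipschitzWith K φ)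
      (hi' : Integrable ψ), Tendsto (fun ε => ∫ x, hilbertTrunc ε φ x * ψ x) (𝓝[>] 0)
        (𝓝 (∫ x, hilbert φ x * ψ x)) := by
    intro φ ψ K hi hL hi'
    refine tendsto_integral_filter_of_dominated_convergence
      (fun x => (2 * K + 2 * ∫ t, |φ t|) * |ψ x|) ?_ ?_ (hi'.abs.const_mul _) ?_
    · filter_upwards [self_mem_nhdsWithin] with ε hε
      exact (meas hi hL hε).aestronglyMeasurable.mul hi'.1
    · filter_upwards [self_mem_nhdsWithin] with ε hε
      refine Eventually.of_forall fun x => ?_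
      rw [norm_mul]
      exact mul_le_mul_of_nonneg_right (abs_hilbertTrunc_le hi hL hε x) (abs_nonneg _)
    · exact Eventually.of_forall fun x => (tendsto_hilbertTrunc_hilbert hi hL x).mul_const _
  have l1 := lim hi hL hi'
  have l2 := (lim hi' hL' hi).neg
  have e : ∫ x, φ x * hilbert ψ x = ∫ x, hilbert ψ x * φ x := by simp only [mul_comm]
  rw [e]
  refine tendsto_nhds_unique l1 (l2.congr' ?_)
  filter_upwards [self_mem_nhdsWithin] with ε hε
  have hε : 0 < ε := hε
  -- At fixed `ε` the truncated kernel is bounded and antisymmetric, so Fubini's theorem applies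
  -- without any principal value.
  set k : ℝ × ℝ → ℝ := fun p => {p : ℝ × ℝ | ε < |p.1 - p.2|}.indicator
    (fun p => 1 / (p.1 - p.2)) p with hk
  have hkm : Measurable k := Measurable.indicator (by fun_prop)
    (isOpen_lt continuous_const (by fun_prop)).measurableSet
  have hkb : ∀ p, ‖k p‖ ≤ ε⁻¹ := fun p => by
    rw [hk]
    by_cases h : ε < |p.1 - p.2|
    · simp only [indicator_of_mem (show p ∈ {p : ℝ × ℝ | ε < |p.1 - p.2|} from h)]
      rw [Real.norm_eq_abs, abs_div, abs_one, one_div]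
      gcongr
    · simp only [indicator_of_notMem (show p ∉ {p : ℝ × ℝ | ε < |p.1 - p.2|} from h)]
      simp [hε.le]
  have tr : ∀ (φ : ℝ → ℝ) x, hilbertTrunc ε φ x = Real.pi⁻¹ * ∫ t, φ t * k (x, t) := by
    intro φ x
    rw [hilbertTrunc, ← integral_indicator (measurableSet_lt_abs_sub _ _)]
    congr 2
    funext t
    simp only [hk, indicator, mem_ofPred_eq]
    split_ifs <;> simp
  have hI : Integrable (fun p : ℝ × ℝ => (φ p.2 * k p) * ψ p.1) (volume.prod volume) := by
    have := (hi'.mul_prod hi).bdd_mul (c := ε⁻¹) hkm.aestronglyMeasurable (Eventually.of_forall hkb)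
    refine this.congr (Eventually.of_forall fun p => ?_)
    simp only
    ring
  have c1 : ∫ x, hilbertTrunc ε φ x * ψ x = Real.pi⁻¹ * ∫ x, ∫ t, (φ t * k (x, t)) * ψ x := by
    rw [← integral_const_mul]
    congr 1
    funext x
    rw [tr, integral_mul_const, mul_assoc]
  have c2 : ∫ x, hilbertTrunc ε ψ x * φ x = Real.pi⁻¹ * ∫ t, ∫ x, (ψ x * k (t, x)) * φ t := by
    rw [← integral_const_mul]
    congr 1
    funext x
    rw [tr, integral_mul_const, mul_assoc]
  rw [c1, c2, integral_integral_swap (f := fun x t => φ t * k (x, t) * ψ x) hI, ← mul_neg, ← integral_neg]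
  congr 2
  funext t
  rw [← integral_neg]
  congr 1
  funext x
  have : k (t, x) = - k (x, t) := by
    simp only [hk, indicator, mem_ofPred_eq, abs_sub_comm t x]
    split_ifs
    · rw [← neg_sub x t, one_div, one_div, inv_neg]
    · simp
  rw [this]
  ring

/-! ### The Poisson kernel and the Poisson formula -/

theorem poisson_nonneg {ε : ℝ} (hε : 0 < ε) (x t : ℝ) : 0 ≤ poisson x ε t := by
  unfold poisson; positivity

theorem integrable_poisson {ε : ℝ} (hε : 0 < ε) (x : ℝ) : Integrable (poisson x ε) := by
  have h := ((integrable_inv_one_add_sq.comp_div hε.ne').comp_sub_left x).const_mul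
    (Real.pi⁻¹ * ε⁻¹)
  refine h.congr (Eventually.of_forall fun t => ?_)
  simp only [poisson]
  field_simp

theorem integral_poisson {ε : ℝ} (hε : 0 < ε) (x : ℝ) : ∫ t, poisson x ε t = 1 := by
  have h : poisson x ε = fun t => (Real.pi⁻¹ * ε⁻¹) * (fun u => (1 + (u / ε) ^ 2)⁻¹) (x - t) := by
    funext t
    simp only [poisson]
    field_simp
  rw [h, integral_const_mul, integral_sub_left_eq_self (fun u => (1 + (u / ε) ^ 2)⁻¹) volume x,
    Measure.integral_comp_div (fun u => (1 + u ^ 2)⁻¹) ε, integral_univ_inv_one_add_sq, abs_of_pos hε,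
    smul_eq_mul]
  field_simp

theorem lipschitzWith_poisson {ε : ℝ} (hε : 0 < ε) (x : ℝ) :
    ∃ K, LipschitzWith K (poisson x ε) := by
  refine ⟨Real.toNNReal (Real.pi⁻¹ * (1 / ε ^ 2)), ?_⟩
  refine LipschitzWith.of_dist_le_mul fun a b => ?_
  rw [Real.coe_toNNReal _ (by positivity), Real.dist_eq, Real.dist_eq, poisson, poisson]
  have hA : 0 < ε ^ 2 + (x - a) ^ 2 := by positivity
  have hB : 0 < ε ^ 2 + (x - b) ^ 2 := by positivity
  have e : Real.pi⁻¹ * (ε / (ε ^ 2 + (x - a) ^ 2)) - Real.pi⁻¹ * (ε / (ε ^ 2 + (x - b) ^ 2)) =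
      Real.pi⁻¹ * (ε * ((x - a) + (x - b)) / ((ε ^ 2 + (x - a) ^ 2) * (ε ^ 2 + (x - b) ^ 2))) *
        (a - b) := by
    field_simp
    ring
  rw [e, abs_mul, abs_mul, abs_of_pos (by positivity : 0 < Real.pi⁻¹)]
  gcongr
  rw [abs_div, abs_of_pos (mul_pos hA hB), div_le_div_iff₀ (by positivity) (by positivity),
    abs_mul, abs_of_pos hε, one_mul]
  have h1 : 2 * ε * |x - a| ≤ ε ^ 2 + (x - a) ^ 2 := by
    rw [← sq_abs (x - a)]; nlinarith [sq_nonneg (ε - |x - a|)]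
  have h2 : 2 * ε * |x - b| ≤ ε ^ 2 + (x - b) ^ 2 := by
    rw [← sq_abs (x - b)]; nlinarith [sq_nonneg (ε - |x - b|)]
  have h3 : ε ^ 2 ≤ ε ^ 2 + (x - a) ^ 2 := by nlinarith [sq_nonneg (x - a)]
  have h4 : ε ^ 2 ≤ ε ^ 2 + (x - b) ^ 2 := by nlinarith [sq_nonneg (x - b)]
  calc ε * |x - a + (x - b)| * ε ^ 2 ≤ ε * (|x - a| + |x - b|) * ε ^ 2 := by
        gcongr; exact abs_add_le _ _
    _ = ((2 * ε * |x - a|) * ε ^ 2 + ε ^ 2 * (2 * ε * |x - b|)) / 2 := by ring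
    _ ≤ ((ε ^ 2 + (x - a) ^ 2) * (ε ^ 2 + (x - b) ^ 2) +
          (ε ^ 2 + (x - a) ^ 2) * (ε ^ 2 + (x - b) ^ 2)) / 2 := by gcongr
    _ = _ := by ring

/-- The Hilbert transform of the Poisson kernel is the conjugate Poisson kernel. -/
theorem hilbert_poisson {ε : ℝ} (hε : 0 < ε) (x t : ℝ) :
    hilbert (poisson x ε) t = Real.pi⁻¹ * ((t - x) / (ε ^ 2 + (t - x) ^ 2)) := by
  obtain ⟨K, hK⟩ := lipschitzWith_poisson hε x
  have hi := integrable_poisson hε x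
  rw [hilbert_eq hi hK]
  congr 1
  set w := t - x with hw
  set c := ε / (Real.pi * (ε ^ 2 + w ^ 2)) with hc
  -- An explicit primitive of the difference quotient, found by partial fractions. It vanishes at
  -- `0` and tends to `w / (ε² + w²)` at infinity.
  set f : ℝ → ℝ := fun y => c * ((1 / 2) * (Real.log (ε ^ 2 + (y + w) ^ 2) -
    Real.log (ε ^ 2 + (y - w) ^ 2)) + (w / ε) * (Real.arctan ((y + w) / ε) +
      Real.arctan ((y - w) / ε))) with hf
  have hA : ∀ y, 0 < ε ^ 2 + (y + w) ^ 2 := fun y => by positivity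
  have hB : ∀ y, 0 < ε ^ 2 + (y - w) ^ 2 := fun y => by positivity
  have hd : ∀ y ∈ Ioi (0 : ℝ), HasDerivAt f (symmQuot (poisson x ε) t y) y := by
    intro y hy
    have hy : 0 < y := hy
    have d1 : HasDerivAt (fun y => Real.log (ε ^ 2 + (y + w) ^ 2)) _ y :=
      ((((hasDerivAt_id y).add_const w).pow 2).const_add (ε ^ 2)).log (hA y).ne'
    have d2 : HasDerivAt (fun y => Real.log (ε ^ 2 + (y - w) ^ 2)) _ y :=
      ((((hasDerivAt_id y).sub_const w).pow 2).const_add (ε ^ 2)).log (hB y).ne'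
    have d3 : HasDerivAt (fun y => Real.arctan ((y + w) / ε)) _ y :=
      (((hasDerivAt_id y).add_const w).div_const ε).arctan
    have d4 : HasDerivAt (fun y => Real.arctan ((y - w) / ε)) _ y :=
      (((hasDerivAt_id y).sub_const w).div_const ε).arctan
    have := ((((d1.sub d2).const_mul (1 / 2)).add ((d3.add d4).const_mul (w / ε))).const_mul c)
    refine this.congr_deriv ?_
    simp only [symmQuot, poisson, id, Pi.pow_apply]
    have e1 : x - (t - y) = y - w := by rw [hw]; ring
    have e2 : x - (t + y) = - (y + w) := by rw [hw]; ring
    rw [e1, e2, neg_sq, hc]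
    have := (hA y).ne'
    have := (hB y).ne'
    have e3 : 1 + ((y + w) / ε) ^ 2 = (ε ^ 2 + (y + w) ^ 2) / ε ^ 2 := by field_simp
    have e4 : 1 + ((y - w) / ε) ^ 2 = (ε ^ 2 + (y - w) ^ 2) / ε ^ 2 := by field_simp
    rw [e3, e4]
    have : ε ^ 2 + w ^ 2 ≠ 0 := by positivity
    field_simp
    ring
  have hcont : ContinuousWithinAt f (Ici 0) 0 := by
    refine Continuous.continuousWithinAt ?_
    refine continuous_const.mul ((continuous_const.mul (Continuous.sub ?_ ?_)).add
      (continuous_const.mul (Continuous.add ?_ ?_)))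
    · exact Continuous.log (by fun_prop) fun y => (hA y).ne'
    · exact Continuous.log (by fun_prop) fun y => (hB y).ne'
    · exact Real.continuous_arctan.comp (by fun_prop)
    · exact Real.continuous_arctan.comp (by fun_prop)
  have hlim : Tendsto f atTop (𝓝 (w / (ε ^ 2 + w ^ 2))) := by
    have l1 : Tendsto (fun y => Real.log (ε ^ 2 + (y + w) ^ 2) - Real.log (ε ^ 2 + (y - w) ^ 2))
        atTop (𝓝 0) := by
      have : Tendsto (fun y : ℝ => (ε ^ 2 + (y + w) ^ 2) / (ε ^ 2 + (y - w) ^ 2)) atTop (𝓝 1) := by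
        have h0 : Tendsto (fun y : ℝ => y⁻¹) atTop (𝓝 0) := tendsto_inv_atTop_zero
        have h1 : Tendsto (fun y : ℝ => ((ε * y⁻¹) ^ 2 + (1 + w * y⁻¹) ^ 2) /
            ((ε * y⁻¹) ^ 2 + (1 - w * y⁻¹) ^ 2)) atTop
            (𝓝 (((ε * 0) ^ 2 + (1 + w * 0) ^ 2) / ((ε * 0) ^ 2 + (1 - w * 0) ^ 2))) := by
          refine Tendsto.div ?_ ?_ (by simp)
          · exact ((h0.const_mul ε).pow 2).add (((h0.const_mul w).const_add 1).pow 2)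
          · exact ((h0.const_mul ε).pow 2).add (((h0.const_mul w).const_sub 1).pow 2)
        have e : ((ε * 0) ^ 2 + (1 + w * 0) ^ 2) / ((ε * 0) ^ 2 + (1 - w * 0) ^ 2) = 1 := by norm_num
        rw [e] at h1
        refine h1.congr' ?_
        filter_upwards [eventually_gt_atTop 0] with y hy
        have : (ε * y⁻¹) ^ 2 + (1 - w * y⁻¹) ^ 2 = (ε ^ 2 + (y - w) ^ 2) / y ^ 2 := by field_simp
        rw [this]
        have := (hB y).ne'
        field_simp
      have h2 := (Real.continuousAt_log one_ne_zero).tendsto.comp this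
      rw [Real.log_one] at h2
      refine h2.congr fun y => ?_
      exact Real.log_div (hA y).ne' (hB y).ne'
    have l2 : Tendsto (fun y => Real.arctan ((y + w) / ε)) atTop (𝓝 (Real.pi / 2)) :=
      (Real.tendsto_arctan_atTop.mono_right nhdsWithin_le_nhds).comp
        ((tendsto_atTop_add_const_right _ w tendsto_id).atTop_div_const hε)
    have l3 : Tendsto (fun y => Real.arctan ((y - w) / ε)) atTop (𝓝 (Real.pi / 2)) :=
      (Real.tendsto_arctan_atTop.mono_right nhdsWithin_le_nhds).comp
        ((tendsto_atTop_add_const_right _ (-w) tendsto_id).atTop_div_const hε)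
    have := ((l1.const_mul (1 / 2)).add ((l2.add l3).const_mul (w / ε))).const_mul c
    convert this using 2
    have : ε ^ 2 + w ^ 2 ≠ 0 := by positivity
    rw [hc]
    field_simp
    ring
  rw [integral_Ioi_of_hasDerivAt_of_tendsto hcont hd (integrableOn_symmQuot hi hK t).1 hlim]
  have : f 0 = 0 := by
    have e : (0 - w) / ε = - ((0 + w) / ε) := by ring
    simp only [hf]
    rw [e, Real.arctan_neg]
    simp
  rw [this, sub_zero]

/-- If `A` is holomorphic near the closed upper half plane and `O(|z|⁻²)` at infinity, its
integral along the real line vanishes. -/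
theorem integral_line_eq_zero {A : ℂ → ℂ} {c C R₀ : ℝ} (hc : 0 < c)
    (hA : DifferentiableOn ℂ A {z | -c < z.im})
    (hb : ∀ z : ℂ, 0 ≤ z.im → R₀ ≤ ‖z‖ → ‖A z‖ ≤ C / ‖z‖ ^ 2)
    (hi : Integrable fun x : ℝ => A x) : ∫ x : ℝ, A x = 0 := by
  have hC : 0 ≤ C := by
    have h := (norm_nonneg _).trans (hb (((max R₀ 1 : ℝ) : ℂ)) (by simp)
      (by rw [Complex.norm_real, Real.norm_eq_abs]; exact (le_max_left _ _).trans (le_abs_self _)))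
    by_contra! hC
    have : 0 < ‖((max R₀ 1 : ℝ) : ℂ)‖ := by
      rw [Complex.norm_real, Real.norm_eq_abs]
      exact abs_pos.2 (by positivity)
    have := div_neg_of_neg_of_pos hC (pow_pos this 2)
    linarith
  have l1 : Tendsto (fun R : ℝ => ∫ x in (-R)..R, A x) atTop (𝓝 (∫ x : ℝ, A x)) :=
    intervalIntegral_tendsto_integral hi tendsto_neg_atTop_atBot tendsto_id
  refine tendsto_nhds_unique l1 ?_
  have l2 : Tendsto (fun R : ℝ => 4 * C / R) atTop (𝓝 0) := tendsto_const_nhds.div_atTop tendsto_id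
  refine squeeze_zero_norm' ?_ l2
  filter_upwards [eventually_ge_atTop (max R₀ 1)] with R hR
  have hR0 : R₀ ≤ R := (le_max_left _ _).trans hR
  have hR1 : 0 < R := lt_of_lt_of_le one_pos ((le_max_right _ _).trans hR)
  -- On the rectangle with base `[-R, R]` and height `R` the three other sides have total length
  -- `4R`, and there the integrand is at most `C / R²`.
  have key := Complex.integral_boundary_rect_eq_zero_of_differentiableOn A (-R : ℂ) (R + R * Complex.I)
    (hA.mono fun z hz => by
      have := hz.2
      simp at this
      rw [uIcc_of_le hR1.le] at this
      exact lt_of_lt_of_le (neg_neg_of_pos hc) this.1)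
  simp only [Complex.neg_re, Complex.ofReal_re, Complex.add_re, Complex.mul_re, Complex.I_re,
    Complex.I_im, Complex.ofReal_im, Complex.neg_im, Complex.add_im, Complex.mul_im, mul_zero,
    mul_one, zero_add, add_zero, neg_zero, Complex.ofReal_zero, zero_mul, sub_self] at key
  have bd : ∀ z : ℂ, 0 ≤ z.im → R ≤ ‖z‖ → ‖A z‖ ≤ C / R ^ 2 := fun z h1 h2 =>
    (hb z h1 (hR0.trans h2)).trans (by gcongr)
  have b1 : ‖∫ x in (-R)..R, A (x + R * Complex.I)‖ ≤ C / R ^ 2 * |R - -R| := by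
    refine intervalIntegral.norm_integral_le_of_norm_le_const fun x _ => bd _ (by simp [hR1.le]) ?_
    have := Complex.abs_im_le_norm (x + R * Complex.I)
    simp only [Complex.add_im, Complex.mul_im, Complex.ofReal_im, Complex.ofReal_re, Complex.I_im,
      Complex.I_re, mul_one, mul_zero, zero_add, add_zero] at this
    exact (le_abs_self R).trans this
  have b2 : ∀ r : ℝ, |r| = R → ‖∫ y in (0:ℝ)..R, A (r + y * Complex.I)‖ ≤ C / R ^ 2 * |R - 0| := by
    intro r hr
    refine intervalIntegral.norm_integral_le_of_norm_le_const fun y hy => bd _ ?_ ?_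
    · rw [uIoc_of_le hR1.le] at hy
      simp [hy.1.le]
    · have := Complex.abs_re_le_norm (r + y * Complex.I)
      simp only [Complex.add_re, Complex.mul_re, Complex.ofReal_im, Complex.ofReal_re, Complex.I_im,
        Complex.I_re, mul_one, mul_zero, sub_zero, add_zero] at this
      exact hr ▸ this
  have b3 := b2 R (abs_of_pos hR1)
  have b4 := b2 (-R) (by rw [abs_neg, abs_of_pos hR1])
  push_cast at b4
  have e : ∫ x in (-R)..R, A x = (∫ x in (-R)..R, A (x + R * Complex.I)) -
      Complex.I • (∫ y in (0:ℝ)..R, A (R + y * Complex.I)) +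
      Complex.I • (∫ y in (0:ℝ)..R, A (-R + y * Complex.I)) := by
    rw [Complex.ofReal_neg] at key
    linear_combination key
  rw [e]
  refine (norm_add_le _ _).trans ?_
  have := norm_sub_le (∫ x in (-R)..R, A (x + R * Complex.I))
    (Complex.I • (∫ y in (0:ℝ)..R, A (R + y * Complex.I)))
  rw [norm_smul, Complex.norm_I, one_mul] at this ⊢
  have e2 : C / R ^ 2 * |R - -R| + C / R ^ 2 * |R - 0| + C / R ^ 2 * |R - 0| = 4 * C / R := by
    rw [sub_zero, sub_neg_eq_add, abs_of_pos hR1, abs_of_pos (by linarith)]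
    field_simp
    ring
  linarith

/-- The Poisson formula on the upper half plane. -/
theorem poisson_formula_at_I {Φ : ℂ → ℂ} {c M : ℝ} (hc : 0 < c)
    (hΦ : DifferentiableOn ℂ Φ {z | -c < z.im}) (hM : ∀ z : ℂ, -c < z.im → ‖Φ z‖ ≤ M)
    {δ : ℝ} (hδ : 0 < δ) :
    ∫ s : ℝ, (poisson 0 δ s : ℂ) * Φ s = Φ (δ * Complex.I) := by
  set w : ℂ := δ * Complex.I with hw
  have hwim : w.im = δ := by simp [hw]
  have hM0 : 0 ≤ M := (norm_nonneg _).trans (hM 0 (by simpa using hc))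
  have hopen : IsOpen {z : ℂ | -c < z.im} := isOpen_lt continuous_const Complex.continuous_im
  -- This is `(Φ - Φ(w)) / (s² + δ²)` with the singularity at `w = iδ` removed by `dslope`. The
  -- other pole `-iδ` lies outside the half plane once its depth is at most `δ`. Boundedness of `Φ`
  -- gives the decay, and the vanishing integral says that `∫ PΦ = Φ(w) ∫ P`.
  set A : ℂ → ℂ := fun s => dslope Φ w s / (s + w) with hA
  set c' := min c δ with hc'
  have hc'0 : 0 < c' := lt_min hc hδ
  have hAd : DifferentiableOn ℂ A {z | -c' < z.im} := by
    refine DifferentiableOn.div ?_ (by fun_prop) ?_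
    · have := (Complex.differentiableOn_dslope (c := w) (hopen.mem_nhds (by
        show -c < w.im; rw [hwim]; linarith))).2 hΦ
      exact this.mono fun z hz => by
        have hz : -c' < z.im := hz
        have := min_le_left c δ
        show -c < z.im
        linarith
    · intro s hs h
      have h1 : (s + w).im = 0 := by rw [h]; rfl
      rw [Complex.add_im, hwim] at h1
      have h2 : -c' < s.im := hs
      have := min_le_right c δ
      linarith
  have hAe : ∀ s : ℂ, s ≠ w → A s = (Φ s - Φ w) / (s ^ 2 + δ ^ 2) := by
    intro s hs
    simp only [hA]
    rw [dslope_of_ne _ hs, slope_def_field, div_div]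
    congr 1
    have : w ^ 2 = -(δ : ℂ) ^ 2 := by rw [hw, mul_pow, Complex.I_sq]; ring
    linear_combination -this
  have hne : ∀ s : ℝ, (s : ℂ) ≠ w := fun s h => by
    have := congrArg Complex.im h
    rw [hwim, Complex.ofReal_im] at this
    linarith
  have hP : ∀ s : ℝ, (poisson 0 δ s : ℂ) = (Real.pi⁻¹ * δ : ℂ) * (1 / ((s : ℂ) ^ 2 + δ ^ 2)) := by
    intro s
    simp only [poisson]
    push_cast
    rw [zero_sub, neg_sq, add_comm ((δ : ℂ) ^ 2)]
    ring
  have hAP : ∀ s : ℝ, (Real.pi⁻¹ * δ : ℂ) * A s = poisson 0 δ s * Φ s - poisson 0 δ s * Φ w := by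
    intro s
    rw [hAe s (hne s), hP]
    ring
  have hPi : Integrable fun s : ℝ => (poisson 0 δ s : ℂ) := (integrable_poisson hδ 0).ofReal
  have hI1 : Integrable fun s : ℝ => (poisson 0 δ s : ℂ) * Φ s := by
    refine hPi.mul_bdd (c := M) ?_ (Eventually.of_forall fun s => hM s (by simpa using hc))
    refine Continuous.aestronglyMeasurable ?_
    refine hΦ.continuousOn.comp_continuous Complex.continuous_ofReal fun s => ?_
    simpa using hc
  have hI2 : Integrable fun s : ℝ => (poisson 0 δ s : ℂ) * Φ w := hPi.mul_const _
  have hcne : (Real.pi⁻¹ * δ : ℂ) ≠ 0 := by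
    exact_mod_cast (by positivity : Real.pi⁻¹ * δ ≠ 0)
  have hAi : Integrable fun s : ℝ => A s := by
    refine ((hI1.sub hI2).const_mul ((Real.pi⁻¹ * δ : ℂ)⁻¹)).congr (Eventually.of_forall fun s => ?_)
    simp only [Pi.sub_apply]
    rw [← hAP, inv_mul_cancel_left₀ hcne]
  have h0 := integral_line_eq_zero (C := 4 * M) (R₀ := 2 * δ) hc'0 hAd (fun z hz hz2 => by
    have hz0 : 0 < ‖z‖ := by linarith
    have hzw : z ≠ w := fun h => by
      have : ‖w‖ = δ := by rw [hw]; simp [abs_of_pos hδ]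
      rw [h, this] at hz2
      linarith
    have h1 : ‖z‖ ^ 2 / 2 ≤ ‖z ^ 2 + (δ : ℂ) ^ 2‖ := by
      have := norm_sub_norm_le (z ^ 2) (-(δ : ℂ) ^ 2)
      rw [norm_neg, norm_pow, norm_pow, Complex.norm_real, Real.norm_eq_abs, sq_abs,
        sub_neg_eq_add] at this
      nlinarith
    rw [hAe z hzw, norm_div, div_le_div_iff₀ (by nlinarith) (by positivity)]
    have h2 : ‖Φ z - Φ w‖ ≤ 2 * M := by
      have := norm_sub_le (Φ z) (Φ w)
      have h3 := hM z (by linarith)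
      have h4 := hM w (by rw [hwim]; linarith)
      linarith
    calc ‖Φ z - Φ w‖ * ‖z‖ ^ 2 ≤ 2 * M * ‖z‖ ^ 2 := by gcongr
      _ = 4 * M * (‖z‖ ^ 2 / 2) := by ring
      _ ≤ _ := by gcongr) hAi
  have h1 : ∫ s : ℝ, (Real.pi⁻¹ * δ : ℂ) * A s = 0 := by rw [integral_const_mul, h0, mul_zero]
  simp only [hAP] at h1
  rw [integral_sub hI1 hI2, integral_mul_const, integral_complex_ofReal, integral_poisson hδ,
    Complex.ofReal_one, one_mul, sub_eq_zero] at h1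
  exact h1

/-- Translation by `x + iε` moves the line of integration inside the half plane, so no boundary
values of `Ψ` are involved. -/
theorem poisson_formula {Ψ : ℂ → ℂ} {M : ℝ} (hΨ : DifferentiableOn ℂ Ψ {z | 0 < z.im})
    (hM : ∀ z : ℂ, 0 < z.im → ‖Ψ z‖ ≤ M) {ε δ : ℝ} (hε : 0 < ε) (hδ : 0 < δ) (x : ℝ) :
    ∫ t : ℝ, (poisson x δ t : ℂ) * Ψ (t + ε * Complex.I) = Ψ (x + (ε + δ : ℝ) * Complex.I) := by
  have h := poisson_formula_at_I (Φ := fun z => Ψ (z + (x + ε * Complex.I))) (M := M) hε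
    (hΨ.comp (by fun_prop) fun z hz => by
      have hz : -ε < z.im := hz
      show 0 < (z + (x + ε * Complex.I)).im
      simp
      linarith) (fun z hz => hM _ (by simp; linarith)) hδ
  rw [← integral_add_right_eq_self _ x]
  have e1 : ∀ s : ℝ, (poisson x δ (s + x) : ℂ) * Ψ ((s + x : ℝ) + ε * Complex.I) =
      poisson 0 δ s * Ψ (s + (x + ε * Complex.I)) := fun s => by
    have : poisson x δ (s + x) = poisson 0 δ s := by
      simp only [poisson]
      ring_nf
    rw [this]
    push_cast
    ring_nf
  simp only [e1]
  rw [h]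
  push_cast
  ring_nf

/-! ### Cauchy transforms of nonnegative functions -/

/-- The conjugate Poisson kernel. -/
noncomputable def conjPoisson (x ε t : ℝ) : ℝ := Real.pi⁻¹ * ((x - t) / (ε ^ 2 + (x - t) ^ 2))

theorem abs_conjPoisson_le {ε : ℝ} (hε : 0 < ε) (x t : ℝ) : |conjPoisson x ε t| ≤ ε⁻¹ := by
  rw [conjPoisson, abs_mul, abs_of_pos (by positivity), abs_div,
    abs_of_pos (by positivity : 0 < ε ^ 2 + (x - t) ^ 2)]
  refine (mul_le_of_le_one_left (by positivity)
    (inv_le_one_of_one_le₀ (by linarith [Real.pi_gt_three]))).trans ?_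
  rw [inv_eq_one_div, div_le_div_iff₀ (by positivity) hε, one_mul, ← sq_abs (x - t)]
  nlinarith [sq_nonneg (ε - |x - t|), abs_nonneg (x - t)]

theorem continuous_conjPoisson {ε : ℝ} (hε : 0 < ε) (x : ℝ) : Continuous (conjPoisson x ε) := by
  unfold conjPoisson
  refine continuous_const.mul (Continuous.div (by fun_prop) (by fun_prop) fun t => ?_)
  positivity

theorem poisson_le {ε : ℝ} (hε : 0 < ε) (x t : ℝ) : poisson x ε t ≤ (Real.pi * ε)⁻¹ := by
  rw [poisson, mul_inv]
  gcongr
  rw [inv_eq_one_div, div_le_div_iff₀ (by positivity) hε]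
  nlinarith [sq_nonneg (x - t)]

theorem continuous_poisson (x ε : ℝ) : Continuous (poisson x ε) := (contDiff_poisson x ε).continuous

/-- The normalised Cauchy transform on the upper half plane, with real part the Poisson integral
and imaginary part the conjugate Poisson integral. -/
noncomputable def cauchyTransform (g : ℝ → ℝ) (z : ℂ) : ℂ :=
  ∫ t, Complex.I / (Real.pi * (z - t)) * g t

theorem cauchy_kernel_eq {ε : ℝ} (hε : 0 < ε) (x t : ℝ) :
    Complex.I / (Real.pi * ((x + ε * Complex.I : ℂ) - t)) =
      (poisson x ε t : ℂ) + (conjPoisson x ε t : ℂ) * Complex.I := by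
  have h1 : ((ε ^ 2 + (x - t) ^ 2 : ℝ) : ℂ) ≠ 0 := by
    exact_mod_cast (by positivity : ε ^ 2 + (x - t) ^ 2 ≠ 0)
  have h2 : (x + ε * Complex.I : ℂ) - t ≠ 0 := fun h => by
    have := congrArg Complex.im h
    simp at this
    exact hε.ne' this
  have h3 : (Real.pi : ℂ) ≠ 0 := by exact_mod_cast Real.pi_ne_zero
  simp only [poisson, conjPoisson]
  rw [div_eq_iff (mul_ne_zero h3 h2)]
  push_cast at h1 ⊢
  field_simp
  linear_combination (-(ε * (x - t)) : ℂ) * Complex.I_sq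

theorem norm_cauchy_kernel_le {z : ℂ} (hz : 0 < z.im) (t : ℝ) :
    ‖Complex.I / (Real.pi * (z - t))‖ ≤ (Real.pi * z.im)⁻¹ := by
  rw [norm_div, Complex.norm_I, norm_mul, Complex.norm_real, Real.norm_eq_abs,
    abs_of_pos Real.pi_pos, one_div]
  have h : z.im ≤ ‖z - t‖ := by
    have := Complex.abs_im_le_norm (z - t)
    simp at this
    exact (le_abs_self _).trans this
  gcongr

theorem cauchy_kernel_ne {z : ℂ} (hz : 0 < z.im) (t : ℝ) : z - t ≠ 0 := fun h => by
  have := congrArg Complex.im h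
  simp at this
  exact hz.ne' this

section
variable {g : ℝ → ℝ} (hg : Integrable g)
include hg

theorem integrable_cauchy_kernel_mul {z : ℂ} (hz : 0 < z.im) :
    Integrable fun t : ℝ => Complex.I / (Real.pi * (z - t)) * g t := by
  refine hg.ofReal.bdd_mul (c := (Real.pi * z.im)⁻¹) ?_
    (Eventually.of_forall fun t => norm_cauchy_kernel_le hz t)
  refine Continuous.aestronglyMeasurable (Continuous.div continuous_const (by fun_prop) fun t => ?_)
  exact mul_ne_zero (by exact_mod_cast Real.pi_ne_zero) (cauchy_kernel_ne hz t)

theorem norm_cauchyTransform_le {z : ℂ} (hz : 0 < z.im) :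
    ‖cauchyTransform g z‖ ≤ (Real.pi * z.im)⁻¹ * ∫ t, |g t| := by
  rw [← integral_const_mul]
  refine norm_integral_le_of_norm_le (hg.abs.const_mul _) (Eventually.of_forall fun t => ?_)
  rw [norm_mul, Complex.norm_real]
  exact mul_le_mul_of_nonneg_right (norm_cauchy_kernel_le hz t) (abs_nonneg _)

theorem cauchyTransform_eq {ε : ℝ} (hε : 0 < ε) (x : ℝ) :
    cauchyTransform g (x + ε * Complex.I) =
      ((∫ t, poisson x ε t * g t : ℝ) : ℂ) + ((∫ t, conjPoisson x ε t * g t : ℝ) : ℂ) * Complex.I := by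
  have i1 : Integrable fun t => poisson x ε t * g t :=
    hg.bdd_mul (c := (Real.pi * ε)⁻¹) (continuous_poisson x ε).aestronglyMeasurable
      (Eventually.of_forall fun t => by
        rw [Real.norm_eq_abs, abs_of_nonneg (poisson_nonneg hε x t)]; exact poisson_le hε x t)
  have i2 : Integrable fun t => conjPoisson x ε t * g t :=
    hg.bdd_mul (c := ε⁻¹) (continuous_conjPoisson hε x).aestronglyMeasurable
      (Eventually.of_forall fun t => abs_conjPoisson_le hε x t)
  rw [cauchyTransform, ← integral_complex_ofReal, ← integral_complex_ofReal, ← integral_mul_const,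
    ← integral_add i1.ofReal (i2.ofReal.mul_const _)]
  congr 1
  funext t
  rw [cauchy_kernel_eq hε]
  push_cast
  ring

theorem differentiableOn_cauchyTransform :
    DifferentiableOn ℂ (cauchyTransform g) {z | 0 < z.im} := by
  intro z hz
  have hz : 0 < z.im := hz
  have hball : Metric.ball z (z.im / 2) ⊆ {w | z.im / 2 < w.im} := fun w hw => by
    have := (Complex.abs_im_le_norm (w - z)).trans_lt (mem_ball_iff_norm.1 hw)
    rw [Complex.sub_im, abs_lt] at this
    show z.im / 2 < w.im
    linarith
  have hpi : (Real.pi : ℂ) ≠ 0 := by exact_mod_cast Real.pi_ne_zero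
  have key := hasDerivAt_integral_of_dominated_loc_of_deriv_le (μ := volume) (𝕜 := ℂ)
    (F := fun (z : ℂ) (t : ℝ) => Complex.I / (Real.pi * (z - t)) * g t)
    (F' := fun (z : ℂ) (t : ℝ) => - (Complex.I * (Real.pi * 1)) / (Real.pi * (z - t)) ^ 2 * g t)
    (bound := fun t => Real.pi / (Real.pi * (z.im / 2)) ^ 2 * |g t|) (x₀ := z)
    (s := Metric.ball z (z.im / 2)) (Metric.ball_mem_nhds z (by linarith)) ?_
    (integrable_cauchy_kernel_mul hg hz) ?_ ?_ (hg.abs.const_mul _) ?_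
  · exact key.2.differentiableAt.differentiableWithinAt
  · filter_upwards [(isOpen_lt continuous_const Complex.continuous_im).mem_nhds hz] with w hw
    exact (integrable_cauchy_kernel_mul hg hw).1
  · refine AEStronglyMeasurable.mul (Continuous.aestronglyMeasurable
      (Continuous.div continuous_const (by fun_prop) fun t => ?_)) hg.ofReal.1
    exact pow_ne_zero _ (mul_ne_zero hpi (cauchy_kernel_ne hz t))
  · refine Eventually.of_forall fun t w hw => ?_
    have hw : z.im / 2 < w.im := hball hw
    rw [norm_mul, norm_div, norm_neg, norm_mul, Complex.norm_I, norm_mul, Complex.norm_real,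
      Complex.norm_real, norm_pow, norm_mul, Complex.norm_real, Real.norm_eq_abs, Real.norm_eq_abs,
      abs_of_pos Real.pi_pos, norm_one, one_mul, mul_one]
    have : z.im / 2 ≤ ‖w - t‖ := by
      have := Complex.abs_im_le_norm (w - t)
      simp at this
      exact hw.le.trans ((le_abs_self _).trans this)
    gcongr
  · refine Eventually.of_forall fun t w hw => ?_
    have hw : z.im / 2 < w.im := hball hw
    have h1 : HasDerivAt (fun w : ℂ => (Real.pi : ℂ) * (w - t)) (Real.pi * 1) w :=
      ((hasDerivAt_id w).sub_const _).const_mul _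
    have h2 := ((hasDerivAt_const w Complex.I).div h1
      (mul_ne_zero hpi (cauchy_kernel_ne (by linarith) t))).mul_const (g t : ℂ)
    refine h2.congr_deriv ?_
    simp

variable (h0 : ∀ t, 0 ≤ g t)
include h0

theorem re_cauchyTransform_nonneg {z : ℂ} (hz : 0 < z.im) : 0 ≤ (cauchyTransform g z).re := by
  have := cauchyTransform_eq hg hz z.re
  rw [Complex.re_add_im] at this
  rw [this]
  simp only [Complex.add_re, Complex.ofReal_re, Complex.mul_re, Complex.I_re, mul_zero,
    Complex.ofReal_im, Complex.I_im, mul_one, sub_self, add_zero]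
  exact integral_nonneg fun t => mul_nonneg (poisson_nonneg hz _ _) (h0 t)

end

theorem one_add_ne_zero_of_re_nonneg {w : ℂ} (hw : 0 ≤ w.re) : 1 + w ≠ 0 := fun h => by
  have := congrArg Complex.re h
  simp at this
  linarith

/-- The map `w ↦ w / (1 + w)` sends the right half plane into the disc `|ζ|² ≤ Re ζ`. Applied to the
Cauchy transform, which is only weakly integrable on horizontal lines, it produces a bounded
function that is square integrable on them, and `Re ζ` still detects where `w` is large. -/
theorem re_div_one_add {w : ℂ} (hw : 0 ≤ w.re) : ‖w / (1 + w)‖ ^ 2 ≤ (w / (1 + w)).re ∧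
    ‖w / (1 + w)‖ ≤ 1 ∧ ‖w / (1 + w)‖ ≤ ‖w‖ ∧ (1 ≤ ‖w‖ → 1 / 4 ≤ (w / (1 + w)).re) := by
  have hn : 0 < Complex.normSq (1 + w) := Complex.normSq_pos.2 (one_add_ne_zero_of_re_nonneg hw)
  have e1 : ‖w / (1 + w)‖ ^ 2 = Complex.normSq w / Complex.normSq (1 + w) := by
    rw [norm_div, div_pow, Complex.sq_norm, Complex.sq_norm]
  have e2 : (w / (1 + w)).re = (w.re + Complex.normSq w) / Complex.normSq (1 + w) := by
    rw [Complex.div_re, ← add_div]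
    congr 1
    simp [Complex.normSq_apply]
    ring
  have e3 : Complex.normSq (1 + w) = 1 + 2 * w.re + Complex.normSq w := by
    simp [Complex.normSq_apply]
    ring
  have hw2 := Complex.normSq_nonneg w
  refine ⟨?_, ?_, ?_, fun h => ?_⟩
  · rw [e1, e2]; gcongr; linarith
  · rw [← sq_le_one_iff₀ (norm_nonneg _), e1, div_le_one hn]
    linarith
  · rw [← sq_le_sq₀ (norm_nonneg _) (norm_nonneg _), e1, Complex.sq_norm]
    exact div_le_self hw2 (by linarith)
  · have h1 : 1 ≤ Complex.normSq w := by rw [← Complex.sq_norm]; nlinarith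
    have h2 : w.re ^ 2 ≤ Complex.normSq w := by simp [Complex.normSq_apply]; nlinarith
    rw [e2, div_le_div_iff₀ (by norm_num) hn, e3]
    nlinarith

/-- The bounded holomorphic function `F / (1 + F)` attached to the Cauchy transform `F`. -/
noncomputable def cauchyQuot (g : ℝ → ℝ) (z : ℂ) : ℂ :=
  cauchyTransform g z / (1 + cauchyTransform g z)

section
variable {g : ℝ → ℝ} (hg : Integrable g) (h0 : ∀ t, 0 ≤ g t)
include hg h0

theorem differentiableOn_cauchyQuot : DifferentiableOn ℂ (cauchyQuot g) {z | 0 < z.im} :=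
  (differentiableOn_cauchyTransform hg).div
    ((differentiableOn_const _).add (differentiableOn_cauchyTransform hg))
    fun _ hz => one_add_ne_zero_of_re_nonneg (re_cauchyTransform_nonneg hg h0 hz)

theorem norm_cauchyQuot_le_one {z : ℂ} (hz : 0 < z.im) : ‖cauchyQuot g z‖ ≤ 1 :=
  (re_div_one_add (re_cauchyTransform_nonneg hg h0 hz)).2.1

theorem re_cauchyQuot_nonneg {z : ℂ} (hz : 0 < z.im) : 0 ≤ (cauchyQuot g z).re :=
  (sq_nonneg _).trans (re_div_one_add (re_cauchyTransform_nonneg hg h0 hz)).1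

theorem continuous_cauchyQuot_line {ε : ℝ} (hε : 0 < ε) :
    Continuous fun x : ℝ => cauchyQuot g (x + ε * Complex.I) :=
  (differentiableOn_cauchyQuot hg h0).continuousOn.comp_continuous (by fun_prop)
    fun x => by show 0 < (x + ε * Complex.I : ℂ).im; simpa using hε

/-- At height `δ` the function is at most `∫ g / (πδ)`. The Poisson formula expresses this value as
a Poisson mean over the line at height `ε`; multiplying by `πδ` and letting `δ → ∞`, Fatou's lemma
bounds the integral along that line. -/
theorem lintegral_re_cauchyQuot_le {ε : ℝ} (hε : 0 < ε) :
    ∫⁻ x : ℝ, ENNReal.ofReal (cauchyQuot g (x + ε * Complex.I)).re ≤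
      ENNReal.ofReal (∫ t, g t) := by
  have hcont := Complex.continuous_re.comp (continuous_cauchyQuot_line hg h0 hε)
  have him : ∀ x : ℝ, 0 < (x + ε * Complex.I : ℂ).im := fun x => by simpa using hε
  -- With `δ = n + 1`, the factor `πδ P_{iδ}(x) = 1 / (1 + (x/δ)²)` tends to `1`.
  set k : ℕ → ℝ → ℝ := fun n x =>
    Real.pi * (n + 1 : ℝ) * (poisson 0 (n + 1) x * (cauchyQuot g (x + ε * Complex.I)).re) with hk
  have hk0 : ∀ n x, 0 ≤ k n x := fun n x => by
    have := poisson_nonneg (ε := (n + 1 : ℝ)) (by positivity) 0 x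
    have := re_cauchyQuot_nonneg hg h0 (him x)
    simp only [hk]
    positivity
  have hkm : ∀ n, Continuous (k n) := fun n =>
    continuous_const.mul ((continuous_poisson _ _).mul hcont)
  have hki : ∀ n, ∫⁻ x, ENNReal.ofReal (k n x) ≤ ENNReal.ofReal (∫ t, g t) := by
    intro n
    have hn : (0 : ℝ) < n + 1 := by positivity
    have hint : Integrable fun x : ℝ => (poisson 0 (n + 1) x : ℂ) * cauchyQuot g (x + ε * Complex.I) :=
      (integrable_poisson hn 0).ofReal.mul_bdd (c := 1)
        (continuous_cauchyQuot_line hg h0 hε).aestronglyMeasurable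
        (Eventually.of_forall fun x => norm_cauchyQuot_le_one hg h0 (him x))
    have hre : ∀ x : ℝ, k n x = Real.pi * (n + 1 : ℝ) *
        RCLike.re ((poisson 0 (n + 1) x : ℂ) * cauchyQuot g (x + ε * Complex.I)) := fun x => by
      simp [hk]
    have hki : Integrable (k n) := by
      refine (hint.re.const_mul (Real.pi * (n + 1 : ℝ))).congr (Eventually.of_forall fun x => ?_)
      exact (hre x).symm
    rw [← ofReal_integral_eq_lintegral_ofReal hki (Eventually.of_forall (hk0 n))]
    refine ENNReal.ofReal_le_ofReal ?_
    have : ∫ x, k n x = Real.pi * (n + 1 : ℝ) *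
        (cauchyQuot g ((0 : ℝ) + (ε + (n + 1) : ℝ) * Complex.I)).re := by
      simp only [hre]
      rw [integral_const_mul, integral_re hint,
        poisson_formula (differentiableOn_cauchyQuot hg h0)
          (fun z hz => norm_cauchyQuot_le_one hg h0 hz) hε hn 0]
      rfl
    rw [this]
    have him2 : 0 < ((0 : ℝ) + (ε + (n + 1) : ℝ) * Complex.I : ℂ).im := by
      simp; positivity
    have h1 := (re_div_one_add (re_cauchyTransform_nonneg hg h0 him2)).2.2.1
    have h2 := norm_cauchyTransform_le hg him2
    have h3 := (Complex.re_le_norm (cauchyQuot g ((0 : ℝ) + (ε + (n + 1) : ℝ) * Complex.I)))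
    have h4 : ((0 : ℝ) + (ε + (n + 1) : ℝ) * Complex.I : ℂ).im = ε + (n + 1) := by simp
    rw [h4] at h2
    have h5 : ∫ t, |g t| = ∫ t, g t := by simp only [abs_of_nonneg (h0 _)]
    rw [h5] at h2
    have hG : 0 ≤ ∫ t, g t := integral_nonneg h0
    calc _ ≤ Real.pi * (n + 1 : ℝ) * ((Real.pi * (ε + (n + 1)))⁻¹ * ∫ t, g t) := by
          gcongr
          exact h3.trans (h1.trans h2)
      _ = ((n + 1 : ℝ) / (ε + (n + 1))) * ∫ t, g t := by
          have := Real.pi_pos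
          field_simp
      _ ≤ 1 * ∫ t, g t := by
          gcongr
          rw [div_le_one (by positivity)]
          linarith
      _ = _ := one_mul _
  have hlim : ∀ x : ℝ, Tendsto (fun n => k n x) atTop
      (𝓝 (cauchyQuot g (x + ε * Complex.I)).re) := by
    intro x
    have l : Tendsto (fun n : ℕ => 1 / (1 + (x * (1 / ((n : ℝ) + 1))) ^ 2)) atTop
        (𝓝 (1 / (1 + (x * 0) ^ 2))) :=
      Tendsto.div tendsto_const_nhds
        (((tendsto_one_div_add_atTop_nhds_zero_nat.const_mul x).pow 2).const_add 1) (by simp)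
    have := l.mul_const (cauchyQuot g (x + ε * Complex.I)).re
    simp only [mul_zero, ne_eq, OfNat.ofNat_ne_zero, not_false_eq_true, zero_pow, add_zero, div_one,
      one_mul] at this
    refine this.congr fun n => ?_
    simp only [hk, poisson]
    have : (n + 1 : ℝ) ≠ 0 := by positivity
    rw [zero_sub, neg_sq]
    have := Real.pi_pos
    field_simp
  calc ∫⁻ x : ℝ, ENNReal.ofReal (cauchyQuot g (x + ε * Complex.I)).re
      = ∫⁻ x : ℝ, liminf (fun n => ENNReal.ofReal (k n x)) atTop := by
        congr 1
        funext x
        exact ((ENNReal.continuous_ofReal.tendsto _).comp (hlim x)).liminf_eq.symm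
    _ ≤ liminf (fun n => ∫⁻ x, ENNReal.ofReal (k n x)) atTop :=
        lintegral_liminf_le fun n => (hkm n).measurable.ennreal_ofReal
    _ ≤ _ := by
        refine (liminf_le_liminf (Eventually.of_forall hki)).trans ?_
        simp

end

/-- Fatou's lemma for sets. Continuity from below holds for arbitrary sets, so nothing has to be
measurable; it will be applied to the level sets of pointwise limits. -/
theorem measure_le_of_eventually_mem {α : Type*} [MeasurableSpace α] {μ : Measure α} {A : Set α}
    {s : ℕ → Set α} {c : ℝ≥0∞} (hA : ∀ x ∈ A, ∀ᶠ n in atTop, x ∈ s n) (hs : ∀ n, μ (s n) ≤ c) :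
    μ A ≤ c := by
  have h1 : A ⊆ ⋃ m, ⋂ n ≥ m, s n := fun x hx => by
    obtain ⟨m, hm⟩ := eventually_atTop.1 (hA x hx)
    exact mem_iUnion.2 ⟨m, mem_iInter₂.2 hm⟩
  have h2 : Monotone fun m => ⋂ n ≥ m, s n := fun a b hab x hx =>
    mem_iInter₂.2 fun n hn => mem_iInter₂.1 hx n (le_trans hab hn)
  refine (measure_mono h1).trans ?_
  rw [h2.measure_iUnion]
  exact iSup_le fun m => (measure_mono (iInter₂_subset m le_rfl)).trans (hs m)

section
variable {g : ℝ → ℝ} (hg : Integrable g) (h0 : ∀ t, 0 ≤ g t)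
include hg h0

/-- Chebyshev's inequality for the real part of `F / (1 + F)`, which is at least `1/4` wherever `|F|
≥ 1`. -/
theorem measure_one_le_norm_cauchyTransform_le {ε : ℝ} (hε : 0 < ε) :
    volume {x : ℝ | 1 ≤ ‖cauchyTransform g (x + ε * Complex.I)‖} ≤
      ENNReal.ofReal (4 * ∫ t, g t) := by
  have h1 := lintegral_re_cauchyQuot_le hg h0 hε
  have hm := (Complex.continuous_re.comp (continuous_cauchyQuot_line hg h0 hε)).measurable.ennreal_ofReal
  have h2 := mul_meas_ge_le_lintegral (μ := volume) hm (ENNReal.ofReal (1 / 4))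
  have h3 : {x : ℝ | 1 ≤ ‖cauchyTransform g (x + ε * Complex.I)‖} ⊆
      {x : ℝ | ENNReal.ofReal (1 / 4) ≤ ENNReal.ofReal (cauchyQuot g (x + ε * Complex.I)).re} := by
    intro x hx
    exact ENNReal.ofReal_le_ofReal ((re_div_one_add (re_cauchyTransform_nonneg hg h0
      (by simpa using hε))).2.2.2 hx)
  have h4 := (mul_le_mul_right (measure_mono h3) (ENNReal.ofReal (1 / 4))).trans (h2.trans h1)
  rw [ENNReal.ofReal_mul (by norm_num)]
  calc _ = ENNReal.ofReal 4 * (ENNReal.ofReal (1 / 4) *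
        volume {x : ℝ | 1 ≤ ‖cauchyTransform g (x + ε * Complex.I)‖}) := by
        rw [← mul_assoc, ← ENNReal.ofReal_mul (by norm_num)]
        norm_num
    _ ≤ _ := by gcongr

theorem measure_le_norm_cauchyTransform_le {ε : ℝ} (hε : 0 < ε) {c : ℝ} (hc : 0 < c) :
    volume {x : ℝ | c ≤ ‖cauchyTransform g (x + ε * Complex.I)‖} ≤
      ENNReal.ofReal (4 * (∫ t, g t) / c) := by
  have h := measure_one_le_norm_cauchyTransform_le (g := fun t => c⁻¹ * g t) (hg.const_mul _)
    (fun t => mul_nonneg (by positivity) (h0 t)) hε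
  have e : ∀ z, cauchyTransform (fun t => c⁻¹ * g t) z = (c⁻¹ : ℝ) * cauchyTransform g z := by
    intro z
    rw [cauchyTransform, cauchyTransform, ← integral_const_mul]
    congr 1
    funext t
    push_cast
    ring
  simp only [e, norm_mul, Complex.norm_real, norm_inv, Real.norm_eq_abs, abs_of_pos hc] at h
  rw [integral_const_mul] at h
  convert h using 2
  · ext x
    simp only [mem_ofPred_eq]
    rw [le_inv_mul_iff₀ hc, mul_one]
  · ring

theorem memLp_cauchyQuot_line {ε : ℝ} (hε : 0 < ε) :
    eLpNorm (fun x : ℝ => cauchyQuot g (x + ε * Complex.I)) 2 volume ≤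
      (ENNReal.ofReal (∫ t, g t)) ^ (1 / (2 : ℝ)) := by
  rw [eLpNorm_eq_lintegral_rpow_enorm_toReal (by norm_num) (by norm_num)]
  simp only [ENNReal.toReal_ofNat]
  refine ENNReal.rpow_le_rpow ((lintegral_mono fun x => ?_).trans
    (lintegral_re_cauchyQuot_le hg h0 hε)) (by norm_num)
  rw [← ofReal_norm, ENNReal.ofReal_rpow_of_nonneg (norm_nonneg _) (by norm_num)]
  refine ENNReal.ofReal_le_ofReal ?_
  rw [Real.rpow_two]
  exact (re_div_one_add (re_cauchyTransform_nonneg hg h0 (by simpa using hε))).1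

omit hg h0 in
theorem memLp_poisson {δ : ℝ} (hδ : 0 < δ) (x : ℝ) :
    MemLp (fun t => (poisson x δ t : ℂ)) 2 volume := by
  have hm := (Complex.continuous_ofReal.comp (continuous_poisson x δ)).aestronglyMeasurable
    (μ := volume)
  refine (memLp_two_iff_integrable_sq_norm hm).2 ?_
  refine ((integrable_poisson hδ x).const_mul (Real.pi * δ)⁻¹).mono' (hm.norm.pow 2)
    (Eventually.of_forall fun t => ?_)
  simp only [Function.comp, Complex.norm_real, norm_pow, norm_norm]
  rw [Real.norm_eq_abs, abs_of_nonneg (poisson_nonneg hδ x t), sq]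
  exact mul_le_mul_of_nonneg_right (poisson_le hδ x t) (poisson_nonneg hδ x t)

/-- The restrictions to horizontal lines are bounded in `L²`, so they have a weak limit as the
height decreases. The Poisson kernel lies in `L²`, so the Poisson formula passes to this limit. -/
theorem exists_boundary_cauchyQuot : ∃ Ψ : ℝ → ℂ, MemLp Ψ 2 ∧
    ∀ (x δ : ℝ), 0 < δ → ∫ t, (poisson x δ t : ℂ) * Ψ t = cauchyQuot g (x + δ * Complex.I) := by
  have hε : ∀ n : ℕ, (0 : ℝ) < 1 / ((n : ℝ) + 1) := fun n => by positivity
  have hfin : (ENNReal.ofReal (∫ t, g t)) ^ (1 / (2 : ℝ)) ≠ ⊤ :=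
    ENNReal.rpow_ne_top_of_nonneg (by norm_num) ENNReal.ofReal_ne_top
  have hmem : ∀ n : ℕ, MemLp (fun x : ℝ => cauchyQuot g (x + (1 / ((n : ℝ) + 1) : ℝ) * Complex.I)) 2 volume :=
    fun n => ⟨(continuous_cauchyQuot_line hg h0 (hε n)).aestronglyMeasurable,
      (memLp_cauchyQuot_line hg h0 (hε n)).trans_lt (lt_top_iff_ne_top.2 hfin)⟩
  set r := ((ENNReal.ofReal (∫ t, g t)) ^ (1 / (2 : ℝ))).toReal with hr
  let ψ : ℕ → Lp ℂ 2 (volume : Measure ℝ) := fun n => (hmem n).toLp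
  have hψ : ∀ n, ‖ψ n‖ ≤ r := fun n => by
    rw [Lp.norm_toLp]
    exact ENNReal.toReal_mono hfin (memLp_cauchyQuot_line hg h0 (hε n))
  let T : ℕ → WeakDual ℂ (Lp ℂ 2 (volume : Measure ℝ)) := fun n =>
    StrongDual.toWeakDual (InnerProductSpace.toDual ℂ _ (ψ n))
  have hcomp := WeakDual.isCompact_closedBall (𝕜 := ℂ) (E := Lp ℂ 2 (volume : Measure ℝ)) 0 r
  -- Weak compactness is used along an ultrafilter finer than `atTop`, which avoids extracting a
  -- subsequence.
  obtain ⟨x₀, -, hx₀⟩ := hcomp.ultrafilter_le_nhds ((hyperfilter ℕ).map T) (by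
    rw [le_principal_iff, Ultrafilter.mem_coe, Ultrafilter.mem_map]
    refine Filter.univ_mem' fun n => ?_
    show WeakDual.toStrongDual (T n) ∈ Metric.closedBall _ _
    rw [mem_closedBall_zero_iff]
    exact ((InnerProductSpace.toDual ℂ _).norm_map (ψ n)).trans_le (hψ n))
  have hT : Tendsto T (hyperfilter ℕ) (𝓝 x₀) := hx₀
  obtain ⟨Ψ, hΨ⟩ := (InnerProductSpace.toDual ℂ (Lp ℂ 2 (volume : Measure ℝ))).surjective
    (WeakDual.toStrongDual x₀)
  refine ⟨Ψ, Lp.memLp Ψ, fun x δ hδ => ?_⟩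
  have hP := memLp_poisson hδ x
  have hinner : ∀ φ : Lp ℂ 2 (volume : Measure ℝ),
      ∫ t, (poisson x δ t : ℂ) * φ t = inner ℂ hP.toLp φ := by
    intro φ
    rw [L2.inner_def]
    refine integral_congr_ae ?_
    filter_upwards [hP.coeFn_toLp] with t ht
    rw [ht, RCLike.inner_apply]
    simp [mul_comm]
  have l1 : Tendsto (fun n => T n hP.toLp) (hyperfilter ℕ) (𝓝 (x₀ hP.toLp)) :=
    ((WeakDual.eval_continuous _).tendsto _).comp hT
  have e1 : ∀ n, T n hP.toLp = (starRingEnd ℂ) (inner ℂ hP.toLp (ψ n)) := fun n => by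
    rw [inner_conj_symm]; rfl
  have e2 : x₀ hP.toLp = (starRingEnd ℂ) (inner ℂ hP.toLp Ψ) := by
    rw [inner_conj_symm]
    have := congrArg (fun f => f hP.toLp) hΨ
    exact this.symm
  have l2 : Tendsto (fun n => inner ℂ hP.toLp (ψ n)) (hyperfilter ℕ) (𝓝 (inner ℂ hP.toLp Ψ)) := by
    simp only [e1, e2] at l1
    have := (Complex.continuous_conj.tendsto _).comp l1
    simpa [Function.comp_def] using this
  have e3 : ∀ n : ℕ, inner ℂ hP.toLp (ψ n) =
      cauchyQuot g (x + ((1 / ((n : ℝ) + 1) : ℝ) + δ : ℝ) * Complex.I) := by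
    intro n
    rw [← hinner, ← poisson_formula (differentiableOn_cauchyQuot hg h0)
          (fun z hz => norm_cauchyQuot_le_one hg h0 hz) (hε n) hδ x]
    refine integral_congr_ae ?_
    filter_upwards [(hmem n).coeFn_toLp] with t ht
    simp only [ψ, ht]
  rw [hinner]
  refine tendsto_nhds_unique l2 ?_
  simp only [e3]
  have hd : ContinuousAt (cauchyQuot g) (x + δ * Complex.I) :=
    ((differentiableOn_cauchyQuot hg h0).differentiableAt
      ((isOpen_lt continuous_const Complex.continuous_im).mem_nhds (by
        show 0 < (x + δ * Complex.I : ℂ).im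
        simpa using hδ))).continuousAt
  have l3 : Tendsto (fun n : ℕ => (x + ((1 / ((n : ℝ) + 1) : ℝ) + δ : ℝ) * Complex.I : ℂ)) atTop
      (𝓝 (x + δ * Complex.I)) := by
    have h1 := (tendsto_one_div_add_atTop_nhds_zero_nat (𝕜 := ℝ)).add_const δ
    rw [zero_add] at h1
    exact (((Complex.continuous_ofReal.tendsto _).comp h1).mul_const _).const_add _
  exact (hd.tendsto.comp l3).mono_left (Nat.hyperfilter_le_atTop)

end

/-! ### Convergence of Poisson integrals at Lebesgue points -/

/-- Lebesgue points, for averages over symmetric intervals. -/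
def IsLebesguePoint (h : ℝ → ℂ) (x : ℝ) : Prop :=
  ∀ η > 0, ∀ᶠ r in 𝓝[>] (0 : ℝ),
    ∫⁻ t in Icc (x - r) (x + r), ‖h t - h x‖ₑ ≤ ENNReal.ofReal (η * r)

theorem ae_isLebesguePoint {h : ℝ → ℂ} (hh : LocallyIntegrable h) :
    ∀ᵐ x, IsLebesguePoint h x := by
  filter_upwards [(Besicovitch.vitaliFamily (volume : Measure ℝ)).ae_tendsto_average_norm_sub hh]
    with x hx η hη
  have h1 := (hx.comp (Besicovitch.tendsto_filterAt volume x)).eventually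
    (gt_mem_nhds (show 0 < η / 2 by positivity))
  filter_upwards [h1, self_mem_nhdsWithin] with r hr hr0
  have hr0 : 0 < r := hr0
  simp only [Function.comp] at hr
  rw [Real.closedBall_eq_Icc, setAverage_eq, measureReal_def, Real.volume_Icc, smul_eq_mul,
    ENNReal.toReal_ofReal (by linarith), inv_mul_lt_iff₀ (by linarith)] at hr
  have hi : IntegrableOn (fun t => h t - h x) (Icc (x - r) (x + r)) :=
    (hh.integrableOn_isCompact isCompact_Icc).sub (integrableOn_const (by simp))
  rw [← ofReal_integral_norm_eq_lintegral_enorm hi]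
  exact ENNReal.ofReal_le_ofReal (by linarith)

/-- Dyadic decomposition: where `2ⁿδ ≤ |x - t|` the kernel is at most `1 / (4ⁿδ)`. The radii are cut
off at `r` because averages are controlled only up to that radius. -/
theorem poisson_le_tsum {δ r : ℝ} (hδ : 0 < δ) {x t : ℝ} (ht : |x - t| ≤ r) :
    ENNReal.ofReal (poisson x δ t) ≤ ∑' n : ℕ, ENNReal.ofReal (4 / δ * (1 / 4) ^ n) *
      (Icc (x - min (2 ^ n * δ) r) (x + min (2 ^ n * δ) r)).indicator 1 t := by
  obtain ⟨n, h1, h2⟩ : ∃ n : ℕ, |x - t| ≤ 2 ^ n * δ ∧ poisson x δ t ≤ 4 / δ * (1 / 4) ^ n := by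
    have hpi : Real.pi⁻¹ ≤ 1 := inv_le_one_of_one_le₀ (by linarith [Real.pi_gt_three])
    have hpos : 0 ≤ δ / (δ ^ 2 + (x - t) ^ 2) := by positivity
    rcases le_or_gt (|x - t|) δ with h | h
    · refine ⟨0, by simpa using h, ?_⟩
      rw [poisson]
      refine (mul_le_of_le_one_left hpos hpi).trans ?_
      rw [pow_zero, mul_one, div_le_div_iff₀ (by positivity) hδ]
      nlinarith [sq_nonneg (x - t)]
    · obtain ⟨n, hn1, hn2⟩ := exists_nat_pow_near (x := |x - t| / δ) (y := 2)
        (by rw [le_div_iff₀ hδ]; linarith) (by norm_num)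
      refine ⟨n + 1, ((div_lt_iff₀ hδ).1 hn2).le, ?_⟩
      rw [le_div_iff₀ hδ] at hn1
      rw [poisson]
      refine (mul_le_of_le_one_left hpos hpi).trans ?_
      have e : 4 / δ * (1 / 4) ^ (n + 1) = 1 / (δ * 4 ^ n) := by
        rw [pow_succ, one_div_pow]
        field_simp
      rw [e, div_le_div_iff₀ (by positivity) (by positivity), one_mul, ← sq_abs (x - t)]
      have : (4 : ℝ) ^ n = (2 ^ n) ^ 2 := by rw [← pow_mul, mul_comm, pow_mul]; norm_num
      rw [this]
      nlinarith [pow_le_pow_left₀ (by positivity) hn1 2]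
  refine le_trans ?_ (ENNReal.le_tsum n)
  rw [indicator_of_mem (by
    rw [abs_le] at ht h1
    constructor
    · linarith [le_min (show x - t ≤ 2 ^ n * δ by linarith) ht.2]
    · linarith [le_min (show t - x ≤ 2 ^ n * δ by linarith) (show t - x ≤ r by linarith)])]
  simpa using ENNReal.ofReal_le_ofReal h2

/-- An interval of radius `2ⁿδ` carries weight `4·4⁻ⁿ / δ` and mass at most `η 2ⁿδ`; the geometric
series `4η ∑ 2⁻ⁿ` gives the constant `8`. -/
theorem lintegral_poisson_near_le {h : ℝ → ℂ} {x η r δ : ℝ} (hη : 0 ≤ η) (hδ : 0 < δ)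
    (hr : 0 < r) (hm : AEMeasurable h)
    (hA : ∀ ρ, 0 < ρ → ρ ≤ r → ∫⁻ t in Icc (x - ρ) (x + ρ), ‖h t - h x‖ₑ ≤ ENNReal.ofReal (η * ρ)) :
    ∫⁻ t in Icc (x - r) (x + r), ENNReal.ofReal (poisson x δ t) * ‖h t - h x‖ₑ ≤
      ENNReal.ofReal (8 * η) := by
  have hm' : AEMeasurable fun t => ‖h t - h x‖ₑ := (hm.sub_const _).enorm
  calc ∫⁻ t in Icc (x - r) (x + r), ENNReal.ofReal (poisson x δ t) * ‖h t - h x‖ₑ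
      ≤ ∫⁻ t, ∑' n : ℕ, ENNReal.ofReal (4 / δ * (1 / 4) ^ n) *
      (Icc (x - min (2 ^ n * δ) r) (x + min (2 ^ n * δ) r)).indicator (fun t => ‖h t - h x‖ₑ) t := by
        rw [← lintegral_indicator measurableSet_Icc]
        refine lintegral_mono fun t => ?_
        by_cases ht : t ∈ Icc (x - r) (x + r)
        · rw [indicator_of_mem ht]
          have := poisson_le_tsum hδ (x := x) (t := t) (r := r)
            (abs_le.2 ⟨by linarith [ht.2], by linarith [ht.1]⟩)
          refine (mul_le_mul_left this _).trans (le_of_eq ?_)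
          rw [← ENNReal.tsum_mul_right]
          congr 1
          funext n
          by_cases h' : t ∈ Icc (x - min (2 ^ n * δ) r) (x + min (2 ^ n * δ) r) <;> simp [h']
        · rw [indicator_of_notMem ht]; exact zero_le
    _ = ∑' n : ℕ, ENNReal.ofReal (4 / δ * (1 / 4) ^ n) *
        ∫⁻ t in Icc (x - min (2 ^ n * δ) r) (x + min (2 ^ n * δ) r), ‖h t - h x‖ₑ := by
        rw [lintegral_tsum fun n => ((hm'.indicator measurableSet_Icc).const_mul _)]
        congr 1
        funext n
        rw [lintegral_const_mul'' _ (hm'.indicator measurableSet_Icc),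
          lintegral_indicator measurableSet_Icc]
    _ ≤ ∑' n : ℕ, ENNReal.ofReal (4 * η * (1 / 2) ^ n) := by
        refine ENNReal.tsum_le_tsum fun n => ?_
        refine (mul_le_mul_right (hA _ (lt_min (by positivity) hr) (min_le_right _ _)) _).trans ?_
        rw [← ENNReal.ofReal_mul (by positivity)]
        refine ENNReal.ofReal_le_ofReal ?_
        calc 4 / δ * (1 / 4) ^ n * (η * min (2 ^ n * δ) r)
            ≤ 4 / δ * (1 / 4) ^ n * (η * (2 ^ n * δ)) := by gcongr; exact min_le_left _ _
          _ = 4 * η * ((1 / 4) ^ n * 2 ^ n) := by field_simp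
          _ = _ := by rw [← mul_pow]; norm_num
    _ = _ := by
        rw [← ENNReal.ofReal_tsum_of_nonneg (fun n => by positivity)
          (summable_geometric_two.mul_left _), tsum_mul_left, tsum_geometric_two]
        congr 1
        ring

theorem poisson_le_mul_poisson {δ : ℝ} (hδ : 0 < δ) (x t : ℝ) :
    poisson x δ t ≤ δ * (1 + 1 / δ ^ 2) * poisson x 1 t := by
  simp only [poisson]
  have h : δ / (δ ^ 2 + (x - t) ^ 2) ≤ δ * (1 + 1 / δ ^ 2) * (1 / (1 ^ 2 + (x - t) ^ 2)) := by
    rw [mul_one_div, div_le_div_iff₀ (by positivity) (by positivity), mul_assoc]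
    gcongr
    have : (1 + 1 / δ ^ 2) * (δ ^ 2 + (x - t) ^ 2) =
      1 ^ 2 + (x - t) ^ 2 + δ ^ 2 + (x - t) ^ 2 / δ ^ 2 := by field_simp; ring
    rw [this]
    have : 0 ≤ δ ^ 2 + (x - t) ^ 2 / δ ^ 2 := by positivity
    linarith
  calc _ ≤ Real.pi⁻¹ * (δ * (1 + 1 / δ ^ 2) * (1 / (1 ^ 2 + (x - t) ^ 2))) := by gcongr
    _ = _ := by ring

/-- The factor `δ`, with a constant depending only on `r`, makes the contribution from outside the
interval of radius `r` vanish as `δ → 0`. -/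
theorem poisson_le_mul_poisson_of_lt {δ r : ℝ} (hδ : 0 < δ) (hr : 0 < r) {x t : ℝ}
    (ht : r < |x - t|) : poisson x δ t ≤ δ * (1 + 1 / r ^ 2) * poisson x 1 t := by
  simp only [poisson]
  have h2 : r ^ 2 ≤ (x - t) ^ 2 := by rw [← sq_abs (x - t)]; gcongr
  have h : δ / (δ ^ 2 + (x - t) ^ 2) ≤ δ * (1 + 1 / r ^ 2) * (1 / (1 ^ 2 + (x - t) ^ 2)) := by
    rw [mul_one_div, div_le_div_iff₀ (by positivity) (by positivity), mul_assoc]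
    gcongr
    have h3 : (1 + 1 / r ^ 2) * (δ ^ 2 + (x - t) ^ 2) =
      (x - t) ^ 2 + (x - t) ^ 2 / r ^ 2 + (δ ^ 2 + δ ^ 2 / r ^ 2) := by field_simp; ring
    have h4 : 1 ≤ (x - t) ^ 2 / r ^ 2 := (one_le_div (by positivity)).2 h2
    have : 0 ≤ δ ^ 2 + δ ^ 2 / r ^ 2 := by positivity
    rw [h3]
    linarith
  calc _ ≤ Real.pi⁻¹ * (δ * (1 + 1 / r ^ 2) * (1 / (1 ^ 2 + (x - t) ^ 2))) := by gcongr
    _ = _ := by ring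

/-- The Poisson integral converges at Lebesgue points. -/
theorem tendsto_poisson_integral {h : ℝ → ℂ} {x : ℝ} (hx : IsLebesguePoint h x)
    (hm : AEStronglyMeasurable h) (hi : Integrable fun t => (poisson x 1 t : ℂ) * h t) :
    Tendsto (fun δ : ℝ => ∫ t, (poisson x δ t : ℂ) * h t) (𝓝[>] 0) (𝓝 (h x)) := by
  have hiδ : ∀ {δ : ℝ}, 0 < δ → Integrable fun t => (poisson x δ t : ℂ) * h t := by
    intro δ hδ
    refine (hi.norm.const_mul (δ * (1 + 1 / δ ^ 2))).mono'
      ((Complex.continuous_ofReal.comp (continuous_poisson x δ)).aestronglyMeasurable.mul hm)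
      (Eventually.of_forall fun t => ?_)
    rw [norm_mul, norm_mul, Complex.norm_real, Complex.norm_real, Real.norm_eq_abs, Real.norm_eq_abs,
      abs_of_nonneg (poisson_nonneg hδ x t), abs_of_nonneg (poisson_nonneg one_pos x t), ← mul_assoc]
    gcongr
    exact poisson_le_mul_poisson hδ x t
  have hcδ : ∀ {δ : ℝ}, 0 < δ → Integrable fun t => (poisson x δ t : ℂ) * h x := fun hδ =>
    (integrable_poisson hδ x).ofReal.mul_const _
  have hB : ∫⁻ t, ENNReal.ofReal (poisson x 1 t) * ‖h t - h x‖ₑ ≠ ⊤ := by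
    have := ((hiδ one_pos).sub (hcδ one_pos)).2
    refine ne_of_lt (lt_of_le_of_lt (lintegral_mono fun t => ?_) this)
    simp only [Pi.sub_apply]
    rw [← mul_sub, enorm_mul, ← ofReal_norm (poisson x 1 t : ℂ), Complex.norm_real, Real.norm_eq_abs,
      abs_of_nonneg (poisson_nonneg one_pos x t)]
  rw [Metric.tendsto_nhds]
  intro ε hε
  -- With `ε / 32` the near part contributes `8ε / 32 = ε / 4`, and the far part is made smaller
  -- than `ε / 4`.
  obtain ⟨r₀, hr₀, hA⟩ := mem_nhdsGT_iff_exists_Ioo_subset.1 (hx (ε / 32) (by positivity))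
  have hr₀ : 0 < r₀ := hr₀
  set r := r₀ / 2 with hr
  have hr0 : 0 < r := by positivity
  set B := ∫⁻ t, ENNReal.ofReal (poisson x 1 t) * ‖h t - h x‖ₑ with hBdef
  have hlim : Tendsto (fun δ : ℝ => ENNReal.ofReal (δ * (1 + 1 / r ^ 2)) * B) (𝓝[>] 0) (𝓝 0) := by
    have h1 : Tendsto (fun δ : ℝ => ENNReal.ofReal (δ * (1 + 1 / r ^ 2))) (𝓝[>] 0) (𝓝 0) := by
      have : Tendsto (fun δ : ℝ => ENNReal.ofReal (δ * (1 + 1 / r ^ 2))) (𝓝 0)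
          (𝓝 (ENNReal.ofReal (0 * (1 + 1 / r ^ 2)))) :=
        (ENNReal.continuous_ofReal.comp (continuous_mul_const _)).tendsto 0
      rw [zero_mul, ENNReal.ofReal_zero] at this
      exact this.mono_left nhdsWithin_le_nhds
    have := ENNReal.Tendsto.mul_const h1 (Or.inr hB)
    rwa [zero_mul] at this
  filter_upwards [self_mem_nhdsWithin, hlim.eventually (gt_mem_nhds
    (ENNReal.ofReal_pos.2 (show 0 < ε / 4 by positivity)))] with δ hδ hδ2
  have hδ : 0 < δ := hδ
  have e : (∫ t, (poisson x δ t : ℂ) * h t) - h x = ∫ t, (poisson x δ t : ℂ) * (h t - h x) := by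
    simp only [mul_sub]
    rw [integral_sub (hiδ hδ) (hcδ hδ), integral_mul_const, integral_complex_ofReal,
      integral_poisson hδ, Complex.ofReal_one, one_mul]
  have key : ‖∫ t, (poisson x δ t : ℂ) * (h t - h x)‖ₑ ≤ ENNReal.ofReal (8 * (ε / 32)) +
      ENNReal.ofReal (ε / 4) := by
    refine (enorm_integral_le_lintegral_enorm _).trans ?_
    have e2 : ∀ t, ‖(poisson x δ t : ℂ) * (h t - h x)‖ₑ =
        ENNReal.ofReal (poisson x δ t) * ‖h t - h x‖ₑ := fun t => by
      rw [enorm_mul, ← ofReal_norm (poisson x δ t : ℂ), Complex.norm_real, Real.norm_eq_abs,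
        abs_of_nonneg (poisson_nonneg hδ x t)]
    simp only [e2]
    rw [← lintegral_add_compl _ (measurableSet_Icc (a := x - r) (b := x + r))]
    refine add_le_add (lintegral_poisson_near_le (by positivity) hδ hr0 hm.aemeasurable
      fun ρ h1 h2 => hA ⟨h1, by linarith⟩) (le_trans ?_ hδ2.le)
    calc ∫⁻ t in (Icc (x - r) (x + r))ᶜ, ENNReal.ofReal (poisson x δ t) * ‖h t - h x‖ₑ
        ≤ ∫⁻ t in (Icc (x - r) (x + r))ᶜ, ENNReal.ofReal (δ * (1 + 1 / r ^ 2)) *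
          (ENNReal.ofReal (poisson x 1 t) * ‖h t - h x‖ₑ) := by
          refine setLIntegral_mono_ae' measurableSet_Icc.compl (Eventually.of_forall fun t ht => ?_)
          rw [← mul_assoc, ← ENNReal.ofReal_mul (by positivity)]
          gcongr
          refine poisson_le_mul_poisson_of_lt hδ hr0 ?_
          by_contra! h'
          rw [abs_le] at h'
          exact ht ⟨by linarith [h'.2], by linarith [h'.1]⟩
      _ ≤ ∫⁻ t, ENNReal.ofReal (δ * (1 + 1 / r ^ 2)) *
          (ENNReal.ofReal (poisson x 1 t) * ‖h t - h x‖ₑ) := setLIntegral_le_lintegral _ _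
      _ = _ := lintegral_const_mul' _ _ ENNReal.ofReal_ne_top
  rw [dist_eq_norm, e]
  rw [← ENNReal.ofReal_add (by positivity) (by positivity), ← ofReal_norm,
    ENNReal.ofReal_le_ofReal_iff (by positivity)] at key
  linarith

section
variable {g : ℝ → ℝ} (hg : Integrable g) (h0 : ∀ t, 0 ≤ g t)
include hg h0

/-- The Cauchy transform of a nonnegative integrable function has boundary values almost
everywhere. -/
theorem ae_tendsto_cauchyTransform : ∀ᵐ x : ℝ, ∃ c : ℂ,
    Tendsto (fun ε : ℝ => cauchyTransform g (x + ε * Complex.I)) (𝓝[>] 0) (𝓝 c) := by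
  obtain ⟨Ψ, hΨ, hP⟩ := exists_boundary_cauchyQuot hg h0
  have hl : ∀ᵐ x : ℝ, Tendsto (fun ε : ℝ => cauchyQuot g (x + ε * Complex.I)) (𝓝[>] 0) (𝓝 (Ψ x)) := by
    filter_upwards [ae_isLebesguePoint (hΨ.locallyIntegrable (by norm_num))] with x hx
    have hm : MemLp (fun t => (poisson x 1 t : ℂ)) 2 volume := memLp_poisson one_pos x
    refine (tendsto_poisson_integral hx hΨ.1 (hm.integrable_mul hΨ)).congr' ?_
    filter_upwards [self_mem_nhdsWithin] with δ hδ
    exact hP x δ hδ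
  have hq : ∀ {x ε : ℝ}, 0 < ε → 1 - cauchyQuot g (x + ε * Complex.I) =
      1 / (1 + cauchyTransform g (x + ε * Complex.I)) := fun {x ε} hε => by
    have := one_add_ne_zero_of_re_nonneg (re_cauchyTransform_nonneg hg h0
      (z := x + ε * Complex.I) (by simpa using hε))
    rw [cauchyQuot]
    field_simp
    ring
  -- A limit equal to `1` forces the Cauchy transform `F` to blow up. By the weak type inequality at
  -- every level `c`, this happens only on a null set. Elsewhere `F = q / (1 - q)` converges, with
  -- `q` the quotient `F / (1 + F)`.
  have hne : ∀ᵐ x : ℝ, ¬ (Ψ x = 1 ∧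
      Tendsto (fun ε : ℝ => cauchyQuot g (x + ε * Complex.I)) (𝓝[>] 0) (𝓝 (Ψ x))) := by
    rw [ae_iff]
    simp only [not_not]
    have hs : Tendsto (fun n : ℕ => 1 / ((n : ℝ) + 1)) atTop (𝓝[>] 0) :=
      tendsto_nhdsWithin_iff.2 ⟨tendsto_one_div_add_atTop_nhds_zero_nat,
        Eventually.of_forall fun n => by show (0 : ℝ) < _; positivity⟩
    have bd : ∀ c : ℝ, 0 < c → volume {x : ℝ | Ψ x = 1 ∧
        Tendsto (fun ε : ℝ => cauchyQuot g (x + ε * Complex.I)) (𝓝[>] 0) (𝓝 (Ψ x))} ≤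
        ENNReal.ofReal (4 * (∫ t, g t) / c) := by
      intro c hc
      refine measure_le_of_eventually_mem (s := fun n : ℕ => {x : ℝ |
        c ≤ ‖cauchyTransform g (x + (1 / ((n : ℝ) + 1) : ℝ) * Complex.I)‖}) ?_
        fun n => measure_le_norm_cauchyTransform_le hg h0 (by positivity) hc
      rintro x ⟨hx1, hx2⟩
      have l1 := ((hx2.comp hs).const_sub 1).norm
      rw [hx1, sub_self, norm_zero] at l1
      filter_upwards [l1.eventually (gt_mem_nhds (show (0 : ℝ) < 1 / (c + 1) by positivity))] with n hn
      simp only [Function.comp] at hn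
      have hε : (0 : ℝ) < 1 / ((n : ℝ) + 1) := by positivity
      rw [hq hε, norm_div, norm_one] at hn
      have him : ∀ ε : ℝ, 0 < ε → 0 < (x + ε * Complex.I : ℂ).im := fun ε hε => by simpa using hε
      have hpos : 0 < ‖1 + cauchyTransform g (x + (1 / ((n : ℝ) + 1) : ℝ) * Complex.I)‖ :=
        norm_pos_iff.2 (one_add_ne_zero_of_re_nonneg (re_cauchyTransform_nonneg hg h0 (him _ hε)))
      rw [div_lt_div_iff₀ hpos (by positivity), one_mul, one_mul] at hn
      have := norm_add_le 1 (cauchyTransform g (x + (1 / ((n : ℝ) + 1) : ℝ) * Complex.I))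
      rw [norm_one] at this
      show c ≤ ‖cauchyTransform g (x + (1 / ((n : ℝ) + 1) : ℝ) * Complex.I)‖
      linarith
    have l : Tendsto (fun c : ℝ => ENNReal.ofReal (4 * (∫ t, g t) / c)) atTop (𝓝 0) := by
      rw [← ENNReal.ofReal_zero]
      exact (ENNReal.continuous_ofReal.tendsto 0).comp (tendsto_const_nhds.div_atTop tendsto_id)
    refine le_antisymm (ge_of_tendsto l ?_) zero_le
    filter_upwards [eventually_gt_atTop 0] with c hc using bd c hc
  filter_upwards [hl, hne] with x h1 h2
  have h3 : 1 - Ψ x ≠ 0 := fun h => h2 ⟨(sub_eq_zero.1 h).symm, h1⟩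
  refine ⟨Ψ x / (1 - Ψ x), (h1.div (h1.const_sub 1) h3).congr' ?_⟩
  filter_upwards [self_mem_nhdsWithin] with ε hε
  have := one_add_ne_zero_of_re_nonneg (re_cauchyTransform_nonneg hg h0
      (z := x + ε * Complex.I) (by simpa using hε))
  simp only [Pi.div_apply]
  rw [hq hε, cauchyQuot]
  field_simp

/-- The conjugate Poisson integral is the imaginary part of the Cauchy transform. The weak type
bound at the heights `1 / (n + 1)` passes to the limit through `measure_le_of_eventually_mem`. -/
theorem exists_conjugate_of_nonneg : ∃ h : ℝ → ℝ,
    (∀ᵐ x, Tendsto (fun ε => ∫ t, conjPoisson x ε t * g t) (𝓝[>] 0) (𝓝 (h x))) ∧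
    ∀ c > 0, ∃ s, {x | c < |h x|} ⊆ s ∧ volume s ≤ ENNReal.ofReal (4 * (∫ t, g t) / c) := by
  classical
  have hs : Tendsto (fun n : ℕ => 1 / ((n : ℝ) + 1)) atTop (𝓝[>] 0) :=
    tendsto_nhdsWithin_iff.2 ⟨tendsto_one_div_add_atTop_nhds_zero_nat,
      Eventually.of_forall fun n => by show (0 : ℝ) < _; positivity⟩
  have im_eq : ∀ {ε : ℝ}, 0 < ε → ∀ x : ℝ, ∫ t, conjPoisson x ε t * g t =
      (cauchyTransform g (x + ε * Complex.I)).im := fun hε x => by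
    rw [cauchyTransform_eq hg hε]
    simp
  have hlim : ∀ᵐ x, ∃ c, Tendsto (fun ε => ∫ t, conjPoisson x ε t * g t) (𝓝[>] 0) (𝓝 c) := by
    filter_upwards [ae_tendsto_cauchyTransform hg h0] with x ⟨c, hc⟩
    refine ⟨c.im, ((Complex.continuous_im.tendsto c).comp hc).congr' ?_⟩
    filter_upwards [self_mem_nhdsWithin] with ε hε
    exact (im_eq hε x).symm
  set h : ℝ → ℝ := fun x =>
    if H : ∃ c, Tendsto (fun ε => ∫ t, conjPoisson x ε t * g t) (𝓝[>] 0) (𝓝 c) then H.choose else 0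
    with hh
  have hspec : ∀ x, (∃ c, Tendsto (fun ε => ∫ t, conjPoisson x ε t * g t) (𝓝[>] 0) (𝓝 c)) →
      Tendsto (fun ε => ∫ t, conjPoisson x ε t * g t) (𝓝[>] 0) (𝓝 (h x)) := fun x H => by
    simp only [hh, H, dif_pos]
    exact H.choose_spec
  refine ⟨h, hlim.mono hspec, fun c hc => ⟨_, Subset.rfl, ?_⟩⟩
  refine measure_le_of_eventually_mem (s := fun n : ℕ => {x : ℝ |
    c ≤ ‖cauchyTransform g (x + (1 / ((n : ℝ) + 1) : ℝ) * Complex.I)‖}) ?_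
    fun n => measure_le_norm_cauchyTransform_le hg h0 (by positivity) hc
  intro x hx
  have hx : c < |h x| := hx
  have H : ∃ c, Tendsto (fun ε => ∫ t, conjPoisson x ε t * g t) (𝓝[>] 0) (𝓝 c) := by
    by_contra H
    simp only [hh, H, dif_neg, not_false_eq_true, abs_zero] at hx
    linarith
  filter_upwards [((hspec x H).comp hs).abs.eventually (lt_mem_nhds hx)] with n hn
  simp only [Function.comp] at hn
  rw [im_eq (by positivity)] at hn
  exact hn.le.trans (Complex.abs_im_le_norm _)

end

/-- The conjugate Poisson integrals of an integrable function converge almost everywhere, and the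
limit satisfies the weak type inequality. -/
theorem exists_conjugate {g : ℝ → ℂ} (hg : Integrable g) : ∃ h : ℝ → ℂ, AEMeasurable h ∧
    (∀ᵐ x, Tendsto (fun ε => ∫ t, (conjPoisson x ε t : ℂ) * g t) (𝓝[>] 0) (𝓝 (h x))) ∧
    ∀ c > 0, volume {x | c < ‖h x‖} ≤ ENNReal.ofReal (64 * (∫ t, ‖g t‖) / c) := by
  have hre : Integrable fun t => (g t).re := hg.re
  have him : Integrable fun t => (g t).im := hg.im
  obtain ⟨h1, l1, w1⟩ := exists_conjugate_of_nonneg (g := fun t => max (g t).re 0) hre.pos_part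
    (fun t => le_max_right _ _)
  obtain ⟨h2, l2, w2⟩ := exists_conjugate_of_nonneg (g := fun t => max (-(g t).re) 0) hre.neg_part
    (fun t => le_max_right _ _)
  obtain ⟨h3, l3, w3⟩ := exists_conjugate_of_nonneg (g := fun t => max (g t).im 0) him.pos_part
    (fun t => le_max_right _ _)
  obtain ⟨h4, l4, w4⟩ := exists_conjugate_of_nonneg (g := fun t => max (-(g t).im) 0) him.neg_part
    (fun t => le_max_right _ _)
  set h : ℝ → ℂ := fun x => ((h1 x - h2 x : ℝ) : ℂ) + ((h3 x - h4 x : ℝ) : ℂ) * Complex.I with hh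
  have hdec : ∀ {ε : ℝ}, 0 < ε → ∀ x, ∫ t, (conjPoisson x ε t : ℂ) * g t =
      (((∫ t, conjPoisson x ε t * max (g t).re 0) - ∫ t, conjPoisson x ε t * max (-(g t).re) 0 : ℝ) : ℂ)
      + (((∫ t, conjPoisson x ε t * max (g t).im 0) - ∫ t, conjPoisson x ε t * max (-(g t).im) 0 : ℝ) : ℂ)
        * Complex.I := by
    intro ε hε x
    have I : ∀ {f : ℝ → ℝ}, Integrable f → Integrable fun t => conjPoisson x ε t * f t := fun hf =>
      hf.bdd_mul (c := ε⁻¹) (continuous_conjPoisson hε x).aestronglyMeasurable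
        (Eventually.of_forall fun t => abs_conjPoisson_le hε x t)
    rw [← integral_sub (I hre.pos_part) (I hre.neg_part), ← integral_sub (I him.pos_part) (I him.neg_part),
      ← integral_complex_ofReal, ← integral_complex_ofReal, ← integral_mul_const, ← integral_add]
    · congr 1
      funext t
      have e : ∀ a : ℝ, max a 0 - max (-a) 0 = a := fun a => by
        rcases le_total a 0 with h | h
        · rw [max_eq_right h, max_eq_left (by linarith)]; ring
        · rw [max_eq_left h, max_eq_right (by linarith)]; ring
      rw [← mul_sub, ← mul_sub, e, e]
      conv_lhs => rw [← Complex.re_add_im (g t)]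
      push_cast
      ring
    · exact ((I hre.pos_part).sub (I hre.neg_part)).ofReal
    · exact ((I him.pos_part).sub (I him.neg_part)).ofReal.mul_const _
  have hl : ∀ᵐ x, Tendsto (fun ε => ∫ t, (conjPoisson x ε t : ℂ) * g t) (𝓝[>] 0) (𝓝 (h x)) := by
    filter_upwards [l1, l2, l3, l4] with x t1 t2 t3 t4
    refine (((Complex.continuous_ofReal.tendsto _).comp (t1.sub t2)).add
      (((Complex.continuous_ofReal.tendsto _).comp (t3.sub t4)).mul_const Complex.I)).congr' ?_
    filter_upwards [self_mem_nhdsWithin] with ε hε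
    exact (hdec hε x).symm
  have hs : Tendsto (fun n : ℕ => 1 / ((n : ℝ) + 1)) atTop (𝓝[>] 0) :=
    tendsto_nhdsWithin_iff.2 ⟨tendsto_one_div_add_atTop_nhds_zero_nat,
      Eventually.of_forall fun n => by show (0 : ℝ) < _; positivity⟩
  refine ⟨h, ?_, hl, fun c hc => ?_⟩
  · refine aemeasurable_of_tendsto_metrizable_ae atTop (f := fun (n : ℕ) x =>
      ∫ t, (conjPoisson x (1 / ((n : ℝ) + 1)) t : ℂ) * g t) (fun n => ?_)
      (hl.mono fun x hx => hx.comp hs)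
    refine (AEStronglyMeasurable.integral_prod_right' (f := fun p : ℝ × ℝ =>
      (conjPoisson p.1 (1 / ((n : ℝ) + 1)) p.2 : ℂ) * g p.2) ?_).aemeasurable
    refine AEStronglyMeasurable.mul ?_ hg.1.comp_snd
    refine (Complex.measurable_ofReal.comp ?_).aestronglyMeasurable
    unfold conjPoisson
    fun_prop
  -- Each of the four nonnegative parts is allowed a quarter of the level: `4 · 4 = 16` for each
  -- one, hence `64` in total.
  · have hc4 : 0 < c / 4 := by positivity
    obtain ⟨s1, a1, b1⟩ := w1 (c / 4) hc4
    obtain ⟨s2, a2, b2⟩ := w2 (c / 4) hc4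
    obtain ⟨s3, a3, b3⟩ := w3 (c / 4) hc4
    obtain ⟨s4, a4, b4⟩ := w4 (c / 4) hc4
    have hsub : {x | c < ‖h x‖} ⊆ (s1 ∪ s2) ∪ (s3 ∪ s4) := by
      intro x hx
      have hx : c < ‖h x‖ := hx
      by_contra hn
      simp only [mem_union, not_or] at hn
      have n1 : |h1 x| ≤ c / 4 := not_lt.1 fun h => hn.1.1 (a1 h)
      have n2 : |h2 x| ≤ c / 4 := not_lt.1 fun h => hn.1.2 (a2 h)
      have n3 : |h3 x| ≤ c / 4 := not_lt.1 fun h => hn.2.1 (a3 h)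
      have n4 : |h4 x| ≤ c / 4 := not_lt.1 fun h => hn.2.2 (a4 h)
      have := norm_add_le ((h1 x - h2 x : ℝ) : ℂ) (((h3 x - h4 x : ℝ) : ℂ) * Complex.I)
      rw [norm_mul, Complex.norm_I, mul_one, Complex.norm_real, Complex.norm_real, Real.norm_eq_abs,
        Real.norm_eq_abs] at this
      have := abs_sub (h1 x) (h2 x)
      have := abs_sub (h3 x) (h4 x)
      simp only [hh] at hx
      linarith
    have bd : ∀ {f : ℝ → ℝ}, Integrable f → (∀ t, f t ≤ ‖g t‖) →
        ENNReal.ofReal (4 * (∫ t, f t) / (c / 4)) ≤ ENNReal.ofReal (16 * (∫ t, ‖g t‖) / c) := by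
      intro f hf hfg
      refine ENNReal.ofReal_le_ofReal ?_
      have := integral_mono hf hg.norm hfg
      calc 4 * (∫ t, f t) / (c / 4) = 16 * (∫ t, f t) / c := by field_simp; ring
        _ ≤ _ := by gcongr
    have r1 := fun t => Complex.abs_re_le_norm (g t)
    have r2 := fun t => Complex.abs_im_le_norm (g t)
    have c1 := b1.trans (bd hre.pos_part fun t => max_le ((le_abs_self _).trans (r1 t)) (norm_nonneg _))
    have c2 := b2.trans (bd hre.neg_part fun t => max_le ((neg_le_abs _).trans (r1 t)) (norm_nonneg _))
    have c3 := b3.trans (bd him.pos_part fun t => max_le ((le_abs_self _).trans (r2 t)) (norm_nonneg _))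
    have c4 := b4.trans (bd him.neg_part fun t => max_le ((neg_le_abs _).trans (r2 t)) (norm_nonneg _))
    have hG : 0 ≤ 16 * (∫ t, ‖g t‖) / c := by
      have : 0 ≤ ∫ t, ‖g t‖ := integral_nonneg fun t => norm_nonneg _
      positivity
    calc volume {x | c < ‖h x‖} ≤ (volume s1 + volume s2) + (volume s3 + volume s4) :=
          (measure_mono hsub).trans ((measure_union_le _ _).trans
            (add_le_add (measure_union_le _ _) (measure_union_le _ _)))
      _ ≤ _ := add_le_add (add_le_add c1 c2) (add_le_add c3 c4)
      _ = _ := by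
          rw [← ENNReal.ofReal_add hG hG, ← ENNReal.ofReal_add (by positivity) (by positivity)]
          congr 1
          ring

/-! ### The operator on odd functions and domination of increments -/

section
variable {E : Type*} [NormedAddCommGroup E] [NormedSpace ℝ E]

/-- The `j`-th term of the subtransfer operator on odd functions. -/
noncomputable def oddTerm (u : ℝ → E) (x : ℝ) (j : ℕ) : E :=
  ((2 * j + 2 - x)⁻¹ ^ 2) • u (2 * j + 2 - x)⁻¹ - ((2 * j + 2 + x)⁻¹ ^ 2) • u (2 * j + 2 + x)⁻¹

/-- The subtransfer operator on odd functions, in terms of their values on `]0, 1[`. -/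
noncomputable def oddTransfer (u : ℝ → E) (x : ℝ) : E := ∑' j : ℕ, oddTerm u x j

/-- `u` vanishes at `0` and its increments on `[0, 1[` are dominated by those of `D`. -/
def Dom (u : ℝ → E) (D : ℝ → ℝ) : Prop :=
  u 0 = 0 ∧ D 0 = 0 ∧ ∀ x y, 0 ≤ x → x ≤ y → y < 1 → ‖u y - u x‖ ≤ D y - D x

variable {u v : ℝ → E} {D D' : ℝ → ℝ}

omit [NormedSpace ℝ E] in
theorem Dom.mono_on (h : Dom u D) {x y : ℝ} (hx : 0 ≤ x) (hxy : x ≤ y) (hy : y < 1) : D x ≤ D y :=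
  sub_nonneg.1 ((norm_nonneg _).trans (h.2.2 x y hx hxy hy))

omit [NormedSpace ℝ E] in
theorem Dom.nonneg (h : Dom u D) {x : ℝ} (hx : 0 ≤ x) (hx1 : x < 1) : 0 ≤ D x :=
  h.2.1 ▸ h.mono_on le_rfl hx hx1

omit [NormedSpace ℝ E] in
theorem Dom.norm_le (h : Dom u D) {x : ℝ} (hx : 0 ≤ x) (hx1 : x < 1) : ‖u x‖ ≤ D x := by
  simpa [h.1, h.2.1] using h.2.2 0 x le_rfl hx hx1

omit [NormedSpace ℝ E] in
theorem Dom.self (h : Dom u D) : Dom D D :=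
  ⟨h.2.1, h.2.1, fun x y hx hxy hy => by
    rw [Real.norm_eq_abs, abs_of_nonneg (sub_nonneg.2 (h.mono_on hx hxy hy))]⟩

omit [NormedSpace ℝ E] in
theorem Dom.add (h : Dom u D) (h' : Dom v D') : Dom (fun x => u x + v x) (fun x => D x + D' x) := by
  refine ⟨by simp [h.1, h'.1], by simp [h.2.1, h'.2.1], fun x y hx hxy hy => ?_⟩
  have := norm_add_le (u y - u x) (v y - v x)
  rw [show u y + v y - (u x + v x) = u y - u x + (v y - v x) by abel]
  linarith [h.2.2 x y hx hxy hy, h'.2.2 x y hx hxy hy]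

omit [NormedSpace ℝ E] in
theorem Dom.neg (h : Dom u D) : Dom (fun x => - u x) D := by
  refine ⟨by simp [h.1], h.2.1, fun x y hx hxy hy => ?_⟩
  rw [neg_sub_neg, norm_sub_rev]
  exact h.2.2 x y hx hxy hy

omit [NormedSpace ℝ E] in
theorem Dom.sub (h : Dom u D) (h' : Dom v D') : Dom (fun x => u x - v x) (fun x => D x + D' x) := by
  simpa only [sub_eq_add_neg] using h.add h'.neg

theorem Dom.const_smul (h : Dom u D) (c : ℝ) : Dom (fun x => c • u x) (fun x => |c| * D x) := by
  refine ⟨by simp [h.1], by simp [h.2.1], fun x y hx hxy hy => ?_⟩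
  rw [← smul_sub, norm_smul, Real.norm_eq_abs, ← mul_sub]
  exact mul_le_mul_of_nonneg_left (h.2.2 x y hx hxy hy) (abs_nonneg _)

omit [NormedSpace ℝ E] in
theorem Dom.congr (h : Dom u D) (huv : EqOn u v (Ico 0 1)) : Dom v D := by
  refine ⟨by rw [← huv ⟨le_rfl, one_pos⟩, h.1], h.2.1, fun x y hx hxy hy => ?_⟩
  rw [← huv ⟨hx, hxy.trans_lt hy⟩, ← huv ⟨hx.trans hxy, hy⟩]
  exact h.2.2 x y hx hxy hy

/-- Product rule: the increment of `x² u(x)` is `b²(u b - u a) + (b² - a²) u a`, and both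
coefficients are nonnegative. -/
theorem Dom.sq_smul (h : Dom u D) {a b : ℝ} (ha : 0 ≤ a) (hab : a ≤ b) (hb : b < 1) :
    ‖b ^ 2 • u b - a ^ 2 • u a‖ ≤ b ^ 2 * D b - a ^ 2 * D a := by
  have e : b ^ 2 • u b - a ^ 2 • u a = b ^ 2 • (u b - u a) + (b ^ 2 - a ^ 2) • u a := by
    rw [smul_sub, sub_smul]; abel
  have hsq : 0 ≤ b ^ 2 - a ^ 2 := by nlinarith
  calc ‖b ^ 2 • u b - a ^ 2 • u a‖ ≤ b ^ 2 * ‖u b - u a‖ + (b ^ 2 - a ^ 2) * ‖u a‖ := by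
        rw [e]
        refine (norm_add_le _ _).trans ?_
        rw [norm_smul, norm_smul, Real.norm_of_nonneg (sq_nonneg b), Real.norm_of_nonneg hsq]
    _ ≤ b ^ 2 * (D b - D a) + (b ^ 2 - a ^ 2) * D a := by
        gcongr
        · exact h.2.2 a b ha hab hb
        · exact h.norm_le ha (hab.trans_lt hb)
    _ = _ := by ring

theorem inv_mem_unit {x : ℝ} (hx : -1 < x) (hx1 : x < 1) (j : ℕ) :
    0 < (2 * j + 2 - x)⁻¹ ∧ (2 * j + 2 - x)⁻¹ < 1 ∧ 0 < (2 * j + 2 + x)⁻¹ ∧ (2 * j + 2 + x)⁻¹ < 1 := by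
  have hj : (0 : ℝ) ≤ j := Nat.cast_nonneg j
  exact ⟨inv_pos.2 (by linarith), inv_lt_one_of_one_lt₀ (by linarith), inv_pos.2 (by linarith),
    inv_lt_one_of_one_lt₀ (by linarith)⟩

theorem summable_inv_odd_sq : Summable fun j : ℕ => ((2 * j + 1 : ℝ) ^ 2)⁻¹ := by
  have h := (summable_nat_add_iff 1).2 (Real.summable_nat_pow_inv.2 (show 1 < 2 by norm_num))
  refine Summable.of_nonneg_of_le (fun j => by positivity) (fun j => ?_) h
  have hj : (0 : ℝ) ≤ j := Nat.cast_nonneg j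
  push_cast
  gcongr
  linarith

/-- The `j`-th term is the increment of `t² u(t)` between `1/(2j+2+x)` and `1/(2j+2-x)`, so
`Dom.sq_smul` applies. -/
theorem Dom.norm_oddTerm_le (h : Dom u D) {x : ℝ} (hx : 0 ≤ x) (hx1 : x < 1) (j : ℕ) :
    ‖oddTerm u x j‖ ≤ oddTerm D x j ∧ oddTerm D x j ≤ D (2 - x)⁻¹ * ((2 * j + 1 : ℝ) ^ 2)⁻¹ := by
  have hj : (0 : ℝ) ≤ j := Nat.cast_nonneg j
  obtain ⟨p1, p2, p3, p4⟩ := inv_mem_unit (by linarith) hx1 j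
  have hab : (2 * j + 2 + x)⁻¹ ≤ (2 * j + 2 - x)⁻¹ := inv_anti₀ (by linarith) (by linarith)
  refine ⟨h.sq_smul p3.le hab p2, ?_⟩
  have h1 := h.nonneg p3.le p4
  have h2 : D (2 * j + 2 - x)⁻¹ ≤ D (2 - x)⁻¹ :=
    h.mono_on p1.le (inv_anti₀ (by linarith) (by linarith)) (inv_lt_one_of_one_lt₀ (by linarith))
  have h3 : (2 * j + 2 - x)⁻¹ ^ 2 ≤ ((2 * j + 1 : ℝ) ^ 2)⁻¹ := by
    rw [inv_pow]
    gcongr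
    linarith
  calc oddTerm D x j ≤ (2 * j + 2 - x)⁻¹ ^ 2 * D (2 * j + 2 - x)⁻¹ := by
        simp only [oddTerm, smul_eq_mul]
        have : 0 ≤ (2 * j + 2 + x)⁻¹ ^ 2 * D (2 * j + 2 + x)⁻¹ := by positivity
        linarith
    _ ≤ ((2 * j + 1 : ℝ) ^ 2)⁻¹ * D (2 - x)⁻¹ :=
        mul_le_mul h3 h2 (h.nonneg p1.le p2) (by positivity)
    _ = _ := mul_comm _ _

theorem Dom.summable_self (h : Dom u D) {x : ℝ} (hx : 0 ≤ x) (hx1 : x < 1) :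
    Summable (oddTerm D x) :=
  Summable.of_nonneg_of_le (fun j => (norm_nonneg _).trans (h.norm_oddTerm_le hx hx1 j).1)
    (fun j => (h.norm_oddTerm_le hx hx1 j).2) (summable_inv_odd_sq.mul_left _)

theorem oddTransfer_zero (u : ℝ → E) : oddTransfer u 0 = 0 := by
  simp [oddTransfer, oddTerm]

theorem oddTerm_neg (u : ℝ → E) (x : ℝ) (j : ℕ) : oddTerm u (-x) j = - oddTerm u x j := by
  simp only [oddTerm, sub_neg_eq_add, ← sub_eq_add_neg, neg_sub]

theorem oddTransfer_neg (u : ℝ → E) (x : ℝ) : oddTransfer u (-x) = - oddTransfer u x := by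
  simp only [oddTransfer, oddTerm_neg, tsum_neg]

variable [CompleteSpace E]

theorem Dom.summable (h : Dom u D) {x : ℝ} (hx : 0 ≤ x) (hx1 : x < 1) : Summable (oddTerm u x) :=
  Summable.of_norm_bounded (h.summable_self hx hx1) fun j => (h.norm_oddTerm_le hx hx1 j).1

theorem Dom.summable_of_abs (h : Dom u D) {x : ℝ} (hx : |x| < 1) : Summable (oddTerm u x) := by
  rw [abs_lt] at hx
  rcases le_total 0 x with h0 | h0
  · exact h.summable h0 hx.2
  · have : oddTerm u x = fun j => - oddTerm u (-x) j := by
      funext j; rw [oddTerm_neg, neg_neg]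
    rw [this]
    exact (h.summable (by linarith) (by linarith)).neg

/-- As `x` grows, `1/(2j+2-x)` increases and `1/(2j+2+x)` decreases, while the latter enters with a
minus sign; so both halves of each term have dominated increments. All later comparisons rest on
this positivity. -/
theorem Dom.oddTransfer (h : Dom u D) : Dom (oddTransfer u) (GaussHilbert.oddTransfer D) := by
  refine ⟨oddTransfer_zero u, oddTransfer_zero D, fun x y hx hxy hy => ?_⟩
  have hx1 := hxy.trans_lt hy
  have hy0 := hx.trans hxy
  simp only [GaussHilbert.oddTransfer]
  rw [← (h.summable hy0 hy).tsum_sub (h.summable hx hx1),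
    ← (h.summable_self hy0 hy).tsum_sub (h.summable_self hx hx1)]
  refine tsum_of_norm_bounded ((h.summable_self hy0 hy).sub (h.summable_self hx hx1)).hasSum
    fun j => ?_
  have hj : (0 : ℝ) ≤ j := Nat.cast_nonneg j
  obtain ⟨p1, p2, p3, p4⟩ := inv_mem_unit (by linarith) hx1 j
  obtain ⟨q1, q2, q3, q4⟩ := inv_mem_unit (by linarith) hy j
  have a1 := h.sq_smul p1.le (show (2 * j + 2 - x)⁻¹ ≤ (2 * j + 2 - y)⁻¹ from
    inv_anti₀ (by linarith) (by linarith)) q2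
  have a2 := h.sq_smul q3.le (show (2 * j + 2 + y)⁻¹ ≤ (2 * j + 2 + x)⁻¹ from
    inv_anti₀ (by linarith) (by linarith)) p4
  refine le_trans ?_ ((norm_add_le _ _).trans (add_le_add a1 a2) |>.trans (le_of_eq ?_))
  · refine le_of_eq (congrArg norm ?_)
    simp only [oddTerm]
    abel
  · simp only [oddTerm, smul_eq_mul]
    ring

theorem Dom.iterate (h : Dom u D) (n : ℕ) :
    Dom (GaussHilbert.oddTransfer^[n] u) (GaussHilbert.oddTransfer^[n] D) := by
  induction n with
  | zero => exact h
  | succ n ih => simp only [Function.iterate_succ_apply']; exact ih.oddTransfer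

omit [CompleteSpace E] in
theorem oddTransfer_congr (huv : EqOn u v (Ioo 0 1)) {x : ℝ} (hx : -1 < x) (hx1 : x < 1) :
    oddTransfer u x = oddTransfer v x := by
  refine tsum_congr fun j => ?_
  obtain ⟨p1, p2, p3, p4⟩ := inv_mem_unit hx hx1 j
  simp only [oddTerm, huv ⟨p1, p2⟩, huv ⟨p3, p4⟩]

omit [CompleteSpace E] in
theorem oddTransfer_iterate_congr (huv : EqOn u v (Ico 0 1)) (n : ℕ) :
    EqOn (oddTransfer^[n] u) (oddTransfer^[n] v) (Ico 0 1) := by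
  induction n with
  | zero => exact huv
  | succ n ih =>
    intro x hx
    simp only [Function.iterate_succ_apply']
    exact oddTransfer_congr (ih.mono Ioo_subset_Ico_self) (by linarith [hx.1]) hx.2

theorem Dom.oddTransfer_add (h : Dom u D) (h' : Dom v D') {x : ℝ} (hx : |x| < 1) :
    GaussHilbert.oddTransfer (fun x => u x + v x) x =
      GaussHilbert.oddTransfer u x + GaussHilbert.oddTransfer v x := by
  simp only [GaussHilbert.oddTransfer]
  rw [← (h.summable_of_abs hx).tsum_add (h'.summable_of_abs hx)]
  refine tsum_congr fun j => ?_
  simp only [oddTerm, smul_add]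
  abel

omit [CompleteSpace E] in
theorem oddTransfer_const_smul (c : ℝ) (u : ℝ → E) (x : ℝ) :
    oddTransfer (fun x => c • u x) x = c • oddTransfer u x := by
  simp only [oddTransfer]
  rw [← tsum_const_smul'']
  refine tsum_congr fun j => ?_
  simp only [oddTerm, smul_sub, smul_comm c]

omit [CompleteSpace E] in
theorem oddTransfer_neg_fun (u : ℝ → E) (x : ℝ) :
    oddTransfer (fun x => - u x) x = - oddTransfer u x := by
  simpa using oddTransfer_const_smul (-1) u x

theorem Dom.oddTransfer_sub (h : Dom u D) (h' : Dom v D') {x : ℝ} (hx : |x| < 1) :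
    GaussHilbert.oddTransfer (fun x => u x - v x) x =
      GaussHilbert.oddTransfer u x - GaussHilbert.oddTransfer v x := by
  simp only [sub_eq_add_neg]
  rw [h.oddTransfer_add h'.neg hx, oddTransfer_neg_fun]

theorem Dom.iterate_add (h : Dom u D) (h' : Dom v D') (n : ℕ) :
    EqOn (GaussHilbert.oddTransfer^[n] (fun x => u x + v x))
      (fun x => GaussHilbert.oddTransfer^[n] u x + GaussHilbert.oddTransfer^[n] v x) (Ico 0 1) := by
  induction n with
  | zero => exact fun x _ => rfl
  | succ n ih =>
    intro x hx
    simp only [Function.iterate_succ_apply']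
    rw [oddTransfer_congr (ih.mono Ioo_subset_Ico_self) (by linarith [hx.1]) hx.2,
      (h.iterate n).oddTransfer_add (h'.iterate n) (by rw [abs_of_nonneg hx.1]; exact hx.2)]

omit [CompleteSpace E] in
theorem iterate_const_smul (c : ℝ) (u : ℝ → E) (n : ℕ) :
    oddTransfer^[n] (fun x => c • u x) = fun x => c • oddTransfer^[n] u x := by
  induction n with
  | zero => rfl
  | succ n ih =>
    funext x
    simp only [Function.iterate_succ_apply']
    rw [ih, oddTransfer_const_smul]

theorem Dom.iterate_sub (h : Dom u D) (h' : Dom v D') (n : ℕ) :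
    EqOn (GaussHilbert.oddTransfer^[n] (fun x => u x - v x))
      (fun x => GaussHilbert.oddTransfer^[n] u x - GaussHilbert.oddTransfer^[n] v x) (Ico 0 1) := by
  intro x hx
  have e := iterate_const_smul (-1) v n
  have := h.iterate_add (v := fun x => (-1 : ℝ) • v x) (h'.const_smul (-1)) n hx
  simp only [e] at this
  simpa [sub_eq_add_neg] using this

omit [NormedSpace ℝ E] in
/-- Sums of functions with dominated increments. -/
theorem Dom.tsum {w : ℕ → ℝ → E} {c : ℕ → ℝ} (h : ∀ j, Dom (w j) (fun x => c j * x))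
    (hc : Summable c) : Dom (fun x => ∑' j, w j x) (fun x => (∑' j, c j) * x) := by
  have hs : ∀ x, 0 ≤ x → x < 1 → Summable fun j => w j x := fun x hx hx1 =>
    Summable.of_norm_bounded (hc.mul_right x) fun j => (h j).norm_le hx hx1
  refine ⟨by simp [(h _).1], by simp, fun x y hx hxy hy => ?_⟩
  rw [← (hs y (hx.trans hxy) hy).tsum_sub (hs x hx (hxy.trans_lt hy)), ← mul_sub, ← tsum_mul_right]
  exact tsum_of_norm_bounded (hc.mul_right _).hasSum fun j => by
    have := (h j).2.2 x y hx hxy hy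
    rwa [← mul_sub] at this

end

/-! ### The kernels `logKer s` and their images under the operator -/

/-- The kernel `1 / (a - x) - 1 / (a + x)`. -/
noncomputable def poleKer (a x : ℝ) : ℝ := (a - x)⁻¹ - (a + x)⁻¹

/-- The kernel `2 s² x / (1 - s² x²)`. -/
noncomputable def logKer (s x : ℝ) : ℝ := 2 * s ^ 2 * x / (1 - s ^ 2 * x ^ 2)

theorem poleKer_zero (a : ℝ) : poleKer a 0 = 0 := by simp [poleKer]

theorem logKer_zero (s : ℝ) : logKer s 0 = 0 := by simp [logKer]

theorem logKer_neg (s x : ℝ) : logKer s (-x) = - logKer s x := by simp [logKer, neg_div]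

theorem logKer_neg_left (s x : ℝ) : logKer (-s) x = logKer s x := by simp [logKer]

theorem poleKer_sub {a x y : ℝ} (hx : |x| < a) (hy : |y| < a) :
    poleKer a y - poleKer a x =
      (y - x) * ((a - y)⁻¹ * (a - x)⁻¹ + (a + y)⁻¹ * (a + x)⁻¹) := by
  rw [abs_lt] at hx hy
  have h1 : a - x ≠ 0 := by linarith
  have h2 : a - y ≠ 0 := by linarith
  have h3 : a + x ≠ 0 := by linarith
  have h4 : a + y ≠ 0 := by linarith
  unfold poleKer
  field_simp
  ring

theorem one_sub_sq_mul_sq_pos {s x : ℝ} (hs : |s| ≤ 1) (hx : |x| < 1) : 0 < 1 - s ^ 2 * x ^ 2 := by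
  have h1 : s ^ 2 ≤ 1 := (sq_le_one_iff_abs_le_one s).2 hs
  have h2 : x ^ 2 < 1 := (sq_lt_one_iff_abs_lt_one x).2 hx
  nlinarith [sq_nonneg s, sq_nonneg x]

theorem logKer_eq_poleKer {s x : ℝ} (hs0 : s ≠ 0) (hs : |s| ≤ 1) (hx : |x| < 1) :
    logKer s x = poleKer s⁻¹ x := by
  have h := one_sub_sq_mul_sq_pos hs hx
  have hsx : |s * x| < 1 := by
    rw [abs_mul]; nlinarith [abs_nonneg s, abs_nonneg x]
  rw [abs_lt] at hsx
  have h1 : 1 - s * x ≠ 0 := by linarith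
  have h2 : 1 + s * x ≠ 0 := by linarith
  have e1 : (s⁻¹ - x)⁻¹ = s / (1 - s * x) := by
    rw [show s⁻¹ - x = (1 - s * x) / s by field_simp, inv_div]
  have e2 : (s⁻¹ + x)⁻¹ = s / (1 + s * x) := by
    rw [show s⁻¹ + x = (1 + s * x) / s by field_simp, inv_div]
  rw [logKer, poleKer, e1, e2, div_sub_div _ _ h1 h2, show (1 - s * x) * (1 + s * x) =
    1 - s ^ 2 * x ^ 2 by ring]
  congr 1
  ring

theorem logKer_sub {s x y : ℝ} (hs : |s| ≤ 1) (hx : |x| < 1) (hy : |y| < 1) :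
    logKer s y - logKer s x = 2 * (y - x) * s ^ 2 * (1 + s ^ 2 * (x * y)) /
      ((1 - s ^ 2 * y ^ 2) * (1 - s ^ 2 * x ^ 2)) := by
  have h1 := (one_sub_sq_mul_sq_pos hs hx).ne'
  have h2 := (one_sub_sq_mul_sq_pos hs hy).ne'
  rw [logKer, logKer, div_sub_div _ _ h2 h1]
  congr 1
  ring

theorem abs_logKer_sub_le {s s' x : ℝ} (hs : |s| ≤ 1) (hs' : |s'| ≤ 1) (hx : |x| < 1) :
    |logKer s x - logKer s' x| ≤ 4 * |s - s'| * ((1 - x ^ 2) ^ 2)⁻¹ := by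
  have h1 := one_sub_sq_mul_sq_pos hs hx
  have h2 := one_sub_sq_mul_sq_pos hs' hx
  have hx2 : x ^ 2 < 1 := (sq_lt_one_iff_abs_lt_one x).2 hx
  have hsq : s ^ 2 ≤ 1 := (sq_le_one_iff_abs_le_one s).2 hs
  have hsq' : s' ^ 2 ≤ 1 := (sq_le_one_iff_abs_le_one s').2 hs'
  have e : logKer s x - logKer s' x =
      2 * x * (s + s') * (s - s') / ((1 - s ^ 2 * x ^ 2) * (1 - s' ^ 2 * x ^ 2)) := by
    rw [logKer, logKer, div_sub_div _ _ h1.ne' h2.ne']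
    congr 1
    ring
  rw [e, abs_div, abs_of_pos (mul_pos h1 h2), div_eq_mul_inv]
  have hss : |s + s'| ≤ 2 := (abs_add_le _ _).trans (by linarith)
  refine mul_le_mul ?_ ?_ (by positivity) (by positivity)
  · rw [abs_mul, abs_mul, abs_mul, abs_two]
    gcongr
    nlinarith [abs_nonneg x, abs_nonneg (s + s')]
  · have := sq_nonneg x
    refine inv_anti₀ (by nlinarith) ?_
    rw [sq (1 - x ^ 2)]
    gcongr <;> nlinarith

/-- In the factored form of `logKer_sub` the difference quotient in `x` is visibly increasing in
`s²`. -/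
theorem logKer_dom {s : ℝ} (hs : |s| ≤ 1) : Dom (logKer s) (logKer 1) := by
  refine ⟨logKer_zero s, logKer_zero 1, fun x y hx hxy hy => ?_⟩
  have hx' : |x| < 1 := by rw [abs_of_nonneg hx]; linarith
  have hy' : |y| < 1 := by rw [abs_of_nonneg (hx.trans hxy)]; linarith
  have hsq : s ^ 2 ≤ 1 := (sq_le_one_iff_abs_le_one s).2 hs
  rw [logKer_sub hs hx' hy', logKer_sub (by simp) hx' hy']
  have h1 := one_sub_sq_mul_sq_pos hs hx'
  have h2 := one_sub_sq_mul_sq_pos hs hy'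
  have h3 := one_sub_sq_mul_sq_pos (s := 1) (by simp) hx'
  have h4 := one_sub_sq_mul_sq_pos (s := 1) (by simp) hy'
  have hxy0 : 0 ≤ x * y := mul_nonneg hx (hx.trans hxy)
  have hyx : 0 ≤ y - x := by linarith
  rw [Real.norm_of_nonneg (by positivity)]
  have hq0 := sq_nonneg s
  simp only [one_pow] at h3 h4 ⊢
  generalize s ^ 2 = q at *
  gcongr

/-- The difference quotient in `x` is a sum of products of two reciprocals, and a further difference
in the pole brings in a third reciprocal. One of the three is bounded by `1`, since `m ≥ 2`; the
other two keep the quadratic decay needed for summation over the poles. -/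
theorem poleKer_sub_dom {m a b : ℝ} (hm : 2 ≤ m) (ha : m ≤ a) (hb : m ≤ b) :
    Dom (fun x => poleKer a x - poleKer b x) (fun x => 4 * |a - b| * ((m - 1) ^ 2)⁻¹ * x) := by
  refine ⟨by simp [poleKer_zero], by simp, fun x y hx hxy hy => ?_⟩
  have hxa : |x| < a := by rw [abs_of_nonneg hx]; linarith
  have hya : |y| < a := by rw [abs_of_nonneg (hx.trans hxy)]; linarith
  have hxb : |x| < b := by rw [abs_of_nonneg hx]; linarith
  have hyb : |y| < b := by rw [abs_of_nonneg (hx.trans hxy)]; linarith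
  have e := poleKer_sub hxa hya
  have e' := poleKer_sub hxb hyb
  have hq1 : (m - 1)⁻¹ ≤ 1 := inv_le_one_of_one_le₀ (by linarith)
  have hq0 : 0 ≤ (m - 1)⁻¹ := inv_nonneg.2 (by linarith)
  have key : ∀ c, |c| ≤ 1 → ∀ d, m ≤ d → 0 ≤ (d + c)⁻¹ ∧ (d + c)⁻¹ ≤ (m - 1)⁻¹ := by
    intro c hc d hd
    rw [abs_le] at hc
    exact ⟨inv_nonneg.2 (by linarith), inv_anti₀ (by linarith) (by linarith)⟩
  have triple : ∀ p q r : ℝ, 0 ≤ p → p ≤ (m - 1)⁻¹ → 0 ≤ q → q ≤ (m - 1)⁻¹ → 0 ≤ r →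
      r ≤ (m - 1)⁻¹ → p * q * r ≤ (m - 1)⁻¹ ^ 2 := by
    intro p q r hp hp' hq hq' hr hr'
    calc p * q * r ≤ (m - 1)⁻¹ * (m - 1)⁻¹ * 1 := by
          gcongr
          exact hr'.trans hq1
      _ = _ := by ring
  have diff : ∀ c c', |c| ≤ 1 → |c'| ≤ 1 →
      |(a + c)⁻¹ * (a + c')⁻¹ - (b + c)⁻¹ * (b + c')⁻¹| ≤ 2 * |a - b| * (m - 1)⁻¹ ^ 2 := by
    intro c c' hc hc'
    obtain ⟨p0, p1⟩ := key c hc a ha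
    obtain ⟨q0, q1⟩ := key c' hc' a ha
    obtain ⟨r0, r1⟩ := key c hc b hb
    obtain ⟨s0, s1⟩ := key c' hc' b hb
    rw [abs_le] at hc hc'
    have n1 : a + c ≠ 0 := by linarith
    have n2 : a + c' ≠ 0 := by linarith
    have n3 : b + c ≠ 0 := by linarith
    have n4 : b + c' ≠ 0 := by linarith
    have e : (a + c)⁻¹ * (a + c')⁻¹ - (b + c)⁻¹ * (b + c')⁻¹ = - (a - b) *
        ((a + c)⁻¹ * (b + c)⁻¹ * (a + c')⁻¹ + (a + c')⁻¹ * (b + c')⁻¹ * (b + c)⁻¹) := by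
      field_simp
      ring
    rw [e, abs_mul, abs_neg, abs_of_nonneg (a := _ + _) (by positivity)]
    have t1 := triple _ _ _ p0 p1 r0 r1 q0 q1
    have t2 := triple _ _ _ q0 q1 s0 s1 r0 r1
    nlinarith [abs_nonneg (a - b)]
  have d1 := diff (-y) (-x) (by rw [abs_neg, abs_of_nonneg] <;> linarith)
    (by rw [abs_neg, abs_of_nonneg] <;> linarith)
  have d2 := diff y x (by rw [abs_of_nonneg] <;> linarith) (by rw [abs_of_nonneg] <;> linarith)
  simp only [← sub_eq_add_neg] at d1
  rw [show poleKer a y - poleKer b y - (poleKer a x - poleKer b x) = (y - x) *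
    (((a - y)⁻¹ * (a - x)⁻¹ - (b - y)⁻¹ * (b - x)⁻¹) +
      ((a + y)⁻¹ * (a + x)⁻¹ - (b + y)⁻¹ * (b + x)⁻¹)) by linear_combination e - e', norm_mul,
    Real.norm_of_nonneg (by linarith : 0 ≤ y - x), ← mul_sub, mul_comm (y - x)]
  refine mul_le_mul_of_nonneg_right ((abs_add_le _ _).trans ?_) (by linarith)
  rw [inv_pow] at d1 d2
  linarith

/-- The terms of the remainder `resKer`. -/
noncomputable def resTerm (s : ℝ) (j : ℕ) (x : ℝ) : ℝ :=
  (poleKer (2 * j + 2) x - poleKer (2 * j + 2 + s) x) +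
    (poleKer (2 * j + 2) x - poleKer (2 * j + 4 - s) x)

/-- The difference between `logKer (2 - s)⁻¹` and the subtransfer of `logKer s`. -/
noncomputable def resKer (s x : ℝ) : ℝ := ∑' j : ℕ, resTerm s j x

/-- The Lipschitz constant of the functions `resKer s`. -/
noncomputable def resConst : ℝ := ∑' j : ℕ, 8 * ((2 * j + 1 : ℝ) ^ 2)⁻¹

theorem resConst_nonneg : 0 ≤ resConst := tsum_nonneg fun j => by positivity

theorem resTerm_dom {s : ℝ} (hs : 0 ≤ s) (hs1 : s ≤ 1) (j : ℕ) :
    Dom (resTerm s j) (fun x => 8 * ((2 * j + 1 : ℝ) ^ 2)⁻¹ * x) := by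
  have hj : (0 : ℝ) ≤ j := Nat.cast_nonneg j
  have h1 := poleKer_sub_dom (m := 2 * j + 2) (a := 2 * j + 2) (b := 2 * j + 2 + s) (by linarith)
    le_rfl (by linarith)
  have h2 := poleKer_sub_dom (m := 2 * j + 2) (a := 2 * j + 2) (b := 2 * j + 4 - s) (by linarith)
    le_rfl (by linarith)
  have h := h1.add h2
  have e : (fun x : ℝ => 8 * ((2 * j + 1 : ℝ) ^ 2)⁻¹ * x) = fun x =>
      4 * |(2 * j + 2 : ℝ) - (2 * j + 2 + s)| * ((2 * j + 2 - 1 : ℝ) ^ 2)⁻¹ * x +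
      4 * |(2 * j + 2 : ℝ) - (2 * j + 4 - s)| * ((2 * j + 2 - 1 : ℝ) ^ 2)⁻¹ * x := by
    funext x
    rw [show (2 * j + 2 : ℝ) - (2 * j + 2 + s) = -s by ring,
      show (2 * j + 2 : ℝ) - (2 * j + 4 - s) = -(2 - s) by ring, abs_neg, abs_neg,
      abs_of_nonneg hs, abs_of_nonneg (show 0 ≤ 2 - s by linarith),
      show (2 * j + 2 - 1 : ℝ) = 2 * j + 1 by ring]
    ring
  rw [e]
  exact h

theorem resTerm_sub_dom {s s' : ℝ} (hs : 0 ≤ s) (hs1 : s ≤ 1) (hs' : 0 ≤ s') (hs1' : s' ≤ 1)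
    (j : ℕ) : Dom (fun x => resTerm s j x - resTerm s' j x)
      (fun x => 8 * ((2 * j + 1 : ℝ) ^ 2)⁻¹ * |s - s'| * x) := by
  have hj : (0 : ℝ) ≤ j := Nat.cast_nonneg j
  have h1 := poleKer_sub_dom (m := 2 * j + 2) (a := 2 * j + 2 + s') (b := 2 * j + 2 + s)
    (by linarith) (by linarith) (by linarith)
  have h2 := poleKer_sub_dom (m := 2 * j + 2) (a := 2 * j + 4 - s') (b := 2 * j + 4 - s)
    (by linarith) (by linarith) (by linarith)
  have h := h1.add h2
  have e : (fun x : ℝ => 8 * ((2 * j + 1 : ℝ) ^ 2)⁻¹ * |s - s'| * x) = fun x =>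
      4 * |(2 * j + 2 + s' : ℝ) - (2 * j + 2 + s)| * ((2 * j + 2 - 1 : ℝ) ^ 2)⁻¹ * x +
      4 * |(2 * j + 4 - s' : ℝ) - (2 * j + 4 - s)| * ((2 * j + 2 - 1 : ℝ) ^ 2)⁻¹ * x := by
    funext x
    rw [show (2 * j + 2 + s' : ℝ) - (2 * j + 2 + s) = -(s - s') by ring,
      show (2 * j + 4 - s' : ℝ) - (2 * j + 4 - s) = s - s' by ring, abs_neg,
      show (2 * j + 2 - 1 : ℝ) = 2 * j + 1 by ring]
    ring
  rw [e]
  refine h.congr fun x _ => ?_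
  simp only [resTerm]
  ring

theorem summable_resConst : Summable fun j : ℕ => 8 * ((2 * j + 1 : ℝ) ^ 2)⁻¹ :=
  summable_inv_odd_sq.mul_left 8

theorem resKer_dom {s : ℝ} (hs : 0 ≤ s) (hs1 : s ≤ 1) :
    Dom (resKer s) (fun x => resConst * x) :=
  Dom.tsum (resTerm_dom hs hs1) summable_resConst

theorem summable_resTerm {s x : ℝ} (hs : 0 ≤ s) (hs1 : s ≤ 1) (hx : 0 ≤ x) (hx1 : x < 1) :
    Summable fun j => resTerm s j x :=
  Summable.of_norm_bounded (summable_resConst.mul_right x) fun j =>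
    (resTerm_dom hs hs1 j).norm_le hx hx1

theorem resKer_sub_dom {s s' : ℝ} (hs : 0 ≤ s) (hs1 : s ≤ 1) (hs' : 0 ≤ s') (hs1' : s' ≤ 1) :
    Dom (fun x => resKer s x - resKer s' x) (fun x => resConst * |s - s'| * x) := by
  have h := Dom.tsum (resTerm_sub_dom hs hs1 hs' hs1') (summable_resConst.mul_right |s - s'|)
  rw [tsum_mul_right] at h
  refine h.congr fun x hx => ?_
  exact (summable_resTerm hs hs1 hx.1 hx.2).tsum_sub (summable_resTerm hs' hs1' hx.1 hx.2)

/-- Partial fractions: for `t = 1/b`, `t² logKer s t = 1/(b-s) + 1/(b+s) - 2/b`. -/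
theorem oddTerm_logKer {s x : ℝ} (hs : 0 ≤ s) (hs1 : s ≤ 1) (hx : -1 < x) (hx1 : x < 1) (j : ℕ) :
    oddTerm (logKer s) x j = poleKer (2 * j + 2 - s) x + poleKer (2 * j + 2 + s) x
      - 2 * poleKer (2 * j + 2) x := by
  have hj : (0 : ℝ) ≤ j := Nat.cast_nonneg j
  have key : ∀ b : ℝ, 1 < b → b⁻¹ ^ 2 * logKer s b⁻¹ = (b - s)⁻¹ + (b + s)⁻¹ - 2 * b⁻¹ := by
    intro b hb
    have h1 : b - s ≠ 0 := by linarith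
    have h2 : b + s ≠ 0 := by linarith
    have h3 : b ≠ 0 := by linarith
    have h4 : 1 - s ^ 2 * b⁻¹ ^ 2 ≠ 0 := by
      rw [inv_pow, ← div_eq_mul_inv, one_sub_div (by positivity),
        show b ^ 2 - s ^ 2 = (b - s) * (b + s) by ring]
      positivity
    have h5 : b ^ 2 - s ^ 2 ≠ 0 := by
      rw [show b ^ 2 - s ^ 2 = (b - s) * (b + s) by ring]
      positivity
    have e : 1 - s ^ 2 * b⁻¹ ^ 2 = (b ^ 2 - s ^ 2) / b ^ 2 := by field_simp
    rw [logKer, e]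
    field_simp
    ring
  simp only [oddTerm, smul_eq_mul]
  rw [key _ (by linarith), key _ (by linarith)]
  simp only [poleKer]
  rw [show 2 * (j : ℝ) + 2 - x - s = 2 * j + 2 - s - x by ring,
    show 2 * (j : ℝ) + 2 - x + s = 2 * j + 2 + s - x by ring,
    show 2 * (j : ℝ) + 2 + x - s = 2 * j + 2 - s + x by ring,
    show 2 * (j : ℝ) + 2 + x + s = 2 * j + 2 + s + x by ring]
  ring

/-- The poles `2j+2-s` and `2j+4-s` of successive terms telescope, leaving the pole `2 - s`, that
is, the kernel with parameter `1/(2-s)`. All other poles stay at distance at least `1` from `[0, 1[`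
and make up the Lipschitz remainder `resKer s`. -/
theorem oddTransfer_logKer {s x : ℝ} (hs : 0 ≤ s) (hs1 : s ≤ 1) (hx : 0 ≤ x) (hx1 : x < 1) :
    oddTransfer (logKer s) x = logKer (2 - s)⁻¹ x - resKer s x := by
  have hsum : HasSum (oddTerm (logKer s) x) (oddTransfer (logKer s) x) :=
    ((logKer_dom (by rwa [abs_of_nonneg hs])).summable hx hx1).hasSum
  have hres := (summable_resTerm hs hs1 hx hx1).hasSum
  have hpart : ∀ n : ℕ, ∑ j ∈ Finset.range n, oddTerm (logKer s) x j =
      poleKer (2 - s) x - poleKer (2 * n + 2 - s) x - ∑ j ∈ Finset.range n, resTerm s j x := by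
    intro n
    induction n with
    | zero => simp
    | succ n ih =>
      rw [Finset.sum_range_succ, ih, Finset.sum_range_succ, oddTerm_logKer hs hs1 (by linarith) hx1,
        resTerm]
      push_cast
      rw [show 2 * ((n : ℝ) + 1) + 2 - s = 2 * n + 4 - s by ring]
      ring
  have h0 : Tendsto (fun n : ℕ => poleKer (2 * n + 2 - s) x) atTop (𝓝 0) := by
    have aux : ∀ c : ℝ, Tendsto (fun n : ℕ => (2 * (n : ℝ) + c)⁻¹) atTop (𝓝 0) := fun c =>
      tendsto_inv_atTop_zero.comp (tendsto_atTop_add_const_right _ _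
        (tendsto_natCast_atTop_atTop.const_mul_atTop two_pos))
    have := (aux (2 - s - x)).sub (aux (2 - s + x))
    rw [sub_zero] at this
    refine this.congr fun n => ?_
    rw [poleKer]
    congr 2 <;> ring
  have h1 := ((tendsto_const_nhds (x := poleKer (2 - s) x)).sub h0).sub hres.tendsto_sum_nat
  rw [sub_zero] at h1
  have h2 := hsum.tendsto_sum_nat
  rw [funext hpart] at h2
  rw [tendsto_nhds_unique h2 h1, logKer_eq_poleKer (inv_ne_zero (by linarith)) ?_ ?_, inv_inv]
  · rfl
  · rw [abs_of_nonneg (by rw [inv_nonneg]; linarith)]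
    exact inv_le_one_of_one_le₀ (by linarith)
  · rwa [abs_of_nonneg hx]

theorem Dom.congr_right {u : ℝ → ℝ} {D D' : ℝ → ℝ} (h : Dom u D) (hD : EqOn D D' (Ico 0 1)) :
    Dom u D' := by
  refine ⟨h.1, by rw [← hD ⟨le_rfl, one_pos⟩, h.2.1], fun x y hx hxy hy => ?_⟩
  rw [← hD ⟨hx, hxy.trans_lt hy⟩, ← hD ⟨hx.trans hxy, hy⟩]
  exact h.2.2 x y hx hxy hy

theorem logKer_one_dom : Dom (logKer 1) (logKer 1) := logKer_dom (by simp)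

/-- The difference between `logKer 1` and its subtransfer. -/
noncomputable def gapKer (x : ℝ) : ℝ := logKer 1 x - oddTransfer (logKer 1) x

/-- The parameter `1` is the fixed point of `s ↦ 1/(2-s)`, so only the remainder survives. -/
theorem gapKer_eq : EqOn gapKer (resKer 1) (Ico 0 1) := by
  intro x hx
  rw [gapKer, oddTransfer_logKer zero_le_one le_rfl hx.1 hx.2]
  norm_num

/-- All terms are nondecreasing, so the one with `j = 0` suffices. Its slope is at least twice `5 ·
(1/9) · (1/16) ≥ 1/30`, using only the poles on the negative side. -/
theorem le_resKer_one_sub {x y : ℝ} (hx : 0 ≤ x) (hxy : x ≤ y) (hy : y < 1) :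
    y - x ≤ 15 * (resKer 1 y - resKer 1 x) := by
  have hs : ∀ x, 0 ≤ x → x < 1 → Summable fun j => resTerm 1 j x := fun x hx hx1 =>
    summable_resTerm zero_le_one le_rfl hx hx1
  have hterm : ∀ j : ℕ, resTerm 1 j y - resTerm 1 j x = 2 * (y - x) *
      (((2 * j + 2 - y : ℝ)⁻¹ * (2 * j + 2 - x : ℝ)⁻¹ - (2 * j + 3 - y : ℝ)⁻¹ * (2 * j + 3 - x : ℝ)⁻¹) +
       ((2 * j + 2 + y : ℝ)⁻¹ * (2 * j + 2 + x : ℝ)⁻¹ - (2 * j + 3 + y : ℝ)⁻¹ * (2 * j + 3 + x : ℝ)⁻¹)) := by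
    intro j
    have hj : (0 : ℝ) ≤ j := Nat.cast_nonneg j
    have e1 := poleKer_sub (a := 2 * j + 2) (x := x) (y := y)
      (by rw [abs_of_nonneg hx]; linarith) (by rw [abs_of_nonneg (hx.trans hxy)]; linarith)
    have e2 := poleKer_sub (a := 2 * j + 3) (x := x) (y := y)
      (by rw [abs_of_nonneg hx]; linarith) (by rw [abs_of_nonneg (hx.trans hxy)]; linarith)
    simp only [resTerm, show (2 * j + 2 + 1 : ℝ) = 2 * j + 3 by ring,
      show (2 * j + 4 - 1 : ℝ) = 2 * j + 3 by ring]
    linear_combination 2 * e1 - 2 * e2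
  have hmono : ∀ c j : ℝ, |c| ≤ 1 → 0 ≤ j → ∀ d : ℝ, |d| ≤ 1 →
      (2 * j + 3 + c)⁻¹ * (2 * j + 3 + d)⁻¹ ≤ (2 * j + 2 + c)⁻¹ * (2 * j + 2 + d)⁻¹ := by
    intro c j hc hj d hd
    rw [abs_le] at hc hd
    have : 0 < 2 * j + 2 + c := by linarith
    have : 0 < 2 * j + 2 + d := by linarith
    have : 0 ≤ (2 * j + 3 + d)⁻¹ := inv_nonneg.2 (by linarith)
    gcongr <;> linarith
  have hy1 : |y| ≤ 1 := by rw [abs_of_nonneg] <;> linarith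
  have hx1 : |x| ≤ 1 := by rw [abs_of_nonneg] <;> linarith
  have hnn : ∀ j : ℕ, 0 ≤ resTerm 1 j y - resTerm 1 j x := by
    intro j
    rw [hterm]
    have h1 := hmono (-y) j (by rwa [abs_neg]) (Nat.cast_nonneg j) (-x) (by rwa [abs_neg])
    have h2 := hmono y j hy1 (Nat.cast_nonneg j) x hx1
    simp only [← sub_eq_add_neg] at h1
    exact mul_nonneg (by linarith) (by linarith)
  have h0 : (y - x) / 15 ≤ resTerm 1 0 y - resTerm 1 0 x := by
    rw [hterm]
    have h1 := hmono (-y) 0 (by rwa [abs_neg]) le_rfl (-x) (by rwa [abs_neg])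
    simp only [← sub_eq_add_neg, mul_zero, zero_add] at h1
    have hp2 : 0 < 2 + y := by linarith
    have hp3 : 0 < 2 + x := by linarith
    have h2 : 1 / 30 ≤ (2 + y)⁻¹ * (2 + x)⁻¹ - (3 + y)⁻¹ * (3 + x)⁻¹ := by
      have e : (2 + y)⁻¹ * (2 + x)⁻¹ - (3 + y)⁻¹ * (3 + x)⁻¹ =
          (5 + x + y) * ((2 + y)⁻¹ * (2 + x)⁻¹) * ((3 + y)⁻¹ * (3 + x)⁻¹) := by
        have : 3 + y ≠ 0 := by linarith
        have : 3 + x ≠ 0 := by linarith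
        field_simp
        ring
      rw [e]
      have : 0 < 3 + y := by linarith
      have : 0 < 3 + x := by linarith
      have : 0 < 5 + x + y := by linarith
      calc (1 / 30 : ℝ) ≤ 5 * (3⁻¹ * 3⁻¹) * (4⁻¹ * 4⁻¹) := by norm_num
        _ ≤ _ := by
          gcongr <;> linarith
    simp only [CharP.cast_eq_zero, mul_zero, zero_add]
    have : 0 ≤ y - x := by linarith
    nlinarith
  have hsum := ((hs y (hx.trans hxy) hy).sub (hs x hx (hxy.trans_lt hy)))
  have := hsum.le_tsum 0 fun j _ => hnn j
  rw [(hs y (hx.trans hxy) hy).tsum_sub (hs x hx (hxy.trans_lt hy))] at this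
  simp only [resKer]
  linarith

theorem gapKer_dom : Dom gapKer gapKer := by
  refine Dom.self (u := gapKer) ⟨?_, ?_, fun x y hx hxy hy => ?_⟩
  · simp [gapKer, logKer_zero, oddTransfer_zero]
  · simp [gapKer, logKer_zero, oddTransfer_zero]
  · have := le_resKer_one_sub hx hxy hy
    rw [gapKer_eq ⟨hx.trans hxy, hy⟩, gapKer_eq ⟨hx, hxy.trans_lt hy⟩, Real.norm_of_nonneg]
    linarith

/-- Together with the telescoping of the iterates of `gapKer`, this makes the iterates of every
Lipschitz function vanishing at `0` summable. -/
theorem Dom.of_lipschitz {u : ℝ → ℝ} {c : ℝ} (hc : 0 ≤ c) (h : Dom u (fun x => c * x)) :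
    Dom u (fun x => (15 * c) * gapKer x) := by
  refine ⟨h.1, by simp [gapKer_dom.1], fun x y hx hxy hy => (h.2.2 x y hx hxy hy).trans ?_⟩
  simp only
  rw [gapKer_eq ⟨hx.trans hxy, hy⟩, gapKer_eq ⟨hx, hxy.trans_lt hy⟩, ← mul_sub, ← mul_sub]
  have := mul_le_mul_of_nonneg_left (le_resKer_one_sub hx hxy hy) hc
  linarith

theorem iterate_gapKer (m : ℕ) : EqOn (oddTransfer^[m] gapKer)
    (fun x => oddTransfer^[m] (logKer 1) x - oddTransfer^[m + 1] (logKer 1) x) (Ico 0 1) := by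
  intro x hx
  exact logKer_one_dom.iterate_sub logKer_one_dom.oddTransfer m hx

/-- The sum telescopes to `L - T^M L` with `L` the function `logKer 1`, and `T^M L ≥ 0`. -/
theorem sum_iterate_gapKer_le (M : ℕ) {x : ℝ} (hx : 0 ≤ x) (hx1 : x < 1) :
    ∑ m ∈ Finset.range M, oddTransfer^[m] gapKer x ≤ logKer 1 x := by
  rw [Finset.sum_congr rfl fun m _ => iterate_gapKer m ⟨hx, hx1⟩, Finset.sum_range_sub']
  have := (logKer_one_dom.iterate M).nonneg hx hx1
  simp only [Function.iterate_zero, id]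
  linarith

/-! ### Iteration of the kernels and a summable majorant -/

/-- The iterates of `s ↦ 1 / (2 - s)`. -/
noncomputable def sIter (s : ℝ) (m : ℕ) : ℝ := (fun s : ℝ => (2 - s)⁻¹)^[m] s

theorem sIter_succ (s : ℝ) (m : ℕ) : sIter s (m + 1) = (2 - sIter s m)⁻¹ :=
  Function.iterate_succ_apply' _ _ _

/-- For `s < 1` the map `s ↦ 1/(2-s)` increases `1/(1-s)` by exactly `1`. -/
theorem sIter_mem {s : ℝ} (hs : 0 ≤ s) (hs1 : s ≤ 1) (m : ℕ) :
    0 ≤ sIter s m ∧ sIter s m ≤ 1 ∧ 1 - sIter s m ≤ (m + 1 : ℝ)⁻¹ := by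
  induction m with
  | zero => exact ⟨hs, hs1, by simpa [sIter] using hs⟩
  | succ m ih =>
    obtain ⟨h0, h1, h2⟩ := ih
    rw [sIter_succ]
    have hpos : 0 < 2 - sIter s m := by linarith
    have hm : (0 : ℝ) ≤ m := Nat.cast_nonneg m
    refine ⟨inv_nonneg.2 hpos.le, inv_le_one_of_one_le₀ (by linarith), ?_⟩
    have hm1 : (0 : ℝ) < m + 1 := by linarith
    rw [show 1 - (2 - sIter s m)⁻¹ = (1 - sIter s m) / (2 - sIter s m) by field_simp; ring,
      div_le_iff₀ hpos]
    push_cast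
    have h3 : (1 - sIter s m) * (m + 1) ≤ 1 := by
      calc (1 - sIter s m) * (m + 1) ≤ (m + 1 : ℝ)⁻¹ * (m + 1) := by gcongr
        _ = 1 := inv_mul_cancel₀ hm1.ne'
    rw [inv_mul_eq_div, le_div_iff₀ (by linarith)]
    nlinarith

/-- The fixed point `1` is parabolic: the displacement is `(1-s)²/(2-s)`, quadratic in the distance
to it, hence summable along the orbit. -/
theorem abs_sIter_sub_le {s : ℝ} (hs : 0 ≤ s) (hs1 : s ≤ 1) (m : ℕ) :
    |sIter s (m + 1) - sIter s m| ≤ ((m + 1 : ℝ) ^ 2)⁻¹ := by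
  obtain ⟨h0, h1, h2⟩ := sIter_mem hs hs1 m
  have hpos : 0 < 2 - sIter s m := by linarith
  have e : sIter s (m + 1) - sIter s m = (1 - sIter s m) ^ 2 / (2 - sIter s m) := by
    rw [sIter_succ]
    field_simp
    ring
  rw [e, abs_of_nonneg (by positivity), ← inv_pow]
  refine (div_le_self (sq_nonneg _) (by linarith)).trans ?_
  gcongr

/-- The coefficients of `accKer`. -/
noncomputable def accCoef (m : ℕ) : ℝ := 15 * (resConst * ((m + 1 : ℝ) ^ 2)⁻¹)

theorem accCoef_nonneg (m : ℕ) : 0 ≤ accCoef m := by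
  have := resConst_nonneg
  unfold accCoef
  positivity

/-- An accumulated majorant, `accKer (m + 1) = oddTransfer (accKer m) + accCoef m * logKer 1`. -/
noncomputable def accKer : ℕ → ℝ → ℝ
  | 0 => fun x => 0 * logKer 1 x
  | m + 1 => fun x => oddTransfer (accKer m) x + accCoef m * logKer 1 x

theorem accKer_dom (m : ℕ) : Dom (accKer m) (accKer m) := by
  induction m with
  | zero => simpa [accKer] using logKer_one_dom.const_smul 0
  | succ m ih =>
    have := ih.oddTransfer.add (logKer_one_dom.const_smul (accCoef m))
    rw [abs_of_nonneg (accCoef_nonneg m)] at this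
    exact this

/-- The defects of `accKer` obey the same recursion as the error in `iterate_stepKer_dom`, and being
defects they have telescoping sums. -/
theorem accKer_succ_sub (m : ℕ) : EqOn
    (fun x => accKer (m + 1) x - oddTransfer (accKer (m + 1)) x)
    (fun x => oddTransfer (fun x => accKer m x - oddTransfer (accKer m) x) x
      + accCoef m * gapKer x) (Ico 0 1) := by
  intro x hx
  have hx' : |x| < 1 := by rw [abs_of_nonneg hx.1]; exact hx.2
  have e : oddTransfer (accKer (m + 1)) x = oddTransfer (oddTransfer (accKer m)) x
      + accCoef m * oddTransfer (logKer 1) x := by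
    have := (accKer_dom m).oddTransfer.oddTransfer_add (logKer_one_dom.const_smul (accCoef m)) hx'
    rw [oddTransfer_const_smul] at this
    exact this
  simp only
  rw [e, (accKer_dom m).oddTransfer_sub (accKer_dom m).oddTransfer hx', gapKer]
  simp only [accKer]
  ring

/-- Telescoping gives `(∑ accCoef m) L - accKer M`, where `L` is `logKer 1` and `accKer M` is
nonnegative. -/
theorem sum_accKer_le (M : ℕ) {x : ℝ} (hx : 0 ≤ x) (hx1 : x < 1) :
    ∑ m ∈ Finset.range M, (accKer m x - oddTransfer (accKer m) x) ≤
      (∑ m ∈ Finset.range M, accCoef m) * logKer 1 x := by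
  have e : ∑ m ∈ Finset.range M, (accKer m x - oddTransfer (accKer m) x) =
      (∑ m ∈ Finset.range M, accCoef m) * logKer 1 x - accKer M x := by
    induction M with
    | zero => simp [accKer]
    | succ M ih =>
      rw [Finset.sum_range_succ, ih, Finset.sum_range_succ]
      simp only [accKer]
      ring
  rw [e]
  have := (accKer_dom M).nonneg hx hx1
  linarith

/-- The increments of the kernels along the iterates of `s ↦ 1 / (2 - s)`. -/
noncomputable def stepKer (s : ℝ) (m : ℕ) (x : ℝ) : ℝ :=
  logKer (sIter s (m + 1)) x - logKer (sIter s m) x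

theorem logKer_sIter_dom {s : ℝ} (hs : 0 ≤ s) (hs1 : s ≤ 1) (m : ℕ) :
    Dom (logKer (sIter s m)) (logKer 1) := by
  obtain ⟨h0, h1, -⟩ := sIter_mem hs hs1 m
  exact logKer_dom (by rwa [abs_of_nonneg h0])

theorem oddTransfer_stepKer {s : ℝ} (hs : 0 ≤ s) (hs1 : s ≤ 1) (m : ℕ) :
    EqOn (oddTransfer (stepKer s m)) (fun x => stepKer s (m + 1) x +
      (resKer (sIter s m) x - resKer (sIter s (m + 1)) x)) (Ico 0 1) := by
  intro x hx
  have hx' : |x| < 1 := by rw [abs_of_nonneg hx.1]; exact hx.2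
  have h := (logKer_sIter_dom hs hs1 (m + 1)).oddTransfer_sub (logKer_sIter_dom hs hs1 m) hx'
  obtain ⟨h0, h1, -⟩ := sIter_mem hs hs1 m
  obtain ⟨h0', h1', -⟩ := sIter_mem hs hs1 (m + 1)
  rw [oddTransfer_logKer h0 h1 hx.1 hx.2, oddTransfer_logKer h0' h1' hx.1 hx.2, ← sIter_succ,
    ← sIter_succ] at h
  rw [show oddTransfer (stepKer s m) x = _ from h]
  simp only [stepKer]
  ring

/-- At each stage the operator turns `stepKer s m` into `stepKer s (m + 1)` up to a function with
Lipschitz constant `resConst · |s_{m+1} - s_m|`. This new error is dominated by a multiple of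
`gapKer`, and the older errors are carried along by the operator. -/
theorem iterate_stepKer_dom {s : ℝ} (hs : 0 ≤ s) (hs1 : s ≤ 1) (m : ℕ) :
    Dom (fun x => oddTransfer^[m] (stepKer s 0) x - stepKer s m x)
      (fun x => accKer m x - oddTransfer (accKer m) x) := by
  have hstep : ∀ m, Dom (stepKer s m) _ := fun m =>
    (logKer_sIter_dom hs hs1 (m + 1)).sub (logKer_sIter_dom hs hs1 m)
  induction m with
  | zero =>
    have e : (fun x => accKer 0 x - oddTransfer (accKer 0) x) = fun x => |0| * logKer 1 x := by
      funext x
      simp [accKer, oddTransfer, oddTerm]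
    rw [e]
    exact ((logKer_one_dom).const_smul 0).congr fun x _ => by simp
  | succ m ih =>
    obtain ⟨h0, h1, -⟩ := sIter_mem hs hs1 m
    obtain ⟨h0', h1', -⟩ := sIter_mem hs hs1 (m + 1)
    have hr : Dom (fun x => resKer (sIter s m) x - resKer (sIter s (m + 1)) x)
        (fun x => accCoef m * gapKer x) := by
      refine Dom.of_lipschitz (by have := resConst_nonneg; positivity) ?_
      have h := resKer_sub_dom h0 h1 h0' h1'
      refine ⟨h.1, by simp, fun x y hx hxy hy => (h.2.2 x y hx hxy hy).trans ?_⟩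
      rw [← mul_sub, ← mul_sub, abs_sub_comm]
      have := abs_sIter_sub_le hs hs1 m
      have := resConst_nonneg
      have : 0 ≤ y - x := by linarith
      gcongr
    refine ((ih.oddTransfer.add hr).congr ?_).congr_right (accKer_succ_sub m).symm
    intro x hx
    have hx' : |x| < 1 := by rw [abs_of_nonneg hx.1]; exact hx.2
    have h := ((hstep 0).iterate m).oddTransfer_sub (hstep m) hx'
    simp only
    rw [h, oddTransfer_stepKer hs hs1 m hx, Function.iterate_succ_apply']
    ring

theorem logKer_one_le {x : ℝ} (hx : 0 ≤ x) (hx1 : x < 1) :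
    logKer 1 x ≤ 2 * ((1 - x ^ 2) ^ 2)⁻¹ := by
  have h : 0 < 1 - x ^ 2 := by nlinarith
  have h' : 1 - x ^ 2 ≤ 1 := by nlinarith
  rw [logKer, one_pow, mul_one, one_mul, div_eq_mul_inv]
  have : (1 - x ^ 2) ^ 2 ≤ 1 - x ^ 2 := by nlinarith
  gcongr
  linarith

/-- The iterates of `logKer s - oddTransfer (logKer s)` have a summable majorant, which does not
depend on `s`. -/
theorem exists_majorant : ∃ (C : ℝ) (b : ℕ → ℝ → ℝ), 0 ≤ C ∧
    (∀ m s x, 0 ≤ s → s ≤ 1 → 0 ≤ x → x < 1 →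
      |oddTransfer^[m] (fun x => logKer s x - oddTransfer (logKer s) x) x| ≤ b m x) ∧
    ∀ M x, 0 ≤ x → x < 1 → ∑ m ∈ Finset.range M, b m x ≤ C * ((1 - x ^ 2) ^ 2)⁻¹ := by
  have hR := resConst_nonneg
  have hsq : Summable fun m : ℕ => ((m + 1 : ℝ) ^ 2)⁻¹ := by
    have h := (summable_nat_add_iff 1).2 (Real.summable_nat_pow_inv.2 (show 1 < 2 by norm_num))
    simpa using h
  set Z := ∑' m : ℕ, ((m + 1 : ℝ) ^ 2)⁻¹ with hZ
  have hZ0 : 0 ≤ Z := tsum_nonneg fun m => by positivity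
  have hZle : ∀ M, ∑ m ∈ Finset.range M, ((m + 1 : ℝ) ^ 2)⁻¹ ≤ Z := fun M =>
    hsq.sum_le_tsum _ fun m _ => by positivity
  -- The function to be iterated is `resKer s - stepKer s 0`. The three terms bound, in this order,
  -- `stepKer s m`, the accumulated error between it and the iterate of `stepKer s 0`, and the
  -- iterate of the Lipschitz function `resKer s`.
  refine ⟨4 * Z + 2 * (15 * (resConst * Z)) + 2 * (15 * resConst), fun m x =>
    4 * ((m + 1 : ℝ) ^ 2)⁻¹ * ((1 - x ^ 2) ^ 2)⁻¹ + (accKer m x - oddTransfer (accKer m) x) +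
      15 * resConst * oddTransfer^[m] gapKer x, by positivity, ?_, ?_⟩
  · intro m s x hs hs1 hx hx1
    have hstep : Dom (stepKer s 0) _ :=
      (logKer_sIter_dom hs hs1 1).sub (logKer_sIter_dom hs hs1 0)
    have hres := resKer_dom hs hs1
    have hres' := Dom.of_lipschitz hR hres
    have e : EqOn (fun x => logKer s x - oddTransfer (logKer s) x)
        (fun x => resKer s x - stepKer s 0 x) (Ico 0 1) := by
      intro x hx
      simp only
      rw [oddTransfer_logKer hs hs1 hx.1 hx.2, stepKer, sIter_succ]
      simp only [sIter, Function.iterate_zero, id]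
      ring
    rw [oddTransfer_iterate_congr e m ⟨hx, hx1⟩, hres.iterate_sub hstep m ⟨hx, hx1⟩]
    have h1 := (hres'.iterate m).norm_le hx hx1
    have h2 := (iterate_stepKer_dom hs hs1 m).norm_le hx hx1
    have e3 := congrFun (iterate_const_smul (15 * resConst) gapKer m) x
    simp only [smul_eq_mul] at e3
    rw [e3] at h1
    obtain ⟨p0, p1, -⟩ := sIter_mem hs hs1 m
    obtain ⟨q0, q1, -⟩ := sIter_mem hs hs1 (m + 1)
    have h3 : |stepKer s m x| ≤ 4 * ((m + 1 : ℝ) ^ 2)⁻¹ * ((1 - x ^ 2) ^ 2)⁻¹ := by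
      refine (abs_logKer_sub_le (by rwa [abs_of_nonneg q0]) (by rwa [abs_of_nonneg p0])
        (by rwa [abs_of_nonneg hx])).trans ?_
      gcongr
      exact abs_sIter_sub_le hs hs1 m
    rw [Real.norm_eq_abs] at h1 h2
    have := abs_le.1 h1
    have := abs_le.1 h2
    have := abs_le.1 h3
    refine abs_le.2 ⟨?_, ?_⟩ <;> linarith
  · intro M x hx hx1
    rw [Finset.sum_add_distrib, Finset.sum_add_distrib, ← Finset.sum_mul, ← Finset.mul_sum,
      ← Finset.mul_sum]
    have h1 := sum_accKer_le M hx hx1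
    have h2 := sum_iterate_gapKer_le M hx hx1
    have h3 := logKer_one_le hx hx1
    have h0 := logKer_one_dom.nonneg hx hx1
    have h4 : ∑ m ∈ Finset.range M, accCoef m ≤ 15 * (resConst * Z) := by
      simp only [accCoef, ← Finset.mul_sum]
      have := hZle M
      gcongr
    have hp : 0 ≤ ((1 - x ^ 2) ^ 2)⁻¹ := by positivity
    have h5 : (∑ m ∈ Finset.range M, accCoef m) * logKer 1 x ≤
        15 * (resConst * Z) * (2 * ((1 - x ^ 2) ^ 2)⁻¹) := by
      gcongr
    have h6 : 15 * resConst * ∑ m ∈ Finset.range M, oddTransfer^[m] gapKer x ≤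
        15 * resConst * (2 * ((1 - x ^ 2) ^ 2)⁻¹) := by
      have := h2.trans h3
      gcongr
    have h7 : 4 * (∑ m ∈ Finset.range M, ((m + 1 : ℝ) ^ 2)⁻¹) * ((1 - x ^ 2) ^ 2)⁻¹ ≤
        4 * Z * ((1 - x ^ 2) ^ 2)⁻¹ := by
      have := hZle M
      gcongr
    linarith

/-- The iterates of odd Lipschitz functions are dominated by `logKer 1` and tend to zero. -/
theorem Dom.tendsto_iterate {E : Type*} [NormedAddCommGroup E] [NormedSpace ℝ E] [CompleteSpace E]
    {u : ℝ → E} {c : ℝ} (hc : 0 ≤ c) (h : Dom u (fun x => c * x)) {x : ℝ} (hx : 0 ≤ x)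
    (hx1 : x < 1) : (∀ m, ‖GaussHilbert.oddTransfer^[m] u x‖ ≤ 15 * c * logKer 1 x) ∧
      Tendsto (fun m => GaussHilbert.oddTransfer^[m] u x) atTop (𝓝 0) := by
  have hid : Dom (fun x => c * x) (fun x => (15 * c) * gapKer x) := by
    refine Dom.of_lipschitz hc ⟨by simp, by simp, fun x y hx hxy hy => ?_⟩
    rw [← mul_sub, Real.norm_of_nonneg (mul_nonneg hc (by linarith))]
  have hb : ∀ m, ‖GaussHilbert.oddTransfer^[m] u x‖ ≤
      15 * c * GaussHilbert.oddTransfer^[m] gapKer x := by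
    intro m
    have h1 := (h.iterate m).norm_le hx hx1
    have h2 := (hid.iterate m).norm_le hx hx1
    have e3 := congrFun (iterate_const_smul (15 * c) gapKer m) x
    simp only [smul_eq_mul] at e3
    rw [e3] at h2
    exact h1.trans ((le_abs_self _).trans h2)
  have hnn : ∀ m, 0 ≤ GaussHilbert.oddTransfer^[m] gapKer x := fun m =>
    (gapKer_dom.iterate m).nonneg hx hx1
  have hsum : Summable fun m => GaussHilbert.oddTransfer^[m] gapKer x :=
    summable_of_sum_range_le hnn fun M => sum_iterate_gapKer_le M hx hx1
  refine ⟨fun m => (hb m).trans ?_, ?_⟩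
  · have h1 := Finset.single_le_sum (f := fun m => GaussHilbert.oddTransfer^[m] gapKer x)
      (fun i _ => hnn i) (Finset.self_mem_range_succ m)
    have h2 := sum_iterate_gapKer_le (m + 1) hx hx1
    have := h1.trans h2
    gcongr
  · refine squeeze_zero_norm hb ?_
    simpa using hsum.tendsto_atTop_zero.const_mul (15 * c)

/-! ### Superpositions of kernels and odd potentials -/

section
variable {μ : Measure ℝ} {w : ℝ → ℝ → ℝ} {D : ℝ → ℝ} {g : ℝ → ℂ}

theorem integrable_dom_mul (hD : ∀ᵐ t ∂μ, Dom (w t) D)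
    (hm : ∀ x ∈ Ico (0 : ℝ) 1, AEStronglyMeasurable (fun t => w t x) μ) (hg : Integrable g μ)
    {x : ℝ} (hx : x ∈ Ico (0 : ℝ) 1) : Integrable (fun t => (w t x : ℂ) * g t) μ := by
  refine hg.bdd_mul (c := D x) (Complex.continuous_ofReal.comp_aestronglyMeasurable (hm x hx)) ?_
  filter_upwards [hD] with t ht
  rw [Complex.norm_real]
  exact ht.norm_le hx.1 hx.2

theorem dom_integral (h0 : D 0 = 0) (hD : ∀ᵐ t ∂μ, Dom (w t) D)
    (hm : ∀ x ∈ Ico (0 : ℝ) 1, AEStronglyMeasurable (fun t => w t x) μ) (hg : Integrable g μ) :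
    Dom (fun x => ∫ t, (w t x : ℂ) * g t ∂μ) (fun x => (∫ t, ‖g t‖ ∂μ) * D x) := by
  refine ⟨?_, by simp [h0], fun x y hx hxy hy => ?_⟩
  · refine integral_eq_zero_of_ae ?_
    filter_upwards [hD] with t ht
    simp [ht.1]
  · rw [← integral_sub (integrable_dom_mul hD hm hg ⟨hx.trans hxy, hy⟩)
      (integrable_dom_mul hD hm hg ⟨hx, hxy.trans_lt hy⟩), ← mul_sub, ← integral_mul_const]
    refine norm_integral_le_of_norm_le (hg.norm.mul_const _) ?_
    filter_upwards [hD] with t ht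
    rw [← sub_mul, norm_mul, mul_comm, ← Complex.ofReal_sub, Complex.norm_real]
    exact mul_le_mul_of_nonneg_left (ht.2.2 x y hx hxy hy) (norm_nonneg _)

theorem aestronglyMeasurable_oddTransfer (hD : ∀ᵐ t ∂μ, Dom (w t) D)
    (hm : ∀ x ∈ Ico (0 : ℝ) 1, AEStronglyMeasurable (fun t => w t x) μ) {x : ℝ}
    (hx : x ∈ Ico (0 : ℝ) 1) : AEStronglyMeasurable (fun t => oddTransfer (w t) x) μ := by
  refine aestronglyMeasurable_of_tendsto_ae atTop
    (f := fun n t => ∑ j ∈ Finset.range n, oddTerm (w t) x j) (fun n => ?_) ?_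
  · refine Finset.aestronglyMeasurable_fun_sum _ fun j _ => ?_
    obtain ⟨p1, p2, p3, p4⟩ := inv_mem_unit (by linarith [hx.1]) hx.2 j
    exact ((hm _ ⟨p1.le, p2⟩).const_mul _).sub ((hm _ ⟨p3.le, p4⟩).const_mul _)
  · filter_upwards [hD] with t ht
    exact (ht.summable hx.1 hx.2).hasSum.tendsto_sum_nat

/-- The bound on the `j`-th term is summable uniformly in the parameter `t`, which justifies
exchanging sum and integral. -/
theorem oddTransfer_integral (hD : ∀ᵐ t ∂μ, Dom (w t) D)
    (hm : ∀ x ∈ Ico (0 : ℝ) 1, AEStronglyMeasurable (fun t => w t x) μ) (hg : Integrable g μ) :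
    EqOn (oddTransfer fun x => ∫ t, (w t x : ℂ) * g t ∂μ)
      (fun x => ∫ t, ((oddTransfer (w t) x : ℝ) : ℂ) * g t ∂μ) (Ico 0 1) := by
  intro x hx
  have hterm : ∀ j t, ((oddTerm (w t) x j : ℝ) : ℂ) * g t =
      (((2 * j + 2 - x : ℝ)⁻¹ ^ 2 : ℝ)) • ((w t (2 * j + 2 - x)⁻¹ : ℂ) * g t) -
        (((2 * j + 2 + x : ℝ)⁻¹ ^ 2 : ℝ)) • ((w t (2 * j + 2 + x)⁻¹ : ℂ) * g t) := by
    intro j t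
    simp only [oddTerm, smul_eq_mul, Complex.real_smul, Complex.ofReal_sub, Complex.ofReal_mul]
    ring
  have hI : ∀ (c : ℝ) (y : ℝ), y ∈ Ico (0 : ℝ) 1 →
      Integrable (fun t => c • ((w t y : ℂ) * g t)) μ := fun c y hy =>
    (integrable_dom_mul hD hm hg hy).smul c
  have hint : ∀ j : ℕ, Integrable (fun t => ((oddTerm (w t) x j : ℝ) : ℂ) * g t) μ := by
    intro j
    simp only [hterm]
    obtain ⟨p1, p2, p3, p4⟩ := inv_mem_unit (by linarith [hx.1]) hx.2 j
    exact (hI _ _ ⟨p1.le, p2⟩).sub (hI _ _ ⟨p3.le, p4⟩)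
  have hle : ∀ j : ℕ, ∀ᵐ t ∂μ, ‖((oddTerm (w t) x j : ℝ) : ℂ) * g t‖ ≤
      (D (2 - x)⁻¹ * ((2 * j + 1 : ℝ) ^ 2)⁻¹) * ‖g t‖ := by
    intro j
    filter_upwards [hD] with t ht
    rw [norm_mul, Complex.norm_real]
    have := ht.norm_oddTerm_le hx.1 hx.2 j
    exact mul_le_mul_of_nonneg_right (this.1.trans this.2) (norm_nonneg _)
  have hsum : Summable fun j : ℕ => ∫ t, ‖((oddTerm (w t) x j : ℝ) : ℂ) * g t‖ ∂μ := by
    refine Summable.of_nonneg_of_le (fun j => integral_nonneg fun t => norm_nonneg _) (fun j => ?_)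
      ((summable_inv_odd_sq.mul_left (D (2 - x)⁻¹)).mul_right (∫ t, ‖g t‖ ∂μ))
    rw [← integral_const_mul]
    exact integral_mono_ae (hint j).norm (hg.norm.const_mul _) (hle j)
  have key := (hasSum_integral_of_summable_integral_norm hint hsum).tsum_eq
  have e1 : ∀ j : ℕ, ∫ t, ((oddTerm (w t) x j : ℝ) : ℂ) * g t ∂μ =
      oddTerm (fun x => ∫ t, (w t x : ℂ) * g t ∂μ) x j := by
    intro j
    simp only [hterm]
    obtain ⟨p1, p2, p3, p4⟩ := inv_mem_unit (by linarith [hx.1]) hx.2 j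
    rw [integral_sub (hI _ _ ⟨p1.le, p2⟩) (hI _ _ ⟨p3.le, p4⟩), integral_smul, integral_smul]
    rfl
  simp only [e1] at key
  rw [oddTransfer, key]
  refine integral_congr_ae ?_
  filter_upwards [hD] with t ht
  rw [tsum_mul_right, ← Complex.ofReal_tsum]
  rfl

theorem iterate_oddTransfer_integral (hD : ∀ᵐ t ∂μ, Dom (w t) D)
    (hm : ∀ x ∈ Ico (0 : ℝ) 1, AEStronglyMeasurable (fun t => w t x) μ) (hg : Integrable g μ)
    (n : ℕ) : (∀ x ∈ Ico (0 : ℝ) 1, AEStronglyMeasurable (fun t => oddTransfer^[n] (w t) x) μ) ∧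
    EqOn (oddTransfer^[n] fun x => ∫ t, (w t x : ℂ) * g t ∂μ)
      (fun x => ∫ t, ((oddTransfer^[n] (w t) x : ℝ) : ℂ) * g t ∂μ) (Ico 0 1) := by
  induction n with
  | zero => exact ⟨hm, fun x _ => rfl⟩
  | succ n ih =>
    have hD' : ∀ᵐ t ∂μ, Dom (oddTransfer^[n] (w t)) (oddTransfer^[n] D) :=
      hD.mono fun t ht => ht.iterate n
    simp only [Function.iterate_succ_apply']
    refine ⟨fun x hx => aestronglyMeasurable_oddTransfer hD' ih.1 hx, fun x hx => ?_⟩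
    rw [oddTransfer_congr (ih.2.mono Ioo_subset_Ico_self) (by linarith [hx.1]) hx.2]
    exact oddTransfer_integral hD' ih.1 hg hx

end

/-- The functions whose increments are controlled by those of `logKer 1` are stable under the
subtransfer. -/
theorem oddTransfer_logKer_one_dom : Dom (oddTransfer (logKer 1)) (logKer 1) := by
  have h := logKer_one_dom.oddTransfer
  refine ⟨h.1, logKer_zero 1, fun x y hx hxy hy => (h.2.2 x y hx hxy hy).trans ?_⟩
  -- The image of `logKer 1` is `logKer 1 - gapKer`, and `gapKer` is nondecreasing.
  have := gapKer_dom.mono_on hx hxy hy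
  simp only [gapKer] at this
  linarith

theorem oddTransfer_const_mul (c : ℝ) (u : ℝ → ℝ) (x : ℝ) :
    oddTransfer (fun x => c * u x) x = c * oddTransfer u x :=
  oddTransfer_const_smul c u x

section
variable {E : Type*} [NormedAddCommGroup E] [NormedSpace ℝ E]

omit [NormedSpace ℝ E] in
theorem Dom.mono_right {u : ℝ → E} {c c' : ℝ} {D : ℝ → ℝ} (h : Dom u (fun x => c * D x))
    (hD : Dom D D) (hc : c ≤ c') : Dom u (fun x => c' * D x) := by
  refine ⟨h.1, by simp [hD.1], fun x y hx hxy hy => (h.2.2 x y hx hxy hy).trans ?_⟩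
  simp only
  rw [← mul_sub, ← mul_sub]
  exact mul_le_mul_of_nonneg_right hc (sub_nonneg.2 (hD.mono_on hx hxy hy))

omit [NormedSpace ℝ E] in
theorem Dom.congr_right' {u : ℝ → E} {D D' : ℝ → ℝ} (h : Dom u D) (hD : ∀ x, D x = D' x) : Dom u D' :=
  funext hD ▸ h

theorem Dom.oddTransfer_of_logKer [CompleteSpace E] {u : ℝ → E} {c : ℝ} (hc : 0 ≤ c)
    (h : Dom u (fun x => c * logKer 1 x)) :
    Dom (GaussHilbert.oddTransfer u) (fun x => c * logKer 1 x) := by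
  have h' := h.oddTransfer
  refine ⟨h'.1, by simp [logKer_zero], fun x y hx hxy hy => (h'.2.2 x y hx hxy hy).trans ?_⟩
  simp only [oddTransfer_const_mul]
  rw [← mul_sub, ← mul_sub]
  exact mul_le_mul_of_nonneg_left
    ((le_abs_self _).trans (oddTransfer_logKer_one_dom.2.2 x y hx hxy hy)) hc

theorem Dom.iterate_of_logKer [CompleteSpace E] {u : ℝ → E} {c : ℝ} (hc : 0 ≤ c)
    (h : Dom u (fun x => c * logKer 1 x)) (n : ℕ) :
    Dom (GaussHilbert.oddTransfer^[n] u) (fun x => c * logKer 1 x) := by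
  induction n with
  | zero => exact h
  | succ n ih =>
    rw [Function.iterate_succ_apply']
    exact ih.oddTransfer_of_logKer hc

omit [NormedSpace ℝ E] in
/-- A function dominated by `logKer 1` is continuous. -/
theorem Dom.continuousOn {u : ℝ → E} {c : ℝ} (h : Dom u (fun x => c * logKer 1 x)) :
    ContinuousOn u (Ico 0 1) := by
  intro x hx
  have hL : ContinuousOn (fun x => c * logKer 1 x) (Ico 0 1) := by
    intro y hy
    have : 1 - 1 ^ 2 * y ^ 2 ≠ 0 :=
      (one_sub_sq_mul_sq_pos (s := 1) (by simp) (by rw [abs_of_nonneg hy.1]; exact hy.2)).ne'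
    unfold logKer
    refine ContinuousAt.continuousWithinAt ?_
    fun_prop (disch := assumption)
  have hLx := hL x hx
  rw [ContinuousWithinAt, tendsto_iff_norm_sub_tendsto_zero] at hLx ⊢
  refine squeeze_zero' (Eventually.of_forall fun y => norm_nonneg _) ?_ hLx
  filter_upwards [self_mem_nhdsWithin] with y hy
  rcases le_total x y with hxy | hxy
  · exact (h.2.2 x y hx.1 hxy hy.2).trans (le_abs_self _)
  · rw [norm_sub_rev]
    exact (h.2.2 y x hy.1 hxy hx.2).trans (by rw [norm_sub_rev]; exact le_abs_self _)

end

theorem measurable_logKer (x : ℝ) : Measurable fun t => logKer t x := by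
  unfold logKer
  fun_prop

/-- The odd logarithmic potential of a function on `]-1, 1[`. -/
noncomputable def oddPot (g : ℝ → ℂ) (x : ℝ) : ℂ := ∫ t in Ioo (-1 : ℝ) 1, (logKer t x : ℂ) * g t

theorem ae_logKer_dom : ∀ᵐ t ∂(volume.restrict (Ioo (-1 : ℝ) 1)), Dom (logKer t) (logKer 1) := by
  filter_upwards [ae_restrict_mem measurableSet_Ioo] with t ht
  exact logKer_dom (abs_le.2 ⟨ht.1.le, ht.2.le⟩)

theorem oddPot_neg (g : ℝ → ℂ) (x : ℝ) : oddPot g (-x) = - oddPot g x := by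
  simp only [oddPot, logKer_neg, Complex.ofReal_neg, neg_mul, integral_neg]

theorem oddPot_dom {g : ℝ → ℂ} (hg : IntegrableOn g (Ioo (-1) 1)) :
    Dom (oddPot g) (fun x => (∫ t in Ioo (-1 : ℝ) 1, ‖g t‖) * logKer 1 x) :=
  dom_integral (logKer_zero 1) ae_logKer_dom
    (fun x _ => (measurable_logKer x).aestronglyMeasurable) hg

/-- The majorant of `exists_majorant` does not depend on the parameter, so it survives integration
against `g`. Negative parameters are covered because `logKer` is even in its first argument. -/
theorem exists_oddPot_majorant : ∃ (C : ℝ) (b : ℕ → ℝ → ℝ), 0 ≤ C ∧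
    (∀ m x (g : ℝ → ℂ), IntegrableOn g (Ioo (-1) 1) → 0 ≤ x → x < 1 →
      ‖oddTransfer^[m] (fun x => oddPot g x - oddTransfer (oddPot g) x) x‖ ≤
        (∫ t in Ioo (-1 : ℝ) 1, ‖g t‖) * b m x) ∧
    (∀ m x, 0 ≤ x → x < 1 → 0 ≤ b m x) ∧
    ∀ M x, 0 ≤ x → x < 1 → ∑ m ∈ Finset.range M, b m x ≤ C * ((1 - x ^ 2) ^ 2)⁻¹ := by
  obtain ⟨C, b, hC, hb, hs⟩ := exists_majorant
  refine ⟨C, b, hC, fun m x g hg hx hx1 => ?_, fun m x hx hx1 =>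
    (abs_nonneg _).trans (hb m 0 x le_rfl zero_le_one hx hx1), hs⟩
  have hm : ∀ x ∈ Ico (0 : ℝ) 1, AEStronglyMeasurable (fun t => logKer t x)
      (volume.restrict (Ioo (-1 : ℝ) 1)) := fun x _ => (measurable_logKer x).aestronglyMeasurable
  have hm' : ∀ x ∈ Ico (0 : ℝ) 1, AEStronglyMeasurable
      (fun t => logKer t x - oddTransfer (logKer t) x) (volume.restrict (Ioo (-1 : ℝ) 1)) :=
    fun x hx => (hm x hx).sub (aestronglyMeasurable_oddTransfer ae_logKer_dom hm hx)
  have hD' : ∀ᵐ t ∂(volume.restrict (Ioo (-1 : ℝ) 1)),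
      Dom (fun x => logKer t x - oddTransfer (logKer t) x)
        (fun x => logKer 1 x + oddTransfer (logKer 1) x) :=
    ae_logKer_dom.mono fun t ht => ht.sub ht.oddTransfer
  have e : EqOn (fun x => oddPot g x - oddTransfer (oddPot g) x)
      (fun x => ∫ t in Ioo (-1 : ℝ) 1, ((logKer t x - oddTransfer (logKer t) x : ℝ) : ℂ) * g t)
      (Ico 0 1) := by
    intro x hx
    simp only [Complex.ofReal_sub, sub_mul]
    rw [integral_sub (integrable_dom_mul ae_logKer_dom hm hg hx)
      (integrable_dom_mul (ae_logKer_dom.mono fun t ht => ht.oddTransfer)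
        (fun x hx => aestronglyMeasurable_oddTransfer ae_logKer_dom hm hx) hg hx)]
    exact congrArg (oddPot g x - ·) (oddTransfer_integral ae_logKer_dom hm hg hx)
  rw [oddTransfer_iterate_congr e m ⟨hx, hx1⟩,
    (iterate_oddTransfer_integral hD' hm' hg m).2 ⟨hx, hx1⟩]
  simp only
  rw [← integral_mul_const]
  refine norm_integral_le_of_norm_le (hg.norm.mul_const _) ?_
  filter_upwards [ae_restrict_mem measurableSet_Ioo] with t ht
  rw [norm_mul, mul_comm, Complex.norm_real]
  refine mul_le_mul_of_nonneg_left ?_ (norm_nonneg _)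
  have h := hb m |t| x (abs_nonneg t) (abs_le.2 ⟨ht.1.le, ht.2.le⟩) hx hx1
  have e : logKer |t| = logKer t := by
    rcases abs_choice t with h | h
    · rw [h]
    · rw [h]; funext x; exact logKer_neg_left t x
  rwa [e] at h

/-- Sequences of the kind that occurs in the iteration of the subtransfer operator remain bounded
locally on `]-1, 1[`. -/
theorem exists_iteration_bound : ∃ C : ℝ, 0 ≤ C ∧ ∀ (κ : ℝ) (k O : ℕ → ℝ → ℂ),
    (∀ j, IntegrableOn (k j) (Ioo (-1) 1)) → (∀ j, ∫ t in Ioo (-1 : ℝ) 1, ‖k j t‖ ≤ κ) →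
    Dom (O 0) (fun x => κ * logKer 1 x) →
    (∀ N, EqOn (O (N + 1)) (fun x => oddTransfer (O N) x + (2 * Real.pi)⁻¹ •
      (oddPot (k N) x - oddTransfer (oddPot (k (N + 1))) x)) (Ico 0 1)) →
    (∀ N, ∃ c, 0 ≤ c ∧ Dom (O N) (fun x => c * logKer 1 x)) ∧
      ∀ N, ∀ x ∈ Ico (0 : ℝ) 1, ‖O N x‖ ≤ C * κ * ((1 - x ^ 2) ^ 2)⁻¹ := by
  obtain ⟨C, b, hC, hb, hb0, hs⟩ := exists_oddPot_majorant
  refine ⟨2 * C + 6, by positivity, fun κ k O hk hκ hO hstep => ?_⟩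
  have hκ0 : 0 ≤ κ := (integral_nonneg fun t => norm_nonneg _).trans (hκ 0)
  have hpi : (2 * Real.pi)⁻¹ ≤ 1 := inv_le_one_of_one_le₀ (by linarith [Real.two_le_pi])
  have hpi0 : 0 ≤ (2 * Real.pi)⁻¹ := by positivity
  have hpot : ∀ j, Dom (oddPot (k j)) (fun x => κ * logKer 1 x) := fun j =>
    (oddPot_dom (hk j)).mono_right logKer_one_dom (hκ j)
  have hOD : ∀ N, ∃ c, 0 ≤ c ∧ Dom (O N) (fun x => c * logKer 1 x) := by
    intro N
    induction N with
    | zero => exact ⟨κ, hκ0, hO⟩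
    | succ N ih =>
      obtain ⟨c, hc, h⟩ := ih
      refine ⟨c + |(2 * Real.pi)⁻¹| * (κ + κ), by positivity, ?_⟩
      have h1 := (h.oddTransfer_of_logKer hc).add (((hpot N).sub
        ((hpot (N + 1)).oddTransfer_of_logKer hκ0)).const_smul (2 * Real.pi)⁻¹)
      exact (h1.congr (hstep N).symm).congr_right' fun x => by ring
  refine ⟨hOD, ?_⟩
  -- Adding this term absorbs the summand with `k (N + 1)`. The recursion becomes `R (N + 1) = T (R
  -- N) + w N`, where `w N` involves `k N` only, through `pot - T² pot`.
  set R : ℕ → ℝ → ℂ := fun N x => O N x + (2 * Real.pi)⁻¹ • oddTransfer (oddPot (k N)) x with hR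
  have hRD : ∀ N, ∃ c, 0 ≤ c ∧ Dom (R N) (fun x => c * logKer 1 x) := by
    intro N
    obtain ⟨c, hc, h⟩ := hOD N
    refine ⟨c + |(2 * Real.pi)⁻¹| * κ, by positivity, ?_⟩
    have := h.add (((hpot N).oddTransfer_of_logKer hκ0).const_smul (2 * Real.pi)⁻¹)
    exact this.congr_right' fun x => by ring
  set w : ℕ → ℝ → ℂ := fun N x => (2 * Real.pi)⁻¹ • (oddPot (k N) x -
    oddTransfer (oddTransfer (oddPot (k N))) x) with hw
  have hwD : ∀ N, Dom (w N) _ := fun N => ((hpot N).sub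
    (((hpot N).oddTransfer_of_logKer hκ0).oddTransfer_of_logKer hκ0)).const_smul (2 * Real.pi)⁻¹
  have hRstep : ∀ N, EqOn (R (N + 1)) (fun x => oddTransfer (R N) x + w N x) (Ico 0 1) := by
    intro N x hx
    have hx' : |x| < 1 := by rw [abs_of_nonneg hx.1]; exact hx.2
    obtain ⟨c, hc, h⟩ := hOD N
    have e := h.oddTransfer_add (((hpot N).oddTransfer_of_logKer hκ0).const_smul (2 * Real.pi)⁻¹) hx'
    rw [oddTransfer_const_smul] at e
    simp only [hR, hw] at e ⊢
    rw [e, hstep N hx]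
    simp only [smul_sub]
    ring
  -- Since `pot - T² pot = (pot - T pot) + T (pot - T pot)`, the majorants with indices `m` and `m +
  -- 1` suffice.
  have hwb : ∀ j m x, x ∈ Ico (0 : ℝ) 1 →
      ‖oddTransfer^[m] (w j) x‖ ≤ κ * (b m x + b (m + 1) x) := by
    intro j m x hx
    have e : EqOn (w j) (fun x => (2 * Real.pi)⁻¹ • ((oddPot (k j) x - oddTransfer (oddPot (k j)) x)
        + oddTransfer (fun x => oddPot (k j) x - oddTransfer (oddPot (k j)) x) x)) (Ico 0 1) := by
      intro x hx
      have hx' : |x| < 1 := by rw [abs_of_nonneg hx.1]; exact hx.2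
      simp only [hw]
      rw [(hpot j).oddTransfer_sub (hpot j).oddTransfer hx']
      congr 1
      ring
    have hd := (hpot j).sub (hpot j).oddTransfer
    rw [oddTransfer_iterate_congr e m hx, iterate_const_smul]
    simp only
    rw [hd.iterate_add hd.oddTransfer m hx, norm_smul, Real.norm_of_nonneg hpi0]
    have h1 := hb m x (k j) (hk j) hx.1 hx.2
    have h2 := hb (m + 1) x (k j) (hk j) hx.1 hx.2
    rw [Function.iterate_succ_apply] at h2
    have h3 := norm_add_le
      (oddTransfer^[m] (fun x => oddPot (k j) x - oddTransfer (oddPot (k j)) x) x)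
      (oddTransfer^[m] (oddTransfer fun x => oddPot (k j) x - oddTransfer (oddPot (k j)) x) x)
    have h4 := mul_le_mul_of_nonneg_right (hκ j) (hb0 m x hx.1 hx.2)
    have h5 := mul_le_mul_of_nonneg_right (hκ j) (hb0 (m + 1) x hx.1 hx.2)
    refine (mul_le_of_le_one_left (norm_nonneg _) hpi).trans ?_
    linarith
  have hR0 : Dom (R 0) (fun x => (2 * κ) * logKer 1 x) := by
    have := hO.add (((hpot 0).oddTransfer_of_logKer hκ0).const_smul (2 * Real.pi)⁻¹)
    refine (this.congr_right' (D' := fun x => (κ + |(2 * Real.pi)⁻¹| * κ) * logKer 1 x)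
      fun x => by ring).mono_right logKer_one_dom ?_
    rw [abs_of_nonneg hpi0]
    nlinarith
  -- Unrolling the recursion, the inhomogeneities are hit by pairwise different numbers of iterates,
  -- so their contributions are summed by the majorant. The extra exponent `m` makes the induction
  -- possible.
  have main : ∀ N m x, x ∈ Ico (0 : ℝ) 1 → ‖oddTransfer^[m] (R N) x‖ ≤ 2 * κ * logKer 1 x +
      ∑ i ∈ Finset.range N, κ * (b (m + i) x + b (m + i + 1) x) := by
    intro N
    induction N with
    | zero =>
      intro m x hx
      simpa using (hR0.iterate_of_logKer (by positivity) m).norm_le hx.1 hx.2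
    | succ N ih =>
      intro m x hx
      obtain ⟨c, hc, h⟩ := hRD N
      rw [oddTransfer_iterate_congr (hRstep N) m hx, h.oddTransfer.iterate_add (hwD N) m hx,
        Finset.sum_range_succ']
      have h1 := ih (m + 1) x hx
      have h2 := hwb N m x hx
      rw [Function.iterate_succ_apply] at h1
      refine (norm_add_le _ _).trans ((add_le_add h1 h2).trans (le_of_eq ?_))
      rw [add_assoc]
      congr 2
      refine Finset.sum_congr rfl fun i _ => ?_
      rw [show m + 1 + i = m + (i + 1) by ring]
  intro N x hx
  have h1 := main N 0 x hx
  simp only [Function.iterate_zero, id, zero_add] at h1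
  have h2 : ∑ i ∈ Finset.range N, κ * (b i x + b (i + 1) x) ≤
      κ * (2 * C * ((1 - x ^ 2) ^ 2)⁻¹) := by
    rw [← Finset.mul_sum, Finset.sum_add_distrib]
    refine mul_le_mul_of_nonneg_left ?_ hκ0
    have h3 := hs N x hx.1 hx.2
    have h4 := hs (N + 1) x hx.1 hx.2
    rw [Finset.sum_range_succ'] at h4
    have := hb0 0 x hx.1 hx.2
    linarith
  have h3 : ‖oddTransfer (oddPot (k N)) x‖ ≤ κ * logKer 1 x :=
    ((hpot N).oddTransfer_of_logKer hκ0).norm_le hx.1 hx.2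
  have h4 := logKer_one_le hx.1 hx.2
  have h5 : ‖O N x‖ ≤ ‖R N x‖ + ‖oddTransfer (oddPot (k N)) x‖ := by
    have e : O N x = R N x - (2 * Real.pi)⁻¹ • oddTransfer (oddPot (k N)) x := by simp [hR]
    rw [e]
    refine (norm_sub_le _ _).trans ?_
    rw [norm_smul, Real.norm_of_nonneg hpi0]
    have := mul_le_of_le_one_left (norm_nonneg (oddTransfer (oddPot (k N)) x)) hpi
    linarith
  have h6 := mul_le_mul_of_nonneg_left h4 hκ0
  calc ‖O N x‖ ≤ 3 * (κ * logKer 1 x) + κ * (2 * C * ((1 - x ^ 2) ^ 2)⁻¹) := by linarith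
    _ ≤ 3 * (κ * (2 * ((1 - x ^ 2) ^ 2)⁻¹)) + κ * (2 * C * ((1 - x ^ 2) ^ 2)⁻¹) := by linarith
    _ = _ := by ring

/-! ### The modified Hilbert transform of periodized test functions -/

/-- This identity reduces the modified transform of a bounded function to the ordinary transform of
its damped version, divided by `1 + t²`, which is integrable. -/
theorem modHilbert_kernel {z t : ℝ} (h : z - t ≠ 0) : 1 / (z - t) + t / (1 + t ^ 2) =
    (1 + z ^ 2) * ((1 + t ^ 2)⁻¹ * (1 / (z - t))) - z * (1 + t ^ 2)⁻¹ := by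
  have : 1 + t ^ 2 ≠ 0 := by positivity
  field_simp
  ring

theorem tendsto_setIntegral_trunc {ψ : ℝ → ℝ} (hi : Integrable ψ) (z : ℝ) :
    Tendsto (fun ε => ∫ t in {t : ℝ | ε < |z - t|}, ψ t) (𝓝[>] 0) (𝓝 (∫ t, ψ t)) := by
  have e : ∀ ε, ∫ t in {t : ℝ | ε < |z - t|}, ψ t = ∫ t, {t : ℝ | ε < |z - t|}.indicator ψ t :=
    fun ε => (integral_indicator (measurableSet_lt_abs_sub ε z)).symm
  simp only [e]
  refine tendsto_integral_filter_of_dominated_convergence (fun t => |ψ t|) ?_ ?_ hi.abs ?_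
  · exact Eventually.of_forall fun ε => (hi.1.indicator (measurableSet_lt_abs_sub ε z))
  · refine Eventually.of_forall fun ε => Eventually.of_forall fun t => ?_
    rw [← Real.norm_eq_abs]
    exact norm_indicator_le_norm_self _ _
  · have : ∀ᵐ t : ℝ, t ≠ z := by simp [ae_iff]
    filter_upwards [this] with t ht
    refine tendsto_const_nhds.congr' ?_
    filter_upwards [Ioo_mem_nhdsGT (abs_pos.2 (sub_ne_zero.2 ht.symm))] with ε hε
    rw [indicator_of_mem]
    exact hε.2

theorem modHilbert_eq {ψ : ℝ → ℝ} {K : ℝ≥0} (hi : Integrable fun t => ψ t * (1 + t ^ 2)⁻¹)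
    (hL : LipschitzWith K fun t => ψ t * (1 + t ^ 2)⁻¹) (z : ℝ) :
    modHilbert ψ z = (1 + z ^ 2) * hilbert (fun t => ψ t * (1 + t ^ 2)⁻¹) z
      - z * (Real.pi⁻¹ * ∫ t, ψ t * (1 + t ^ 2)⁻¹) := by
  refine Tendsto.limUnder_eq ((((tendsto_hilbertTrunc_hilbert hi hL z).const_mul (1 + z ^ 2)).sub
    (((tendsto_setIntegral_trunc hi z).const_mul Real.pi⁻¹).const_mul z)).congr' ?_)
  filter_upwards [self_mem_nhdsWithin] with ε hε
  have hε' : 0 < ε := hε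
  have e : ∫ t in {t : ℝ | ε < |z - t|}, ψ t * (1 / (z - t) + t / (1 + t ^ 2)) =
      ∫ t in {t : ℝ | ε < |z - t|}, ((1 + z ^ 2) * (ψ t * (1 + t ^ 2)⁻¹ * (1 / (z - t)))
        - z * (ψ t * (1 + t ^ 2)⁻¹)) := by
    refine setIntegral_congr_fun (measurableSet_lt_abs_sub ε z) fun t ht => ?_
    have ht' : z - t ≠ 0 := abs_pos.1 (hε'.trans ht)
    rw [modHilbert_kernel ht']
    ring
  rw [e, integral_sub ((integrable_trunc_kernel hi hε' z).const_mul _)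
    (hi.integrableOn.const_mul _), integral_const_mul, integral_const_mul, hilbertTrunc]
  ring

/-- On integrable functions the two transforms differ by a constant, which functions of mean zero do
not see. -/
theorem modHilbert_of_integrable {φ : ℝ → ℝ} {K : ℝ≥0} (hi : Integrable φ) (hL : LipschitzWith K φ)
    (z : ℝ) : modHilbert φ z = hilbert φ z + Real.pi⁻¹ * ∫ t, φ t * (t / (1 + t ^ 2)) := by
  have hi' : Integrable fun t => φ t * (t / (1 + t ^ 2)) := by
    refine hi.mul_bdd (c := 1) (Measurable.aestronglyMeasurable (by fun_prop)) (Eventually.of_forall fun t => ?_)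
    rw [Real.norm_eq_abs, abs_div, abs_of_nonneg (by positivity : 0 ≤ 1 + t ^ 2),
      div_le_one (by positivity)]
    nlinarith [sq_nonneg (|t| - 1), sq_abs t, abs_nonneg t]
  refine Tendsto.limUnder_eq (((tendsto_hilbertTrunc_hilbert hi hL z).add
    ((tendsto_setIntegral_trunc hi' z).const_mul Real.pi⁻¹)).congr' ?_)
  filter_upwards [self_mem_nhdsWithin] with ε hε
  have hε' : 0 < ε := hε
  have e : ∀ t, φ t * (1 / (z - t) + t / (1 + t ^ 2)) = φ t * (1 / (z - t)) +
    φ t * (t / (1 + t ^ 2)) := fun t => mul_add _ _ _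
  simp only [e]
  rw [integral_add (integrable_trunc_kernel hi hε' z) hi'.integrableOn, hilbertTrunc]
  ring

theorem integrable_of_hasSum {ι : Type*} [Countable ι] {α : Type*} [MeasurableSpace α]
    {μ : Measure α} {E : Type*} [NormedAddCommGroup E] {F : ι → α → E} {f : α → E}
    (hF : ∀ i, Integrable (F i) μ) (hs : Summable fun i => ∫ a, ‖F i a‖ ∂μ)
    (hf : AEStronglyMeasurable f μ) (h : ∀ᵐ a ∂μ, HasSum (fun i => F i a) (f a)) :
    Integrable f μ := by
  refine ⟨hf, ?_⟩
  have h1 : ∫⁻ a, ‖f a‖ₑ ∂μ ≤ ∑' i, ∫⁻ a, ‖F i a‖ₑ ∂μ := by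
    rw [← lintegral_tsum fun i => (hF i).1.enorm]
    refine lintegral_mono_ae ?_
    filter_upwards [h] with a ha
    rw [← ha.tsum_eq]
    exact enorm_tsum_le_tsum_enorm
  refine h1.trans_lt ?_
  have h2 : ∀ i, ∫⁻ a, ‖F i a‖ₑ ∂μ = ENNReal.ofReal (∫ a, ‖F i a‖ ∂μ) := fun i =>
    (ofReal_integral_norm_eq_lintegral_enorm (hF i)).symm
  simp only [h2]
  rw [← ENNReal.ofReal_tsum_of_nonneg (fun i => integral_nonneg fun a => norm_nonneg _) hs]
  exact ENNReal.ofReal_lt_top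

section
variable {ι : Type*} [Countable ι] {χ : ι → ℝ → ℝ} {χ' : ℝ → ℝ} {K : ι → ℝ≥0}

omit [Countable ι] in
theorem lipschitzWith_of_hasSum (hL : ∀ i, LipschitzWith (K i) (χ i)) (hK : Summable K)
    (h : ∀ t, HasSum (fun i => χ i t) (χ' t)) : LipschitzWith (∑' i, K i) χ' := by
  refine LipschitzWith.of_dist_le_mul fun x y => ?_
  rw [dist_eq_norm, NNReal.coe_tsum, ← tsum_mul_right, ← ((h x).sub (h y)).tsum_eq]
  refine tsum_of_norm_bounded ((NNReal.summable_coe.2 hK).mul_right _).hasSum fun i => ?_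
  rw [← dist_eq_norm]
  exact (hL i).dist_le_mul x y

/-- Summability of the `L¹` norms and of the Lipschitz constants is exactly what the bound of
`integrableOn_symmQuot` needs for termwise integration. -/
theorem hasSum_hilbert (hi : ∀ i, Integrable (χ i)) (hL : ∀ i, LipschitzWith (K i) (χ i))
    (hK : Summable K) (hs : Summable fun i => ∫ t, |χ i t|)
    (h : ∀ t, HasSum (fun i => χ i t) (χ' t)) (z : ℝ) :
    HasSum (fun i => hilbert (χ i) z) (hilbert χ' z) := by
  have hL' := lipschitzWith_of_hasSum hL hK h
  have hi' : Integrable χ' :=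
    integrable_of_hasSum hi hs hL'.continuous.aestronglyMeasurable (Eventually.of_forall h)
  rw [hilbert_eq hi' hL']
  simp only [hilbert_eq (hi _) (hL _)]
  refine HasSum.mul_left _ ?_
  have hs' : Summable fun i => ∫ y in Ioi 0, ‖symmQuot (χ i) z y‖ := by
    refine Summable.of_nonneg_of_le (fun i => integral_nonneg fun y => norm_nonneg _)
      (fun i => (integrableOn_symmQuot (hi i) (hL i) z).2) ?_
    exact ((NNReal.summable_coe.2 hK).mul_left 2).add (hs.mul_left 2)
  have key := hasSum_integral_of_summable_integral_norm
    (fun i => (integrableOn_symmQuot (hi i) (hL i) z).1) hs'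
  have e : ∀ y, ∑' i, symmQuot (χ i) z y = symmQuot χ' z y := fun y =>
    (((h (z - y)).sub (h (z + y))).div_const y).tsum_eq
  simpa only [e] using key

end

theorem summable_inv_one_add_int_sq : Summable fun j : ℤ => (1 + (j : ℝ) ^ 2)⁻¹ := by
  refine Summable.of_norm_bounded_eventually (Real.summable_one_div_int_pow.2 one_lt_two) ?_
  filter_upwards [(finite_singleton (0 : ℤ)).compl_mem_cofinite] with j hj
  have : (j : ℝ) ≠ 0 := by exact_mod_cast hj
  rw [Real.norm_of_nonneg (by positivity), one_div]
  gcongr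
  linarith

/-- Smooth functions supported in `[-a, a]`, where `0 < a < 1`. -/
structure UnitTest (φ : ℝ → ℝ) (a : ℝ) : Prop where
  contDiff : ContDiff ℝ ∞ φ
  pos : 0 < a
  lt_one : a < 1
  zero : ∀ t, a ≤ |t| → φ t = 0

section
variable {φ : ℝ → ℝ} {a : ℝ} (h : UnitTest φ a)
include h

theorem UnitTest.hasCompactSupport : HasCompactSupport φ := by
  refine HasCompactSupport.intro (isCompact_Icc (a := -a) (b := a)) fun t ht => h.zero t ?_
  by_contra! hlt
  exact ht ⟨(abs_lt.1 hlt).1.le, (abs_lt.1 hlt).2.le⟩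

theorem UnitTest.integrable : Integrable φ :=
  h.contDiff.continuous.integrable_of_hasCompactSupport h.hasCompactSupport

theorem UnitTest.exists_lipschitz : ∃ K : ℝ≥0, LipschitzWith K φ :=
  h.contDiff.lipschitzWith_of_hasCompactSupport h.hasCompactSupport (by simp)

theorem UnitTest.exists_bound : ∃ B : ℝ, 0 ≤ B ∧ ∀ t, |φ t| ≤ B := by
  obtain ⟨B, hB⟩ := h.hasCompactSupport.exists_bound_of_continuous h.contDiff.continuous
  exact ⟨B, (norm_nonneg _).trans (hB 0), hB⟩

theorem UnitTest.exists_hilbert_bound : ∃ B : ℝ, 0 ≤ B ∧ ∀ t, |hilbert φ t| ≤ B := by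
  obtain ⟨K, hK⟩ := h.exists_lipschitz
  exact ⟨_, (abs_nonneg _).trans (abs_hilbert_le h.integrable hK 0), abs_hilbert_le h.integrable hK⟩

theorem UnitTest.zero_of_one_le {t : ℝ} (ht : 1 ≤ |t|) : φ t = 0 := h.zero t (h.lt_one.le.trans ht)

theorem UnitTest.measurable_hilbert : Measurable (hilbert φ) := by
  obtain ⟨K, hK⟩ := h.exists_lipschitz
  exact GaussHilbert.measurable_hilbert h.integrable hK

theorem UnitTest.hilbert_eq {w : ℝ} (hw : a < |w|) :
    hilbert φ w = Real.pi⁻¹ * ∫ t, φ t / (w - t) := by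
  refine hilbert_eq_of_eventually_zero ?_
  filter_upwards [(isOpen_lt continuous_const continuous_abs).mem_nhds hw] with t ht
  exact h.zero t (le_of_lt ht)

/-- If `|x + 2j| < 1` with `j ≠ 0`, then `|x| > 2|j| - 1 ≥ |j|`. -/
theorem UnitTest.weight_le {x : ℝ} {j : ℤ} (hx : φ (x + 2 * j) ≠ 0) :
    (1 + x ^ 2)⁻¹ ≤ (1 + (j : ℝ) ^ 2)⁻¹ := by
  have hlt : |x + 2 * j| < 1 := by
    by_contra! hle
    exact hx (h.zero_of_one_le hle)
  have hsq : (j : ℝ) ^ 2 ≤ x ^ 2 := by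
    rcases eq_or_ne j 0 with rfl | hj
    · simpa using sq_nonneg x
    · have h1 : (1 : ℝ) ≤ |(j : ℝ)| := by exact_mod_cast Int.one_le_abs hj
      rw [sq_le_sq]
      have := abs_sub_abs_le_abs_sub (2 * j : ℝ) (-x)
      rw [abs_mul, abs_two, abs_neg, sub_neg_eq_add, add_comm (2 * (j : ℝ))] at this
      linarith
  gcongr

/-- A translate of the function by an even integer, damped. -/
theorem UnitTest.damped_lipschitz : ∃ C : ℝ≥0, ∀ j : ℤ,
    LipschitzWith (C * NNReal.mk (1 + (j : ℝ) ^ 2)⁻¹ (by positivity))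
      (fun t => φ (t + 2 * j) * (1 + t ^ 2)⁻¹) := by
  obtain ⟨K, hK⟩ := h.exists_lipschitz
  obtain ⟨B, hB0, hB⟩ := h.exists_bound
  refine ⟨K + NNReal.mk (2 * B) (by positivity), fun j => LipschitzWith.of_dist_le_mul fun x y => ?_⟩
  have hw := fun x => h.weight_le (x := x) (j := j)
  have hxw : ∀ x : ℝ, |x| * (1 + x ^ 2)⁻¹ ≤ 1 := by
    intro x
    rw [← div_eq_mul_inv, div_le_one (by positivity)]
    nlinarith [sq_nonneg (|x| - 1), sq_abs x, abs_nonneg x]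
  have hwd : ∀ x y : ℝ, |(1 + x ^ 2)⁻¹ - (1 + y ^ 2)⁻¹| ≤
      |x - y| * ((1 + x ^ 2)⁻¹ + (1 + y ^ 2)⁻¹) := by
    intro x y
    have e : (1 + x ^ 2)⁻¹ - (1 + y ^ 2)⁻¹ =
        -(x - y) * ((x * (1 + x ^ 2)⁻¹) * (1 + y ^ 2)⁻¹ + (y * (1 + y ^ 2)⁻¹) * (1 + x ^ 2)⁻¹) := by
      have : 1 + x ^ 2 ≠ 0 := by positivity
      have : 1 + y ^ 2 ≠ 0 := by positivity
      field_simp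
      ring
    rw [e, abs_mul, abs_neg]
    refine mul_le_mul_of_nonneg_left ((abs_add_le _ _).trans ?_) (abs_nonneg _)
    have p1 : 0 ≤ (1 + x ^ 2)⁻¹ := by positivity
    have p2 : 0 ≤ (1 + y ^ 2)⁻¹ := by positivity
    rw [abs_mul, abs_mul, abs_mul, abs_mul, abs_of_nonneg p1, abs_of_nonneg p2]
    have := mul_le_mul_of_nonneg_right (hxw x) p2
    have := mul_le_mul_of_nonneg_right (hxw y) p1
    linarith
  set c := (1 + (j : ℝ) ^ 2)⁻¹ with hc
  have hc0 : 0 ≤ c := by positivity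
  have hφ : ∀ x y : ℝ, |φ (x + 2 * j) - φ (y + 2 * j)| ≤ K * |x - y| := by
    intro x y
    have := hK.dist_le_mul (x + 2 * j) (y + 2 * j)
    rwa [Real.dist_eq, Real.dist_eq, add_sub_add_right_eq_sub] at this
  -- If one point lies where the translate vanishes, the weight need only be estimated at the other
  -- point, where it is at most `c`.
  have hone : ∀ x y : ℝ, φ (y + 2 * j) = 0 →
      |φ (x + 2 * j) * (1 + x ^ 2)⁻¹ - φ (y + 2 * j) * (1 + y ^ 2)⁻¹| ≤ K * c * |x - y| := by
    intro x y hy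
    rw [hy, zero_mul, sub_zero]
    rcases eq_or_ne (φ (x + 2 * j)) 0 with hx | hx
    · rw [hx, zero_mul, abs_zero]
      positivity
    · have h1 := hφ x y
      rw [hy, sub_zero] at h1
      rw [abs_mul, abs_of_nonneg (by positivity : 0 ≤ (1 + x ^ 2)⁻¹)]
      have := hw x hx
      calc |φ (x + 2 * j)| * (1 + x ^ 2)⁻¹ ≤ (K * |x - y|) * c := by gcongr
        _ = _ := by ring
  have hcoe : (((K + NNReal.mk (2 * B) (by positivity)) * NNReal.mk c hc0 : ℝ≥0) : ℝ) = (K + 2 * B) * c := rfl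
  rw [Real.dist_eq, Real.dist_eq, hcoe]
  have hle : K * c * |x - y| ≤ (K + 2 * B) * c * |x - y| := by
    gcongr
    linarith
  rcases eq_or_ne (φ (y + 2 * j)) 0 with hy | hy
  · exact (hone x y hy).trans hle
  rcases eq_or_ne (φ (x + 2 * j)) 0 with hx | hx
  · rw [abs_sub_comm, abs_sub_comm x]
    refine (hone y x hx).trans ?_
    rw [abs_sub_comm y]
    exact hle
  · have e : φ (x + 2 * j) * (1 + x ^ 2)⁻¹ - φ (y + 2 * j) * (1 + y ^ 2)⁻¹ =
        (φ (x + 2 * j) - φ (y + 2 * j)) * (1 + x ^ 2)⁻¹ +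
          φ (y + 2 * j) * ((1 + x ^ 2)⁻¹ - (1 + y ^ 2)⁻¹) := by ring
    rw [e]
    refine (abs_add_le _ _).trans ?_
    rw [abs_mul, abs_mul, abs_of_nonneg (by positivity : 0 ≤ (1 + x ^ 2)⁻¹)]
    calc |φ (x + 2 * j) - φ (y + 2 * j)| * (1 + x ^ 2)⁻¹ +
          |φ (y + 2 * j)| * |(1 + x ^ 2)⁻¹ - (1 + y ^ 2)⁻¹|
        ≤ K * |x - y| * c + B * (|x - y| * (c + c)) := by
          gcongr
          · exact hφ x y
          · exact hw x hx
          · exact hB _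
          · exact (hwd x y).trans (by gcongr; exacts [hw x hx, hw y hy])
      _ = _ := by ring

theorem UnitTest.summable_damped (t : ℝ) :
    Summable fun j : ℤ => φ (t + 2 * j) * (1 + t ^ 2)⁻¹ := by
  obtain ⟨B, hB0, hB⟩ := h.exists_bound
  refine Summable.of_norm_bounded (summable_inv_one_add_int_sq.mul_left B) fun j => ?_
  rcases eq_or_ne (φ (t + 2 * j)) 0 with h0 | h0
  · rw [h0, zero_mul, norm_zero]
    positivity
  · rw [norm_mul, Real.norm_of_nonneg (by positivity : 0 ≤ (1 + t ^ 2)⁻¹)]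
    exact mul_le_mul (hB _) (h.weight_le h0) (by positivity) hB0

theorem UnitTest.summable (t : ℝ) : Summable fun j : ℤ => φ (t + 2 * j) := by
  refine (summable_mul_right_iff (a := (1 + t ^ 2)⁻¹) (by positivity)).1 (h.summable_damped t)

/-- After division by `1 + t²` the translates have summable `L¹` norms and Lipschitz constants, so
the transform may be taken termwise. The constants in the sum come from `modHilbert_of_integrable`
and drop out on subtracting the value at `0`. -/
theorem UnitTest.hasSum_modHilbert (z : ℝ) :
    HasSum (fun j : ℤ => hilbert φ (z + 2 * j) +
      Real.pi⁻¹ * ∫ t, φ (t + 2 * j) * (t / (1 + t ^ 2))) (modHilbert (periodize φ) z) := by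
  obtain ⟨C, hC⟩ := h.damped_lipschitz
  obtain ⟨K, hK⟩ := h.exists_lipschitz
  have hi : ∀ j : ℤ, Integrable fun t => φ (t + 2 * j) := fun j => h.integrable.comp_add_right _
  have hχ : ∀ j : ℤ, Integrable fun t => φ (t + 2 * j) * (1 + t ^ 2)⁻¹ := by
    intro j
    refine (hi j).mul_bdd (c := 1) (Measurable.aestronglyMeasurable (by fun_prop))
      (Eventually.of_forall fun t => ?_)
    rw [Real.norm_of_nonneg (by positivity)]
    exact inv_le_one_of_one_le₀ (by nlinarith [sq_nonneg t])
  have hK' : Summable fun j : ℤ => C * NNReal.mk (1 + (j : ℝ) ^ 2)⁻¹ (by positivity) := by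
    refine Summable.mul_left C ?_
    rw [← NNReal.summable_coe]
    exact summable_inv_one_add_int_sq
  have hs : Summable fun j : ℤ => ∫ t, |φ (t + 2 * j) * (1 + t ^ 2)⁻¹| := by
    refine Summable.of_nonneg_of_le (fun j => integral_nonneg fun t => abs_nonneg _) (fun j => ?_)
      (summable_inv_one_add_int_sq.mul_right (∫ t, |φ t|))
    rw [← integral_add_right_eq_self (fun t => |φ t|) (2 * (j : ℝ)), ← integral_const_mul]
    refine integral_mono (hχ j).abs ((hi j).abs.const_mul _) fun t => ?_
    simp only
    rw [abs_mul, mul_comm, abs_of_nonneg (by positivity : 0 ≤ (1 + t ^ 2)⁻¹)]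
    rcases eq_or_ne (φ (t + 2 * j)) 0 with h0 | h0
    · rw [h0, abs_zero, mul_zero, mul_zero]
    · exact mul_le_mul_of_nonneg_right (h.weight_le h0) (abs_nonneg _)
  have hsum : ∀ t, HasSum (fun j : ℤ => φ (t + 2 * j) * (1 + t ^ 2)⁻¹)
      (periodize φ t * (1 + t ^ 2)⁻¹) := fun t => (h.summable t).hasSum.mul_right _
  have hL := lipschitzWith_of_hasSum hC hK' hsum
  have hI := integrable_of_hasSum hχ hs hL.continuous.aestronglyMeasurable
    (Eventually.of_forall hsum)
  have h1 := hasSum_hilbert hχ hC hK' hs hsum z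
  have h2 := hasSum_integral_of_summable_integral_norm hχ hs
  rw [show (fun t => ∑' j : ℤ, φ (t + 2 * j) * (1 + t ^ 2)⁻¹) =
    fun t => periodize φ t * (1 + t ^ 2)⁻¹ from funext fun t => (hsum t).tsum_eq] at h2
  rw [modHilbert_eq hI hL z]
  have e : (fun j : ℤ => hilbert φ (z + 2 * j) + Real.pi⁻¹ * ∫ t, φ (t + 2 * j) * (t / (1 + t ^ 2)))
      = fun j : ℤ => (1 + z ^ 2) * hilbert (fun t => φ (t + 2 * j) * (1 + t ^ 2)⁻¹) z
        - z * (Real.pi⁻¹ * ∫ t, φ (t + 2 * j) * (1 + t ^ 2)⁻¹) := by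
    funext j
    rw [← hilbert_comp_add, ← modHilbert_of_integrable (hi j)
      (hK.comp (isometry_add_right (2 * (j : ℝ))).lipschitz), modHilbert_eq (hχ j) (hC j)]
  rw [e]
  exact (h1.mul_left (1 + z ^ 2)).sub ((h2.mul_left Real.pi⁻¹).mul_left z)

/-- The periodization of the Hilbert transform, normalized at the origin. -/
theorem UnitTest.hasSum_hilbert_sub (z : ℝ) :
    HasSum (fun j : ℤ => hilbert φ (z + 2 * j) - hilbert φ (2 * j))
      (modHilbert (periodize φ) z - modHilbert (periodize φ) 0) := by
  have := (h.hasSum_modHilbert z).sub (h.hasSum_modHilbert 0)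
  simpa only [zero_add, add_sub_add_right_eq_sub] using this

end

/-! ### Fejér means of the translates of a Hilbert transform -/

/-- The Fejér weights. -/
noncomputable def tent (n : ℕ) (j : ℤ) : ℝ := max 0 (1 - |(j : ℝ)| / (n + 1))

theorem tent_nonneg (n : ℕ) (j : ℤ) : 0 ≤ tent n j := le_max_left _ _

theorem tent_le_one (n : ℕ) (j : ℤ) : tent n j ≤ 1 :=
  max_le zero_le_one (sub_le_self _ (by positivity))

theorem tent_eq_zero {n : ℕ} {j : ℤ} (hj : j ∉ Finset.Icc (-(n : ℤ)) n) : tent n j = 0 := by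
  rw [Finset.mem_Icc, ← abs_le, not_le] at hj
  refine max_eq_left (sub_nonpos.2 ?_)
  rw [le_div_iff₀ (by positivity), one_mul]
  exact_mod_cast hj

/-- The slope `1 / (n + 1)` is the reason for using tents. Sharp cut-offs of a series with terms of
size `1/i` can produce logarithmically growing sums when the centre is near the edge of the window.
-/
theorem abs_tent_sub_le (n : ℕ) (i j : ℤ) : |tent n i - tent n j| ≤ |(|(i : ℝ)| - |(j : ℝ)|)| / (n + 1) := by
  have h := abs_max_sub_max_le_abs (1 - |(i : ℝ)| / (n + 1)) (1 - |(j : ℝ)| / (n + 1)) 0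
  rw [max_comm _ 0, max_comm _ 0] at h
  refine h.trans (le_of_eq ?_)
  rw [sub_sub_sub_cancel_left, ← sub_div, abs_div, abs_sub_comm,
    abs_of_pos (by positivity : (0 : ℝ) < n + 1)]

theorem tendsto_tent (j : ℤ) : Tendsto (fun n => tent n j) atTop (𝓝 1) := by
  have h : Tendsto (fun n : ℕ => |(j : ℝ)| / (n + 1)) atTop (𝓝 0) :=
    tendsto_const_nhds.div_atTop (tendsto_atTop_add_const_right _ _ tendsto_natCast_atTop_atTop)
  have := (tendsto_const_nhds (x := (1 : ℝ))).sub h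
  rw [sub_zero] at this
  simpa [tent] using (tendsto_const_nhds (x := (0 : ℝ))).max this

theorem summable_tent_mul (n : ℕ) (v : ℤ → ℝ) : Summable fun j => tent n j * v j :=
  summable_of_ne_finset_zero (s := Finset.Icc (-(n : ℤ)) n) fun j hj => by
    rw [tent_eq_zero hj, zero_mul]

theorem tsum_tent_mul (n : ℕ) (v : ℤ → ℝ) :
    ∑' j, tent n j * v j = ∑ j ∈ Finset.Icc (-(n : ℤ)) n, tent n j * v j :=
  tsum_eq_sum fun j hj => by rw [tent_eq_zero hj, zero_mul]

theorem tendsto_tsum_tent {v : ℤ → ℝ} (hv : Summable v) :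
    Tendsto (fun n => ∑' j, tent n j * v j) atTop (𝓝 (∑' j, v j)) := by
  refine tendsto_tsum_of_dominated_convergence hv.norm (fun j => ?_) (Eventually.of_forall ?_)
  · simpa using (tendsto_tent j).mul_const (v j)
  · intro n j
    rw [norm_mul, Real.norm_of_nonneg (tent_nonneg n j)]
    exact mul_le_of_le_one_left (norm_nonneg _) (tent_le_one n j)

theorem exists_hasSum_indicator_Icc (n : ℕ) : ∃ A : ℤ → ℝ, (∀ j, 0 ≤ A j) ∧
    (∀ j ∈ Finset.Icc (-(n : ℤ)) n, A j = 1) ∧ HasSum A (2 * n + 1) := by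
  refine ⟨fun j => if j ∈ Finset.Icc (-(n : ℤ)) n then 1 else 0,
    fun j => by positivity, fun j hj => if_pos hj, ?_⟩
  have e : ∑ j ∈ Finset.Icc (-(n : ℤ)) n, (if j ∈ Finset.Icc (-(n : ℤ)) n then (1 : ℝ) else 0) =
      2 * n + 1 := by
    rw [Finset.sum_congr rfl fun j hj => if_pos hj, Finset.sum_const, Int.card_Icc]
    simp only [nsmul_eq_mul, mul_one]
    have : ((n : ℤ) + 1 - -(n : ℤ)).toNat = 2 * n + 1 := by omega
    rw [this]
    push_cast
    ring
  rw [← e]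
  exact hasSum_sum_of_ne_finset_zero fun j hj => if_neg hj

/-- Tent means of nearly odd sequences are bounded, uniformly in the centre. -/
theorem abs_tsum_tent_le {v : ℤ → ℝ} {C : ℝ} (hC : 0 ≤ C) (h1 : ∀ i : ℤ, |(i : ℝ)| * |v i| ≤ C)
    (h2 : ∀ i : ℤ, |v i + v (-i)| ≤ C * (1 + (i : ℝ) ^ 2)⁻¹) (n : ℕ) (m : ℤ) :
    |∑' j, tent n j * v (j + m)| ≤ C * (∑' i : ℤ, (1 + (i : ℝ) ^ 2)⁻¹) + 8 * C := by
  -- Recentring puts the near oddness of `v` at the origin, at the price of weights no longer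
  -- symmetric about it.
  set c : ℤ → ℝ := fun i => tent n (i - m) * v i with hc
  have e1 : ∑' j, tent n j * v (j + m) = ∑' i, c i := by
    rw [← (Equiv.addRight m).tsum_eq c]
    simp [hc]
  have hcs : Summable c := by
    rw [← (Equiv.addRight m).summable_iff]
    simpa [hc, Function.comp_def] using summable_tent_mul n fun j => v (j + m)
  have hcs' : Summable fun i => c (-i) := (Equiv.neg ℤ).summable_iff.2 hcs
  have e2 : 2 * ∑' i, c i = ∑' i, (c i + c (-i)) := by
    rw [hcs.tsum_add hcs', show ∑' i, c (-i) = ∑' i, c i from (Equiv.neg ℤ).tsum_eq c, two_mul]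
  obtain ⟨A, hA0, hA, hAs⟩ := exists_hasSum_indicator_Icc n
  have hA1 : HasSum (fun i => A (i + m)) (2 * n + 1) :=
    (Equiv.hasSum_iff (f := A) (Equiv.addRight m)).2 hAs
  have hA2 : HasSum (fun i => A (i - m)) (2 * n + 1) :=
    (Equiv.hasSum_iff (f := A) (Equiv.subRight m)).2 hAs
  have hn : (0 : ℝ) < n + 1 := by positivity
  have hterm : ∀ i, |c i + c (-i)| ≤ C * (1 + (i : ℝ) ^ 2)⁻¹ +
      2 * C / (n + 1) * (A (i + m) + A (i - m)) := by
    intro i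
    -- The first summand uses the near oddness of `v`. In the second, the weight difference is at
    -- most `2|i| / (n+1)` and `|v (-i)|` is of order `1/|i|`; it vanishes unless `i + m` or `i - m`
    -- lies in the window, which leaves at most `2(2n + 1)` indices.
    have e : c i + c (-i) = tent n (i - m) * (v i + v (-i)) +
        (tent n (-i - m) - tent n (i - m)) * v (-i) := by simp only [hc]; ring
    rw [e]
    refine (abs_add_le _ _).trans (add_le_add ?_ ?_)
    · rw [abs_mul, abs_of_nonneg (tent_nonneg _ _)]
      exact (mul_le_of_le_one_left (abs_nonneg _) (tent_le_one _ _)).trans (h2 i)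
    · by_cases hz : i + m ∈ Finset.Icc (-(n : ℤ)) n ∨ i - m ∈ Finset.Icc (-(n : ℤ)) n
      · have hone : 1 ≤ A (i + m) + A (i - m) := by
          rcases hz with hz | hz
          · rw [hA _ hz]
            linarith [hA0 (i - m)]
          · rw [hA _ hz]
            linarith [hA0 (i + m)]
        have h3 := abs_tent_sub_le n (-i - m) (i - m)
        have h4 : |(|((-i - m : ℤ) : ℝ)| - |((i - m : ℤ) : ℝ)|)| ≤ 2 * |(i : ℝ)| := by
          refine (abs_abs_sub_abs_le _ _).trans (le_of_eq ?_)
          push_cast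
          rw [show (-(i : ℝ) - m - (i - m)) = -(2 * i) by ring, abs_neg, abs_mul, abs_two]
        have h5 := h1 (-i)
        push_cast at h5
        rw [abs_neg] at h5
        calc |(tent n (-i - m) - tent n (i - m)) * v (-i)|
            ≤ (2 * |(i : ℝ)| / (n + 1)) * |v (-i)| := by
              rw [abs_mul]
              refine mul_le_mul_of_nonneg_right (h3.trans ?_) (abs_nonneg _)
              exact div_le_div_of_nonneg_right h4 hn.le
          _ = 2 / (n + 1) * (|(i : ℝ)| * |v (-i)|) := by ring
          _ ≤ 2 / (n + 1) * C := by gcongr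
          _ = 2 * C / (n + 1) * 1 := by ring
          _ ≤ _ := by gcongr
      · push Not at hz
        have h3 : tent n (-i - m) = 0 := by
          apply tent_eq_zero
          have := hz.1
          rw [Finset.mem_Icc] at this ⊢
          omega
        rw [h3, tent_eq_zero hz.2, sub_zero, zero_mul, abs_zero]
        have := hA0 (i + m)
        have := hA0 (i - m)
        positivity
  have hsum := (summable_inv_one_add_int_sq.hasSum.mul_left C).add
    ((hA1.add hA2).mul_left (2 * C / (n + 1)))
  have h3 := tsum_of_norm_bounded (f := fun i => c i + c (-i)) hsum hterm
  rw [← e2, Real.norm_eq_abs, abs_mul, abs_two] at h3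
  have h4 : 2 * C / (n + 1) * (2 * n + 1 + (2 * n + 1)) ≤ 8 * C := by
    rw [div_mul_eq_mul_div, div_le_iff₀ hn]
    nlinarith
  rw [e1]
  have := abs_nonneg (∑' i, c i)
  linarith

/-- The periodization of the Hilbert transform, normalized at the origin. -/
noncomputable def cotSum (φ : ℝ → ℝ) (z : ℝ) : ℝ :=
  modHilbert (periodize φ) z - modHilbert (periodize φ) 0

section
variable {φ : ℝ → ℝ} {a : ℝ} (h : UnitTest φ a)
include h

theorem UnitTest.abs_integral_mul_le {k : ℝ → ℝ} {c : ℝ} (hk : ∀ t, |t| < 1 → |k t| ≤ c) :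
    |∫ t, φ t * k t| ≤ c * ∫ t, |φ t| := by
  rw [← integral_const_mul, ← Real.norm_eq_abs]
  refine norm_integral_le_of_norm_le (h.integrable.abs.const_mul c) (Eventually.of_forall fun t => ?_)
  rw [Real.norm_eq_abs, abs_mul, mul_comm]
  by_cases ht : |t| < 1
  · exact mul_le_mul_of_nonneg_right (hk t ht) (abs_nonneg _)
  · rw [h.zero_of_one_le (not_lt.1 ht), abs_zero, mul_zero, mul_zero]

theorem UnitTest.integrable_mul {k : ℝ → ℝ} {c : ℝ} (hm : Measurable k)
    (hk : ∀ t, |t| < 1 → |k t| ≤ c) : Integrable fun t => φ t * k t := by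
  refine Integrable.mono' (h.integrable.abs.const_mul c)
    (h.integrable.1.mul hm.aestronglyMeasurable) (Eventually.of_forall fun t => ?_)
  rw [Real.norm_eq_abs, abs_mul, mul_comm]
  by_cases ht : |t| < 1
  · exact mul_le_mul_of_nonneg_right (hk t ht) (abs_nonneg _)
  · rw [h.zero_of_one_le (not_lt.1 ht), abs_zero, mul_zero, mul_zero]

/-- Off the support the transform is the ordinary integral of `φ t / (w - t)`, which decays like
`1/|w|`. The leading terms at `r + 2i` and `r - 2i` are opposite, so their sum decays like `i⁻²`. -/
theorem UnitTest.hilbert_decay : ∃ C : ℝ, 0 ≤ C ∧ ∀ r : ℝ, |r| ≤ 1 → ∀ i : ℤ,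
    |(i : ℝ)| * |hilbert φ (r + 2 * i)| ≤ C ∧
    |hilbert φ (r + 2 * i) + hilbert φ (r + 2 * (-i : ℤ))| ≤ C * (1 + (i : ℝ) ^ 2)⁻¹ := by
  obtain ⟨B, hB0, hB⟩ := h.exists_hilbert_bound
  have hI0 : 0 ≤ ∫ t, |φ t| := integral_nonneg fun t => abs_nonneg _
  refine ⟨4 * B + 2 * ∫ t, |φ t|, by positivity, fun r hr i => ?_⟩
  have hpi : Real.pi⁻¹ ≤ 1 := inv_le_one_of_one_le₀ (by linarith [Real.two_le_pi])
  have hpi0 : 0 ≤ Real.pi⁻¹ := by positivity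
  rcases le_or_gt |i| 1 with hi | hi
  · have hi1 : |(i : ℝ)| ≤ 1 := by exact_mod_cast hi
    have hsq : (i : ℝ) ^ 2 ≤ 1 := (sq_le_one_iff_abs_le_one _).2 hi1
    constructor
    · have := hB (r + 2 * i)
      nlinarith [abs_nonneg (i : ℝ), abs_nonneg (hilbert φ (r + 2 * i))]
    · refine (abs_add_le _ _).trans ((add_le_add (hB _) (hB _)).trans ?_)
      rw [← div_eq_mul_inv, le_div_iff₀ (by positivity)]
      nlinarith
  · have hi2 : (2 : ℝ) ≤ |(i : ℝ)| := by exact_mod_cast hi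
    have hsq : 4 ≤ (i : ℝ) ^ 2 := by rw [← sq_abs]; nlinarith
    have hlow : ∀ (k : ℤ) (t : ℝ), |k| = |i| → |t| < 1 → |(i : ℝ)| ≤ |r + 2 * k - t| := by
      intro k t hk ht
      have hk' : |(k : ℝ)| = |(i : ℝ)| := by exact_mod_cast hk
      have h1 := abs_sub_abs_le_abs_sub (2 * k : ℝ) (t - r)
      rw [abs_mul, abs_two, hk', show (2 * k - (t - r) : ℝ) = r + 2 * k - t by ring] at h1
      have := abs_sub t r
      linarith
    have heq : ∀ k : ℤ, |k| = |i| → hilbert φ (r + 2 * k) = Real.pi⁻¹ * ∫ t, φ t / (r + 2 * k - t) := by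
      intro k hk
      refine h.hilbert_eq ?_
      have := hlow k 0 hk (by simp)
      rw [sub_zero] at this
      linarith [h.lt_one]
    constructor
    · rw [heq i rfl, abs_mul, abs_of_nonneg hpi0]
      have h1 : |∫ t, φ t / (r + 2 * i - t)| ≤ |(i : ℝ)|⁻¹ * ∫ t, |φ t| := by
        simp only [div_eq_mul_inv]
        refine h.abs_integral_mul_le fun t ht => ?_
        rw [abs_inv]
        exact inv_anti₀ (by linarith) (hlow i t rfl ht)
      calc |(i : ℝ)| * (Real.pi⁻¹ * |∫ t, φ t / (r + 2 * i - t)|)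
          ≤ |(i : ℝ)| * (1 * (|(i : ℝ)|⁻¹ * ∫ t, |φ t|)) := by gcongr
        _ = ∫ t, |φ t| := by field_simp
        _ ≤ _ := by linarith
    · have hk : ∀ k : ℤ, |k| = |i| → Integrable fun t => φ t * (r + 2 * k - t)⁻¹ := by
        intro k hk
        refine h.integrable_mul (c := |(i : ℝ)|⁻¹) (by fun_prop) fun t ht => ?_
        rw [abs_inv]
        exact inv_anti₀ (by linarith) (hlow k t hk ht)
      rw [heq i rfl, heq (-i) (abs_neg i), ← mul_add, abs_mul, abs_of_nonneg hpi0]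
      simp only [div_eq_mul_inv]
      rw [← integral_add (hk i rfl) (hk (-i) (abs_neg i))]
      simp only [← mul_add]
      have h1 : |∫ t, φ t * ((r + 2 * i - t)⁻¹ + (r + 2 * (-i : ℤ) - t)⁻¹)| ≤
          (2 * (1 + (i : ℝ) ^ 2)⁻¹) * ∫ t, |φ t| := by
        refine h.abs_integral_mul_le fun t ht => ?_
        have n1 : r + 2 * i - t ≠ 0 := abs_pos.1 (by linarith [hlow i t rfl ht])
        have n2 : r + 2 * (-i : ℤ) - t ≠ 0 := abs_pos.1 (by linarith [hlow (-i) t (abs_neg i) ht])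
        push_cast at n2
        have hrt : |r - t| ≤ 2 := (abs_sub _ _).trans (by linarith)
        have hrt2 : (r - t) ^ 2 ≤ 4 := by rw [← sq_abs]; nlinarith [abs_nonneg (r - t)]
        have e : (r + 2 * i - t)⁻¹ + (r + 2 * (-i : ℤ) - t)⁻¹ =
            -(2 * (r - t)) / (4 * (i : ℝ) ^ 2 - (r - t) ^ 2) := by
          have n3 : 4 * (i : ℝ) ^ 2 - (r - t) ^ 2 ≠ 0 := by nlinarith
          push_cast
          rw [show r + 2 * (i : ℝ) - t = (r - t) + 2 * i by ring] at n1 ⊢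
          rw [show r + 2 * -(i : ℝ) - t = (r - t) - 2 * i by ring] at n2 ⊢
          generalize r - t = u at *
          rw [eq_div_iff n3]
          field_simp
          ring
        rw [e, abs_div, abs_neg, abs_mul, abs_two, abs_of_pos (by nlinarith :
          0 < 4 * (i : ℝ) ^ 2 - (r - t) ^ 2), div_le_iff₀ (by nlinarith), ← div_eq_mul_inv,
          div_mul_eq_mul_div, le_div_iff₀ (by positivity)]
        nlinarith
      calc _ ≤ 1 * ((2 * (1 + (i : ℝ) ^ 2)⁻¹) * ∫ t, |φ t|) := by gcongr
        _ = (2 * ∫ t, |φ t|) * (1 + (i : ℝ) ^ 2)⁻¹ := by ring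
        _ ≤ _ := by gcongr; linarith

/-- With `z = r + 2m` and `|r| ≤ 1`, the shift by `m` is covered by the uniformity of
`abs_tsum_tent_le` in the centre. -/
theorem UnitTest.exists_tent_bound : ∃ C : ℝ, 0 ≤ C ∧ ∀ (n : ℕ) (z : ℝ),
    |∑' j, tent n j * hilbert φ (z + 2 * j)| ≤ C := by
  obtain ⟨C, hC, hd⟩ := h.hilbert_decay
  refine ⟨C * (∑' i : ℤ, (1 + (i : ℝ) ^ 2)⁻¹) + 8 * C, ?_, fun n z => ?_⟩
  · have : 0 ≤ ∑' i : ℤ, (1 + (i : ℝ) ^ 2)⁻¹ := tsum_nonneg fun i => by positivity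
    positivity
  · have hr : |z - 2 * (round (z / 2) : ℤ)| ≤ 1 := by
      have := abs_sub_round (z / 2)
      rw [abs_le] at this ⊢
      constructor <;> linarith [this.1, this.2]
    have := abs_tsum_tent_le hC (fun i => (hd _ hr i).1) (fun i => (hd _ hr i).2) n (round (z / 2))
    refine le_of_eq_of_le (congrArg abs (tsum_congr fun j => ?_)) this
    push_cast
    congr 2
    ring

theorem UnitTest.hasSum_cotSum (z : ℝ) :
    HasSum (fun j : ℤ => hilbert φ (z + 2 * j) - hilbert φ (2 * j)) (cotSum φ z) :=
  h.hasSum_hilbert_sub z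

theorem UnitTest.tendsto_tent_cotSum (z : ℝ) :
    Tendsto (fun n => ∑' j, tent n j * (hilbert φ (z + 2 * j) - hilbert φ (2 * j))) atTop
      (𝓝 (cotSum φ z)) := by
  rw [← (h.hasSum_cotSum z).tsum_eq]
  exact tendsto_tsum_tent (h.hasSum_cotSum z).summable

theorem UnitTest.exists_tent_cotSum_bound : ∃ C : ℝ, 0 ≤ C ∧ ∀ (n : ℕ) (z : ℝ),
    |∑' j, tent n j * (hilbert φ (z + 2 * j) - hilbert φ (2 * j))| ≤ C := by
  obtain ⟨C, hC, hb⟩ := h.exists_tent_bound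
  refine ⟨C + C, by positivity, fun n z => ?_⟩
  have e : ∑' j : ℤ, tent n j * (hilbert φ (z + 2 * j) - hilbert φ (2 * j)) =
      ∑' j, tent n j * hilbert φ (z + 2 * j) - ∑' j, tent n j * hilbert φ (0 + 2 * j) := by
    rw [← (summable_tent_mul n _).tsum_sub (summable_tent_mul n _)]
    simp only [mul_sub, zero_add]
  rw [e]
  exact (abs_sub _ _).trans (add_le_add (hb n z) (hb n 0))

theorem UnitTest.exists_cotSum_bound : ∃ C : ℝ, 0 ≤ C ∧ ∀ z : ℝ, |cotSum φ z| ≤ C := by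
  obtain ⟨C, hC, hb⟩ := h.exists_tent_cotSum_bound
  exact ⟨C, hC, fun z => le_of_tendsto (h.tendsto_tent_cotSum z).abs
    (Eventually.of_forall fun n => hb n z)⟩

theorem UnitTest.measurable_cotSum : Measurable (cotSum φ) := by
  refine measurable_of_tendsto_metrizable (f := fun n z =>
    ∑' j : ℤ, tent n j * (hilbert φ (z + 2 * j) - hilbert φ (2 * j))) (fun n => ?_)
    (tendsto_pi_nhds.2 h.tendsto_tent_cotSum)
  simp only [tsum_tent_mul]
  refine Finset.measurable_fun_sum _ fun j _ => ?_
  have := h.measurable_hilbert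
  fun_prop

theorem UnitTest.tendsto_hilbert_zero (z : ℝ) :
    Tendsto (fun n : ℕ => hilbert φ (z + 2 * n)) atTop (𝓝 0) ∧
    Tendsto (fun n : ℕ => hilbert φ (z - 2 * n)) atTop (𝓝 0) := by
  obtain ⟨C, hC, hd⟩ := h.hilbert_decay
  set m := round (z / 2) with hm
  have hr : |z - 2 * (m : ℤ)| ≤ 1 := by
    have := abs_sub_round (z / 2)
    rw [abs_le] at this ⊢
    constructor <;> linarith [this.1, this.2]
  have key : ∀ s : ℕ → ℤ, Tendsto (fun n => |((m + s n : ℤ) : ℝ)|) atTop atTop →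
      Tendsto (fun n => hilbert φ (z + 2 * s n)) atTop (𝓝 0) := by
    intro s hs
    refine squeeze_zero_norm' ?_ (tendsto_const_nhds (x := C).div_atTop hs)
    filter_upwards [hs.eventually_gt_atTop 0] with n hn
    rw [le_div_iff₀ hn, mul_comm, Real.norm_eq_abs]
    have := (hd _ hr (m + s n)).1
    rwa [show z - 2 * (m : ℤ) + 2 * ((m + s n : ℤ) : ℝ) = z + 2 * s n by push_cast; ring] at this
  have hn : Tendsto (fun n : ℕ => (n : ℝ)) atTop atTop := tendsto_natCast_atTop_atTop
  refine ⟨?_, ?_⟩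
  · refine key (fun n => n) (tendsto_abs_atTop_atTop.comp ?_)
    push_cast
    exact tendsto_atTop_add_const_left _ _ hn
  · have h2 := key (fun n => -n) (tendsto_abs_atBot_atTop.comp ?_)
    · push_cast at h2
      simpa [sub_eq_add_neg] using h2
    · push_cast
      exact tendsto_atBot_add_const_left _ _ (tendsto_neg_atTop_atBot.comp hn)

/-- The difference over one period is a telescoping sum in both directions, and its ends vanish by
the decay of the Hilbert transform. -/
theorem UnitTest.cotSum_periodic : Function.Periodic (cotSum φ) 2 := by
  intro z
  have hs := (h.hasSum_cotSum (z + 2)).sub (h.hasSum_cotSum z)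
  simp only [sub_sub_sub_cancel_right] at hs
  obtain ⟨t1, t2⟩ := h.tendsto_hilbert_zero z
  obtain ⟨t3, t4⟩ := h.tendsto_hilbert_zero (z + 2)
  have hnat : HasSum (fun n : ℕ => hilbert φ (z + 2 + 2 * (n : ℤ)) - hilbert φ (z + 2 * (n : ℤ)))
      (0 - hilbert φ z) := by
    refine (Summable.hasSum_iff_tendsto_nat
      (hs.summable.comp_injective Nat.cast_injective)).2 ?_
    refine (t1.sub_const (hilbert φ z)).congr fun n => ?_
    have := Finset.sum_range_sub (fun n : ℕ => hilbert φ (z + 2 * n)) n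
    simp only [Nat.cast_zero, mul_zero, add_zero] at this
    rw [← this]
    refine Finset.sum_congr rfl fun i _ => ?_
    simp only [Function.comp]
    push_cast
    congr 2
    ring
  have hneg : HasSum (fun n : ℕ => hilbert φ (z + 2 + 2 * (-(n + 1 : ℤ) : ℤ)) -
      hilbert φ (z + 2 * (-(n + 1 : ℤ) : ℤ))) (hilbert φ z - 0) := by
    have hinj : Function.Injective fun n : ℕ => (-(n + 1 : ℤ) : ℤ) := fun i j hij => by
      simp only [neg_inj, add_left_inj, Nat.cast_inj] at hij
      exact hij
    refine (Summable.hasSum_iff_tendsto_nat (hs.summable.comp_injective hinj)).2 ?_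
    refine (t2.const_sub (hilbert φ z)).congr fun n => ?_
    have := Finset.sum_range_sub' (fun n : ℕ => hilbert φ (z - 2 * n)) n
    simp only [Nat.cast_zero, mul_zero, sub_zero] at this
    rw [← this]
    refine Finset.sum_congr rfl fun i _ => ?_
    simp only [Function.comp]
    push_cast
    congr 2 <;> ring
  have := hs.unique (HasSum.of_nat_of_neg_add_one hnat hneg)
  linarith

end

/-! ### Test functions dual to the subtransfer operator -/

/-- The test function on `]-1, 1[` given by a smooth function supported in `[-a, a]`. -/
def UnitTest.toTest {φ : ℝ → ℝ} {a : ℝ} (h : UnitTest φ a) : 𝓓(symmInterval 1, ℝ) where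
  toFun := φ
  contDiff' := h.contDiff
  hasCompactSupport' := h.hasCompactSupport
  tsupport_subset' := by
    refine (closure_minimal (s := Function.support φ) (t := Icc (-a) a) (fun t ht => ?_)
      isClosed_Icc).trans fun t ht => ⟨by linarith [ht.1, h.lt_one], by linarith [ht.2, h.lt_one]⟩
    by_contra hc
    refine ht (h.zero t ?_)
    by_contra! hlt
    exact hc ⟨(abs_lt.1 hlt).1.le, (abs_lt.1 hlt).2.le⟩

theorem UnitTest.toTest_apply {φ : ℝ → ℝ} {a : ℝ} (h : UnitTest φ a) (t : ℝ) : h.toTest t = φ t :=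
  rfl

theorem exists_unitTest (φ : 𝓓(symmInterval 1, ℝ)) : ∃ a, UnitTest φ a := by
  have hK : IsCompact (tsupport φ) := φ.hasCompactSupport
  have hsub : tsupport φ ⊆ Ioo (-1) 1 := φ.tsupport_subset
  obtain ⟨a, ha0, ha1, ha⟩ : ∃ a : ℝ, 0 < a ∧ a < 1 ∧ ∀ t ∈ tsupport φ, |t| < a := by
    rcases (tsupport φ).eq_empty_or_nonempty with he | hne
    · exact ⟨1 / 2, by norm_num, by norm_num, by simp [he]⟩
    · obtain ⟨t₀, ht₀, hmax⟩ := hK.exists_isMaxOn hne continuous_abs.continuousOn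
      have h1 : |t₀| < 1 := abs_lt.2 (hsub ht₀)
      refine ⟨(1 + |t₀|) / 2, by positivity, by linarith, fun t ht => ?_⟩
      have : |t| ≤ |t₀| := hmax ht
      linarith
  refine ⟨a, φ.contDiff, ha0, ha1, fun t ht => ?_⟩
  by_contra hne
  exact absurd (ha t (subset_tsupport _ hne)) (not_lt.2 ht)

section
variable {φ ψ : ℝ → ℝ} {a : ℝ} (h : UnitTest φ a)

theorem UnitTest.zero_fun (ha : 0 < a) (ha1 : a < 1) : UnitTest (fun _ => 0) a :=
  ⟨contDiff_const, ha, ha1, fun _ _ => rfl⟩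

include h

theorem UnitTest.add (h' : UnitTest ψ a) : UnitTest (fun t => φ t + ψ t) a :=
  ⟨h.contDiff.add h'.contDiff, h.pos, h.lt_one, fun t ht => by rw [h.zero t ht, h'.zero t ht, add_zero]⟩

theorem UnitTest.const_mul (c : ℝ) : UnitTest (fun t => c * φ t) a :=
  ⟨contDiff_const.mul h.contDiff, h.pos, h.lt_one, fun t ht => by rw [h.zero t ht, mul_zero]⟩

theorem UnitTest.hilbert_add (h' : UnitTest ψ a) (x : ℝ) :
    hilbert (fun t => φ t + ψ t) x = hilbert φ x + hilbert ψ x := by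
  obtain ⟨K, hK⟩ := h.exists_lipschitz
  obtain ⟨K', hK'⟩ := h'.exists_lipschitz
  exact GaussHilbert.hilbert_add h.integrable hK h'.integrable hK' x

theorem UnitTest.hilbert_const_mul (c x : ℝ) : hilbert (fun t => c * φ t) x = c * hilbert φ x := by
  obtain ⟨K, hK⟩ := h.exists_lipschitz
  exact GaussHilbert.hilbert_const_mul h.integrable hK c x

theorem UnitTest.inv_two_sub_mem : 0 < (2 - a)⁻¹ ∧ (2 - a)⁻¹ < 1 := by
  have := h.lt_one
  exact ⟨inv_pos.2 (by linarith), inv_lt_one_of_one_lt₀ (by linarith)⟩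

/-- For `|y| ≥ 1/(2-a)` one has `|-1/y + 2j| ≥ 2 - (2-a) = a`, and near `y = 0` the argument `-1/y +
2j` is large. So the transposed operation stays within test functions on `I_1`, which is why `T₁u`
depends only on the restriction of `u` to `I_1`. -/
theorem UnitTest.comp_inversion {j : ℤ} (hj : j ≠ 0) :
    UnitTest (fun y => φ (-1 / y + 2 * j)) (2 - a)⁻¹ := by
  have hj1 : (1 : ℝ) ≤ |(j : ℝ)| := by exact_mod_cast Int.one_le_abs hj
  have h2j : ∀ y : ℝ, |(-1 / y + 2 * j)| ≥ 2 * |(j : ℝ)| - |y|⁻¹ ∧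
      |(-1 / y + 2 * j)| ≥ |y|⁻¹ - 2 * |(j : ℝ)| := by
    intro y
    have h1 := abs_sub_abs_le_abs_sub (2 * j : ℝ) (1 / y)
    have h2 := abs_sub_abs_le_abs_sub (1 / y) (2 * j : ℝ)
    rw [abs_sub_comm (1 / y)] at h2
    rw [show -1 / y + 2 * (j : ℝ) = 2 * j - 1 / y by ring]
    rw [abs_mul, abs_two, abs_div, abs_one, one_div] at h1 h2
    exact ⟨h1, h2⟩
  refine ⟨?_, h.inv_two_sub_mem.1, h.inv_two_sub_mem.2, fun y hy => ?_⟩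
  · rw [contDiff_iff_contDiffAt]
    intro y
    rcases eq_or_ne y 0 with rfl | hy
    · have hev : (fun y => φ (-1 / y + 2 * j)) =ᶠ[𝓝 0] fun _ => 0 := by
        have hpos : (0 : ℝ) < (2 * |(j : ℝ)| + 1)⁻¹ := by positivity
        filter_upwards [Metric.ball_mem_nhds 0 hpos] with t ht
        rw [Metric.mem_ball, dist_zero_right, Real.norm_eq_abs] at ht
        refine h.zero_of_one_le ?_
        rcases eq_or_ne t 0 with rfl | ht0
        · have := (h2j 0).1
          rw [abs_zero, inv_zero, sub_zero] at this
          linarith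
        · have h3 := (h2j t).2
          have h4 : 2 * |(j : ℝ)| + 1 < |t|⁻¹ := by
            rwa [lt_inv_comm₀ (by positivity) (abs_pos.2 ht0)]
          linarith
      exact contDiffAt_const.congr_of_eventuallyEq hev
    · exact h.contDiff.contDiffAt.comp y
        ((contDiffAt_const.div contDiffAt_id hy).add contDiffAt_const)
  · refine h.zero _ ?_
    have h1 := (h2j y).1
    have h2 : |y|⁻¹ ≤ 2 - a := by
      rw [inv_le_comm₀ (lt_of_lt_of_le h.inv_two_sub_mem.1 hy) (by linarith [h.lt_one])]
      exact hy
    linarith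

theorem UnitTest.hilbert_comp_inversion {j : ℤ} (hj : j ≠ 0) {y : ℝ} (hy : y ≠ 0) :
    hilbert (fun y => φ (-1 / y + 2 * j)) y = hilbert φ (-1 / y + 2 * j) - hilbert φ (2 * j) := by
  obtain ⟨K, hK⟩ := h.exists_lipschitz
  have h' := h.comp_inversion hj
  obtain ⟨K', hK'⟩ := h'.exists_lipschitz
  have hj1 : (1 : ℝ) ≤ |(j : ℝ)| := by exact_mod_cast Int.one_le_abs hj
  have h0 : ∀ᶠ t in 𝓝 (0 : ℝ), φ (t + 2 * j) = 0 := by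
    filter_upwards [Metric.ball_mem_nhds (0 : ℝ) one_pos] with t ht
    rw [Metric.mem_ball, dist_zero_right, Real.norm_eq_abs] at ht
    refine h.zero_of_one_le ?_
    have := abs_sub_abs_le_abs_sub (2 * j : ℝ) (-t)
    rw [abs_mul, abs_two, abs_neg, sub_neg_eq_add, add_comm (2 * (j : ℝ))] at this
    linarith
  have key := GaussHilbert.hilbert_comp_inversion (φ := fun t => φ (t + 2 * j))
    (h.integrable.comp_add_right _) (hK.comp (isometry_add_right (2 * (j : ℝ))).lipschitz) h0
    h'.integrable hK' hy
  rw [key, hilbert_comp_add, hilbert_comp_add, zero_add]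

end

/-- The test functions approximating the periodization, composed with the inversion. -/
noncomputable def tentTest (φ : ℝ → ℝ) (n : ℕ) (y : ℝ) : ℝ :=
  ∑ j ∈ (Finset.Icc (-(n : ℤ)) n).erase 0, tent n j * φ (-1 / y + 2 * j)

theorem tent_zero (n : ℕ) : tent n 0 = 1 := by simp [tent]

theorem sum_erase_tent (n : ℕ) (v : ℤ → ℝ) :
    ∑ j ∈ (Finset.Icc (-(n : ℤ)) n).erase 0, tent n j * v j = ∑' j, tent n j * v j - v 0 := by
  have := Finset.add_sum_erase (Finset.Icc (-(n : ℤ)) n) (fun j => tent n j * v j) (a := 0) (by simp)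
  simp only [tent_zero] at this
  rw [tsum_tent_mul]
  linarith

section
variable {φ : ℝ → ℝ} {a : ℝ} (h : UnitTest φ a)
include h

theorem UnitTest.tentSum (s : Finset ℤ) (hs : (0 : ℤ) ∉ s) (c : ℤ → ℝ) :
    UnitTest (fun y => ∑ j ∈ s, c j * φ (-1 / y + 2 * j)) (2 - a)⁻¹ ∧
    ∀ y, y ≠ 0 → hilbert (fun y => ∑ j ∈ s, c j * φ (-1 / y + 2 * j)) y =
      ∑ j ∈ s, c j * (hilbert φ (-1 / y + 2 * j) - hilbert φ (2 * j)) := by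
  induction s using Finset.induction_on with
  | empty =>
    refine ⟨by simpa using UnitTest.zero_fun h.inv_two_sub_mem.1 h.inv_two_sub_mem.2, fun y hy => ?_⟩
    have := (UnitTest.zero_fun h.inv_two_sub_mem.1 h.inv_two_sub_mem.2).hilbert_const_mul 0 y
    simpa using this
  | insert i s hi ih =>
    rw [Finset.mem_insert, not_or] at hs
    obtain ⟨h1, h2⟩ := ih hs.2
    have hi0 : i ≠ 0 := fun h0 => hs.1 h0.symm
    have h3 := (h.comp_inversion hi0).const_mul (c i)
    simp only [Finset.sum_insert hi]
    refine ⟨h3.add h1, fun y hy => ?_⟩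
    rw [h3.hilbert_add h1, h2 y hy, (h.comp_inversion hi0).hilbert_const_mul,
      h.hilbert_comp_inversion hi0 hy]

theorem UnitTest.tentTest (n : ℕ) : UnitTest (tentTest φ n) (2 - a)⁻¹ :=
  (h.tentSum _ (Finset.notMem_erase _ _) _).1

theorem UnitTest.hilbert_tentTest (n : ℕ) {y : ℝ} (hy : y ≠ 0) :
    hilbert (GaussHilbert.tentTest φ n) y =
      ∑' j, tent n j * (hilbert φ (-1 / y + 2 * j) - hilbert φ (2 * j)) -
        (hilbert φ (-1 / y) - hilbert φ 0) := by
  have := (h.tentSum ((Finset.Icc (-(n : ℤ)) n).erase 0) (Finset.notMem_erase _ _) (tent n)).2 y hy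
  refine this.trans ?_
  rw [sum_erase_tent]
  simp

theorem UnitTest.exists_unique_translate (z : ℝ) : ∃ j₀ : ℤ, ∀ j, j ≠ j₀ → φ (z + 2 * j) = 0 := by
  by_cases hex : ∃ j₀ : ℤ, φ (z + 2 * j₀) ≠ 0
  · obtain ⟨j₀, hj₀⟩ := hex
    refine ⟨j₀, fun j hj => ?_⟩
    by_contra hne
    have h1 : |z + 2 * j₀| < 1 := by by_contra! hle; exact hj₀ (h.zero_of_one_le hle)
    have h2 : |z + 2 * j| < 1 := by by_contra! hle; exact hne (h.zero_of_one_le hle)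
    rw [abs_lt] at h1 h2
    have h3 : (j : ℝ) - j₀ < 1 := by linarith
    have h4 : (j₀ : ℝ) - j < 1 := by linarith
    have h5 : j - j₀ < 1 := by exact_mod_cast h3
    have h6 : j₀ - j < 1 := by exact_mod_cast h4
    exact hj (by omega)
  · push Not at hex
    exact ⟨0, fun j _ => hex j⟩

/-- The translates by even integers have disjoint supports, so at most one term is nonzero at each
point. -/
theorem UnitTest.exists_tentTest_bound : ∃ B : ℝ, 0 ≤ B ∧ (∀ n y, |GaussHilbert.tentTest φ n y| ≤ B) ∧
    ∀ z, |periodize φ z| ≤ B := by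
  obtain ⟨B, hB0, hB⟩ := h.exists_bound
  refine ⟨B, hB0, fun n y => ?_, fun z => ?_⟩
  · obtain ⟨j₀, hj₀⟩ := h.exists_unique_translate (-1 / y)
    unfold GaussHilbert.tentTest
    by_cases hm : j₀ ∈ (Finset.Icc (-(n : ℤ)) n).erase 0
    · rw [Finset.sum_eq_single_of_mem j₀ hm fun j _ hj => by rw [hj₀ j hj, mul_zero], abs_mul,
        abs_of_nonneg (tent_nonneg _ _)]
      exact (mul_le_of_le_one_left (abs_nonneg _) (tent_le_one _ _)).trans (hB _)
    · rw [Finset.sum_eq_zero fun j hj => ?_, abs_zero]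
      · exact hB0
      · rw [hj₀ j (fun e => hm (e ▸ hj)), mul_zero]
  · obtain ⟨j₀, hj₀⟩ := h.exists_unique_translate z
    rw [periodize, tsum_eq_single j₀ hj₀]
    exact hB _

theorem UnitTest.continuous_periodize : Continuous (periodize φ) := by
  obtain ⟨C, hC⟩ := h.damped_lipschitz
  have hK' : Summable fun j : ℤ => C * NNReal.mk (1 + (j : ℝ) ^ 2)⁻¹ (by positivity) := by
    refine Summable.mul_left C ?_
    rw [← NNReal.summable_coe]
    exact summable_inv_one_add_int_sq
  have hsum : ∀ t, HasSum (fun j : ℤ => φ (t + 2 * j) * (1 + t ^ 2)⁻¹)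
      (periodize φ t * (1 + t ^ 2)⁻¹) := fun t => (h.summable t).hasSum.mul_right _
  have hL := (lipschitzWith_of_hasSum hC hK' hsum).continuous
  have e : periodize φ = fun t => periodize φ t * (1 + t ^ 2)⁻¹ * (1 + t ^ 2) := by
    funext t
    have : 1 + t ^ 2 ≠ 0 := by positivity
    field_simp
  rw [e]
  exact hL.mul (by fun_prop)

omit h in
theorem periodize_periodic (φ : ℝ → ℝ) : Function.Periodic (periodize φ) 2 := by
  intro z
  rw [periodize, periodize, ← (Equiv.addRight (1 : ℤ)).tsum_eq fun j : ℤ => φ (z + 2 * j)]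
  refine tsum_congr fun j => ?_
  simp only [Equiv.coe_addRight]
  push_cast
  congr 1
  ring

theorem UnitTest.periodize_eq {x : ℝ} (hx : |x| ≤ 1) : periodize φ x = φ x := by
  rw [periodize, tsum_eq_single 0]
  · simp
  · intro j hj
    refine h.zero_of_one_le ?_
    have hj1 : (1 : ℝ) ≤ |(j : ℝ)| := by exact_mod_cast Int.one_le_abs hj
    have := abs_sub_abs_le_abs_sub (2 * j : ℝ) (-x)
    rw [abs_mul, abs_two, abs_neg, sub_neg_eq_add, add_comm (2 * (j : ℝ))] at this
    linarith

theorem UnitTest.tendsto_tentTest (y : ℝ) :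
    Tendsto (fun n => GaussHilbert.tentTest φ n y) atTop
      (𝓝 (periodize φ (-1 / y) - φ (-1 / y))) := by
  have h1 := (tendsto_tsum_tent (h.summable (-1 / y))).sub_const (φ (-1 / y + 2 * (0 : ℤ)))
  have e : ∀ n, GaussHilbert.tentTest φ n y = ∑' j, tent n j * φ (-1 / y + 2 * j)
      - φ (-1 / y + 2 * (0 : ℤ)) := fun n => sum_erase_tent n fun j => φ (-1 / y + 2 * j)
  simp only [e]
  simpa [periodize] using h1

/-- The part of `cotSum` coming from the nontrivial translates. -/
theorem UnitTest.tendsto_hilbert_tentTest {y : ℝ} (hy : y ≠ 0) :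
    Tendsto (fun n => hilbert (GaussHilbert.tentTest φ n) y) atTop
      (𝓝 (cotSum φ (-1 / y) - (hilbert φ (-1 / y) - hilbert φ 0))) := by
  simp only [h.hilbert_tentTest _ hy]
  exact (h.tendsto_tent_cotSum _).sub_const _

theorem UnitTest.exists_hilbert_tentTest_bound : ∃ C : ℝ, 0 ≤ C ∧
    ∀ n y, y ≠ 0 → |hilbert (GaussHilbert.tentTest φ n) y| ≤ C := by
  obtain ⟨C, hC, hb⟩ := h.exists_tent_cotSum_bound
  obtain ⟨B, hB0, hB⟩ := h.exists_hilbert_bound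
  refine ⟨C + (B + B), by positivity, fun n y hy => ?_⟩
  rw [h.hilbert_tentTest n hy]
  exact (abs_sub _ _).trans (add_le_add (hb _ _) ((abs_sub _ _).trans (add_le_add (hB _) (hB _))))

theorem UnitTest.tendsto_integral_tentTest {f : ℝ → ℂ}
    (hf : IntegrableOn f (Icc (-(2 - a)⁻¹) (2 - a)⁻¹)) :
    Tendsto (fun n => ∫ y, (GaussHilbert.tentTest φ n y : ℂ) * f y) atTop
      (𝓝 (∫ y, ((periodize φ (-1 / y) - φ (-1 / y) : ℝ) : ℂ) * f y)) := by
  obtain ⟨B, hB0, hB, -⟩ := h.exists_tentTest_bound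
  set s := Icc (-(2 - a)⁻¹) (2 - a)⁻¹ with hs
  have hz : ∀ n, ∀ y ∉ s, (GaussHilbert.tentTest φ n y : ℂ) * f y = 0 := by
    intro n y hy
    rw [(h.tentTest n).zero y, Complex.ofReal_zero, zero_mul]
    by_contra! hlt
    exact hy ⟨(abs_lt.1 hlt).1.le, (abs_lt.1 hlt).2.le⟩
  have hz' : ∀ y ∉ s, ((periodize φ (-1 / y) - φ (-1 / y) : ℝ) : ℂ) * f y = 0 := by
    intro y hy
    refine tendsto_nhds_unique (((Complex.continuous_ofReal.tendsto _).comp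
      (h.tendsto_tentTest y)).mul_const (f y)) ?_
    refine tendsto_const_nhds.congr fun n => ?_
    exact (hz n y hy).symm
  rw [← setIntegral_eq_integral_of_forall_compl_eq_zero hz']
  have ez := fun n => (setIntegral_eq_integral_of_forall_compl_eq_zero (μ := volume) (hz n)).symm
  simp only [ez]
  refine tendsto_integral_of_dominated_convergence (fun y => B * ‖f y‖) (fun n => ?_)
    (hf.norm.const_mul B) (fun n => Eventually.of_forall fun y => ?_)
    (Eventually.of_forall fun y => ?_)
  · have := (h.tentTest n).contDiff.continuous
    exact (Complex.continuous_ofReal.comp this).aestronglyMeasurable.mul hf.1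
  · rw [norm_mul, Complex.norm_real]
    exact mul_le_mul_of_nonneg_right (hB n y) (norm_nonneg _)
  · exact ((Complex.continuous_ofReal.tendsto _).comp (h.tendsto_tentTest y)).mul_const (f y)

theorem UnitTest.tendsto_integral_hilbert_tentTest {g : ℝ → ℂ} (hg : Integrable g) :
    Tendsto (fun n => ∫ y, (hilbert (GaussHilbert.tentTest φ n) y : ℂ) * g y) atTop
      (𝓝 (∫ y, ((cotSum φ (-1 / y) - (hilbert φ (-1 / y) - hilbert φ 0) : ℝ) : ℂ) * g y)) := by
  obtain ⟨C, hC, hb⟩ := h.exists_hilbert_tentTest_bound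
  have hne : ∀ᵐ y : ℝ, y ≠ 0 := by simp [ae_iff]
  refine tendsto_integral_of_dominated_convergence (fun y => C * ‖g y‖) (fun n => ?_)
    (hg.norm.const_mul C) (fun n => ?_) ?_
  · exact (Complex.measurable_ofReal.comp
      (h.tentTest n).measurable_hilbert).aestronglyMeasurable.mul hg.1
  · filter_upwards [hne] with y hy
    rw [norm_mul, Complex.norm_real]
    exact mul_le_mul_of_nonneg_right (hb n y hy) (norm_nonneg _)
  · filter_upwards [hne] with y hy
    exact ((Complex.continuous_ofReal.tendsto _).comp
      (h.tendsto_hilbert_tentTest hy)).mul_const (g y)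

end

theorem integral_comp_inversion_mul (ψ : ℝ → ℂ) (f : ℝ → ℂ) :
    ∫ y, ψ (-1 / y) * f y = ∫ z, ψ z * involution f z := by
  rw [← integral_inversion]
  refine integral_congr_ae (Eventually.of_forall fun z => ?_)
  simp only [involution, inversion_inversion, Complex.real_smul]
  ring

theorem integrable_involution {f : ℝ → ℂ} (hf : Integrable f) : Integrable (involution f) := by
  exact (integrable_inversion.2 hf).congr
    (Eventually.of_forall fun s => (Complex.real_smul (x := 1 / s ^ 2)))

theorem integral_involution (f : ℝ → ℂ) : ∫ z, involution f z = ∫ y, f y := by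
  simpa using (integral_comp_inversion_mul (fun _ => 1) f).symm

theorem UnitTest.integrable_ofReal_mul {m : ℝ → ℝ} {g : ℝ → ℂ} {C : ℝ} (hg : Integrable g)
    (hm : Measurable m) (hC : ∀ z, |m z| ≤ C) : Integrable fun z => (m z : ℂ) * g z :=
  hg.bdd_mul (c := C) (Complex.measurable_ofReal.comp hm).aestronglyMeasurable
    (Eventually.of_forall fun z => by rw [Complex.norm_real]; exact hC z)

/-- The value of the subtransfer at a test function is determined by the values of the original
distribution at test functions. -/
theorem UnitTest.tendsto_lineAction_tentTest {φ : ℝ → ℝ} {a : ℝ} (h : UnitTest φ a) {f g : ℝ → ℂ}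
    (hfg : Admissible f g) : Tendsto (fun n => lineAction f g (GaussHilbert.tentTest φ n)) atTop
      (𝓝 (sigmaAction (involution f) (involution g) φ)) := by
  obtain ⟨hf, hg, hg0⟩ := hfg
  have hJf := integrable_involution hf
  have hJg := integrable_involution hg
  obtain ⟨B, hB0, -, hB⟩ := h.exists_tentTest_bound
  obtain ⟨B', hB'0, hB'⟩ := h.exists_bound
  obtain ⟨C, hC0, hC⟩ := h.exists_cotSum_bound
  obtain ⟨C', hC'0, hC'⟩ := h.exists_hilbert_bound
  have hlim := (h.tendsto_integral_tentTest hf.integrableOn).sub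
    (h.tendsto_integral_hilbert_tentTest hg)
  refine hlim.trans (le_of_eq (congrArg 𝓝 ?_))
  rw [integral_comp_inversion_mul (fun z => ((periodize φ z - φ z : ℝ) : ℂ)) f,
    integral_comp_inversion_mul
      (fun z => ((cotSum φ z - (hilbert φ z - hilbert φ 0) : ℝ) : ℂ)) g]
  have hper := h.continuous_periodize.measurable
  have i1 := UnitTest.integrable_ofReal_mul hJf hper hB
  have i2 := UnitTest.integrable_ofReal_mul hJf h.contDiff.continuous.measurable hB'
  have i3 := UnitTest.integrable_ofReal_mul hJg h.measurable_cotSum hC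
  have i4 := UnitTest.integrable_ofReal_mul hJg h.measurable_hilbert hC'
  -- The mean of `g` is preserved by the involution. Being zero, it removes the constant produced by
  -- the inversion and the constant that normalizes `cotSum`.
  have hJg0 : ∫ z, involution g z = 0 := by rw [integral_involution, hg0]
  have e1 : ∫ z, ((periodize φ z - φ z : ℝ) : ℂ) * involution f z =
      (∫ z, (periodize φ z : ℂ) * involution f z) - ∫ z, (φ z : ℂ) * involution f z := by
    rw [← integral_sub i1 i2]
    simp only [Complex.ofReal_sub, sub_mul]
  have e2 : ∫ z, ((cotSum φ z - (hilbert φ z - hilbert φ 0) : ℝ) : ℂ) * involution g z =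
      (∫ z, (cotSum φ z : ℂ) * involution g z) - ∫ z, (hilbert φ z : ℂ) * involution g z := by
    have e : ∀ z, ((cotSum φ z - (hilbert φ z - hilbert φ 0) : ℝ) : ℂ) * involution g z =
        ((cotSum φ z : ℂ) * involution g z - (hilbert φ z : ℂ) * involution g z) +
          (hilbert φ 0 : ℂ) * involution g z := fun z => by push_cast; ring
    have i34 : Integrable fun z => (cotSum φ z : ℂ) * involution g z -
      (hilbert φ z : ℂ) * involution g z := i3.sub i4
    simp only [e]
    rw [integral_add i34 (hJg.const_mul _), integral_sub i3 i4, integral_const_mul, hJg0,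
      mul_zero, add_zero]
  have e3 : ∫ z, (modHilbert (periodize φ) z : ℂ) * involution g z =
      ∫ z, (cotSum φ z : ℂ) * involution g z := by
    have e : ∀ z, (modHilbert (periodize φ) z : ℂ) * involution g z =
        (cotSum φ z : ℂ) * involution g z + (modHilbert (periodize φ) 0 : ℂ) * involution g z := by
      intro z
      simp only [cotSum]
      push_cast
      ring
    simp only [e]
    rw [integral_add i3 (hJg.const_mul _), integral_const_mul, hJg0, mul_zero, add_zero]
  rw [e1, e2, sigmaAction, periodizedAction, lineAction, e3]
  ring

/-- The relation defining the subtransfer operator is functional. -/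
theorem IsSubtransfer.unique {u v w : 𝓓'(symmInterval 1, ℂ)} (hv : IsSubtransfer u v)
    (hw : IsSubtransfer u w) : v = w := by
  obtain ⟨f, g, ⟨hfg, hu⟩, hv⟩ := hv
  obtain ⟨f', g', ⟨hfg', hu'⟩, hw⟩ := hw
  refine DFunLike.ext _ _ fun φ => ?_
  obtain ⟨a, h⟩ := exists_unitTest φ
  rw [hv, hw]
  -- The approximating functions are test functions on `I_1`, on which both representations take the
  -- value given by `u`.
  refine tendsto_nhds_unique (h.tendsto_lineAction_tentTest hfg)
    ((h.tendsto_lineAction_tentTest hfg').congr fun n => ?_)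
  exact (hu' (h.tentTest n).toTest).symm.trans (hu (h.tentTest n).toTest)

/-! ### Periodization of integrable functions and the cotangent kernel -/

theorem tsum_of_summable_integral_norm {ι : Type*} [Countable ι] {α : Type*} [MeasurableSpace α]
    {μ : Measure α} {F : ι → α → ℂ} (hF : ∀ i, Integrable (F i) μ)
    (hs : Summable fun i => ∫ a, ‖F i a‖ ∂μ) :
    (∀ᵐ a ∂μ, Summable fun i => F i a) ∧ Integrable (fun a => ∑' i, F i a) μ ∧
      ∫ a, ‖∑' i, F i a‖ ∂μ ≤ ∑' i, ∫ a, ‖F i a‖ ∂μ := by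
  have h2 : ∀ i, ∫⁻ a, ‖F i a‖ₑ ∂μ = ENNReal.ofReal (∫ a, ‖F i a‖ ∂μ) := fun i =>
    (ofReal_integral_norm_eq_lintegral_enorm (hF i)).symm
  have h3 : ∫⁻ a, ∑' i, ‖F i a‖ₑ ∂μ = ENNReal.ofReal (∑' i, ∫ a, ‖F i a‖ ∂μ) := by
    rw [lintegral_tsum fun i => (hF i).1.enorm]
    simp only [h2]
    rw [ENNReal.ofReal_tsum_of_nonneg (fun i => integral_nonneg fun a => norm_nonneg _) hs]
  have hae : ∀ᵐ a ∂μ, Summable fun i => F i a := by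
    have := ae_lt_top' (AEMeasurable.tsum fun i => (hF i).1.enorm)
      (by rw [h3]; exact ENNReal.ofReal_ne_top)
    filter_upwards [this] with a ha
    refine Summable.of_norm ?_
    exact summable_norm_iff.2 (Summable.of_enorm ha.ne)
  have hm : AEStronglyMeasurable (fun a => ∑' i, F i a) μ := by
    refine aestronglyMeasurable_of_tendsto_ae (u := (atTop : Filter (Finset ι)))
      (f := fun s a => ∑ i ∈ s, F i a) (fun s => ?_) ?_
    · exact Finset.aestronglyMeasurable_fun_sum _ fun i _ => (hF i).1
    · filter_upwards [hae] with a ha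
      exact ha.hasSum
  have hi := integrable_of_hasSum hF hs hm (hae.mono fun a ha => ha.hasSum)
  refine ⟨hae, hi, ?_⟩
  rw [← ENNReal.ofReal_le_ofReal_iff (tsum_nonneg fun i => integral_nonneg fun a => norm_nonneg _),
    ofReal_integral_norm_eq_lintegral_enorm hi, ← h3]
  exact lintegral_mono fun a => enorm_tsum_le_tsum_enorm

/-- Integrals over the line as sums of integrals over `]-1, 1[`. -/
theorem hasSum_setIntegral_translates {E : Type*} [NormedAddCommGroup E] [NormedSpace ℝ E]
    {F : ℝ → E} (hF : Integrable F) :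
    HasSum (fun j : ℤ => ∫ x in Ioo (-1 : ℝ) 1, F (x + 2 * j)) (∫ x, F x) := by
  have hd := pairwise_disjoint_Ioc_add_zsmul (-1 : ℝ) 2
  have hu := iUnion_Ioc_add_zsmul (α := ℝ) two_pos (-1)
  have h := hasSum_integral_iUnion (μ := volume) (f := F) (s := fun n : ℤ =>
    Ioc ((-1 : ℝ) + n • 2) (-1 + (n + 1) • 2)) (fun n => measurableSet_Ioc) hd hF.integrableOn
  rw [hu, setIntegral_univ] at h
  have e : (fun j : ℤ => ∫ x in Ioo (-1 : ℝ) 1, F (x + 2 * j)) =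
      fun n : ℤ => ∫ x in Ioc ((-1 : ℝ) + n • 2) (-1 + (n + 1) • 2), F x := by
    funext j
    rw [← integral_Ioc_eq_integral_Ioo, ← integral_indicator measurableSet_Ioc,
      ← integral_indicator measurableSet_Ioc,
      ← integral_add_right_eq_self (fun x => (Ioc _ _).indicator F x) (2 * (j : ℝ))]
    congr 1
    funext x
    simp only [indicator]
    congr 1
    simp only [mem_Ioc, zsmul_eq_mul]
    push_cast
    apply propext
    constructor <;> rintro ⟨h1, h2⟩ <;> constructor <;> linarith
  rw [e]
  exact h

/-- The periodization of a function. -/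
noncomputable def perSum (h : ℝ → ℂ) (x : ℝ) : ℂ := ∑' j : ℤ, h (x + 2 * j)

section
variable {h : ℝ → ℂ} (hh : Integrable h)
include hh

theorem summable_perSum_norm : Summable fun j : ℤ => ∫ x in Ioo (-1 : ℝ) 1, ‖h (x + 2 * j)‖ :=
  (hasSum_setIntegral_translates hh.norm).summable

theorem integrableOn_translate (j : ℤ) (s : Set ℝ) : IntegrableOn (fun x => h (x + 2 * j)) s :=
  (hh.comp_add_right (2 * (j : ℝ))).integrableOn

theorem perSum_summable_integrable : (∀ᵐ x ∂(volume.restrict (Ioo (-1 : ℝ) 1)),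
      Summable fun j : ℤ => h (x + 2 * j)) ∧ IntegrableOn (perSum h) (Ioo (-1) 1) ∧
    ∫ x in Ioo (-1 : ℝ) 1, ‖perSum h x‖ ≤
      ∑' j : ℤ, ∫ x in Ioo (-1 : ℝ) 1, ‖h (x + 2 * j)‖ := by
  have hi : ∀ j : ℤ, Integrable (fun x => h (x + 2 * j)) (volume.restrict (Ioo (-1 : ℝ) 1)) :=
    fun j => integrableOn_translate hh j (Ioo (-1) 1)
  exact tsum_of_summable_integral_norm hi (summable_perSum_norm hh)

theorem ae_summable_perSum :
    ∀ᵐ x ∂(volume.restrict (Ioo (-1 : ℝ) 1)), Summable fun j : ℤ => h (x + 2 * j) :=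
  (perSum_summable_integrable hh).1

theorem integrableOn_perSum : IntegrableOn (perSum h) (Ioo (-1) 1) :=
  (perSum_summable_integrable hh).2.1

theorem integral_norm_perSum_le : ∫ x in Ioo (-1 : ℝ) 1, ‖perSum h x‖ ≤ ∫ x, ‖h x‖ := by
  rw [← (hasSum_setIntegral_translates hh.norm).tsum_eq]
  exact (perSum_summable_integrable hh).2.2

theorem integral_periodic_mul {E : ℝ → ℝ} {C : ℝ} (hE : Measurable E) (hC : ∀ z, |E z| ≤ C)
    (hper : Function.Periodic E 2) :
    ∫ x, (E x : ℂ) * h x = ∫ x in Ioo (-1 : ℝ) 1, (E x : ℂ) * perSum h x := by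
  have hEh : Integrable fun x => (E x : ℂ) * h x := UnitTest.integrable_ofReal_mul hh hE hC
  have hEj : ∀ (j : ℤ) x, E (x + 2 * j) = E x := fun j x => by
    have := hper.int_mul j x
    rwa [mul_comm (j : ℝ)] at this
  have e : ∀ (j : ℤ) x, (E (x + 2 * j) : ℂ) * h (x + 2 * j) = (E x : ℂ) * h (x + 2 * j) :=
    fun j x => by rw [hEj]
  have h1 := hasSum_setIntegral_translates hEh
  have h2 := summable_perSum_norm hEh
  have h3 : ∀ j : ℤ, IntegrableOn (fun x => (E (x + 2 * j) : ℂ) * h (x + 2 * j)) (Ioo (-1) 1) :=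
    fun j => integrableOn_translate hEh j (Ioo (-1) 1)
  simp only [e] at h1 h2 h3
  rw [h1.unique (hasSum_integral_of_summable_integral_norm h3 h2)]
  refine integral_congr_ae (Eventually.of_forall fun x => ?_)
  exact tsum_mul_left

end

/-- The kernel of the periodized Hilbert transform, without the terms from `S`. -/
noncomputable def cotKer (S : Finset ℤ) (z x : ℝ) : ℝ :=
  ∑' j : ℤ, if j ∈ S then 0 else (z + 2 * j - x)⁻¹ - (2 * j - x)⁻¹

section
variable {S : Finset ℤ} {b δ : ℝ} (h0 : (0 : ℤ) ∈ S) (hb : b ≤ 1) (hδ : 0 < δ)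
  (hS : ∀ j ∉ S, ∀ z x : ℝ, |z| < 1 → |x| ≤ b → δ * |(j : ℝ)| ≤ |z + 2 * j - x|)
include h0 hb hδ hS

/-- The difference equals `-z / ((z+2j-x)(2j-x))`, and the factors of the denominator are at least
`δ|j|` and `|j|` in absolute value. -/
theorem abs_cotKer_term_le {z x : ℝ} (hz : |z| < 1) (hx : |x| ≤ b) (j : ℤ) :
    |if j ∈ S then 0 else (z + 2 * j - x)⁻¹ - (2 * j - x)⁻¹| ≤ δ⁻¹ * (1 / (j : ℝ) ^ 2) := by
  split_ifs with hj
  · rw [abs_zero]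
    positivity
  · have hj0 : j ≠ 0 := fun e => hj (e ▸ h0)
    have hj1 : (1 : ℝ) ≤ |(j : ℝ)| := by exact_mod_cast Int.one_le_abs hj0
    have h1 := hS j hj z x hz hx
    have h2 : |(j : ℝ)| ≤ |2 * (j : ℝ) - x| := by
      have := abs_sub_abs_le_abs_sub (2 * j : ℝ) x
      rw [abs_mul, abs_two] at this
      linarith
    have p1 : 0 < |z + 2 * j - x| := lt_of_lt_of_le (by positivity) h1
    have p2 : 0 < |2 * (j : ℝ) - x| := by linarith
    have n1 := abs_pos.1 p1
    have n2 := abs_pos.1 p2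
    rw [inv_sub_inv n1 n2, abs_div, abs_mul, show 2 * (j : ℝ) - x - (z + 2 * j - x) = -z by ring,
      abs_neg, div_le_iff₀ (by positivity), ← sq_abs (j : ℝ)]
    have h3 : δ * |(j : ℝ)| * |(j : ℝ)| ≤ |z + 2 * j - x| * |2 * (j : ℝ) - x| := by gcongr
    calc |z| ≤ 1 := hz.le
      _ = δ⁻¹ * (1 / |(j : ℝ)| ^ 2) * (δ * |(j : ℝ)| * |(j : ℝ)|) := by
        field_simp
      _ ≤ _ := by gcongr

theorem summable_cotKer {z x : ℝ} (hz : |z| < 1) (hx : |x| ≤ b) :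
    Summable fun j : ℤ => if j ∈ S then 0 else (z + 2 * j - x)⁻¹ - (2 * j - x)⁻¹ :=
  Summable.of_norm_bounded ((Real.summable_one_div_int_pow.2 one_lt_two).mul_left δ⁻¹)
    (abs_cotKer_term_le h0 hb hδ hS hz hx)

theorem abs_cotKer_le {z x : ℝ} (hz : |z| < 1) (hx : |x| ≤ b) :
    |cotKer S z x| ≤ δ⁻¹ * ∑' j : ℤ, 1 / (j : ℝ) ^ 2 := by
  rw [← tsum_mul_left]
  exact tsum_of_norm_bounded
    (f := fun j : ℤ => if j ∈ S then 0 else (z + 2 * (j : ℝ) - x)⁻¹ - (2 * (j : ℝ) - x)⁻¹)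
    ((Real.summable_one_div_int_pow.2 one_lt_two).mul_left δ⁻¹).hasSum
    (abs_cotKer_term_le h0 hb hδ hS hz hx)

theorem aestronglyMeasurable_cotKer {φ : ℝ → ℝ} (hφ : Measurable φ)
    (hzero : ∀ t, b < |t| → φ t = 0) :
    AEStronglyMeasurable (fun q : ℝ × ℝ => φ q.2 * cotKer S q.1 q.2)
      ((volume.restrict (Ioo (-1 : ℝ) 1)).prod volume) := by
  refine aestronglyMeasurable_of_tendsto_ae (u := (atTop : Filter (Finset ℤ)))
    (f := fun s q => ∑ j ∈ s, φ q.2 * (if j ∈ S then (0 : ℝ) else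
      (q.1 + 2 * (j : ℝ) - q.2)⁻¹ - (2 * (j : ℝ) - q.2)⁻¹))
    (fun s => ?_) ?_
  · refine Finset.aestronglyMeasurable_fun_sum _ fun j _ => ?_
    refine Measurable.aestronglyMeasurable ?_
    split_ifs
    · fun_prop
    · fun_prop
  · have : ∀ᵐ q ∂((volume.restrict (Ioo (-1 : ℝ) 1)).prod (volume : Measure ℝ)),
        q.1 ∈ Ioo (-1 : ℝ) 1 :=
      Measure.quasiMeasurePreserving_fst.ae (ae_restrict_mem measurableSet_Ioo)
    filter_upwards [this] with q hq
    by_cases hx : |q.2| ≤ b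
    · exact (summable_cotKer h0 hb hδ hS (abs_lt.2 hq) hx).hasSum.mul_left (φ q.2)
    · simp only [hzero q.2 (not_le.1 hx), zero_mul, Finset.sum_const_zero]
      exact tendsto_const_nhds

theorem integrable_cotKer_prod {φ : ℝ → ℝ} (hφ : Measurable φ) (hi : Integrable φ)
    (hzero : ∀ t, b < |t| → φ t = 0) {p : ℝ → ℂ} (hp : IntegrableOn p (Ioo (-1) 1)) :
    Integrable (fun q : ℝ × ℝ => ((φ q.2 * cotKer S q.1 q.2 : ℝ) : ℂ) * p q.1)
      ((volume.restrict (Ioo (-1 : ℝ) 1)).prod volume) := by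
  have hm := aestronglyMeasurable_cotKer h0 hb hδ hS hφ hzero
  set c := δ⁻¹ * ∑' j : ℤ, 1 / (j : ℝ) ^ 2 with hc
  have hmaj : Integrable (fun q : ℝ × ℝ => ‖p q.1‖ * (c * ‖φ q.2‖))
      ((volume.restrict (Ioo (-1 : ℝ) 1)).prod volume) :=
    Integrable.mul_prod (f := fun z => ‖p z‖) (g := fun x => c * ‖φ x‖) hp.norm
      (hi.norm.const_mul c)
  refine hmaj.mono' ((Complex.continuous_ofReal.comp_aestronglyMeasurable hm).mul
    (hp.1.comp_fst)) ?_
  have : ∀ᵐ q ∂((volume.restrict (Ioo (-1 : ℝ) 1)).prod (volume : Measure ℝ)),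
      q.1 ∈ Ioo (-1 : ℝ) 1 :=
    Measure.quasiMeasurePreserving_fst.ae (ae_restrict_mem measurableSet_Ioo)
  filter_upwards [this] with q hq
  rw [norm_mul, Complex.norm_real, mul_comm, norm_mul]
  refine mul_le_mul_of_nonneg_left ?_ (norm_nonneg _)
  by_cases hx : |q.2| ≤ b
  · rw [mul_comm]
    exact mul_le_mul_of_nonneg_right (abs_cotKer_le h0 hb hδ hS (abs_lt.2 hq) hx) (norm_nonneg _)
  · rw [hzero q.2 (not_le.1 hx)]
    simp

/-- Fubini's theorem for the kernel `cotKer`. -/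
theorem integral_cotKer_swap {φ : ℝ → ℝ} (hφ : Measurable φ) (hi : Integrable φ)
    (hzero : ∀ t, b < |t| → φ t = 0) {p : ℝ → ℂ} (hp : IntegrableOn p (Ioo (-1) 1)) :
    ∫ z in Ioo (-1 : ℝ) 1, ((∫ x, φ x * cotKer S z x : ℝ) : ℂ) * p z =
      ∫ x, (φ x : ℂ) * ∫ z in Ioo (-1 : ℝ) 1, (cotKer S z x : ℂ) * p z := by
  have hint := integrable_cotKer_prod h0 hb hδ hS hφ hi hzero hp
  have key := integral_integral_swap (μ := volume.restrict (Ioo (-1 : ℝ) 1)) (ν := volume)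
    (f := fun z x => ((φ x * cotKer S z x : ℝ) : ℂ) * p z) hint
  refine Eq.trans ?_ (key.trans ?_)
  · refine integral_congr_ae (Eventually.of_forall fun z => ?_)
    simp only
    rw [integral_mul_const]
    exact congrArg (· * p z) integral_ofReal.symm
  · refine integral_congr_ae (Eventually.of_forall fun x => ?_)
    simp only
    rw [← integral_const_mul]
    refine integral_congr_ae (Eventually.of_forall fun z => ?_)
    push_cast
    ring

/-- The periodized Hilbert transform on `]-1, 1[`. -/
theorem UnitTest.cotSum_eq {φ : ℝ → ℝ} {a : ℝ} (h : UnitTest φ a) (hab : a ≤ b) {z : ℝ}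
    (hz : |z| < 1) : cotSum φ z = ∑ j ∈ S, (hilbert φ (z + 2 * j) - hilbert φ (2 * j)) +
      Real.pi⁻¹ * ∫ x, φ x * cotKer S z x := by
  have hzero : ∀ t, φ t ≠ 0 → |t| ≤ b := by
    intro t ht
    by_contra! hlt
    exact ht (h.zero t (hab.trans hlt.le))
  set k : ℤ → ℝ → ℝ := fun j x => if j ∈ S then 0 else (z + 2 * j - x)⁻¹ - (2 * j - x)⁻¹ with hk
  have hkm : ∀ j, Measurable (k j) := fun j => by
    simp only [hk]
    split_ifs <;> fun_prop
  have hbound : ∀ (m : ℝ → ℝ) (c : ℝ), Measurable m → (∀ x, |x| ≤ b → |m x| ≤ c) →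
      Integrable (fun x => φ x * m x) ∧ ∫ x, ‖φ x * m x‖ ≤ c * ∫ x, |φ x| := by
    intro m c hm hc
    have hle : ∀ x, ‖φ x * m x‖ ≤ c * |φ x| := by
      intro x
      rw [norm_mul, mul_comm, Real.norm_eq_abs, Real.norm_eq_abs]
      rcases eq_or_ne (φ x) 0 with hx | hx
      · rw [hx, abs_zero, mul_zero, mul_zero]
      · exact mul_le_mul_of_nonneg_right (hc x (hzero x hx)) (abs_nonneg _)
    have hi := (h.integrable.abs.const_mul c).mono' (h.integrable.1.mul hm.aestronglyMeasurable)
      (Eventually.of_forall hle)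
    refine ⟨hi, ?_⟩
    rw [← integral_const_mul]
    exact integral_mono hi.norm (h.integrable.abs.const_mul c) hle
  have hki := fun j => hbound (k j) _ (hkm j) fun x hx => abs_cotKer_term_le h0 hb hδ hS hz hx j
  have hs : Summable fun j => ∫ x, ‖φ x * k j x‖ :=
    Summable.of_nonneg_of_le (fun j => integral_nonneg fun x => norm_nonneg _) (fun j => (hki j).2)
      (((Real.summable_one_div_int_pow.2 one_lt_two).mul_left δ⁻¹).mul_right _)
  have h1 := (hasSum_integral_of_summable_integral_norm (fun j => (hki j).1) hs).mul_left Real.pi⁻¹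
  have e1 : ∀ x, ∑' j, φ x * k j x = φ x * cotKer S z x := fun x => tsum_mul_left
  simp only [e1] at h1
  have h2 : HasSum (fun j => if j ∈ S then hilbert φ (z + 2 * j) - hilbert φ (2 * j) else 0)
      (∑ j ∈ S, (hilbert φ (z + 2 * j) - hilbert φ (2 * j))) := by
    rw [Finset.sum_congr rfl fun j hj => (if_pos hj).symm]
    exact hasSum_sum_of_ne_finset_zero fun j hj => if_neg hj
  refine (h.hasSum_cotSum z).unique ?_
  refine (congrArg (HasSum · _) (funext fun j => ?_)).mpr (h2.add h1)
  by_cases hj : j ∈ S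
  · simp [hk, hj]
  · have hj0 : j ≠ 0 := fun e => hj (e ▸ h0)
    have hj1 : (1 : ℝ) ≤ |(j : ℝ)| := by exact_mod_cast Int.one_le_abs hj0
    have ha := h.lt_one
    have b1 : 1 ≤ |z + 2 * (j : ℝ)| := by
      have := abs_sub_abs_le_abs_sub (2 * j : ℝ) (-z)
      rw [abs_mul, abs_two, abs_neg, sub_neg_eq_add, add_comm (2 * (j : ℝ))] at this
      linarith
    have b2 : 1 ≤ |2 * (j : ℝ)| := by
      rw [abs_mul, abs_two]
      linarith
    have i1 := (hbound (fun x => (z + 2 * j - x)⁻¹) (δ * |(j : ℝ)|)⁻¹ (by fun_prop) fun x hx => by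
      rw [abs_inv]
      exact inv_anti₀ (by positivity) (hS j hj z x hz hx)).1
    have i2 := (hbound (fun x => (2 * j - x)⁻¹) 1 (by fun_prop) fun x hx => by
      rw [abs_inv]
      refine inv_le_one_of_one_le₀ ?_
      have := abs_sub_abs_le_abs_sub (2 * j : ℝ) x
      rw [abs_mul, abs_two] at this
      linarith).1
    simp only [hk, if_neg hj, zero_add]
    rw [h.hilbert_eq (by linarith), h.hilbert_eq (by linarith), ← mul_sub]
    simp only [mul_sub, div_eq_mul_inv]
    rw [integral_sub i1 i2, mul_sub]

end

/-! ### The distribution `f + Hg` on the unit interval -/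

theorem UnitTest.mono {φ : ℝ → ℝ} {a b : ℝ} (h : UnitTest φ a) (hab : a ≤ b) (hb : b < 1) :
    UnitTest φ b :=
  ⟨h.contDiff, h.pos.trans_le hab, hb, fun t ht => h.zero t (hab.trans ht)⟩

section
variable {φ ψ : ℝ → ℝ} {a : ℝ} (h : UnitTest φ a) {f g : ℝ → ℂ} (hf : Integrable f)
  (hg : Integrable g)
include h

theorem UnitTest.integrable_mul_left (hf : IntegrableOn f (Icc (-a) a)) :
    Integrable fun t => (φ t : ℂ) * f t := by
  obtain ⟨B, hB0, hB⟩ := h.exists_bound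
  have h1 : IntegrableOn (fun t => (φ t : ℂ) * f t) (Icc (-a) a) :=
    hf.bdd_mul (c := B) (Complex.continuous_ofReal.comp h.contDiff.continuous).aestronglyMeasurable
      (Eventually.of_forall fun t => by rw [Complex.norm_real]; exact hB t)
  refine (integrableOn_iff_integrable_of_support_subset fun t ht => ?_).1 h1
  by_contra hc
  refine ht ?_
  simp only
  rw [h.zero t, Complex.ofReal_zero, zero_mul]
  by_contra! hlt
  exact hc ⟨(abs_lt.1 hlt).1.le, (abs_lt.1 hlt).2.le⟩

theorem UnitTest.integrable_hilbert_mul (hg : Integrable g) :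
    Integrable fun t => (hilbert φ t : ℂ) * g t := by
  obtain ⟨B, hB0, hB⟩ := h.exists_hilbert_bound
  exact UnitTest.integrable_ofReal_mul hg h.measurable_hilbert hB

include hf hg

theorem UnitTest.lineAction_add (h' : UnitTest ψ a) :
    lineAction f g (fun t => φ t + ψ t) = lineAction f g φ + lineAction f g ψ := by
  rw [lineAction, lineAction, lineAction]
  simp only [h.hilbert_add h', Complex.ofReal_add, add_mul]
  rw [integral_add (h.integrable_mul_left hf.integrableOn) (h'.integrable_mul_left hf.integrableOn),
    integral_add (h.integrable_hilbert_mul hg) (h'.integrable_hilbert_mul hg)]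
  ring

omit hf hg in
theorem UnitTest.lineAction_const_mul (c : ℝ) :
    lineAction f g (fun t => c * φ t) = c • lineAction f g φ := by
  rw [lineAction, lineAction]
  simp only [h.hilbert_const_mul, Complex.ofReal_mul, mul_assoc]
  rw [integral_const_mul, integral_const_mul, Complex.real_smul]
  ring

/-- Only the supremum norm and the Lipschitz constant of the test function enter, so `f + Hg` is a
distribution of order at most one. -/
theorem UnitTest.norm_lineAction_le {B : ℝ} {K : ℝ≥0} (hB : ∀ t, |φ t| ≤ B)
    (hK : LipschitzWith K φ) :
    ‖lineAction f g φ‖ ≤ B * (∫ t, ‖f t‖) + (2 * K + 4 * B) * ∫ t, ‖g t‖ := by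
  have h1 : ∫ t, |φ t| ≤ 2 * B := by
    have e : ∫ t, |φ t| = ∫ t in Icc (-1) 1, |φ t| := by
      refine (setIntegral_eq_integral_of_forall_compl_eq_zero fun t ht => ?_).symm
      rw [h.zero_of_one_le, abs_zero]
      by_contra! hlt
      exact ht ⟨(abs_lt.1 hlt).1.le, (abs_lt.1 hlt).2.le⟩
    rw [e]
    refine (setIntegral_mono h.integrable.abs.integrableOn (by simp) hB).trans ?_
    simp [Measure.real]
    linarith
  have hH : ∀ t, |hilbert φ t| ≤ 2 * K + 4 * B := fun t =>
    (abs_hilbert_le h.integrable hK t).trans (by linarith)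
  refine (norm_sub_le _ _).trans (add_le_add ?_ ?_)
  · rw [← integral_const_mul]
    refine norm_integral_le_of_norm_le (hf.norm.const_mul _) (Eventually.of_forall fun t => ?_)
    rw [norm_mul, Complex.norm_real]
    gcongr
    exact hB t
  · rw [← integral_const_mul]
    refine norm_integral_le_of_norm_le (hg.norm.const_mul _) (Eventually.of_forall fun t => ?_)
    rw [norm_mul, Complex.norm_real]
    gcongr
    exact hH t

end

theorem exists_unitTest_of_compacts (K : TopologicalSpace.Compacts ℝ)
    (hK : (K : Set ℝ) ⊆ symmInterval 1) (φ ψ : 𝓓_{K}(ℝ, ℝ)) :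
    ∃ a, UnitTest φ a ∧ UnitTest ψ a := by
  obtain ⟨a, ha⟩ := exists_unitTest (TestFunction.ofSupportedIn hK φ)
  obtain ⟨b, hb⟩ := exists_unitTest (TestFunction.ofSupportedIn hK ψ)
  exact ⟨max a b, UnitTest.mono ha (le_max_left _ _) (max_lt ha.lt_one hb.lt_one),
    UnitTest.mono hb (le_max_right _ _) (max_lt ha.lt_one hb.lt_one)⟩

/-- The restriction of `f + Hg` to the unit interval exists as a distribution. -/
theorem exists_represents {f g : ℝ → ℂ} (hfg : Admissible f g) :
    ∃ u : 𝓓'(symmInterval 1, ℂ), Represents f g u := by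
  obtain ⟨hf, hg, hg0⟩ := hfg
  have key : ∀ K : TopologicalSpace.Compacts ℝ, (K : Set ℝ) ⊆ symmInterval 1 →
      ∃ T : 𝓓_{K}(ℝ, ℝ) →L[ℝ] ℂ, ∀ φ : 𝓓_{K}(ℝ, ℝ), T φ = lineAction f g φ := by
    intro K hK
    refine ⟨ContDiffMapSupportedIn.mkCLMtoNormedSpace ℝ (fun φ => lineAction f g φ) ?_ ?_ ?_,
      fun φ => rfl⟩
    · intro φ ψ
      obtain ⟨a, h, h'⟩ := exists_unitTest_of_compacts K hK φ ψ
      exact h.lineAction_add hf hg h'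
    · intro c φ
      obtain ⟨a, h, -⟩ := exists_unitTest_of_compacts K hK φ φ
      exact h.lineAction_const_mul c
    -- When the seminorm `S` serves both as the bound and as the Lipschitz constant, `2K + 4B`
    -- becomes `6S`.
    · refine ⟨{0, 1}, (∫ t, ‖f t‖) + 6 * ∫ t, ‖g t‖, by positivity, fun φ => ?_⟩
      obtain ⟨a, h, -⟩ := exists_unitTest_of_compacts K hK φ φ
      set S := (({0, 1} : Finset ℕ).sup fun i => N[ℝ]_{K, (⊤ : ℕ∞), i}) φ with hS
      have hS0 : 0 ≤ S := apply_nonneg _ _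
      have h0 : ∀ t, |φ t| ≤ S := fun t =>
        (ContDiffMapSupportedIn.norm_apply_le_seminorm ℝ).trans
          (Seminorm.le_finset_sup_apply (p := fun i => N[ℝ]_{K, (⊤ : ℕ∞), i}) (x := φ) (i := 0)
            (by simp))
      have h1 : LipschitzWith (NNReal.mk S hS0) φ := by
        refine lipschitzWith_of_nnnorm_fderiv_le (𝕜 := ℝ) (h.contDiff.differentiable (by simp))
          fun t => ?_
        have := (ContDiffMapSupportedIn.norm_iteratedFDeriv_apply_le_seminorm_top ℝ (f := φ)
          (x := t) (i := 1)).trans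
          (Seminorm.le_finset_sup_apply (p := fun i => N[ℝ]_{K, (⊤ : ℕ∞), i}) (x := φ) (i := 1)
            (s := {0, 1}) (by simp))
        rw [norm_iteratedFDeriv_one] at this
        exact this
      refine (h.norm_lineAction_le hf hg h0 h1).trans (le_of_eq ?_)
      simp only [NNReal.coe_mk]
      ring
  choose T hT using key
  exact ⟨TestFunction.limitCLM ℝ (fun φ => lineAction f g φ) T fun K hK φ => (hT K hK φ).symm,
    ⟨hf, hg, hg0⟩, fun φ => rfl⟩

/-! ### The subtransfer operator preserves `𝔏(I_1)` -/

section
variable {S : Finset ℤ} {b δ : ℝ} (h0 : (0 : ℤ) ∈ S) (hb : b ≤ 1) (hδ : 0 < δ)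
  (hS : ∀ j ∉ S, ∀ z x : ℝ, |z| < 1 → |x| ≤ b → δ * |(j : ℝ)| ≤ |z + 2 * j - x|)
include h0 hb hδ hS

theorem integrable_cotKer_integral {p : ℝ → ℂ} (hp : IntegrableOn p (Ioo (-1) 1)) :
    Integrable ((Icc (-b) b).indicator fun x => ∫ z in Ioo (-1 : ℝ) 1, (cotKer S z x : ℂ) * p z) := by
  have h1 := (integrable_cotKer_prod h0 hb hδ hS (φ := (Icc (-b) b).indicator 1)
    (measurable_one.indicator measurableSet_Icc)
    ((integrable_indicator_iff measurableSet_Icc).2 (integrableOn_const (by simp)))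
    (fun t ht => indicator_of_notMem (fun hc : t ∈ Icc (-b) b => ht.not_ge (abs_le.2 hc)) _) hp).integral_prod_right
  refine h1.congr (Eventually.of_forall fun x => ?_)
  by_cases hx : x ∈ Icc (-b) b
  · simp [hx]
  · simp [hx]

/-- Periodicity folds the integral onto `]-1, 1[`. The translates in `S`, which may be singular
there, remain Hilbert transforms, and all the others combine into an integral operator with bounded
kernel. -/
theorem UnitTest.integral_cotSum_mul {φ : ℝ → ℝ} {a : ℝ} (h : UnitTest φ a) (hab : a ≤ b)
    {η : ℝ → ℂ} (hη : Integrable η) :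
    ∫ z, (cotSum φ z : ℂ) * η z =
      ∑ j ∈ S, (∫ z in Ioo (-1 : ℝ) 1, (hilbert φ (z + 2 * j) : ℂ) * perSum η z) -
      (∑ j ∈ S, (hilbert φ (2 * j) : ℂ)) * (∫ z, η z) +
      (Real.pi⁻¹ : ℂ) * ∫ x, (φ x : ℂ) * ∫ z in Ioo (-1 : ℝ) 1, (cotKer S z x : ℂ) * perSum η z := by
  obtain ⟨C, hC0, hC⟩ := h.exists_cotSum_bound
  obtain ⟨B, hB0, hB⟩ := h.exists_hilbert_bound
  have hp := integrableOn_perSum hη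
  have hp1 : ∫ z in Ioo (-1 : ℝ) 1, perSum η z = ∫ z, η z := by
    have := integral_periodic_mul hη (E := fun _ => 1) (C := 1) measurable_const (by simp)
      (fun _ => rfl)
    simpa using this.symm
  have hzero : ∀ t, b < |t| → φ t = 0 := fun t ht => h.zero t (hab.trans ht.le)
  have hφ := h.contDiff.continuous.measurable
  have i1 : ∀ j ∈ S, IntegrableOn (fun z => (hilbert φ (z + 2 * j) : ℂ) * perSum η z)
      (Ioo (-1) 1) := fun j _ =>
    hp.bdd_mul (c := B) (Complex.measurable_ofReal.comp
      (h.measurable_hilbert.comp (measurable_add_const _))).aestronglyMeasurable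
      (Eventually.of_forall fun z => by simpa [Complex.norm_real] using hB _)
  have i2 : IntegrableOn (fun z => ((∫ x, φ x * cotKer S z x : ℝ) : ℂ) * perSum η z)
      (Ioo (-1) 1) := by
    refine (integrable_cotKer_prod h0 hb hδ hS hφ h.integrable hzero hp).integral_prod_left.congr
      (Eventually.of_forall fun z => ?_)
    simp only
    rw [integral_mul_const]
    exact congrArg (· * perSum η z) integral_ofReal
  have i3 : IntegrableOn (fun z => (∑ j ∈ S, (hilbert φ (2 * j) : ℂ)) * perSum η z) (Ioo (-1) 1) :=
    hp.const_mul _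
  have i4 : IntegrableOn (fun z => ∑ j ∈ S, (hilbert φ (z + 2 * j) : ℂ) * perSum η z -
      (∑ j ∈ S, (hilbert φ (2 * j) : ℂ)) * perSum η z) (Ioo (-1) 1) :=
    (integrable_finsetSum _ i1).sub i3
  rw [integral_periodic_mul hη h.measurable_cotSum hC h.cotSum_periodic,
    ← integral_cotKer_swap h0 hb hδ hS hφ h.integrable hzero hp, ← hp1, ← integral_const_mul,
    ← integral_const_mul, ← integral_finsetSum _ i1, ← integral_sub (integrable_finsetSum _ i1) i3,
    ← integral_add i4 (i2.const_mul _)]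
  refine setIntegral_congr_fun measurableSet_Ioo fun z hz => ?_
  rw [h.cotSum_eq h0 hb hδ hS hab (abs_lt.2 hz)]
  push_cast
  rw [Finset.sum_sub_distrib, ← Finset.sum_mul]
  ring

end

theorem integral_ofReal_mul_perSum {φ : ℝ → ℝ} {a : ℝ} (h : UnitTest φ a) {k : ℝ → ℂ}
    (hk : Integrable k) : ∫ x, (periodize φ x : ℂ) * k x =
      ∫ x, (φ x : ℂ) * (Ioo (-1) 1).indicator (perSum k) x := by
  obtain ⟨B, hB0, -, hB⟩ := h.exists_tentTest_bound
  rw [integral_periodic_mul hk h.continuous_periodize.measurable hB (periodize_periodic φ),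
    ← integral_indicator measurableSet_Ioo]
  refine integral_congr_ae (Eventually.of_forall fun x => ?_)
  simp only
  by_cases hx : x ∈ Ioo (-1 : ℝ) 1
  · rw [indicator_of_mem hx, indicator_of_mem hx, h.periodize_eq (abs_le.2 ⟨hx.1.le, hx.2.le⟩)]
  · rw [indicator_of_notMem hx, indicator_of_notMem hx, mul_zero]

theorem integral_indicator_comp_sub (H : ℝ → ℂ) (p : ℝ → ℂ) (c : ℝ) :
    ∫ z in Ioo (-1 : ℝ) 1, H (z + c) * p z =
      ∫ z, H z * (Ioo (-1) 1).indicator p (z - c) := by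
  rw [← integral_indicator measurableSet_Ioo, ← integral_sub_right_eq_self _ c]
  refine integral_congr_ae (Eventually.of_forall fun z => ?_)
  simp only
  by_cases hz : z - c ∈ Ioo (-1 : ℝ) 1
  · rw [indicator_of_mem hz, indicator_of_mem hz, sub_add_cancel]
  · rw [indicator_of_notMem hz, indicator_of_notMem hz, mul_zero]

/-- The extension of `T₁u` is built explicitly. The periodized mean-zero part, cut off to `]-1, 1[`
and translated by the indices in `S`, goes into the new `g'`; the bounded kernel produces an
integrable function, which goes into `f'`. -/
theorem exists_isSubtransfer {u : 𝓓'(symmInterval 1, ℂ)} (hu : u ∈ Lspace (symmInterval 1)) :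
    ∃ v ∈ Lspace (symmInterval 1), IsSubtransfer u v := by
  obtain ⟨f, g, hfg, hu⟩ := hu
  have hfg' := hfg
  obtain ⟨hf, hg, hg0⟩ := hfg
  set k := involution f with hk
  set η := involution g with hη
  have hki : Integrable k := integrable_involution hf
  have hηi : Integrable η := integrable_involution hg
  have hη0 : ∫ z, η z = 0 := by rw [hη, integral_involution, hg0]
  -- These are the translates whose singularity can reach the closure of `I_1`. For `|j| ≥ 2` one
  -- has `|z + 2j - x| ≥ 2|j| - 2 ≥ |j|`.
  set S : Finset ℤ := {-1, 0, 1} with hSdef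
  have h0 : (0 : ℤ) ∈ S := by simp [hSdef]
  have hS : ∀ j ∉ S, ∀ z x : ℝ, |z| < 1 → |x| ≤ 1 → 1 * |(j : ℝ)| ≤ |z + 2 * j - x| := by
    intro j hj z x hz hx
    have hj2 : (2 : ℝ) ≤ |(j : ℝ)| := by
      have : 2 ≤ |j| := by
        simp only [hSdef, Finset.mem_insert, Finset.mem_singleton, not_or] at hj
        rcases abs_cases j with ⟨e, _⟩ | ⟨e, _⟩ <;> omega
      exact_mod_cast this
    have h1 := abs_sub_abs_le_abs_sub (2 * j : ℝ) (x - z)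
    have h2 := abs_sub x z
    rw [abs_mul, abs_two] at h1
    rw [show z + 2 * (j : ℝ) - x = 2 * j - (x - z) by ring]
    linarith
  set p := perSum η with hp
  have hpi : IntegrableOn p (Ioo (-1) 1) := integrableOn_perSum hηi
  set q := (Ioo (-1 : ℝ) 1).indicator p with hq
  have hqi : Integrable q := (integrable_indicator_iff measurableSet_Ioo).2 hpi
  have hqj : ∀ j : ℤ, Integrable fun x => q (x - 2 * j) := fun j => hqi.comp_sub_right _
  set W : ℝ → ℂ := (Icc (-1) 1).indicator fun x => ∫ z in Ioo (-1 : ℝ) 1, (cotKer S z x : ℂ) * p z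
    with hW
  have hWi : Integrable W := integrable_cotKer_integral h0 le_rfl one_pos hS hpi
  have hki' : Integrable ((Ioo (-1 : ℝ) 1).indicator (perSum k)) :=
    (integrable_indicator_iff measurableSet_Ioo).2 (integrableOn_perSum hki)
  have hq0 : ∫ x, q x = 0 := by
    have := integral_periodic_mul hηi (E := fun _ => 1) (C := 1) measurable_const (by simp)
      (fun _ => rfl)
    rw [hq, integral_indicator measurableSet_Ioo]
    simpa [hη0] using this.symm
  -- The sign of `W` comes from the minus sign in `⟨φ, Hg⟩ = -⟨Hφ, g⟩`.
  set f' : ℝ → ℂ := fun x => (Ioo (-1 : ℝ) 1).indicator (perSum k) x - k x - (Real.pi⁻¹ : ℂ) * W x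
    with hf'
  set g' : ℝ → ℂ := fun x => ∑ j ∈ S, q (x - 2 * j) - η x with hg'
  have hadm : Admissible f' g' := by
    refine ⟨(hki'.sub hki).sub (hWi.const_mul _),
      (integrable_finsetSum _ fun j _ => hqj j).sub hηi, ?_⟩
    rw [integral_sub (integrable_finsetSum _ fun j _ => hqj j) hηi,
      integral_finsetSum _ fun j _ => hqj j, hη0, sub_zero]
    refine Finset.sum_eq_zero fun j _ => ?_
    rw [integral_sub_right_eq_self q, hq0]
  obtain ⟨v, hv⟩ := exists_represents hadm
  refine ⟨v, ⟨f', g', hv⟩, f, g, ⟨hfg', hu⟩, fun φ => ?_⟩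
  obtain ⟨a, h⟩ := exists_unitTest φ
  rw [hv.2 φ, sigmaAction, periodizedAction, lineAction, lineAction]
  obtain ⟨C, hC0, hC⟩ := h.exists_cotSum_bound
  have e3 : ∫ z, (modHilbert (periodize φ) z : ℂ) * η z = ∫ z, (cotSum φ z : ℂ) * η z := by
    have e : ∀ z, (modHilbert (periodize φ) z : ℂ) * η z =
        (cotSum φ z : ℂ) * η z + (modHilbert (periodize φ) 0 : ℂ) * η z := by
      intro z
      simp only [cotSum]
      push_cast
      ring
    simp only [e]
    rw [integral_add (UnitTest.integrable_ofReal_mul hηi h.measurable_cotSum hC)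
      (hηi.const_mul _), integral_const_mul, hη0, mul_zero, add_zero]
  rw [e3, h.integral_cotSum_mul h0 le_rfl one_pos hS h.lt_one.le hηi, hη0, mul_zero, sub_zero,
    integral_ofReal_mul_perSum h hki]
  have j1 := h.integrable_mul_left hki'.integrableOn
  have j2 := h.integrable_mul_left hki.integrableOn
  have j3 := h.integrable_mul_left hWi.integrableOn
  have j4 : ∀ j : ℤ, Integrable fun x => (hilbert φ x : ℂ) * q (x - 2 * j) :=
    fun j => h.integrable_hilbert_mul (hqj j)
  have j5 := h.integrable_hilbert_mul hηi
  have e1 : ∫ x, (φ x : ℂ) * f' x = (∫ x, (φ x : ℂ) * (Ioo (-1 : ℝ) 1).indicator (perSum k) x) -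
      (∫ x, (φ x : ℂ) * k x) - (Real.pi⁻¹ : ℂ) * ∫ x, (φ x : ℂ) * W x := by
    have j6 : Integrable fun x => (φ x : ℂ) * (Ioo (-1 : ℝ) 1).indicator (perSum k) x -
      (φ x : ℂ) * k x := j1.sub j2
    rw [← integral_const_mul, ← integral_sub j1 j2, ← integral_sub j6 (j3.const_mul _)]
    refine integral_congr_ae (Eventually.of_forall fun x => ?_)
    simp only [hf']
    ring
  have e2 : ∫ x, (hilbert φ x : ℂ) * g' x =
      ∑ j ∈ S, (∫ x, (hilbert φ x : ℂ) * q (x - 2 * j)) - ∫ x, (hilbert φ x : ℂ) * η x := by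
    rw [← integral_finsetSum _ fun j _ => j4 j,
      ← integral_sub (integrable_finsetSum _ fun j _ => j4 j) j5]
    refine integral_congr_ae (Eventually.of_forall fun x => ?_)
    simp only [hg', mul_sub, Finset.mul_sum]
  have e4 : ∫ x, (φ x : ℂ) * W x =
      ∫ x, (φ x : ℂ) * ∫ z in Ioo (-1 : ℝ) 1, (cotKer S z x : ℂ) * p z := by
    refine integral_congr_ae (Eventually.of_forall fun x => ?_)
    simp only
    by_cases hx : x ∈ Icc (-1 : ℝ) 1
    · rw [hW, indicator_of_mem hx]
    · rw [h.zero_of_one_le (by by_contra! hlt; exact hx ⟨(abs_lt.1 hlt).1.le, (abs_lt.1 hlt).2.le⟩),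
        Complex.ofReal_zero, zero_mul, zero_mul]
  have e5 : ∀ j : ℤ, ∫ z in Ioo (-1 : ℝ) 1, (hilbert φ (z + 2 * j) : ℂ) * p z =
      ∫ x, (hilbert φ x : ℂ) * q (x - 2 * j) := fun j =>
    integral_indicator_comp_sub (fun x => (hilbert φ x : ℂ)) p (2 * j)
  rw [e1, e2, e4, Finset.sum_congr rfl fun j _ => e5 j]
  ring

theorem isSubtransfer_subtransfer {u : 𝓓'(symmInterval 1, ℂ)}
    (hu : u ∈ Lspace (symmInterval 1)) : IsSubtransfer u (subtransfer u) := by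
  obtain ⟨v, -, hv⟩ := exists_isSubtransfer hu
  rw [subtransfer, dif_pos ⟨v, hv⟩]
  exact (⟨v, hv⟩ : ∃ v, IsSubtransfer u v).choose_spec

theorem subtransfer_mem {u : 𝓓'(symmInterval 1, ℂ)} (hu : u ∈ Lspace (symmInterval 1)) :
    subtransfer u ∈ Lspace (symmInterval 1) := by
  obtain ⟨v, hvm, hv⟩ := exists_isSubtransfer hu
  rwa [(isSubtransfer_subtransfer hu).unique hv]

theorem iterate_subtransfer_mem {u : 𝓓'(symmInterval 1, ℂ)} (hu : u ∈ Lspace (symmInterval 1))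
    (N : ℕ) : subtransfer^[N] u ∈ Lspace (symmInterval 1) := by
  induction N with
  | zero => exact hu
  | succ N ih =>
    rw [Function.iterate_succ_apply']
    exact subtransfer_mem ih

theorem isSubtransfer_iff {u : 𝓓'(symmInterval 1, ℂ)} (hu : u ∈ Lspace (symmInterval 1))
    (v : 𝓓'(symmInterval 1, ℂ)) : IsSubtransfer u v ↔ v = subtransfer u :=
  ⟨fun hv => hv.unique (isSubtransfer_subtransfer hu),
    fun e => e ▸ isSubtransfer_subtransfer hu⟩

/-! ### The subtransfer operator on functions -/

theorem hasSum_int_pairs {E : Type*} [NormedAddCommGroup E] {v : ℤ → E} {s : E} (h : HasSum v s)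
    (h0 : v 0 = 0) : HasSum (fun n : ℕ => v (n + 1) + v (-(n + 1))) s := by
  have h1 := h.nat_add_neg
  rw [h0, add_zero] at h1
  have h2 := (hasSum_nat_add_iff' 1).2 h1
  simpa [h0] using h2

/-- The subtransfer operator on functions on `]-1, 1[`. -/
noncomputable def transfer (f : ℝ → ℂ) : ℝ → ℂ :=
  perSum (involution ((Ioo (-1 : ℝ) 1).indicator f))

theorem integral_norm_involution (f : ℝ → ℂ) : ∫ x, ‖involution f x‖ = ∫ x, ‖f x‖ := by
  have e : ∀ x, ‖involution f x‖ = (1 / x ^ 2) • ‖f (-1 / x)‖ := fun x => by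
    rw [involution, norm_mul, Complex.norm_real, Real.norm_of_nonneg (by positivity), smul_eq_mul]
  simp only [e]
  exact integral_inversion fun x => ‖f x‖

theorem involution_indicator_eq_zero (f : ℝ → ℂ) {x : ℝ} (hx : |x| < 1) :
    involution ((Ioo (-1 : ℝ) 1).indicator f) x = 0 := by
  rcases eq_or_ne x 0 with rfl | h0
  · simp [involution]
  · rw [involution, indicator_of_notMem, mul_zero]
    intro hm
    have h1 : |(-1 / x)| < 1 := abs_lt.2 hm
    rw [abs_div, abs_neg, abs_one, div_lt_one (abs_pos.2 h0)] at h1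
    exact lt_asymm h1 hx

theorem involution_indicator_comp_neg {f : ℝ → ℂ} {σ : ℂ} (hf : ∀ x, f (-x) = σ * f x) (x : ℝ) :
    involution ((Ioo (-1 : ℝ) 1).indicator f) (-x) =
      σ * involution ((Ioo (-1 : ℝ) 1).indicator f) x := by
  have h : -(-1 / x) ∈ Ioo (-1 : ℝ) 1 ↔ (-1 / x) ∈ Ioo (-1 : ℝ) 1 := by
    rw [mem_Ioo, mem_Ioo, neg_lt_neg_iff, neg_lt, and_comm]
  simp only [involution, indicator, div_neg, h, hf, neg_sq]
  split_ifs <;> ring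

theorem transfer_comp_neg {f : ℝ → ℂ} {σ : ℂ} (hf : ∀ x, f (-x) = σ * f x) (x : ℝ) :
    transfer f (-x) = σ * transfer f x := by
  rw [transfer, perSum, perSum, ← tsum_mul_left, ← (Equiv.neg ℤ).tsum_eq]
  refine tsum_congr fun j => ?_
  rw [← involution_indicator_comp_neg hf]
  congr 1
  simp
  ring

theorem transfer_even {f : ℝ → ℂ} (hf : ∀ x, f (-x) = f x) (x : ℝ) :
    transfer f (-x) = transfer f x := by
  simpa using transfer_comp_neg (σ := 1) (by simpa using hf) x

section
variable {f : ℝ → ℂ} (hf : IntegrableOn f (Ioo (-1) 1))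
include hf

theorem integrable_involution_indicator :
    Integrable (involution ((Ioo (-1 : ℝ) 1).indicator f)) :=
  integrable_involution ((integrable_indicator_iff measurableSet_Ioo).2 hf)

theorem integrableOn_transfer : IntegrableOn (transfer f) (Ioo (-1) 1) :=
  integrableOn_perSum (integrable_involution_indicator hf)

/-- The involution is an isometry of `L¹` and the periodization is a contraction. -/
theorem integral_norm_transfer_le :
    ∫ x in Ioo (-1 : ℝ) 1, ‖transfer f x‖ ≤ ∫ x in Ioo (-1 : ℝ) 1, ‖f x‖ := by
  refine (integral_norm_perSum_le (integrable_involution_indicator hf)).trans (le_of_eq ?_)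
  rw [integral_norm_involution, ← integral_indicator measurableSet_Ioo]
  simp only [norm_indicator_eq_indicator_norm]

theorem iterate_transfer (n : ℕ) : IntegrableOn (transfer^[n] f) (Ioo (-1) 1) ∧
    ∫ x in Ioo (-1 : ℝ) 1, ‖transfer^[n] f x‖ ≤ ∫ x in Ioo (-1 : ℝ) 1, ‖f x‖ := by
  induction n with
  | zero => exact ⟨hf, le_rfl⟩
  | succ n ih =>
    rw [Function.iterate_succ_apply']
    exact ⟨integrableOn_transfer ih.1, (integral_norm_transfer_le ih.1).trans ih.2⟩

/-- The indices `n + 1` and `-(n + 1)` are paired, and oddness supplies the minus sign. The term `j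
= 0` vanishes because `-1/x` lies outside `]-1, 1[`. -/
theorem transfer_eq_oddTransfer (hodd : ∀ x, f (-x) = - f x) :
    ∀ᵐ x ∂(volume.restrict (Ioo (-1 : ℝ) 1)), transfer f x = oddTransfer f x := by
  filter_upwards [ae_summable_perSum (integrable_involution_indicator hf),
    ae_restrict_mem measurableSet_Ioo] with x hs hx
  have h := hasSum_int_pairs hs.hasSum (by
    rw [Int.cast_zero, mul_zero, add_zero]
    exact involution_indicator_eq_zero f (abs_lt.2 hx))
  refine h.tsum_eq.symm.trans (tsum_congr fun n => ?_)
  obtain ⟨p1, p2, p3, p4⟩ := inv_mem_unit hx.1 hx.2 n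
  have a1 : -1 / (x + 2 * ((n + 1 : ℤ) : ℝ)) = - (2 * n + 2 + x)⁻¹ := by
    push_cast
    rw [neg_div, one_div]
    ring_nf
  have a2 : -1 / (x + 2 * ((-(n + 1) : ℤ) : ℝ)) = (2 * n + 2 - x)⁻¹ := by
    push_cast
    rw [← neg_div_neg_eq, neg_neg, one_div]
    ring_nf
  have b1 : 1 / (x + 2 * ((n + 1 : ℤ) : ℝ)) ^ 2 = (2 * n + 2 + x)⁻¹ ^ 2 := by
    rw [← neg_sq (2 * (n : ℝ) + 2 + x)⁻¹, ← a1, div_pow]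
    norm_num
  have b2 : 1 / (x + 2 * ((-(n + 1) : ℤ) : ℝ)) ^ 2 = (2 * n + 2 - x)⁻¹ ^ 2 := by
    rw [← a2, div_pow]
    norm_num
  have m1 : -(2 * (n : ℝ) + 2 + x)⁻¹ ∈ Ioo (-1 : ℝ) 1 := ⟨by linarith, by linarith⟩
  have m2 : (2 * (n : ℝ) + 2 - x)⁻¹ ∈ Ioo (-1 : ℝ) 1 := ⟨by linarith, p2⟩
  rw [involution, involution, a1, a2, b1, b2, indicator_of_mem m1, indicator_of_mem m2, hodd, oddTerm, Complex.real_smul,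
    Complex.real_smul]
  ring

/-- The image of `1_{I_1} f` under the involution vanishes on `I_1`, so the missing index `j = 0`
makes no difference and the full periodization of `φ` may be used. -/
theorem UnitTest.tendsto_integral_tentTest_transfer {φ : ℝ → ℝ} {a : ℝ} (h : UnitTest φ a) :
    Tendsto (fun n => ∫ y in Ioo (-1 : ℝ) 1, (GaussHilbert.tentTest φ n y : ℂ) * f y) atTop
      (𝓝 (∫ y in Ioo (-1 : ℝ) 1, (φ y : ℂ) * transfer f y)) := by
  have e0 : ∀ (ψ : ℝ → ℂ) (f : ℝ → ℂ), ∫ y in Ioo (-1 : ℝ) 1, ψ y * f y =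
      ∫ y, ψ y * (Ioo (-1 : ℝ) 1).indicator f y := fun ψ f => by
    simp only [← integral_indicator measurableSet_Ioo, indicator_mul_right]
  have hi := (integrable_indicator_iff measurableSet_Ioo).2 hf
  have hJ := integrable_involution hi
  obtain ⟨B, hB0, -, hB⟩ := h.exists_tentTest_bound
  simp only [e0]
  refine (h.tendsto_integral_tentTest hi.integrableOn).trans (le_of_eq (congrArg 𝓝 ?_))
  rw [integral_comp_inversion_mul (fun z => ((periodize φ z - φ z : ℝ) : ℂ)), transfer,
    ← integral_ofReal_mul_perSum h hJ]
  refine integral_congr_ae (Eventually.of_forall fun x => ?_)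
  simp only
  rcases lt_or_ge |x| 1 with hx | hx
  · rw [involution_indicator_eq_zero f hx, mul_zero, mul_zero]
  · rw [h.zero_of_one_le hx, sub_zero]

end

theorem Dom.integrableOn_Icc {O : ℝ → ℂ} {c b : ℝ} (hO : Dom O (fun x => c * logKer 1 x))
    (hodd : ∀ x, O (-x) = - O x) (hb1 : b < 1) : IntegrableOn O (Icc (-b) b) := by
  rcases le_or_gt b 0 with hb | hb0
  · refine IntegrableOn.of_measure_zero (measure_mono_null (t := {0}) (fun x hx => ?_) (by simp))
    exact le_antisymm (hx.2.trans hb) (by linarith [hx.1])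
  have h1 : ContinuousOn O (Icc 0 b) := hO.continuousOn.mono fun x hx => ⟨hx.1, hx.2.trans_lt hb1⟩
  have h2 : ContinuousOn O (Icc (-b) 0) := by
    have h3 : ContinuousOn (fun x => - O (-x)) (Icc (-b) 0) :=
      (h1.comp continuous_neg.continuousOn fun x hx => ⟨by linarith [hx.2], by linarith [hx.1]⟩).neg
    exact h3.congr fun x _ => by simp only [hodd, neg_neg]
  refine ContinuousOn.integrableOn_Icc ?_
  rw [← Icc_union_Icc_eq_Icc (neg_nonpos.2 hb0.le) hb0.le]
  exact h2.union_of_isClosed h1 isClosed_Icc isClosed_Icc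

/-- The subtransfer of a locally integrable odd function. -/
theorem UnitTest.tendsto_integral_tentTest_odd {φ : ℝ → ℝ} {a : ℝ} (h : UnitTest φ a) {O : ℝ → ℂ}
    {c : ℝ} (hO : Dom O (fun x => c * logKer 1 x)) (hodd : ∀ x, O (-x) = - O x) :
    Tendsto (fun n => ∫ y in Ioo (-1 : ℝ) 1, (GaussHilbert.tentTest φ n y : ℂ) * O y) atTop
      (𝓝 (∫ y in Ioo (-1 : ℝ) 1, (φ y : ℂ) * oddTransfer O y)) := by
  obtain ⟨hb0, hb1⟩ := h.inv_two_sub_mem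
  set b := (2 - a)⁻¹ with hb
  -- Near the endpoints `O` need not be integrable. The approximating test functions live in `[-b,
  -- b]`, and for `|x| < a` all the points `1/(2n+2±x)` lie in `[-b, b]`, so the cut-off changes
  -- nothing.
  set O' := (Icc (-b) b).indicator O with hO'
  have hi : Integrable O' :=
    (integrable_indicator_iff measurableSet_Icc).2 (hO.integrableOn_Icc hodd hb1)
  have hodd' : ∀ x, O' (-x) = - O' x := fun x => by
    have : -x ∈ Icc (-b) b ↔ x ∈ Icc (-b) b := by
      rw [mem_Icc, mem_Icc, neg_le_neg_iff, neg_le, and_comm]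
    simp only [hO', indicator, this, hodd]
    split_ifs <;> simp
  have key := h.tendsto_integral_tentTest_transfer (f := O') hi.integrableOn
  refine Tendsto.congr (fun n => ?_) (key.trans (le_of_eq (congrArg 𝓝 ?_)))
  rotate_left
  · refine integral_congr_ae ?_
    filter_upwards [transfer_eq_oddTransfer hi.integrableOn hodd', ae_restrict_mem measurableSet_Ioo]
      with x hx hxI
    rw [hx]
    rcases le_or_gt a |x| with hax | hax
    · rw [h.zero x hax, Complex.ofReal_zero, zero_mul, zero_mul]
    · congr 1
      refine tsum_congr fun n => ?_
      have hn : (0 : ℝ) ≤ n := Nat.cast_nonneg n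
      rw [abs_lt] at hax
      obtain ⟨p1, p2, p3, p4⟩ := inv_mem_unit hxI.1 hxI.2 n
      have q1 : (2 * n + 2 - x)⁻¹ ≤ b := inv_anti₀ (by linarith [h.lt_one]) (by linarith)
      have q2 : (2 * n + 2 + x)⁻¹ ≤ b := inv_anti₀ (by linarith [h.lt_one]) (by linarith)
      have m1 : (2 * (n : ℝ) + 2 - x)⁻¹ ∈ Icc (-b) b := ⟨by linarith, q1⟩
      have m2 : (2 * (n : ℝ) + 2 + x)⁻¹ ∈ Icc (-b) b := ⟨by linarith, q2⟩
      rw [oddTerm, oddTerm, hO', indicator_of_mem m1, indicator_of_mem m2]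
  · refine setIntegral_congr_fun measurableSet_Ioo fun x _ => ?_
    by_cases hx : x ∈ Icc (-b) b
    · rw [hO', indicator_of_mem hx]
    · rw [(h.tentTest n).zero x, Complex.ofReal_zero, zero_mul, zero_mul]
      by_contra! hlt
      exact hx ⟨(abs_lt.1 hlt).1.le, (abs_lt.1 hlt).2.le⟩

/-! ### The subtransfer of the Hilbert transform of an even function -/

theorem integral_symm_mul_even {A : ℝ → ℂ} {g : ℝ → ℂ} (hg : ∀ x, g (-x) = g x)
    (hi : IntegrableOn (fun y => A y * g y) (Ioo (-1) 1)) :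
    ∫ y in Ioo (-1 : ℝ) 1, A y * g y =
      2⁻¹ * ∫ y in Ioo (-1 : ℝ) 1, (A y + A (-y)) * g y := by
  set F := (Ioo (-1 : ℝ) 1).indicator (fun y => A y * g y) with hF
  have hFi : Integrable F := (integrable_indicator_iff measurableSet_Ioo).2 hi
  have e : ∀ y, (Ioo (-1 : ℝ) 1).indicator (fun y => (A y + A (-y)) * g y) y = F y + F (-y) := by
    intro y
    have : -y ∈ Ioo (-1 : ℝ) 1 ↔ y ∈ Ioo (-1 : ℝ) 1 := by
      rw [mem_Ioo, mem_Ioo, neg_lt_neg_iff, neg_lt, and_comm]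
    simp only [hF, indicator, this, hg]
    split_ifs <;> ring
  rw [← integral_indicator measurableSet_Ioo, ← integral_indicator measurableSet_Ioo]
  simp only [e]
  rw [integral_add hFi hFi.comp_neg, integral_neg_eq_self F]
  ring

/-- On a compact part of `I_1` only the central translate is singular, at the price of a separation
constant that degenerates at the endpoints. -/
theorem separated_singleton (b : ℝ) : ∀ j ∉ ({0} : Finset ℤ), ∀ z x : ℝ, |z| < 1 →
    |x| ≤ b → (1 - b) * |(j : ℝ)| ≤ |z + 2 * j - x| := by
  intro j hj z x hz hx
  have hj1 : (1 : ℝ) ≤ |(j : ℝ)| := by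
    exact_mod_cast Int.one_le_abs (by simpa using hj)
  have h1 := abs_sub_abs_le_abs_sub (2 * j : ℝ) (x - z)
  have h2 := abs_sub x z
  rw [abs_mul, abs_two] at h1
  rw [show z + 2 * (j : ℝ) - x = 2 * j - (x - z) by ring]
  nlinarith [abs_nonneg x]

/-- Symmetrizing in `z` and pairing `j` with `-j` turns the poles of the cotangent kernel into those
of `oddTerm_logKer`. -/
theorem cotKer_add_cotKer_neg {z x : ℝ} (hz : |z| < 1) (hx : |x| < 1) :
    cotKer {0} z x + cotKer {0} (-z) x = oddTransfer (logKer z) x := by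
  wlog h0 : 0 ≤ z generalizing z
  · have := this (z := -z) (by rwa [abs_neg]) (by linarith)
    rw [neg_neg, add_comm] at this
    rw [this]
    refine tsum_congr fun j => ?_
    simp only [oddTerm, logKer_neg_left]
  have hx' := abs_lt.1 hx
  have hS := separated_singleton |x|
  have hs : ∀ z' : ℝ, |z'| < 1 → HasSum (fun j : ℤ => if j ∈ ({0} : Finset ℤ) then 0 else
      (z' + 2 * j - x)⁻¹ - (2 * j - x)⁻¹) (cotKer {0} z' x) := fun z' hz' =>
    (summable_cotKer (by simp) hx.le (by linarith) hS hz' le_rfl).hasSum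
  have h1 := (hasSum_int_pairs ((hs z hz).add (hs (-z) (by rwa [abs_neg]))) (by simp)).tsum_eq
  rw [← h1]
  refine tsum_congr fun j => ?_
  rw [oddTerm_logKer h0 (abs_lt.1 hz).2.le hx'.1 hx'.2]
  have n1 : ((j : ℤ) + 1) ∉ ({0} : Finset ℤ) := by simp; omega
  have n2 : -((j : ℤ) + 1) ∉ ({0} : Finset ℤ) := by simp; omega
  simp only [n1, n2, if_false, poleKer]
  have e : ∀ w v : ℝ, w = -v → w⁻¹ = - v⁻¹ := fun w v h => by rw [h, inv_neg]
  push_cast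
  rw [e (z + 2 * -((j : ℝ) + 1) - x) (2 * j + 2 - z + x) (by ring),
    e (-z + 2 * -((j : ℝ) + 1) - x) (2 * j + 2 + z + x) (by ring),
    e (2 * -((j : ℝ) + 1) - x) (2 * j + 2 + x) (by ring)]
  ring_nf

section
variable {φ : ℝ → ℝ} {a : ℝ} (h : UnitTest φ a) {g : ℝ → ℂ} (hg : IntegrableOn g (Ioo (-1) 1))
  (heven : ∀ x, g (-x) = g x)
include h hg heven

/-- An even density sees only the symmetrized kernel, which `cotKer_add_cotKer_neg` identifies; the
factor `1/2` comes from the symmetrization. -/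
theorem UnitTest.integral_mul_cotKer : ∫ x, (φ x : ℂ) *
    ∫ z in Ioo (-1 : ℝ) 1, (cotKer {0} z x : ℂ) * g z =
      2⁻¹ * ∫ x in Ioo (-1 : ℝ) 1, (φ x : ℂ) * oddTransfer (oddPot g) x := by
  have hS := separated_singleton a
  have hi := (integrable_cotKer_prod (by simp) h.lt_one.le (by linarith [h.lt_one]) hS
    h.contDiff.continuous.measurable h.integrable (fun t ht => h.zero t ht.le) hg).prod_left_ae
  rw [← integral_const_mul, ← integral_indicator measurableSet_Ioo]
  refine integral_congr_ae ?_
  filter_upwards [hi] with x hx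
  by_cases hxI : x ∈ Ioo (-1 : ℝ) 1
  swap
  · rw [indicator_of_notMem hxI, h.zero_of_one_le, Complex.ofReal_zero, zero_mul]
    by_contra! hlt
    exact hxI (abs_lt.1 hlt)
  have hx1 : |x| < 1 := abs_lt.2 hxI
  have hpot : oddTransfer (oddPot g) x =
      ∫ z in Ioo (-1 : ℝ) 1, ((oddTransfer (logKer z) x : ℝ) : ℂ) * g z := by
    have key := oddTransfer_integral ae_logKer_dom
      (fun x _ => (measurable_logKer x).aestronglyMeasurable) hg
    rcases le_total 0 x with h0 | h0
    · exact key ⟨h0, hxI.2⟩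
    · have := key (x := -x) ⟨by linarith, by linarith [hxI.1]⟩
      simp only [oddTransfer_neg, Complex.ofReal_neg, neg_mul, integral_neg, neg_inj] at this
      exact this
  rw [indicator_of_mem hxI, hpot, ← integral_const_mul, ← integral_const_mul]
  have e1 : ∀ z, (φ x : ℂ) * ((cotKer {0} z x : ℂ) * g z) = ((φ x * cotKer {0} z x : ℝ) : ℂ) * g z :=
    fun z => by push_cast; ring
  simp only [e1]
  rw [integral_symm_mul_even heven hx, ← integral_const_mul, ← integral_const_mul]
  refine setIntegral_congr_fun measurableSet_Ioo fun z hz => ?_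
  rw [← cotKer_add_cotKer_neg (abs_lt.2 hz) hx1]
  push_cast
  ring

omit heven in
theorem UnitTest.integral_logKer_swap :
    ∫ y in Ioo (-1 : ℝ) 1, ((∫ t, φ t * logKer y t : ℝ) : ℂ) * g y =
      ∫ t in Ioo (-1 : ℝ) 1, (φ t : ℂ) * oddPot g t := by
  obtain ⟨B, hB0, hB⟩ := h.exists_bound
  have ha := h.lt_one
  have ha0 := h.pos
  have hint : Integrable (fun q : ℝ × ℝ => ((φ q.2 * logKer q.1 q.2 : ℝ) : ℂ) * g q.1)
      ((volume.restrict (Ioo (-1 : ℝ) 1)).prod (volume.restrict (Ioo (-1 : ℝ) 1))) := by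
    have hg1 : Integrable (fun q : ℝ × ℝ => g q.1)
        ((volume.restrict (Ioo (-1 : ℝ) 1)).prod (volume.restrict (Ioo (-1 : ℝ) 1))) :=
      Integrable.comp_fst hg _
    refine hg1.bdd_mul (c := B * (2 / (1 - a ^ 2))) (Measurable.aestronglyMeasurable ?_) ?_
    · have := h.contDiff.continuous.measurable
      unfold logKer
      fun_prop
    · have : ∀ᵐ q ∂((volume.restrict (Ioo (-1 : ℝ) 1)).prod (volume.restrict (Ioo (-1 : ℝ) 1))),
          q.1 ∈ Ioo (-1 : ℝ) 1 :=
        Measure.quasiMeasurePreserving_fst.ae (ae_restrict_mem measurableSet_Ioo)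
      filter_upwards [this] with q hq
      have hpos : 0 < 1 - a ^ 2 := by nlinarith
      rw [Complex.norm_real, norm_mul]
      rcases le_or_gt a |q.2| with hq2 | hq2
      · rw [h.zero _ hq2, norm_zero, zero_mul]
        positivity
      · refine mul_le_mul (hB _) ?_ (norm_nonneg _) hB0
        have h1 : q.1 ^ 2 ≤ 1 := (sq_le_one_iff_abs_le_one _).2 (abs_lt.2 hq).le
        have h2 : q.2 ^ 2 ≤ a ^ 2 := sq_le_sq' (by linarith [(abs_lt.1 hq2).1]) (abs_lt.1 hq2).2.le
        have h3 : 1 - a ^ 2 ≤ 1 - q.1 ^ 2 * q.2 ^ 2 := by nlinarith [sq_nonneg q.2, sq_nonneg q.1]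
        rw [logKer, Real.norm_eq_abs, abs_div, abs_of_pos (hpos.trans_le h3)]
        refine div_le_div₀ zero_le_two ?_ hpos h3
        rw [abs_mul, abs_of_nonneg (by positivity : 0 ≤ 2 * q.1 ^ 2)]
        nlinarith [abs_nonneg q.2, sq_nonneg q.1]
  have key := integral_integral_swap (f := fun y t => ((φ t * logKer y t : ℝ) : ℂ) * g y) hint
  refine Eq.trans ?_ (key.trans ?_)
  · refine integral_congr_ae (Eventually.of_forall fun y => ?_)
    simp only
    have e : ∫ t in Ioo (-1 : ℝ) 1, ((φ t * logKer y t : ℝ) : ℂ) =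
        ((∫ t in Ioo (-1 : ℝ) 1, φ t * logKer y t : ℝ) : ℂ) := integral_ofReal
    rw [integral_mul_const, e, setIntegral_eq_integral_of_forall_compl_eq_zero]
    intro t ht
    rw [h.zero_of_one_le, zero_mul]
    by_contra! hlt
    exact ht (abs_lt.1 hlt)
  · refine integral_congr_ae (Eventually.of_forall fun t => ?_)
    simp only [oddPot]
    rw [← integral_const_mul]
    refine integral_congr_ae (Eventually.of_forall fun y => ?_)
    simp only
    push_cast
    ring

/-- The involuted density lives outside `I_1`, where the transform of `φ` is an ordinary integral.
Substituting `z = -1/y` and symmetrizing in `y` gives the poles `±1/y`, that is, the kernel `logKer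
y`. -/
theorem UnitTest.integral_hilbert_mul_involution :
    ∫ z, (hilbert φ z : ℂ) * involution ((Ioo (-1 : ℝ) 1).indicator g) z =
      ((2 * Real.pi)⁻¹ : ℝ) * ∫ t in Ioo (-1 : ℝ) 1, (φ t : ℂ) * oddPot g t := by
  obtain ⟨B, hB0, hB⟩ := h.exists_hilbert_bound
  rw [← integral_comp_inversion_mul (fun z => (hilbert φ z : ℂ))]
  have e : ∀ y, (hilbert φ (-1 / y) : ℂ) * (Ioo (-1 : ℝ) 1).indicator g y =
      (Ioo (-1 : ℝ) 1).indicator (fun y => (hilbert φ (-1 / y) : ℂ) * g y) y := fun y => by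
    rw [indicator_mul_right]
  simp only [e]
  have hm : Measurable fun y => hilbert φ (-1 / y) := h.measurable_hilbert.comp (by fun_prop)
  have hi : IntegrableOn (fun y => (hilbert φ (-1 / y) : ℂ) * g y) (Ioo (-1) 1) :=
    hg.bdd_mul (c := B) (Complex.measurable_ofReal.comp hm).aestronglyMeasurable
      (Eventually.of_forall fun z => by rw [Complex.norm_real]; exact hB _)
  rw [integral_indicator measurableSet_Ioo, integral_symm_mul_even heven hi,
    ← h.integral_logKer_swap hg, ← integral_const_mul, ← integral_const_mul]
  refine setIntegral_congr_ae measurableSet_Ioo ?_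
  have hne : ∀ᵐ y : ℝ, y ≠ 0 := by simp [ae_iff]
  filter_upwards [hne] with y hy hyI
  have hy1 : |y| < 1 := abs_lt.2 hyI
  have hgt : ∀ s : ℝ, |s| = |y|⁻¹ → a < |s| := fun s hs => by
    rw [hs]
    exact h.lt_one.trans ((one_lt_inv₀ (abs_pos.2 hy)).2 hy1)
  have hii : ∀ s : ℝ, |s| = |y|⁻¹ → Integrable fun t => φ t / (s - t) := fun s hs => by
    have hsa := hgt s hs
    refine (h.integrable.norm.const_mul (|s| - a)⁻¹).mono'
      (h.contDiff.continuous.measurable.div (by fun_prop)).aestronglyMeasurable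
      (Eventually.of_forall fun t => ?_)
    rcases le_or_gt a |t| with ht | ht
    · rw [h.zero t ht]
      simp
    · rw [norm_div, div_eq_inv_mul]
      have := abs_sub_abs_le_abs_sub s t
      exact mul_le_mul_of_nonneg_right (inv_anti₀ (by linarith)
        (by rw [Real.norm_eq_abs]; linarith)) (norm_nonneg _)
  have s1 : |(-1 / y)| = |y|⁻¹ := by rw [abs_div, abs_neg, abs_one, one_div]
  have s2 : |(-1 / -y)| = |y|⁻¹ := by rw [abs_div, abs_neg, abs_neg, abs_one, one_div]
  rw [h.hilbert_eq (hgt _ s1), h.hilbert_eq (hgt _ s2)]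
  have key : (∫ t, φ t / (-1 / y - t)) + ∫ t, φ t / (-1 / -y - t) = ∫ t, φ t * logKer y t := by
    rw [← integral_add (hii _ s1) (hii _ s2)]
    refine integral_congr_ae (Eventually.of_forall fun t => ?_)
    simp only
    rcases le_or_gt 1 |t| with ht | ht
    · rw [h.zero_of_one_le ht]
      simp
    · rw [logKer_eq_poleKer hy hy1.le ht, poleKer,
        show -1 / y - t = -(y⁻¹ + t) by rw [neg_div, one_div]; ring,
        show -1 / -y - t = y⁻¹ - t by rw [neg_div_neg_eq, one_div], div_neg]
      ring
  rw [← key]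
  push_cast
  rw [mul_inv]
  ring

/-- Up to the sign of the pairing, `H(1_{I_1} g)` is carried to `H(1_{I_1} Tg)` plus a combination
of two odd potentials. The first potential comes from the missing index `0`, the second from the
nonzero translates of the cotangent kernel. This is the source of the recursion in `oddPart`. -/
theorem UnitTest.tendsto_integral_hilbert_tentTest_even :
    Tendsto (fun n => ∫ y in Ioo (-1 : ℝ) 1, (hilbert (GaussHilbert.tentTest φ n) y : ℂ) * g y)
      atTop (𝓝 ((∫ y in Ioo (-1 : ℝ) 1, (hilbert φ y : ℂ) * transfer g y) -
        ((2 * Real.pi)⁻¹ : ℝ) * ((∫ y in Ioo (-1 : ℝ) 1, (φ y : ℂ) * oddPot g y) -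
          ∫ y in Ioo (-1 : ℝ) 1, (φ y : ℂ) * oddTransfer (oddPot (transfer g)) y))) := by
  have e0 : ∀ (ψ : ℝ → ℂ) (f : ℝ → ℂ), ∫ y in Ioo (-1 : ℝ) 1, ψ y * f y =
      ∫ y, ψ y * (Ioo (-1 : ℝ) 1).indicator f y := fun ψ f => by
    simp only [← integral_indicator measurableSet_Ioo, indicator_mul_right]
  have hi := (integrable_indicator_iff measurableSet_Ioo).2 hg
  have hJ := integrable_involution hi
  obtain ⟨C, hC0, hC⟩ := h.exists_cotSum_bound
  have hlim := h.tendsto_integral_hilbert_tentTest hi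
  simp only [← e0 (fun y => (hilbert (GaussHilbert.tentTest φ _) y : ℂ))] at hlim
  refine hlim.trans (le_of_eq (congrArg 𝓝 ?_))
  rw [integral_comp_inversion_mul
      (fun z => ((cotSum φ z - (hilbert φ z - hilbert φ 0) : ℝ) : ℂ))]
  have i3 := UnitTest.integrable_ofReal_mul hJ h.measurable_cotSum hC
  have i4 := h.integrable_hilbert_mul hJ
  have e2 : ∫ z, ((cotSum φ z - (hilbert φ z - hilbert φ 0) : ℝ) : ℂ) *
      involution ((Ioo (-1 : ℝ) 1).indicator g) z =
      (∫ z, (cotSum φ z : ℂ) * involution ((Ioo (-1 : ℝ) 1).indicator g) z) -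
        (∫ z, (hilbert φ z : ℂ) * involution ((Ioo (-1 : ℝ) 1).indicator g) z) +
        (hilbert φ 0 : ℂ) * ∫ z, involution ((Ioo (-1 : ℝ) 1).indicator g) z := by
    have i34 : Integrable fun z => (cotSum φ z : ℂ) * involution ((Ioo (-1 : ℝ) 1).indicator g) z -
      (hilbert φ z : ℂ) * involution ((Ioo (-1 : ℝ) 1).indicator g) z := i3.sub i4
    rw [← integral_sub i3 i4, ← integral_const_mul, ← integral_add i34 (hJ.const_mul _)]
    refine integral_congr_ae (Eventually.of_forall fun z => ?_)
    simp only
    push_cast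
    ring
  rw [e2, h.integral_cotSum_mul (by simp) h.lt_one.le (by linarith [h.lt_one])
    (separated_singleton a) le_rfl hJ, h.integral_hilbert_mul_involution hg heven]
  have e3 := h.integral_mul_cotKer (integrableOn_transfer hg) (transfer_even heven)
  rw [transfer] at e3
  rw [e3, transfer, Finset.sum_singleton, Finset.sum_singleton, Int.cast_zero, mul_zero]
  simp only [add_zero]
  push_cast
  rw [mul_inv]
  ring

end

/-! ### Existence almost everywhere of the valeur au point -/

theorem abs_inv_sq_add_sub_le {r A B : ℝ} (hr : 0 < r) (hA : r ≤ A) (hB : r ≤ B) (ε : ℝ) :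
    |(ε ^ 2 + A ^ 2)⁻¹ - (ε ^ 2 + B ^ 2)⁻¹| ≤ 2 / r ^ 3 * |A - B| := by
  have hA0 := hr.trans_le hA
  have hB0 := hr.trans_le hB
  have e : (ε ^ 2 + A ^ 2)⁻¹ - (ε ^ 2 + B ^ 2)⁻¹ =
      (A + B) / ((ε ^ 2 + A ^ 2) * (ε ^ 2 + B ^ 2)) * (B - A) := by
    field_simp
    ring
  rw [e, abs_mul, abs_sub_comm B A, abs_of_pos (by positivity)]
  refine mul_le_mul_of_nonneg_right ?_ (abs_nonneg _)
  calc (A + B) / ((ε ^ 2 + A ^ 2) * (ε ^ 2 + B ^ 2)) ≤ (A + B) / (A ^ 2 * B ^ 2) := by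
        gcongr <;> nlinarith [sq_nonneg ε]
    _ = 1 / (A * B ^ 2) + 1 / (A ^ 2 * B) := by field_simp
    _ ≤ 1 / (r * r ^ 2) + 1 / (r ^ 2 * r) := by gcongr
    _ = 2 / r ^ 3 := by field_simp; ring

/-- Away from the singularity the Poisson kernel and its Hilbert transform are small. -/
theorem exists_hilbert_far_bound {χ : ℝ → ℝ} {a x : ℝ} (hχ : UnitTest χ a)
    (h1 : ∀ᶠ t in 𝓝 x, χ t = 1) : ∃ C : ℝ, 0 ≤ C ∧ ∀ ε, 0 < ε →
      (∀ t, |(1 - χ t) * poisson x ε t| ≤ C * ε) ∧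
      Measurable (hilbert fun t => χ t * poisson x ε t) ∧
      ∀ t, |hilbert (fun t => χ t * poisson x ε t) t + conjPoisson x ε t| ≤ C * ε := by
  obtain ⟨r, hr, hball⟩ := Metric.eventually_nhds_iff.1 h1
  obtain ⟨K, hK⟩ := hχ.exists_lipschitz
  obtain ⟨B, hB0, hB⟩ := hχ.exists_bound
  -- The cut-off error `(1 - χ) P` is `π⁻¹ ε m`. Replacing `|t - x|` by its maximum with `r` changes
  -- nothing, since `1 - χ` vanishes within `r` of `x`; it makes the Lipschitz constant and the `L¹`
  -- norm of `m` bounded uniformly in `ε`.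
  set m : ℝ → ℝ → ℝ := fun ε t => (1 - χ t) * (ε ^ 2 + max |t - x| r ^ 2)⁻¹ with hm
  have hpi : Real.pi⁻¹ ≤ 1 := inv_le_one_of_one_le₀ (by linarith [Real.pi_gt_three])
  have e : ∀ ε t, (1 - χ t) * poisson x ε t = Real.pi⁻¹ * ε * m ε t := by
    intro ε t
    rcases lt_or_ge (dist t x) r with h | h
    · simp only [hm, hball h]
      ring
    · rw [Real.dist_eq] at h
      simp only [hm, poisson, max_eq_left h, sq_abs]
      rw [show (x - t) ^ 2 = (t - x) ^ 2 by ring]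
      ring
  have hw : ∀ t, |1 - χ t| ≤ 1 + B := fun t =>
    (abs_sub _ _).trans (by rw [abs_one]; linarith [hB t])
  have hinv : ∀ ε t : ℝ, (ε ^ 2 + max |t - x| r ^ 2)⁻¹ ≤ (r ^ 2)⁻¹ := fun ε t => by
    have : r ^ 2 ≤ max |t - x| r ^ 2 := by gcongr; exact le_max_right _ _
    exact inv_anti₀ (by positivity) (by nlinarith [sq_nonneg ε])
  have hinv0 : ∀ ε t : ℝ, 0 ≤ (ε ^ 2 + max |t - x| r ^ 2)⁻¹ := fun ε t => by positivity
  have hmb : ∀ ε t, |m ε t| ≤ (1 + B) * (r ^ 2)⁻¹ := fun ε t => by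
    rw [hm, abs_mul, abs_of_nonneg (hinv0 ε t)]
    exact mul_le_mul (hw t) (hinv ε t) (hinv0 ε t) (by positivity)
  set L : ℝ≥0 := K * NNReal.mk (r ^ 2)⁻¹ (by positivity) +
    NNReal.mk ((1 + B) * (2 / r ^ 3)) (by positivity) with hL
  have hmL : ∀ ε, LipschitzWith L (m ε) := fun ε => by
    refine LipschitzWith.of_dist_le_mul fun s t => ?_
    have h2 := abs_inv_sq_add_sub_le hr (le_max_right |s - x| r) (le_max_right |t - x| r) ε
    have h3 : |max |s - x| r - max |t - x| r| ≤ |s - t| := by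
      refine (abs_max_sub_max_le_abs _ _ _).trans ((abs_abs_sub_abs_le _ _).trans (le_of_eq ?_))
      congr 1
      ring
    have h4 := hK.dist_le_mul s t
    rw [Real.dist_eq, Real.dist_eq] at h4
    rw [Real.dist_eq, Real.dist_eq, hL]
    push_cast
    have e2 : m ε s - m ε t = -(χ s - χ t) * (ε ^ 2 + max |s - x| r ^ 2)⁻¹ +
        (1 - χ t) * ((ε ^ 2 + max |s - x| r ^ 2)⁻¹ - (ε ^ 2 + max |t - x| r ^ 2)⁻¹) := by
      simp only [hm]
      ring
    rw [e2]
    refine (abs_add_le _ _).trans ?_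
    rw [abs_mul, abs_mul, abs_neg, abs_of_nonneg (hinv0 ε s), add_mul]
    refine add_le_add ?_ ?_
    · refine (mul_le_mul h4 (hinv ε s) (hinv0 ε s) (by positivity)).trans (le_of_eq ?_)
      ring
    · refine (mul_le_mul (hw t) (h2.trans (mul_le_mul_of_nonneg_left h3 (by positivity)))
        (abs_nonneg _) (by positivity)).trans (le_of_eq ?_)
      ring
  set c := max 1 (r ^ 2)⁻¹ with hc
  have hint : ∀ ε, Integrable (m ε) ∧ ∫ t, |m ε t| ≤ (1 + B) * (1 + 1 / r ^ 2) * Real.pi := by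
    intro ε
    have hle : ∀ t, |m ε t| ≤ (1 + B) * (1 + 1 / r ^ 2) * Real.pi * poisson x 1 t := by
      intro t
      rw [hm, abs_mul, abs_of_nonneg (hinv0 ε t), poisson]
      have h5 : (ε ^ 2 + max |t - x| r ^ 2)⁻¹ ≤ (1 + 1 / r ^ 2) * (1 / (1 ^ 2 + (x - t) ^ 2)) := by
        have h6 : r ^ 2 ≤ max |t - x| r ^ 2 := by gcongr; exact le_max_right _ _
        have h7 : (x - t) ^ 2 ≤ max |t - x| r ^ 2 := by
          rw [← sq_abs (x - t), abs_sub_comm]; gcongr; exact le_max_left _ _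
        rw [mul_one_div, inv_eq_one_div, div_le_div_iff₀ (by positivity) (by positivity)]
        have h8 : 1 ≤ 1 / r ^ 2 * max |t - x| r ^ 2 := by
          rw [one_div, ← div_eq_inv_mul, one_le_div (by positivity)]; exact h6
        nlinarith [sq_nonneg ε, mul_nonneg (by positivity : 0 ≤ 1 / r ^ 2) (sq_nonneg ε)]
      refine (mul_le_mul (hw t) h5 (hinv0 ε t) (by positivity)).trans (le_of_eq ?_)
      field_simp
    have hi := (integrable_poisson one_pos x).const_mul ((1 + B) * (1 + 1 / r ^ 2) * Real.pi)
    have hmi : Integrable (m ε) :=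
      hi.mono' (hmL ε).continuous.aestronglyMeasurable (Eventually.of_forall hle)
    refine ⟨hmi, (integral_mono hmi.abs hi hle).trans (le_of_eq ?_)⟩
    rw [integral_const_mul, integral_poisson one_pos, mul_one]
  refine ⟨(1 + B) * (r ^ 2)⁻¹ + (2 * L + 2 * ((1 + B) * (1 + 1 / r ^ 2) * Real.pi)), by positivity,
    fun ε hε => ?_⟩
  have hLnn : (0 : ℝ) ≤ L := L.2
  have hc0 : Real.pi⁻¹ * ε ≤ ε := mul_le_of_le_one_left hε.le hpi
  have hcpos : 0 < Real.pi⁻¹ * ε := by positivity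
  have hA : 0 ≤ (1 + B) * (r ^ 2)⁻¹ := by positivity
  have hD : 0 ≤ (2 * (L : ℝ) + 2 * ((1 + B) * (1 + 1 / r ^ 2) * Real.pi)) := by positivity
  have e' : (fun t => χ t * poisson x ε t) =
      fun t => poisson x ε t + (-(Real.pi⁻¹ * ε)) * m ε t := by
    funext t
    rw [neg_mul, ← e]
    ring
  obtain ⟨KP, hKP⟩ := lipschitzWith_poisson hε x
  have hPi := integrable_poisson hε x
  have hmi' : Integrable fun t => (-(Real.pi⁻¹ * ε)) * m ε t := (hint ε).1.const_mul _
  have hmL' : LipschitzWith (NNReal.mk (Real.pi⁻¹ * ε) hcpos.le * L)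
      fun t => (-(Real.pi⁻¹ * ε)) * m ε t := by
    refine LipschitzWith.of_dist_le_mul fun s t => ?_
    have := (hmL ε).dist_le_mul s t
    rw [Real.dist_eq] at this
    rw [Real.dist_eq, ← mul_sub, abs_mul, abs_neg, abs_of_pos hcpos]
    refine (mul_le_mul_of_nonneg_left this hcpos.le).trans (le_of_eq ?_)
    push_cast
    ring
  have eH : ∀ t, hilbert (fun t => χ t * poisson x ε t) t =
      -conjPoisson x ε t + (-(Real.pi⁻¹ * ε)) * hilbert (m ε) t := by
    intro t
    rw [e', hilbert_add hPi hKP hmi' hmL', hilbert_const_mul (hint ε).1 (hmL ε),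
      hilbert_poisson hε, conjPoisson]
    congr 1
    rw [show (t - x) ^ 2 = (x - t) ^ 2 by ring, ← neg_sub x t]
    ring
  refine ⟨fun t => ?_, ?_, fun t => ?_⟩
  · rw [e, abs_mul, abs_of_pos hcpos, mul_comm]
    exact mul_le_mul ((hmb ε t).trans (le_add_of_nonneg_right hD)) hc0 hcpos.le (by positivity)
  · have : hilbert (fun t => χ t * poisson x ε t) =
        fun t => -conjPoisson x ε t + (-(Real.pi⁻¹ * ε)) * hilbert (m ε) t := funext eH
    rw [this]
    have hmm := measurable_hilbert (hint ε).1 (hmL ε)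
    unfold conjPoisson
    fun_prop
  · rw [eH, neg_add_cancel_comm, abs_mul, abs_neg, abs_of_pos hcpos, mul_comm]
    refine mul_le_mul ?_ hc0 hcpos.le (by positivity)
    refine (abs_hilbert_le (hint ε).1 (hmL ε) t).trans ?_
    have := (hint ε).2
    linarith

theorem integrable_conjPoisson_mul {ε : ℝ} (hε : 0 < ε) (x : ℝ) {g : ℝ → ℂ} (hg : Integrable g) :
    Integrable fun t => (conjPoisson x ε t : ℂ) * g t := by
  refine UnitTest.integrable_ofReal_mul hg ?_ (abs_conjPoisson_le hε x)
  unfold conjPoisson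
  fun_prop

/-- Up to errors `O(ε)`, the kernel `χP` may be replaced by `P` and its Hilbert transform by minus
the conjugate Poisson kernel. The first gives `F x` at a Lebesgue point and the second the conjugate
function. Since `F` is only locally integrable, countably many cut-offs are used, so that the
Lebesgue condition holds for all of them almost everywhere. -/
theorem hasPev_of_isLebesguePoint {u : 𝓓'(symmInterval 1, ℂ)} {F g : ℝ → ℂ} {x : ℝ} {c : ℂ}
    (hx : x ∈ Ioo (-1 : ℝ) 1) (hF : ∀ b < 1, IntegrableOn F (Icc (-b) b)) (hg : Integrable g)
    (hu : ∀ φ : 𝓓(symmInterval 1, ℝ), u φ =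
      (∫ t in Ioo (-1 : ℝ) 1, (φ t : ℂ) * F t) - ∫ t, (hilbert φ t : ℂ) * g t)
    (hL : ∀ n : ℕ, IsLebesguePoint
      ((Icc (-(1 - 1 / ((n : ℝ) + 1))) (1 - 1 / ((n : ℝ) + 1))).indicator F) x)
    (hc : Tendsto (fun ε => ∫ t, (conjPoisson x ε t : ℂ) * g t) (𝓝[>] 0) (𝓝 c)) :
    HasPev u x (F x + c) := by
  refine ⟨hx, fun χ h1 => ?_⟩
  obtain ⟨a, hχ⟩ := exists_unitTest χ
  obtain ⟨C, hC0, hC⟩ := exists_hilbert_far_bound hχ h1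
  have hx1 : |x| < 1 := abs_lt.2 hx
  obtain ⟨n, hn⟩ := exists_nat_one_div_lt (K := ℝ) (ε := 1 - max a |x|)
    (sub_pos.2 (max_lt hχ.lt_one hx1))
  set b : ℝ := 1 - 1 / ((n : ℝ) + 1) with hb
  have hab : a < b := by linarith [le_max_left a |x|]
  have hxb : |x| < b := by linarith [le_max_right a |x|]
  have hb1 : b < 1 := by
    have : (0 : ℝ) < 1 / ((n : ℝ) + 1) := by positivity
    linarith
  set G := (Icc (-b) b).indicator F with hG
  have hGi : Integrable G := (integrable_indicator_iff measurableSet_Icc).2 (hF b hb1)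
  have hGx : G x = F x :=
    indicator_of_mem (show x ∈ Icc (-b) b from ⟨(abs_lt.1 hxb).1.le, (abs_lt.1 hxb).2.le⟩) _
  have hPG : ∀ ε, 0 < ε → Integrable fun t => (poisson x ε t : ℂ) * G t := fun ε hε =>
    UnitTest.integrable_ofReal_mul hGi (continuous_poisson x ε).measurable
      (C := (Real.pi * ε)⁻¹) fun t => by
        rw [abs_of_nonneg (poisson_nonneg hε x t)]; exact poisson_le hε x t
  have hlim := (tendsto_poisson_integral (hL n) hGi.1 (hPG 1 one_pos)).add hc
  simp only [← hb, ← hG, hGx] at hlim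
  have herr : Tendsto (fun ε : ℝ => C * ε * (∫ t, ‖G t‖) + C * ε * ∫ t, ‖g t‖) (𝓝[>] 0) (𝓝 0) := by
    have : Tendsto (fun ε : ℝ => C * ε * (∫ t, ‖G t‖) + C * ε * ∫ t, ‖g t‖) (𝓝 0)
        (𝓝 (C * 0 * (∫ t, ‖G t‖) + C * 0 * ∫ t, ‖g t‖)) := by
      refine Continuous.tendsto ?_ 0
      fun_prop
    simp only [mul_zero, zero_mul, add_zero] at this
    exact this.mono_left nhdsWithin_le_nhds
  refine hlim.congr_dist (squeeze_zero' (Eventually.of_forall fun _ => dist_nonneg) ?_ herr)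
  filter_upwards [self_mem_nhdsWithin] with ε hε
  have hε : 0 < ε := hε
  obtain ⟨c1, c2, c3⟩ := hC ε hε
  rw [hu]
  have hcoe : ∀ t, poissonCutoff χ x ε t = χ t * poisson x ε t := fun t => rfl
  have hcoe' : ⇑(poissonCutoff χ x ε) = fun t => χ t * poisson x ε t := rfl
  have i1 : Integrable fun t => (((1 - χ t) * poisson x ε t : ℝ) : ℂ) * G t :=
    UnitTest.integrable_ofReal_mul hGi
      ((measurable_const.sub hχ.contDiff.continuous.measurable).mul
        (continuous_poisson x ε).measurable) c1
  have i3 := integrable_conjPoisson_mul hε x hg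
  have i2 : Integrable fun t => ((hilbert (fun t => χ t * poisson x ε t) t + conjPoisson x ε t : ℝ)
      : ℂ) * g t := by
    refine UnitTest.integrable_ofReal_mul hg ?_ c3
    unfold conjPoisson at *
    fun_prop
  have e1 : ∫ t in Ioo (-1 : ℝ) 1, (poissonCutoff χ x ε t : ℂ) * F t =
      (∫ t, (poisson x ε t : ℂ) * G t) - ∫ t, (((1 - χ t) * poisson x ε t : ℝ) : ℂ) * G t := by
    rw [← integral_sub (hPG ε hε) i1, ← integral_indicator measurableSet_Ioo]
    refine integral_congr_ae (Eventually.of_forall fun t => ?_)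
    simp only [hcoe]
    rcases le_or_gt a |t| with ht | ht
    · have e0 : (Ioo (-1 : ℝ) 1).indicator (fun t => ((χ t * poisson x ε t : ℝ) : ℂ) * F t) t = 0 := by
        simp [indicator, hχ.zero t ht]
      rw [e0, hχ.zero t ht]
      push_cast
      ring
    · have ht' := abs_lt.1 ht
      rw [indicator_of_mem (show t ∈ Ioo (-1 : ℝ) 1 from ⟨by linarith, by linarith⟩), hG,
        indicator_of_mem (show t ∈ Icc (-b) b from ⟨by linarith, by linarith⟩)]
      push_cast
      ring
  have e2 : ∫ t, (hilbert (poissonCutoff χ x ε) t : ℂ) * g t =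
      (∫ t, ((hilbert (fun t => χ t * poisson x ε t) t + conjPoisson x ε t : ℝ) : ℂ) * g t) -
        ∫ t, (conjPoisson x ε t : ℂ) * g t := by
    rw [← integral_sub i2 i3]
    refine integral_congr_ae (Eventually.of_forall fun t => ?_)
    simp only [hcoe']
    push_cast
    ring
  have b1 : ‖∫ t, (((1 - χ t) * poisson x ε t : ℝ) : ℂ) * G t‖ ≤ C * ε * ∫ t, ‖G t‖ := by
    rw [← integral_const_mul]
    refine norm_integral_le_of_norm_le (hGi.norm.const_mul _) (Eventually.of_forall fun t => ?_)
    rw [norm_mul, Complex.norm_real]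
    exact mul_le_mul_of_nonneg_right (c1 t) (norm_nonneg _)
  have b2 : ‖∫ t, ((hilbert (fun t => χ t * poisson x ε t) t + conjPoisson x ε t : ℝ) : ℂ) * g t‖ ≤
      C * ε * ∫ t, ‖g t‖ := by
    rw [← integral_const_mul]
    refine norm_integral_le_of_norm_le (hg.norm.const_mul _) (Eventually.of_forall fun t => ?_)
    rw [norm_mul, Complex.norm_real]
    exact mul_le_mul_of_nonneg_right (c3 t) (norm_nonneg _)
  rw [e1, e2, dist_eq_norm]
  refine le_trans (le_of_eq ?_) ((norm_add_le _ _).trans (add_le_add b1 b2))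
  congr 1
  ring

theorem exists_cutoff {x : ℝ} (hx : x ∈ Ioo (-1 : ℝ) 1) :
    ∃ χ : 𝓓(symmInterval 1, ℝ), ∀ᶠ t in 𝓝 x, χ t = 1 := by
  have hx1 : |x| < 1 := abs_lt.2 hx
  let f : ContDiffBump x := ⟨(1 - |x|) / 3, (1 - |x|) / 2, by linarith, by linarith⟩
  have h : UnitTest f ((1 + |x|) / 2) := by
    refine ⟨f.contDiff, by positivity, by linarith, fun t ht => f.zero_of_le_dist ?_⟩
    rw [Real.dist_eq]
    have := abs_sub_abs_le_abs_sub t x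
    show (1 - |x|) / 2 ≤ _
    linarith
  exact ⟨h.toTest, f.eventuallyEq_one⟩

theorem HasPev.unique {u : 𝓓'(symmInterval 1, ℂ)} {x : ℝ} {c c' : ℂ} (h : HasPev u x c)
    (h' : HasPev u x c') : c = c' := by
  obtain ⟨χ, hχ⟩ := exists_cutoff h.1
  exact tendsto_nhds_unique (h.2 χ hχ) (h'.2 χ hχ)

theorem HasPev.pev_eq {u : 𝓓'(symmInterval 1, ℂ)} {x : ℝ} {c : ℂ} (h : HasPev u x c) :
    pev u x = c := by
  have hex : ∃ c, HasPev u x c := ⟨c, h⟩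
  rw [pev, dif_pos hex]
  exact hex.choose_spec.unique h

theorem ae_hasPev {u : 𝓓'(symmInterval 1, ℂ)} {F g : ℝ → ℂ}
    (hF : ∀ b < 1, IntegrableOn F (Icc (-b) b)) (hg : Integrable g)
    (hu : ∀ φ : 𝓓(symmInterval 1, ℝ), u φ =
      (∫ t in Ioo (-1 : ℝ) 1, (φ t : ℂ) * F t) - ∫ t, (hilbert φ t : ℂ) * g t) :
    ∃ h : ℝ → ℂ, AEMeasurable h ∧
      (∀ c > 0, volume {x | c < ‖h x‖} ≤ ENNReal.ofReal (64 * (∫ t, ‖g t‖) / c)) ∧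
      ∀ᵐ x ∂(volume.restrict (Ioo (-1 : ℝ) 1)), HasPev u x (F x + h x) := by
  obtain ⟨h, hm, hc, hw⟩ := exists_conjugate hg
  refine ⟨h, hm, hw, ?_⟩
  have hL : ∀ᵐ x : ℝ, ∀ n : ℕ, IsLebesguePoint
      ((Icc (-(1 - 1 / ((n : ℝ) + 1))) (1 - 1 / ((n : ℝ) + 1))).indicator F) x := by
    refine ae_all_iff.2 fun n => ae_isLebesguePoint (Integrable.locallyIntegrable ?_)
    refine (integrable_indicator_iff measurableSet_Icc).2 (hF _ ?_)
    have : (0 : ℝ) < 1 / ((n : ℝ) + 1) := by positivity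
    linarith
  filter_upwards [ae_restrict_of_ae hc, ae_restrict_of_ae hL, ae_restrict_mem measurableSet_Ioo]
    with x h1 h2 hx
  exact hasPev_of_isLebesguePoint hx hF hg hu h2 h1

/-! ### Decay in `L¹` on odd functions -/

/-- A smooth compactly supported approximation is averaged with its reflection. The sign `σ` lets
one argument serve odd and even functions. -/
theorem exists_lipschitz_approx {f : ℝ → ℂ} (hf : Integrable f) {σ : ℂ} (hσ : σ * σ = 1)
    (hsymm : ∀ x, f (-x) = σ * f x) {ε : ℝ} (hε : 0 < ε) :
    ∃ ψ : ℝ → ℂ, Integrable ψ ∧ (∃ K : ℝ≥0, LipschitzWith K ψ) ∧ (∀ x, ψ (-x) = σ * ψ x) ∧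
      ∫ x, ‖f x - ψ x‖ ≤ ε := by
  obtain ⟨g, hgc, hgd, hg⟩ := MemLp.exist_eLpNorm_sub_le (p := 1) (by simp) le_rfl
    (memLp_one_iff_integrable.2 hf) hε
  obtain ⟨K, hK⟩ := hgd.lipschitzWith_of_hasCompactSupport hgc (by simp)
  have hgi : Integrable g := hgd.continuous.integrable_of_hasCompactSupport hgc
  have hσn : ‖σ‖ = 1 := by
    have := congrArg norm hσ
    rw [norm_mul, norm_one] at this
    nlinarith [norm_nonneg σ]
  have hfg : ∫ x, ‖f x - g x‖ ≤ ε := by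
    have h1 : Integrable (f - g) := hf.sub hgi
    have h2 := ofReal_integral_norm_eq_lintegral_enorm h1
    rw [← eLpNorm_one_eq_lintegral_enorm] at h2
    rw [← h2] at hg
    exact (ENNReal.ofReal_le_ofReal_iff hε.le).1 hg
  have hfgi : Integrable fun x => ‖f x - g x‖ := (hf.sub hgi).norm
  refine ⟨fun x => 2⁻¹ * (g x + σ * g (-x)), (hgi.add (hgi.comp_neg.const_mul σ)).const_mul _,
    ⟨K, LipschitzWith.of_dist_le_mul fun x y => ?_⟩, fun x => ?_, ?_⟩
  · have h1 := hK.dist_le_mul x y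
    have h2 := hK.dist_le_mul (-x) (-y)
    rw [dist_neg_neg] at h2
    rw [dist_eq_norm] at h1 h2 ⊢
    rw [← mul_sub, norm_mul, show g x + σ * g (-x) - (g y + σ * g (-y)) =
      (g x - g y) + σ * (g (-x) - g (-y)) by ring]
    have h3 := norm_add_le (g x - g y) (σ * (g (-x) - g (-y)))
    rw [norm_mul, hσn, one_mul] at h3
    rw [norm_inv, Complex.norm_two]
    linarith
  · simp only [neg_neg]
    linear_combination (-2⁻¹ * g (-x)) * hσ
  · calc ∫ x, ‖f x - 2⁻¹ * (g x + σ * g (-x))‖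
        ≤ ∫ x, (2⁻¹ * ‖f x - g x‖ + 2⁻¹ * ‖f (-x) - g (-x)‖) := by
          refine integral_mono (hf.sub ((hgi.add (hgi.comp_neg.const_mul σ)).const_mul _)).norm
            ((hfgi.const_mul _).add (hfgi.comp_neg.const_mul _)) fun x => ?_
          have e : f x - 2⁻¹ * (g x + σ * g (-x)) =
              2⁻¹ * (f x - g x) + 2⁻¹ * (σ * (f (-x) - g (-x))) := by
            rw [hsymm]
            linear_combination (-2⁻¹ * f x) * hσ
          simp only [e]
          refine (norm_add_le _ _).trans (le_of_eq ?_)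
          rw [norm_mul, norm_mul, norm_mul, hσn, norm_inv, Complex.norm_two, one_mul]
      _ = ∫ x, ‖f x - g x‖ := by
          rw [integral_add (hfgi.const_mul _) (hfgi.comp_neg.const_mul _), integral_const_mul,
            integral_const_mul, integral_neg_eq_self fun x => ‖f x - g x‖]
          ring
      _ ≤ ε := hfg

/-- This is the `L¹` contraction for the difference. The approximant `b` is followed under
`oddTransfer`, for which pointwise bounds are available. -/
theorem integral_norm_transfer_sub_le {a b : ℝ → ℂ} (ha : IntegrableOn a (Ioo (-1) 1))
    (hb : IntegrableOn b (Ioo (-1) 1)) (hodd : ∀ x, b (-x) = - b x) :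
    IntegrableOn (oddTransfer b) (Ioo (-1) 1) ∧
    ∫ x in Ioo (-1 : ℝ) 1, ‖transfer a x - oddTransfer b x‖ ≤
      ∫ x in Ioo (-1 : ℝ) 1, ‖a x - b x‖ := by
  have hbT := transfer_eq_oddTransfer hb hodd
  refine ⟨(integrableOn_transfer hb).congr hbT, ?_⟩
  refine le_trans (le_of_eq (integral_congr_ae ?_)) (integral_norm_transfer_le (ha.sub hb))
  filter_upwards [hbT, ae_summable_perSum (integrable_involution_indicator ha),
    ae_summable_perSum (integrable_involution_indicator hb)] with x h1 h2 h3
  rw [← h1, transfer, transfer, transfer, perSum, perSum, perSum, ← h2.tsum_sub h3]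
  congr 2
  funext j
  have e : (Ioo (-1 : ℝ) 1).indicator (fun x => a x - b x) =
    (Ioo (-1 : ℝ) 1).indicator a - (Ioo (-1 : ℝ) 1).indicator b := indicator_sub' _ _ _
  simp only [involution]
  rw [← mul_sub]
  exact congrArg _ (congrFun e _).symm

theorem iterate_oddTransfer_odd {b : ℝ → ℂ} (hodd : ∀ x, b (-x) = - b x) (n : ℕ) (x : ℝ) :
    oddTransfer^[n] b (-x) = - oddTransfer^[n] b x := by
  cases n with
  | zero => exact hodd x
  | succ n => simp only [Function.iterate_succ_apply', oddTransfer_neg]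

theorem integral_norm_iterate_transfer_sub_le {a b : ℝ → ℂ} (ha : IntegrableOn a (Ioo (-1) 1))
    (hb : IntegrableOn b (Ioo (-1) 1)) (hodd : ∀ x, b (-x) = - b x) (n : ℕ) :
    IntegrableOn (oddTransfer^[n] b) (Ioo (-1) 1) ∧
    ∫ x in Ioo (-1 : ℝ) 1, ‖transfer^[n] a x - oddTransfer^[n] b x‖ ≤
      ∫ x in Ioo (-1 : ℝ) 1, ‖a x - b x‖ := by
  induction n with
  | zero => exact ⟨hb, le_rfl⟩
  | succ n ih =>
    have h := integral_norm_transfer_sub_le (iterate_transfer ha n).1 ih.1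
      (iterate_oddTransfer_odd hodd n)
    simp only [Function.iterate_succ_apply']
    exact ⟨h.1, h.2.trans ih.2⟩

theorem logKer_one_le_of_le {x η : ℝ} (h0 : 0 ≤ x) (hx : x ≤ η) (hη : η < 1) :
    logKer 1 x ≤ logKer 1 η := logKer_one_dom.mono_on h0 hx hη

/-- On odd functions, the iterates of the subtransfer operator tend to `0` in `L¹` away from the
endpoints. -/
theorem tendsto_integral_iterate_transfer {f : ℝ → ℂ} (hf : IntegrableOn f (Ioo (-1) 1))
    (hodd : ∀ x, f (-x) = - f x) {η : ℝ} (hη1 : η < 1) :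
    Tendsto (fun N => ∫ x in Ioo (-η) η, ‖transfer^[N] f x‖) atTop (𝓝 0) := by
  have hsub : Ioo (-η) η ⊆ Ioo (-1) 1 := Ioo_subset_Ioo (by linarith) hη1.le
  rw [Metric.tendsto_atTop]
  intro ε hε
  have hsymm : ∀ x, (Ioo (-1 : ℝ) 1).indicator f (-x) = (-1) * (Ioo (-1 : ℝ) 1).indicator f x := by
    intro x
    have : -x ∈ Ioo (-1 : ℝ) 1 ↔ x ∈ Ioo (-1 : ℝ) 1 := by
      rw [mem_Ioo, mem_Ioo, neg_lt_neg_iff, neg_lt, and_comm]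
    simp only [indicator, this, hodd]
    split_ifs <;> simp
  -- The `L¹` error of the Lipschitz approximation is never enlarged by the contraction. The
  -- iterates of `ψ` tend to `0` pointwise and are dominated by a multiple of `logKer 1`, which is
  -- bounded on `I_η`.
  obtain ⟨ψ, hψi, ⟨K, hK⟩, hψodd, hψ⟩ := exists_lipschitz_approx
    ((integrable_indicator_iff measurableSet_Ioo).2 hf) (σ := -1) (by norm_num) hsymm (half_pos hε)
  have hψodd : ∀ x, ψ (-x) = - ψ x := fun x => by rw [hψodd, neg_one_mul]
  have hψ0 : ψ 0 = 0 := by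
    have := hψodd 0
    rw [neg_zero] at this
    exact self_eq_neg.1 this
  have hψD : Dom ψ (fun x => K * x) := by
    refine ⟨hψ0, by simp, fun x y _ hxy _ => ?_⟩
    have := hK.dist_le_mul y x
    rwa [dist_eq_norm, Real.dist_eq, abs_of_nonneg (sub_nonneg.2 hxy), mul_sub] at this
  have hfψ : ∫ x in Ioo (-1 : ℝ) 1, ‖f x - ψ x‖ ≤ ε / 2 := by
    refine le_trans ?_ hψ
    have hi := ((integrable_indicator_iff measurableSet_Ioo).2 hf).sub hψi
    refine le_trans (le_of_eq (setIntegral_congr_fun measurableSet_Ioo fun x hx => ?_))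
      (setIntegral_le_integral hi.norm (Eventually.of_forall fun x => norm_nonneg _))
    rw [indicator_of_mem hx]
  have hlim : Tendsto (fun N => ∫ x in Ioo (-η) η, ‖oddTransfer^[N] ψ x‖) atTop (𝓝 0) := by
    have habs : ∀ N x, ‖oddTransfer^[N] ψ |x|‖ = ‖oddTransfer^[N] ψ x‖ := by
      intro N x
      rcases abs_choice x with h | h <;> rw [h]
      rw [iterate_oddTransfer_odd hψodd, norm_neg]
    have := tendsto_integral_of_dominated_convergence (μ := volume.restrict (Ioo (-η) η))
      (F := fun N x => ‖oddTransfer^[N] ψ x‖) (f := fun _ => 0)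
      (fun _ => 15 * K * logKer 1 η)
      (fun N => ((integral_norm_iterate_transfer_sub_le hf hψi.integrableOn hψodd N).1.mono_set
        hsub).1.norm) (integrableOn_const (by simp)) (fun N => ?_) ?_
    · simpa using this
    · filter_upwards [ae_restrict_mem measurableSet_Ioo] with x hx
      have hx' := abs_lt.2 hx
      rw [norm_norm, ← habs]
      refine ((Dom.tendsto_iterate K.2 hψD (abs_nonneg x) (hx'.trans hη1)).1 N).trans ?_
      exact mul_le_mul_of_nonneg_left (logKer_one_le_of_le (abs_nonneg x) hx'.le hη1)
        (mul_nonneg (by norm_num) K.2)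
    · filter_upwards [ae_restrict_mem measurableSet_Ioo] with x hx
      have hx' := abs_lt.2 hx
      have h1 := (Dom.tendsto_iterate K.2 hψD (abs_nonneg x) (hx'.trans hη1)).2.norm
      simpa only [habs, norm_zero] using h1
  obtain ⟨N₀, hN₀⟩ := Metric.tendsto_atTop.1 hlim (ε / 2) (half_pos hε)
  refine ⟨N₀, fun N hN => ?_⟩
  have h1 := hN₀ N hN
  have hk := integral_norm_iterate_transfer_sub_le hf hψi.integrableOn hψodd N
  have iT := (iterate_transfer hf N).1
  have h2 : ∫ x in Ioo (-η) η, ‖transfer^[N] f x - oddTransfer^[N] ψ x‖ ≤ ε / 2 := by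
    refine le_trans (setIntegral_mono_set (iT.sub hk.1).norm
      (Eventually.of_forall fun x => norm_nonneg _) hsub.eventuallyLE) (hk.2.trans hfψ)
  have h3 : ∫ x in Ioo (-η) η, ‖transfer^[N] f x‖ ≤
      (∫ x in Ioo (-η) η, ‖transfer^[N] f x - oddTransfer^[N] ψ x‖) +
        ∫ x in Ioo (-η) η, ‖oddTransfer^[N] ψ x‖ := by
    have i1 : IntegrableOn (fun x => ‖transfer^[N] f x - oddTransfer^[N] ψ x‖) (Ioo (-η) η) :=
      ((iT.sub hk.1).mono_set hsub).norm
    have i2 := (hk.1.mono_set hsub).norm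
    rw [← integral_add i1 i2]
    refine integral_mono (iT.mono_set hsub).norm (i1.add i2) fun x => ?_
    simpa using norm_add_le (transfer^[N] f x - oddTransfer^[N] ψ x) (oddTransfer^[N] ψ x)
  rw [Real.dist_0_eq_abs, abs_of_nonneg (integral_nonneg fun x => norm_nonneg _)] at h1 ⊢
  linarith

/-! ### Representation of odd distributions and of their iterates -/

theorem UnitTest.comp_neg {φ : ℝ → ℝ} {a : ℝ} (h : UnitTest φ a) : UnitTest (fun t => φ (-t)) a :=
  ⟨h.contDiff.comp contDiff_neg, h.pos, h.lt_one, fun t ht => h.zero _ (by rwa [abs_neg])⟩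

/-- A representation is averaged with its reflection. Reflection changes the sign of the Hilbert
transform, so an odd `f` goes with an even `g`. -/
theorem IsOdd.exists_represents {u : 𝓓'(symmInterval 1, ℂ)} (hu : u ∈ Lspace (symmInterval 1))
    (hodd : IsOdd u) : ∃ f g : ℝ → ℂ, Integrable f ∧ Integrable g ∧ (∀ x, f (-x) = - f x) ∧
      (∀ x, g (-x) = g x) ∧ ∀ φ : 𝓓(symmInterval 1, ℝ), u φ = lineAction f g φ := by
  obtain ⟨f, g, ⟨hf, hg, -⟩, hu⟩ := hu
  refine ⟨fun x => 2⁻¹ * (f x - f (-x)), fun x => 2⁻¹ * (g x + g (-x)),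
    (hf.sub hf.comp_neg).const_mul _, (hg.add hg.comp_neg).const_mul _, fun x => ?_, fun x => ?_,
    fun φ => ?_⟩
  · simp only [neg_neg]
    ring
  · simp only [neg_neg]
    ring
  obtain ⟨a, h⟩ := exists_unitTest φ
  obtain ⟨K, hK⟩ := h.exists_lipschitz
  have h' := h.comp_neg
  have h0 : lineAction f g (fun t => φ t + φ (-t)) = 0 := by
    have := hodd (h.add h').toTest fun t => by
      simp only [UnitTest.toTest_apply, neg_neg]
      ring
    rwa [hu] at this
  rw [h.lineAction_add hf hg h'] at h0
  have e1 : lineAction f g (fun t => φ (-t)) =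
      (∫ t, (φ t : ℂ) * f (-t)) + ∫ t, (hilbert φ t : ℂ) * g (-t) := by
    rw [lineAction, ← integral_neg_eq_self (fun t => (φ t : ℂ) * f (-t)),
      ← integral_neg_eq_self (fun t => (hilbert φ t : ℂ) * g (-t))]
    simp only [neg_neg, hilbert_comp_neg h.integrable hK, Complex.ofReal_neg, neg_mul,
      integral_neg, sub_neg_eq_add]
  have e2 : ∫ t, (φ t : ℂ) * (2⁻¹ * (f t - f (-t))) =
      2⁻¹ * ((∫ t, (φ t : ℂ) * f t) - ∫ t, (φ t : ℂ) * f (-t)) := by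
    rw [← integral_sub (h.integrable_mul_left hf.integrableOn)
      (h.integrable_mul_left hf.comp_neg.integrableOn), ← integral_const_mul]
    refine integral_congr_ae (Eventually.of_forall fun t => ?_)
    simp only
    ring
  have e3 : ∫ t, (hilbert φ t : ℂ) * (2⁻¹ * (g t + g (-t))) =
      2⁻¹ * ((∫ t, (hilbert φ t : ℂ) * g t) + ∫ t, (hilbert φ t : ℂ) * g (-t)) := by
    rw [← integral_add (h.integrable_hilbert_mul hg) (h.integrable_hilbert_mul hg.comp_neg),
      ← integral_const_mul]
    refine integral_congr_ae (Eventually.of_forall fun t => ?_)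
    simp only
    ring
  rw [hu, lineAction, lineAction, e2, e3]
  rw [e1, lineAction] at h0
  linear_combination 2⁻¹ * h0

theorem hilbert_odd_of_even {p : ℝ → ℝ} {K : ℝ≥0} (hi : Integrable p) (hL : LipschitzWith K p)
    (heven : ∀ x, p (-x) = p x) (x : ℝ) : hilbert p (-x) = - hilbert p x := by
  have := hilbert_comp_neg hi hL x
  simp only [heven] at this
  rw [this, neg_neg]

theorem setIntegral_test_mul {φ : ℝ → ℝ} {a : ℝ} (h : UnitTest φ a) (f : ℝ → ℂ) :
    ∫ t in Ioo (-1 : ℝ) 1, (φ t : ℂ) * f t = ∫ t, (φ t : ℂ) * f t := by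
  refine setIntegral_eq_integral_of_forall_compl_eq_zero fun t ht => ?_
  rw [h.zero_of_one_le, Complex.ofReal_zero, zero_mul]
  by_contra! hlt
  exact ht (abs_lt.1 hlt)

/-- An odd element of `𝔏(I_1)` is represented by an odd integrable function and a small even
function. -/
theorem IsOdd.exists_small_represents {u : 𝓓'(symmInterval 1, ℂ)}
    (hu : u ∈ Lspace (symmInterval 1)) (hodd : IsOdd u) {ε : ℝ} (hε : 0 < ε) :
    ∃ f k : ℝ → ℂ, IntegrableOn f (Ioo (-1) 1) ∧ Integrable k ∧ (∀ x, f (-x) = - f x) ∧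
      (∀ x, k (-x) = k x) ∧ ∫ x, ‖k x‖ ≤ ε ∧ ∀ φ : 𝓓(symmInterval 1, ℝ),
        u φ = (∫ t in Ioo (-1 : ℝ) 1, (φ t : ℂ) * f t) - ∫ t, (hilbert φ t : ℂ) * k t := by
  obtain ⟨f, g, hf, hg, hfodd, hgeven, hrep⟩ := hodd.exists_represents hu
  obtain ⟨ψ, hψi, ⟨K, hK⟩, hψeven, hψ⟩ :=
    exists_lipschitz_approx hg (σ := 1) (by norm_num) (by simpa using hgeven) hε
  have hψeven : ∀ x, ψ (-x) = ψ x := by simpa using hψeven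
  have hpi : Integrable fun x => (ψ x).re := hψi.re
  have hqi : Integrable fun x => (ψ x).im := hψi.im
  have hpL : LipschitzWith K fun x => (ψ x).re := LipschitzWith.of_dist_le_mul fun x y => by
    refine le_trans ?_ (hK.dist_le_mul x y)
    rw [Real.dist_eq, dist_eq_norm, ← Complex.sub_re]
    exact Complex.abs_re_le_norm _
  have hqL : LipschitzWith K fun x => (ψ x).im := LipschitzWith.of_dist_le_mul fun x y => by
    refine le_trans ?_ (hK.dist_le_mul x y)
    rw [Real.dist_eq, dist_eq_norm, ← Complex.sub_im]
    exact Complex.abs_im_le_norm _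
  -- The transforms of the real and imaginary parts of the even Lipschitz function `ψ` are bounded
  -- and odd. By antisymmetry of the Hilbert transform they represent `Hψ` as a function, which
  -- joins the odd part `f`.
  set P := hilbert fun x => (ψ x).re with hP
  set Q := hilbert fun x => (ψ x).im with hQ
  have hPm : Measurable P := measurable_hilbert hpi hpL
  have hQm : Measurable Q := measurable_hilbert hqi hqL
  have hPb : ∀ x, |P x| ≤ _ := abs_hilbert_le hpi hpL
  have hQb : ∀ x, |Q x| ≤ _ := abs_hilbert_le hqi hqL
  have hbdd : ∀ {R : ℝ → ℝ} {B : ℝ}, Measurable R → (∀ x, |R x| ≤ B) →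
      IntegrableOn (fun x => (R x : ℂ)) (Ioo (-1) 1) := fun {R B} hm hb =>
    Measure.integrableOn_of_bounded (M := B) (by simp)
      (Complex.measurable_ofReal.comp hm).aestronglyMeasurable
      (Eventually.of_forall fun x => by rw [Complex.norm_real]; exact hb x)
  have hPi := hbdd hPm hPb
  have hQi := hbdd hQm hQb
  refine ⟨fun x => f x + ((P x : ℂ) + Complex.I * (Q x : ℂ)), fun x => g x - ψ x,
    hf.integrableOn.add (hPi.add (hQi.const_mul _)), hg.sub hψi, fun x => ?_, fun x => ?_, hψ,
    fun φ => ?_⟩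
  · simp only
    rw [hfodd, hP, hQ, hilbert_odd_of_even hpi hpL (fun x => by rw [hψeven]),
      hilbert_odd_of_even hqi hqL (fun x => by rw [hψeven])]
    push_cast
    ring
  · simp only
    rw [hgeven, hψeven]
  obtain ⟨a, h⟩ := exists_unitTest φ
  obtain ⟨Kφ, hKφ⟩ := h.exists_lipschitz
  have hsub : Icc (-a) a ⊆ Ioo (-1) 1 := fun t ht =>
    ⟨by linarith [ht.1, h.lt_one], by linarith [ht.2, h.lt_one]⟩
  have e1 : ∫ t, (hilbert φ t : ℂ) * ψ t =
      -((∫ t, (φ t : ℂ) * (P t : ℂ)) + Complex.I * ∫ t, (φ t : ℂ) * (Q t : ℂ)) := by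
    have s1 : ∀ {p : ℝ → ℝ}, Integrable p → LipschitzWith K p →
        ∫ t, (hilbert φ t : ℂ) * (p t : ℂ) = -∫ t, (φ t : ℂ) * (hilbert p t : ℂ) := by
      intro p hp hL
      have := congrArg (fun r : ℝ => (r : ℂ)) (integral_hilbert_mul h.integrable hKφ hp hL)
      simp only [← integral_complex_ofReal, Complex.ofReal_neg] at this
      simpa only [Complex.ofReal_mul] using this
    have j1 := h.integrable_hilbert_mul (g := fun t => ((ψ t).re : ℂ)) hpi.ofReal
    have j2 := h.integrable_hilbert_mul (g := fun t => ((ψ t).im : ℂ)) hqi.ofReal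
    have s2 := s1 hpi hpL
    have s3 := s1 hqi hqL
    rw [neg_add, ← s2, ← mul_neg, ← s3, ← integral_const_mul, ← integral_add j1 (j2.const_mul _)]
    refine integral_congr_ae (Eventually.of_forall fun t => ?_)
    simp only
    conv_lhs => rw [← Complex.re_add_im (ψ t)]
    ring
  have i1 := h.integrable_mul_left hf.integrableOn
  have i2 := h.integrable_mul_left (hPi.mono_set hsub)
  have i3 := h.integrable_mul_left (hQi.mono_set hsub)
  have e2 : ∫ t in Ioo (-1 : ℝ) 1, (φ t : ℂ) * (f t + ((P t : ℂ) + Complex.I * (Q t : ℂ))) =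
      (∫ t, (φ t : ℂ) * f t) +
        ((∫ t, (φ t : ℂ) * (P t : ℂ)) + Complex.I * ∫ t, (φ t : ℂ) * (Q t : ℂ)) := by
    have i23 : Integrable fun t => (φ t : ℂ) * (P t : ℂ) + Complex.I * ((φ t : ℂ) * (Q t : ℂ)) :=
      i2.add (i3.const_mul _)
    rw [setIntegral_test_mul h, ← integral_const_mul, ← integral_add i2 (i3.const_mul _),
      ← integral_add i1 i23]
    refine integral_congr_ae (Eventually.of_forall fun t => ?_)
    simp only
    ring
  have e3 : ∫ t, (hilbert φ t : ℂ) * (g t - ψ t) =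
      (∫ t, (hilbert φ t : ℂ) * g t) - ∫ t, (hilbert φ t : ℂ) * ψ t := by
    rw [← integral_sub (h.integrable_hilbert_mul hg) (h.integrable_hilbert_mul hψi)]
    simp only [mul_sub]
  rw [hrep, lineAction, e2, e3, e1]
  ring

/-- Off the null set `{-1, 1}`, the part of `k` outside `I_1` is the involution of the restriction
to `I_1` of `involution k`, so `UnitTest.integral_hilbert_mul_involution` gives its contribution.
This is where `oddPart k 0` comes from. -/
theorem UnitTest.integral_hilbert_mul_eq {φ : ℝ → ℝ} {a : ℝ} (h : UnitTest φ a) {k : ℝ → ℂ}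
    (hk : Integrable k) (heven : ∀ x, k (-x) = k x) :
    ∫ t, (hilbert φ t : ℂ) * k t = (∫ t in Ioo (-1 : ℝ) 1, (hilbert φ t : ℂ) * k t) +
      ((2 * Real.pi)⁻¹ : ℝ) * ∫ t in Ioo (-1 : ℝ) 1, (φ t : ℂ) * oddPot (involution k) t := by
  have hJ := integrable_involution hk
  have hJeven : ∀ x, involution k (-x) = involution k x := fun x => by
    simp only [involution, neg_sq, div_neg, heven]
  rw [← h.integral_hilbert_mul_involution hJ.integrableOn hJeven,
    ← integral_indicator measurableSet_Ioo,
    ← integral_add ((integrable_indicator_iff measurableSet_Ioo).2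
      (h.integrable_hilbert_mul hk).integrableOn)
      (h.integrable_hilbert_mul (integrable_involution_indicator hJ.integrableOn))]
  have hne : ∀ᵐ x : ℝ, x ∉ ({-1, 1} : Set ℝ) := by
    rw [ae_iff]
    simp only [not_not]
    exact (Set.toFinite ({-1, 1} : Set ℝ)).measure_zero _
  refine integral_congr_ae ?_
  filter_upwards [hne] with x hx
  rcases lt_trichotomy |x| 1 with h1 | h1 | h1
  · rw [involution_indicator_eq_zero _ h1, indicator_of_mem (show x ∈ Ioo (-1 : ℝ) 1 from abs_lt.1 h1),
      mul_zero, add_zero]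
  · rcases eq_or_eq_neg_of_abs_eq h1 with rfl | rfl <;> simp at hx
  · have hx0 : x ≠ 0 := by
      rintro rfl
      simp at h1
      linarith
    have m1 : x ∉ Ioo (-1 : ℝ) 1 := fun hm => (abs_lt.2 hm).not_gt h1
    have m2 : (-1 / x) ∈ Ioo (-1 : ℝ) 1 := by
      refine abs_lt.1 ?_
      rwa [abs_div, abs_neg, abs_one, div_lt_one (abs_pos.2 hx0)]
    rw [indicator_of_notMem m1, zero_add, involution, indicator_of_mem m2, involution,
      inversion_inversion]
    have e : ((1 / x ^ 2 : ℝ) : ℂ) * ((1 / (-1 / x) ^ 2 : ℝ) : ℂ) = 1 := by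
      rw [← Complex.ofReal_mul, show 1 / x ^ 2 * (1 / (-1 / x) ^ 2) = 1 by field_simp,
        Complex.ofReal_one]
    linear_combination (-(hilbert φ x : ℂ) * k x) * e

/-- The odd part that arises in the iteration of the subtransfer operator. -/
noncomputable def oddPart (k : ℝ → ℂ) : ℕ → ℝ → ℂ
  | 0 => fun x => -((2 * Real.pi)⁻¹ • oddPot (involution k) x)
  | N + 1 => fun x => oddTransfer (oddPart k N) x + (2 * Real.pi)⁻¹ •
      (oddPot (transfer^[N] k) x - oddTransfer (oddPot (transfer^[N + 1] k)) x)

theorem oddPart_neg (k : ℝ → ℂ) (N : ℕ) (x : ℝ) : oddPart k N (-x) = - oddPart k N x := by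
  cases N with
  | zero => simp [oddPart, oddPot_neg]
  | succ N =>
    simp only [oddPart, oddPot_neg, oddTransfer_neg]
    module

theorem iterate_transfer_even {k : ℝ → ℂ} (hk : ∀ x, k (-x) = k x) (N : ℕ) (x : ℝ) :
    transfer^[N] k (-x) = transfer^[N] k x := by
  induction N generalizing x with
  | zero => exact hk x
  | succ N ih =>
    rw [Function.iterate_succ_apply']
    exact transfer_even ih x

theorem exists_oddPart_bound : ∃ C : ℝ, 0 ≤ C ∧ ∀ k : ℝ → ℂ, Integrable k →
    (∀ N, ∃ c, 0 ≤ c ∧ Dom (oddPart k N) (fun x => c * logKer 1 x)) ∧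
      ∀ N, ∀ x ∈ Ico (0 : ℝ) 1, ‖oddPart k N x‖ ≤ C * (∫ t, ‖k t‖) * ((1 - x ^ 2) ^ 2)⁻¹ := by
  obtain ⟨C, hC0, hC⟩ := exists_iteration_bound
  refine ⟨C, hC0, fun k hk => hC (∫ t, ‖k t‖) (fun N => transfer^[N] k) (oddPart k)
    (fun N => (iterate_transfer hk.integrableOn N).1) (fun N => ?_) ?_ fun N x _ => rfl⟩
  · exact (iterate_transfer hk.integrableOn N).2.trans
      (setIntegral_le_integral hk.norm (Eventually.of_forall fun x => norm_nonneg _))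
  · have hJ := integrable_involution hk
    have h1 := ((oddPot_dom hJ.integrableOn).const_smul (2 * Real.pi)⁻¹).neg
    have hpi : |(2 * Real.pi)⁻¹| ≤ 1 := by
      rw [abs_of_pos (by positivity)]
      exact inv_le_one_of_one_le₀ (by linarith [Real.pi_gt_three])
    simp only [← mul_assoc] at h1
    refine h1.mono_right logKer_one_dom ?_
    have h2 : ∫ t in Ioo (-1 : ℝ) 1, ‖involution k t‖ ≤ ∫ t, ‖k t‖ := by
      rw [← integral_norm_involution k]
      exact setIntegral_le_integral hJ.norm (Eventually.of_forall fun x => norm_nonneg _)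
    exact (mul_le_of_le_one_left (by positivity) hpi).trans h2

/-- The value of `u` on `tentTest φ n` can be computed from the given expression on `I_1`. Its three
limits are known separately, and uniqueness of limits identifies the subtransfer. -/
theorem subtransfer_apply {u : 𝓓'(symmInterval 1, ℂ)} (hu : u ∈ Lspace (symmInterval 1))
    {f O g : ℝ → ℂ} {c : ℝ} (hf : IntegrableOn f (Ioo (-1) 1)) (hc : 0 ≤ c)
    (hO : Dom O (fun x => c * logKer 1 x)) (hodd : ∀ x, O (-x) = - O x)
    (hg : IntegrableOn g (Ioo (-1) 1)) (heven : ∀ x, g (-x) = g x)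
    (hrep : ∀ φ : 𝓓(symmInterval 1, ℝ), u φ = (∫ t in Ioo (-1 : ℝ) 1, (φ t : ℂ) * f t) +
      (∫ t in Ioo (-1 : ℝ) 1, (φ t : ℂ) * O t) - ∫ t in Ioo (-1 : ℝ) 1, (hilbert φ t : ℂ) * g t)
    (φ : 𝓓(symmInterval 1, ℝ)) :
    subtransfer u φ = (∫ t in Ioo (-1 : ℝ) 1, (φ t : ℂ) * transfer f t) +
      (∫ t in Ioo (-1 : ℝ) 1, (φ t : ℂ) * (oddTransfer O t + (2 * Real.pi)⁻¹ •
        (oddPot g t - oddTransfer (oddPot (transfer g)) t))) -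
      ∫ t in Ioo (-1 : ℝ) 1, (hilbert φ t : ℂ) * transfer g t := by
  obtain ⟨a, h⟩ := exists_unitTest φ
  obtain ⟨f₀, g₀, ⟨hadm, hu₀⟩, hv⟩ := isSubtransfer_subtransfer hu
  have hlim := h.tendsto_lineAction_tentTest hadm
  rw [← hv φ] at hlim
  have hlim' := ((h.tendsto_integral_tentTest_transfer hf).add
    (h.tendsto_integral_tentTest_odd hO hodd)).sub
    (h.tendsto_integral_hilbert_tentTest_even hg heven)
  have e : ∀ n, lineAction f₀ g₀ (tentTest φ n) =
      (∫ t in Ioo (-1 : ℝ) 1, (tentTest φ n t : ℂ) * f t) +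
      (∫ t in Ioo (-1 : ℝ) 1, (tentTest φ n t : ℂ) * O t) -
      ∫ t in Ioo (-1 : ℝ) 1, (hilbert (tentTest φ n) t : ℂ) * g t := fun n =>
    (hu₀ (h.tentTest n).toTest).symm.trans (hrep (h.tentTest n).toTest)
  simp only [e] at hlim
  rw [tendsto_nhds_unique hlim hlim']
  have i1 := h.integrable_mul_left ((hO.oddTransfer_of_logKer hc).integrableOn_Icc
    (oddTransfer_neg O) h.lt_one)
  have i2 := h.integrable_mul_left ((oddPot_dom hg).integrableOn_Icc (oddPot_neg g) h.lt_one)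
  have i3 := h.integrable_mul_left (((oddPot_dom (integrableOn_transfer hg)).oddTransfer_of_logKer
    (by positivity)).integrableOn_Icc (oddTransfer_neg _) h.lt_one)
  have i4 : Integrable fun t => (φ t : ℂ) * oddPot g t -
    (φ t : ℂ) * oddTransfer (oddPot (transfer g)) t := i2.sub i3
  simp only [setIntegral_test_mul h]
  have e2 : ∫ t, (φ t : ℂ) * (oddTransfer O t + (2 * Real.pi)⁻¹ •
        (oddPot g t - oddTransfer (oddPot (transfer g)) t)) =
      (∫ t, (φ t : ℂ) * oddTransfer O t) + ((2 * Real.pi)⁻¹ : ℝ) *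
        ((∫ t, (φ t : ℂ) * oddPot g t) - ∫ t, (φ t : ℂ) * oddTransfer (oddPot (transfer g)) t) := by
    rw [← integral_sub i2 i3, ← integral_const_mul, ← integral_add i1 (i4.const_mul _)]
    refine integral_congr_ae (Eventually.of_forall fun t => ?_)
    simp only [Complex.real_smul]
    ring
  rw [e2]
  ring

/-- The form of the expression, with an odd integrable-type part, an odd locally bounded part and
the Hilbert transform of an even function on `I_1`, is reproduced by `subtransfer_apply`; in the
integrable part no parity is needed. -/
theorem iterate_subtransfer_apply {u : 𝓓'(symmInterval 1, ℂ)} (hu : u ∈ Lspace (symmInterval 1))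
    {f k : ℝ → ℂ} (hf : IntegrableOn f (Ioo (-1) 1)) (hk : Integrable k)
    (heven : ∀ x, k (-x) = k x)
    (hdom : ∀ N, ∃ c, 0 ≤ c ∧ Dom (oddPart k N) (fun x => c * logKer 1 x))
    (hrep : ∀ φ : 𝓓(symmInterval 1, ℝ),
      u φ = (∫ t in Ioo (-1 : ℝ) 1, (φ t : ℂ) * f t) - ∫ t, (hilbert φ t : ℂ) * k t)
    (N : ℕ) (φ : 𝓓(symmInterval 1, ℝ)) :
    subtransfer^[N] u φ = (∫ t in Ioo (-1 : ℝ) 1, (φ t : ℂ) * transfer^[N] f t) +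
      (∫ t in Ioo (-1 : ℝ) 1, (φ t : ℂ) * oddPart k N t) -
      ∫ t in Ioo (-1 : ℝ) 1, (hilbert φ t : ℂ) * transfer^[N] k t := by
  induction N generalizing φ with
  | zero =>
    obtain ⟨a, h⟩ := exists_unitTest φ
    have e : ∫ t in Ioo (-1 : ℝ) 1, (φ t : ℂ) * oddPart k 0 t =
        -(((2 * Real.pi)⁻¹ : ℝ) * ∫ t in Ioo (-1 : ℝ) 1, (φ t : ℂ) * oddPot (involution k) t) := by
      rw [← integral_const_mul, ← integral_neg]
      refine integral_congr_ae (Eventually.of_forall fun t => ?_)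
      simp only [oddPart, Complex.real_smul]
      ring
    simp only [Function.iterate_zero, id_eq]
    rw [hrep, h.integral_hilbert_mul_eq hk heven, e]
    ring
  | succ N ih =>
    obtain ⟨c, hc, hO⟩ := hdom N
    have := subtransfer_apply (iterate_subtransfer_mem hu N) (iterate_transfer hf N).1 hc hO
      (oddPart_neg k N) (iterate_transfer hk.integrableOn N).1 (iterate_transfer_even heven N) ih φ
    simp only [Function.iterate_succ_apply'] at this ⊢
    rw [this]
    simp only [oddPart, Function.iterate_succ_apply']

/-! ### Weak-`L¹` estimates and the conclusion -/

/-- Where `‖p‖ > c`, one of `‖q‖`, `‖r‖` is at least `c/2` or exceeds it. Chebyshev's inequality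
handles `q`, the weak type hypothesis handles `r`, and halving the level costs the factor `2`. -/
theorem weakNorm_le_of_ae {E : Set ℝ} (hE : MeasurableSet E) {p q r : ℝ → ℂ} {R : ℝ}
    (hp : ∀ᵐ x ∂(volume.restrict E), ‖p x‖ ≤ ‖q x‖ + ‖r x‖) (hq : IntegrableOn q E)
    (hR : 0 ≤ R) (hr : ∀ c > 0, volume {x | c < ‖r x‖} ≤ ENNReal.ofReal (R / c)) :
    weakNorm E p ≤ ENNReal.ofReal (2 * (∫ x in E, ‖q x‖) + 2 * R) := by
  refine iSup₂_le fun c hc => ?_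
  have hc2 : 0 < c / 2 := half_pos hc
  have h1 : volume {t ∈ E | c < ‖p t‖} ≤
      volume.restrict E {t | ENNReal.ofReal (c / 2) ≤ ‖q t‖ₑ} + volume {x | c / 2 < ‖r x‖} := by
    have hp' := (ae_restrict_iff' hE).1 hp
    have h2 : volume {t ∈ E | c < ‖p t‖} ≤
        volume (({t | ENNReal.ofReal (c / 2) ≤ ‖q t‖ₑ} ∩ E) ∪ {x | c / 2 < ‖r x‖}) := by
      refine measure_mono_ae ?_
      filter_upwards [hp'] with t ht hmem
      obtain ⟨htE, htc⟩ : t ∈ E ∧ c < ‖p t‖ := hmem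
      have h3 := ht htE
      rcases lt_or_ge (c / 2) ‖r t‖ with h4 | h4
      · exact Or.inr h4
      · refine Or.inl ⟨?_, htE⟩
        show ENNReal.ofReal (c / 2) ≤ ‖q t‖ₑ
        rw [← ofReal_norm]
        exact ENNReal.ofReal_le_ofReal (by linarith)
    refine h2.trans ((measure_union_le _ _).trans (add_le_add_left ?_ _))
    exact (Measure.le_restrict_apply _ _)
  have h5 : ENNReal.ofReal (c / 2) * volume.restrict E {t | ENNReal.ofReal (c / 2) ≤ ‖q t‖ₑ} ≤
      ENNReal.ofReal (∫ x in E, ‖q x‖) := by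
    rw [ofReal_integral_norm_eq_lintegral_enorm hq]
    exact mul_meas_ge_le_lintegral₀ hq.1.enorm _
  have h6 : ENNReal.ofReal (c / 2) * volume {x | c / 2 < ‖r x‖} ≤ ENNReal.ofReal R := by
    refine (mul_le_mul_right (hr _ hc2) _).trans (le_of_eq ?_)
    rw [← ENNReal.ofReal_mul hc2.le]
    congr 1
    field_simp
  have hcc : ENNReal.ofReal c = 2 * ENNReal.ofReal (c / 2) := by
    rw [← ENNReal.ofReal_ofNat, ← ENNReal.ofReal_mul zero_le_two]
    congr 1
    ring
  have hfin : ENNReal.ofReal (2 * (∫ x in E, ‖q x‖) + 2 * R) =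
      2 * (ENNReal.ofReal (∫ x in E, ‖q x‖) + ENNReal.ofReal R) := by
    rw [← ENNReal.ofReal_add (integral_nonneg fun _ => norm_nonneg _) hR, ← mul_add,
      ENNReal.ofReal_mul zero_le_two, ENNReal.ofReal_ofNat]
  rw [hcc, hfin, mul_assoc]
  refine mul_le_mul_right ((mul_le_mul_right h1 _).trans ?_) _
  rw [mul_add]
  exact add_le_add h5 h6

theorem ae_pev_of_mem {u : 𝓓'(symmInterval 1, ℂ)} (hu : u ∈ Lspace (symmInterval 1)) :
    (∀ᵐ x ∂(volume.restrict (Ioo (-1 : ℝ) 1)), ∃ c, HasPev u x c) ∧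
      MemWeakL1 (Ioo (-1) 1) (pev u) := by
  obtain ⟨f, g, ⟨hf, hg, -⟩, hu⟩ := hu
  obtain ⟨h, hm, hw, hpev⟩ := ae_hasPev (fun b _ => hf.integrableOn) hg fun φ => by
    obtain ⟨a, hφ⟩ := exists_unitTest φ
    rw [hu, lineAction, setIntegral_test_mul hφ]
  have he : ∀ᵐ x ∂(volume.restrict (Ioo (-1 : ℝ) 1)), pev u x = f x + h x := by
    filter_upwards [hpev] with x hx using hx.pev_eq
  refine ⟨hpev.mono fun x hx => ⟨_, hx⟩, ?_, ?_⟩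
  · exact (hf.1.aemeasurable.restrict.add hm.restrict).congr (he.mono fun x hx => hx.symm)
  · refine (weakNorm_le_of_ae measurableSet_Ioo (he.mono fun x hx => ?_) hf.integrableOn
      (by positivity) hw).trans_lt ENNReal.ofReal_lt_top
    rw [hx]
    exact norm_add_le _ _

/-- The valeur au point is the function `T^N f + O_N` plus the conjugate function of `1_{I_1} T^N
k`. In the constants, `4M` bounds twice the integral of `M` over `I_η`, as `η < 1`, and `128` is
twice the weak type constant `64`; the `L¹` norm of `T^N k` does not exceed that of `k`. -/
theorem weakNorm_pev_iterate_le {u : 𝓓'(symmInterval 1, ℂ)} (hu : u ∈ Lspace (symmInterval 1))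
    {f k : ℝ → ℂ} (hf : IntegrableOn f (Ioo (-1) 1)) (hk : Integrable k)
    (heven : ∀ x, k (-x) = k x)
    (hdom : ∀ N, ∃ c, 0 ≤ c ∧ Dom (oddPart k N) (fun x => c * logKer 1 x))
    (hrep : ∀ φ : 𝓓(symmInterval 1, ℝ),
      u φ = (∫ t in Ioo (-1 : ℝ) 1, (φ t : ℂ) * f t) - ∫ t, (hilbert φ t : ℂ) * k t)
    {η M : ℝ} (hη0 : 0 < η) (hη1 : η < 1) (N : ℕ)
    (hM : ∀ x ∈ Ico (0 : ℝ) η, ‖oddPart k N x‖ ≤ M) :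
    weakNorm (Ioo (-1) 1) ((Ioo (-η) η).indicator (pev (subtransfer^[N] u))) ≤
      ENNReal.ofReal (2 * (∫ x in Ioo (-η) η, ‖transfer^[N] f x‖) + 4 * M +
        128 * ∫ x, ‖k x‖) := by
  have hsub : Ioo (-η) η ⊆ Ioo (-1) 1 := Ioo_subset_Ioo (by linarith) hη1.le
  obtain ⟨c, hc0, hO⟩ := hdom N
  have hfN := (iterate_transfer hf N).1
  have hkN := iterate_transfer hk.integrableOn N
  have hOb : ∀ b < 1, IntegrableOn (oddPart k N) (Icc (-b) b) := fun b hb =>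
    hO.integrableOn_Icc (oddPart_neg k N) hb
  have hIcc : ∀ b < (1 : ℝ), Icc (-b) b ⊆ Ioo (-1) 1 := fun b hb x hx =>
    ⟨by linarith [hx.1], by linarith [hx.2]⟩
  obtain ⟨h, hm, hw, hpev⟩ := ae_hasPev (u := subtransfer^[N] u)
    (F := fun x => transfer^[N] f x + oddPart k N x)
    (g := (Ioo (-1 : ℝ) 1).indicator (transfer^[N] k))
    (fun b hb => (hfN.mono_set (hIcc b hb)).add (hOb b hb))
    ((integrable_indicator_iff measurableSet_Ioo).2 hkN.1) fun φ => by
      obtain ⟨a, hφ⟩ := exists_unitTest φ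
      have i1 := hφ.integrable_mul_left (hfN.mono_set (hIcc a hφ.lt_one))
      have i2 := hφ.integrable_mul_left (hOb a hφ.lt_one)
      rw [iterate_subtransfer_apply hu hf hk heven hdom hrep N φ]
      simp only [setIntegral_test_mul hφ]
      simp only [← integral_indicator measurableSet_Ioo, mul_add, indicator_mul_right]
      rw [integral_add i1 i2]
  have hnorm : ∫ t, ‖(Ioo (-1 : ℝ) 1).indicator (transfer^[N] k) t‖ ≤ ∫ t, ‖k t‖ := by
    simp only [norm_indicator_eq_indicator_norm]
    rw [integral_indicator measurableSet_Ioo]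
    exact hkN.2.trans (setIntegral_le_integral hk.norm (Eventually.of_forall fun _ => norm_nonneg _))
  have hMabs : ∀ x ∈ Ioo (-η) η, ‖oddPart k N x‖ ≤ M := by
    intro x hx
    rcases le_total 0 x with h0 | h0
    · exact hM x ⟨h0, hx.2⟩
    · rw [← norm_neg, ← oddPart_neg]
      exact hM (-x) ⟨by linarith, by linarith [hx.1]⟩
  have iO : IntegrableOn (oddPart k N) (Ioo (-η) η) :=
    (hOb η hη1).mono_set Ioo_subset_Icc_self
  have ifO : IntegrableOn (fun x => transfer^[N] f x + oddPart k N x) (Ioo (-η) η) :=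
    (hfN.mono_set hsub).add iO
  refine (weakNorm_le_of_ae measurableSet_Ioo
    (q := (Ioo (-η) η).indicator fun x => transfer^[N] f x + oddPart k N x) (r := h)
    (R := 64 * ∫ x, ‖k x‖) (hpev.mono fun x hx => ?_)
    ((integrable_indicator_iff measurableSet_Ioo).2 ifO).integrableOn (by positivity)
    fun c hc => (hw c hc).trans (ENNReal.ofReal_le_ofReal (by gcongr))).trans
    (ENNReal.ofReal_le_ofReal ?_)
  · by_cases hxη : x ∈ Ioo (-η) η
    · rw [indicator_of_mem hxη, indicator_of_mem hxη, hx.pev_eq]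
      exact norm_add_le _ _
    · rw [indicator_of_notMem hxη, norm_zero]
      positivity
  · have e : ∫ x in Ioo (-1 : ℝ) 1, ‖(Ioo (-η) η).indicator
        (fun x => transfer^[N] f x + oddPart k N x) x‖ =
        ∫ x in Ioo (-η) η, ‖transfer^[N] f x + oddPart k N x‖ := by
      simp only [norm_indicator_eq_indicator_norm]
      rw [setIntegral_indicator measurableSet_Ioo, inter_eq_self_of_subset_right hsub]
    have iN := (hfN.mono_set hsub).norm
    have iM : IntegrableOn (fun _ => M) (Ioo (-η) η) := integrableOn_const (by simp)
    have hle : ∫ x in Ioo (-η) η, ‖transfer^[N] f x + oddPart k N x‖ ≤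
        (∫ x in Ioo (-η) η, ‖transfer^[N] f x‖) + ∫ x in Ioo (-η) η, M := by
      rw [← integral_add iN iM]
      refine setIntegral_mono_on ifO.norm (iN.add iM) measurableSet_Ioo fun x hx => ?_
      exact (norm_add_le _ _).trans (add_le_add_right (hMabs x hx) _)
    have hM0 : 0 ≤ M := (norm_nonneg _).trans (hM 0 ⟨le_rfl, hη0⟩)
    have hconst : ∫ x in Ioo (-η) η, M = 2 * η * M := by
      simp [Measure.real]
      left
      rw [ENNReal.toReal_ofReal] <;> linarith
    rw [e]
    nlinarith

end GaussHilbert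

theorem mainTheorem2 :
    -- the subtransfer operator is well defined on `𝔏(I_1)`, and maps this space into itself
    (∀ u ∈ GaussHilbert.Lspace (GaussHilbert.symmInterval 1),
      GaussHilbert.subtransfer u ∈ GaussHilbert.Lspace (GaussHilbert.symmInterval 1) ∧
      ∀ v, GaussHilbert.IsSubtransfer u v ↔ v = GaussHilbert.subtransfer u) ∧
    ∀ u₀ ∈ GaussHilbert.Lspace (GaussHilbert.symmInterval 1), GaussHilbert.IsOdd u₀ →
      -- the functions `pev(T₁^N u₀)` are defined a.e. on `I_1` and belong to `L^{1,∞}(I_1)`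
      (∀ N : ℕ,
        (∀ᵐ x ∂volume.restrict (Ioo (-1 : ℝ) 1),
          ∃ c : ℂ, GaussHilbert.HasPev (GaussHilbert.subtransfer^[N] u₀) x c) ∧
        GaussHilbert.MemWeakL1 (Ioo (-1) 1)
          (GaussHilbert.pev (GaussHilbert.subtransfer^[N] u₀))) ∧
      -- the asymptotic decay
      ∀ η : ℝ, 0 < η → η < 1 →
        Tendsto
          (fun N : ℕ => GaussHilbert.weakNorm (Ioo (-1) 1)
            ((Ioo (-η) η).indicator (GaussHilbert.pev (GaussHilbert.subtransfer^[N] u₀))))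
          atTop (𝓝 0) := by
  refine ⟨fun u hu => ⟨GaussHilbert.subtransfer_mem hu, GaussHilbert.isSubtransfer_iff hu⟩,
    fun u hu hodd => ⟨fun N => GaussHilbert.ae_pev_of_mem
      (GaussHilbert.iterate_subtransfer_mem hu N), fun η hη0 hη1 => ?_⟩⟩
  obtain ⟨C, hC0, hC⟩ := GaussHilbert.exists_oddPart_bound
  refine ENNReal.tendsto_nhds_zero.2 fun ε hε => ?_
  obtain ⟨δ, hδ0, hδε⟩ : ∃ δ : ℝ, 0 < δ ∧ ENNReal.ofReal δ ≤ ε := by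
    obtain ⟨δ, h0, h1⟩ := ENNReal.lt_iff_exists_nnreal_btwn.1 hε
    exact ⟨δ, by exact_mod_cast h0, by rw [ENNReal.ofReal_coe_nnreal]; exact h1.le⟩
  have hw : 0 < 1 - η ^ 2 := by nlinarith
  set A := ((1 - η ^ 2) ^ 2)⁻¹ with hA
  have hA0 : 0 < A := by positivity
  -- The representation is fixed before `N`. With this smallness of `k`, the terms `4M + 128‖k‖₁`,
  -- where `M = C‖k‖₁A`, stay below `δ / 2` for every `N`; the term with `T^N f` is eventually below
  -- `2 · δ / 4`.
  obtain ⟨f, k, hf, hk, hfodd, hkeven, hkε, hrep⟩ :=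
    hodd.exists_small_represents hu (ε := δ / (2 * (4 * C * A + 128))) (by positivity)
  obtain ⟨hdom, hbound⟩ := hC k hk
  have hlim := GaussHilbert.tendsto_integral_iterate_transfer hf hfodd hη1
  filter_upwards [hlim.eventually (gt_mem_nhds (show 0 < δ / 4 by positivity))] with N hN
  refine (GaussHilbert.weakNorm_pev_iterate_le hu hf hk hkeven hdom hrep hη0 hη1 N
    (M := C * (∫ x, ‖k x‖) * A) fun x hx => ?_).trans
    ((ENNReal.ofReal_le_ofReal ?_).trans hδε)
  · refine (hbound N x ⟨hx.1, hx.2.trans hη1⟩).trans ?_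
    have h1 : x ^ 2 ≤ η ^ 2 := pow_le_pow_left₀ hx.1 hx.2.le 2
    have hk0 : 0 ≤ ∫ x, ‖k x‖ := integral_nonneg fun _ => norm_nonneg _
    refine mul_le_mul_of_nonneg_left (inv_anti₀ (by positivity) ?_) (by positivity)
    exact pow_le_pow_left₀ hw.le (by linarith) 2
  · have h2 : (4 * C * A + 128) * (∫ x, ‖k x‖) ≤ δ / 2 := by
      have hB : 0 < 4 * C * A + 128 := by positivity
      refine (mul_le_mul_of_nonneg_left hkε hB.le).trans (le_of_eq ?_)
      field_simp
    nlinarith
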